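/- Let $d\ge 2$ and $2\le k<\ell$ be integers with $\gcd(k,\ell)=1$, and let $X=X_{d,k,\ell}\subset\mathbb A^4_{\mathbb C}$ be the Koras–Russell threefold of the first kind, i.e. the hypersurface $$x^dy+z^k+t^\ell+x=0 .$$ Let $\mathrm{Aut}(X)$ be the group of algebraic automorphisms of $X$. Let $\mathcal A$ be the group of $\mathbb C$-algebra automorphisms of $\mathbb C[x,z,t]$ that preserve the ideals $(x)$ and $(x^d,\,z^k+t^\ell+x)$. For $1\le n\le d$ let $\mathcal A_n\subset\mathcal A$ be the subgroup of those $\varphi$ with $\varphi(x)=x$ and $\varphi(p)\equiv p \pmod{x^n}$ for all $p\in\mathbb C[x,z,t]$. View $\mathcal A_n$ also as a subgroup of $\mathrm{Aut}(X)$, namely the group of automorphisms of $X$ whose pullback on the coordinate ring of $X$ restricts on the subring $\mathbb C[x,z,t]$ to an element of $\mathcal A_n$. A one-parameter unipotent subgroup of $\mathrm{Aut}(X)$ is the image of $\mathbb G_a=(\mathbb C,+)$ in $\mathrm{Aut}(X)$ under an algebraic action $\mathbb G_a\times X\to X$. Then the following hold. 1. Every automorphism of $X$ extends to an automorphism of $\mathbb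 A^4$. 2. $\mathrm{Aut}(X)$ acts on (the closed points of) $X$ with exactly four orbits: the open set $\{x\ne 0\}\cap X$, isomorphic to $\mathbb C^*\times\mathbb C^2$; the set $\{x=0,\ z\neq 0\}\cap X$, isomorphic to $\mathbb C^*\times\mathbb C$; the line $\{x=z=t=0\}$ minus the origin; and the fixed point $(0,0,0,0)$. 3. Every finite subgroup of $\mathrm{Aut}(X)$ is cyclic. 4. Every one-parameter unipotent subgroup of $\mathrm{Aut}(X)$ is contained in $\mathcal A_d$. In particular, the subgroup of $\mathrm{Aut}(X)$ generated by all one-parameter unipotent subgroups is strictly contained in $\mathcal A_1$. -/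

import Mathlib

namespace KorasRussell

section AffineGeometry

/-- A self-map of a subset `Z` of complex affine `n`-space that is given by polynomials
(for Zariski closed `Z`: a morphism `Z → Z`). -/
def IsPolynomialMap {n : ℕ} (Z : Set (Fin n → ℂ)) (f : Z → Z) : Prop :=
  ∃ F : Fin n → MvPolynomial (Fin n) ℂ,
    ∀ (v : Z) (i : Fin n), (f v).1 i = MvPolynomial.eval v.1 (F i)

theorem IsPolynomialMap.comp {n : ℕ} {Z : Set (Fin n → ℂ)} {f g : Z → Z}
    (hf : IsPolynomialMap Z f) (hg : IsPolynomialMap Z g) :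
    IsPolynomialMap Z (fun v => f (g v)) := by
  obtain ⟨F, hF⟩ := hf
  obtain ⟨G, hG⟩ := hg
  refine ⟨fun i => MvPolynomial.bind₁ G (F i), fun v i => ?_⟩
  have h : (g v).1 = fun j => MvPolynomial.eval v.1 (G j) := funext (hG v)
  rw [hF, h]
  exact (MvPolynomial.eval₂Hom_bind₁ (RingHom.id ℂ) v.1 G (F i)).symm

theorem IsPolynomialMap.id {n : ℕ} (Z : Set (Fin n → ℂ)) :
    IsPolynomialMap Z (fun v => v) :=
  ⟨fun i => MvPolynomial.X i, fun v i => by simp⟩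

/-- The automorphism group of the affine variety `Z` (a Zariski closed subset of affine space):
bijections of `Z` that are polynomial together with their inverse. -/
def Aut {n : ℕ} (Z : Set (Fin n → ℂ)) : Subgroup (Equiv.Perm Z) where
  carrier := {e | IsPolynomialMap Z e ∧ IsPolynomialMap Z e.symm}
  mul_mem' := by
    rintro a b ⟨ha, ha'⟩ ⟨hb, hb'⟩
    exact ⟨ha.comp hb, hb'.comp ha'⟩
  one_mem' := ⟨IsPolynomialMap.id Z, IsPolynomialMap.id Z⟩
  inv_mem' := by
    rintro a ⟨ha, ha'⟩
    exact ⟨ha', ha⟩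

/-- `H` is a one-parameter unipotent subgroup of `Aut Z`: the image of an algebraic action of the
additive group of complex numbers, i.e. of a homomorphism `ρ` from `(ℂ, +)` to `Aut Z` such that
`(s, v) ↦ ρ(s) v` is given by polynomials in `s` and the coordinates of `v`. -/
def IsOneParameterUnipotent {n : ℕ} {Z : Set (Fin n → ℂ)} (H : Subgroup (Aut Z)) : Prop :=
  ∃ ρ : Multiplicative ℂ →* Aut Z,
    (∃ F : Fin n → MvPolynomial (Fin (n + 1)) ℂ, ∀ (s : ℂ) (v : Z) (i : Fin n),
      (ρ (Multiplicative.ofAdd s) • v).1 i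
        = MvPolynomial.eval (Fin.cons s v.1 : Fin (n + 1) → ℂ) (F i)) ∧
    H = ρ.range

/-- A regular function on a (locally closed) subset of affine space: locally in the Zariski
topology a quotient of polynomials. -/
def IsRegularFunction {n : ℕ} (S : Set (Fin n → ℂ)) (f : S → ℂ) : Prop :=
  ∀ p : S, ∃ g h : MvPolynomial (Fin n) ℂ, MvPolynomial.eval p.1 h ≠ 0 ∧
    ∀ q : S, MvPolynomial.eval q.1 h ≠ 0 →
      f q = MvPolynomial.eval q.1 g / MvPolynomial.eval q.1 h

/-- Isomorphism of quasi-affine varieties. -/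
def AreIsomorphic {n m : ℕ} (S : Set (Fin n → ℂ)) (T : Set (Fin m → ℂ)) : Prop :=
  ∃ e : S ≃ T,
    (∀ i, IsRegularFunction S (fun p => (e p).1 i)) ∧
    (∀ j, IsRegularFunction T (fun q => (e.symm q).1 j))

end AffineGeometry

section Threefold

/-- The hypersurface `x^d y + z^k + t^ℓ + x = 0` in affine 4-space; the coordinates
`0, 1, 2, 3` are `x, y, z, t`. -/
def threefold (d k l : ℕ) : Set (Fin 4 → ℂ) :=
  {v | v 0 ^ d * v 1 + v 2 ^ k + v 3 ^ l + v 0 = 0}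

/-- The part `x ≠ 0` of the threefold. -/
def openStratum (d k l : ℕ) : Set (Fin 4 → ℂ) :=
  {v | v ∈ threefold d k l ∧ v 0 ≠ 0}

/-- The part `x = 0`, `z ≠ 0` of the threefold. -/
def surfaceStratum (d k l : ℕ) : Set (Fin 4 → ℂ) :=
  {v | v ∈ threefold d k l ∧ v 0 = 0 ∧ v 2 ≠ 0}

/-- The line `x = z = t = 0` without the origin. -/
def puncturedLine : Set (Fin 4 → ℂ) :=
  {v | v 0 = 0 ∧ v 2 = 0 ∧ v 3 = 0 ∧ v ≠ 0}

/-- The polynomial ring `ℂ[x, z, t]`; the variables `0, 1, 2` are `x, z, t`. -/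
abbrev Rxzt : Type := MvPolynomial (Fin 3) ℂ

/-- The ideal `(x)` of `ℂ[x, z, t]`. -/
noncomputable def idealX : Ideal Rxzt := Ideal.span {MvPolynomial.X 0}

/-- The ideal `(x^d, z^k + t^ℓ + x)` of `ℂ[x, z, t]`. -/
noncomputable def idealJ (d k l : ℕ) : Ideal Rxzt :=
  Ideal.span {MvPolynomial.X 0 ^ d,
    MvPolynomial.X 1 ^ k + MvPolynomial.X 2 ^ l + MvPolynomial.X 0}

/-- The automorphisms of a commutative `ℂ`-algebra that map the ideal `I` onto itself. -/
def idealStabilizer {R : Type*} [CommRing R] [Algebra ℂ R] (I : Ideal R) :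
    Subgroup (R ≃ₐ[ℂ] R) where
  carrier := {φ | ∀ p, φ p ∈ I ↔ p ∈ I}
  mul_mem' := by
    intro a b ha hb p
    exact (ha (b p)).trans (hb p)
  one_mem' := fun p => Iff.rfl
  inv_mem' := by
    intro a ha p
    have h := ha (a⁻¹ p)
    rw [← AlgEquiv.mul_apply, mul_inv_cancel, AlgEquiv.one_apply] at h
    exact h.symm

/-- The group `𝒜` of automorphisms of `ℂ[x, z, t]` preserving the ideals `(x)` and
`(x^d, z^k + t^ℓ + x)`. -/
noncomputable def groupA (d k l : ℕ) : Subgroup (Rxzt ≃ₐ[ℂ] Rxzt) :=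
  idealStabilizer idealX ⊓ idealStabilizer (idealJ d k l)

/-- The subgroup `𝒜_n` of `𝒜`: automorphisms that fix `x` and are congruent to the identity
modulo `(x^n)`. -/
noncomputable def groupAn (d k l n : ℕ) : Subgroup (Rxzt ≃ₐ[ℂ] Rxzt) where
  carrier := {φ | φ ∈ groupA d k l ∧ φ (MvPolynomial.X 0) = MvPolynomial.X 0 ∧
    ∀ p, φ p - p ∈ Ideal.span {(MvPolynomial.X 0 ^ n : Rxzt)}}
  mul_mem' := by
    rintro a b ⟨ha, ha0, ha'⟩ ⟨hb, hb0, hb'⟩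
    refine ⟨mul_mem ha hb, ?_, fun p => ?_⟩
    · rw [AlgEquiv.mul_apply, hb0, ha0]
    · have h := add_mem (ha' (b p)) (hb' p)
      rwa [sub_add_sub_cancel] at h
  one_mem' := ⟨one_mem _, rfl, fun p => by simp⟩
  inv_mem' := by
    rintro a ⟨ha, ha0, ha'⟩
    refine ⟨inv_mem ha, ?_, fun p => ?_⟩
    · conv_lhs => rw [← ha0]
      rw [← AlgEquiv.mul_apply, inv_mul_cancel, AlgEquiv.one_apply]
    · have h := neg_mem (ha' (a⁻¹ p))
      rwa [← AlgEquiv.mul_apply, mul_inv_cancel, AlgEquiv.one_apply, neg_sub] at h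

/-- The projection of the threefold to affine 3-space, `(x, y, z, t) ↦ (x, z, t)`. -/
def proj (v : Fin 4 → ℂ) : Fin 3 → ℂ := ![v 0, v 2, v 3]

/-- The automorphism `ψ` of the threefold induces (by pulling back functions) the automorphism `φ`
of the subring `ℂ[x, z, t]` of its coordinate ring. -/
def Induces {d k l : ℕ} (ψ : Aut (threefold d k l)) (φ : Rxzt ≃ₐ[ℂ] Rxzt) : Prop :=
  ∀ (p : Rxzt) (v : threefold d k l),
    MvPolynomial.eval (proj (ψ • v).1) p = MvPolynomial.eval (proj v.1) (φ p)

/-- The group `𝒜_n`, viewed as a subgroup of the automorphism group of the threefold: the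
automorphisms of the threefold that induce an element of `𝒜_n` on `ℂ[x, z, t]`. -/
noncomputable def subgroupA (d k l n : ℕ) : Subgroup (Aut (threefold d k l)) where
  carrier := {ψ | ∃ φ ∈ groupAn d k l n, Induces ψ φ}
  mul_mem' := by
    rintro a b ⟨f, hf, haf⟩ ⟨g, hg, hbg⟩
    refine ⟨g * f, mul_mem hg hf, fun p v => ?_⟩
    rw [mul_smul, haf, hbg, AlgEquiv.mul_apply]
  one_mem' := ⟨1, one_mem _, fun p v => by simp⟩
  inv_mem' := by
    rintro a ⟨f, hf, haf⟩
    refine ⟨f⁻¹, inv_mem hf, fun p v => ?_⟩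
    have h := haf (f⁻¹ p) (a⁻¹ • v)
    rw [smul_inv_smul, ← AlgEquiv.mul_apply, mul_inv_cancel, AlgEquiv.one_apply] at h
    exact h.symm

end Threefold

end KorasRussell

/-! Write `S = z^k + t^ℓ + x` and let `B` be the coordinate ring of the threefold, realised inside
the Laurent polynomials in `x, z, t` by `y = -S / x^d`. Everything rests on one fact about locally
nilpotent derivations: the kernel of a nonzero one on `B` lies in `ℂ[x, z, t]` and contains `x`
(`kernel_of_locally_nilpotent`).

For the first half, order exponents lexicographically by pole order along `x = 0` and then by the
weight making `z^k + t^ℓ` homogeneous, and replace the derivation by its top homogeneous part `D`. A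
kernel element outside `ℂ[x, z, t]` has a leading form divisible by `(z^k + t^ℓ) / x^d`, so `D`
kills that function. An abc-type lemma for two powers shows that a nonzero such `D` kills none of
`x`, `z`, `t`, `z^k - μ t^ℓ`. Hence the last nonzero iterates of `z^k` and `t^ℓ` are multiples of
one power of the leading form of `y`. A linear combination in which they cancel gives a
contradiction. For the second half, the ideal `(x, z^k + t^ℓ)` is contained in `xB`. If `x` were not
a constant, the kernel would therefore embed in the functions on the cusp, and its transcendence
degree would be too small.

Consequently automorphisms preserve `ℂ[x, z, t]`, send `x` to a multiple of itself, and preserve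
`(x^d, S) = x^d B ∩ ℂ[x, z, t]`, so they induce elements of `𝒜`. Modulo `x` they give automorphisms
of the plane preserving a cusp. A comparison of Jacobians and weighted degrees makes these diagonal,
and the coefficient of `x` in `S` ties the scalar on `x` to them. The result is a character of `Aut
X` with values in `ℂ^*` and kernel `𝒜₁`, split by an explicit torus (`exists_hasChar`,
`exists_torus`).

An element of `𝒜_n` with `n < d` is, modulo `x^{n+1}`, the identity plus `x^n {h, ·}`. Preservation
of `(x^d, S)` makes `h` constant on the cusp, so `h` may be taken divisible by `S`
(`exists_first_order_hamiltonian`). Conversely, for `h = S g`, exponentiate `x^n (S - c) g` over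
`ℂ[x, c]`. The truncated exponential lifts to a genuine symplectic automorphism, because
Hamiltonians are sums of powers of linear forms and those integrate to shears. The lift preserves
`(x^d, S - c)`, so it acts on all hypersurfaces `x^d y + S = c` at once, that is, on affine 4-space
(`exists_aut_of_hamiltonian`). Dividing off these automorphisms leads from `𝒜_1` to `𝒜_d`, whose
elements extend directly. This proves extension, and since every factor fixes the origin, it also
proves that the origin is fixed (`extends_and_fixes`).

The torus and translations by multiples of `x^d` in `z` and `t` give transitivity on the strata, and
the character shows that the strata are invariant. The group `𝒜₁` is torsion free because it is
filtered by powers of `x` with quotients in characteristic zero, so finite subgroups embed in `ℂ^*`.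
Finally, let `∂` generate an action of the additive group. It kills `x` and is divisible by `x`. If
it is divisible by `x^n` with `n < d`, then `∂ / x^n` modulo `x` is the Hamiltonian derivation of a
multiple of `z^k + t^ℓ`. Being locally nilpotent, it kills `z^k + t^ℓ`, hence `z` and `t`, so `∂` is
divisible by `x^{n+1}` (`dvd_generator_succ`). The Hamiltonian `x S` gives elements of `𝒜_1` outside
`𝒜_2`, so the inclusion is strict. -/

namespace KorasRussell

/-! ### Degree functions of locally nilpotent derivations. -/

section LocallyNilpotent

variable {k A : Type*} [CommRing k] [CommRing A] [Algebra k A]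

/-- Some iterate of `D` kills `f`. -/
def IsNilAt (D : Derivation k A A) (f : A) : Prop := ∃ n : ℕ, D^[n] f = 0

/-- The degree of `f` with respect to the derivation `D` is exactly `n`. -/
def HasDeg (D : Derivation k A A) (f : A) (n : ℕ) : Prop := D^[n] f ≠ 0 ∧ D^[n + 1] f = 0

theorem iterate_map_zero' (D : Derivation k A A) (n : ℕ) : D^[n] 0 = 0 :=
  iterate_map_zero D n

theorem iterate_map_add' (D : Derivation k A A) (n : ℕ) (f g : A) :
    D^[n] (f + g) = D^[n] f + D^[n] g :=
  iterate_map_add D n f g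

theorem iterate_eq_zero_of_le {D : Derivation k A A} {f : A} {n m : ℕ} (h : D^[n] f = 0)
    (hnm : n ≤ m) : D^[m] f = 0 := by
  obtain ⟨j, rfl⟩ := Nat.exists_eq_add_of_le' hnm
  rw [Function.iterate_add_apply, h, iterate_map_zero']

theorem IsNilAt.exists_hasDeg {D : Derivation k A A} {f : A} (hf : IsNilAt D f) (h0 : f ≠ 0) :
    ∃ n, HasDeg D f n := by
  classical
  have hpos : Nat.find hf ≠ 0 := by
    intro h
    have := Nat.find_spec hf
    rw [h] at this
    exact h0 this
  obtain ⟨n, hn⟩ := Nat.exists_eq_succ_of_ne_zero hpos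
  refine ⟨n, Nat.find_min hf (by omega), ?_⟩
  have := Nat.find_spec hf
  rwa [hn] at this

theorem HasDeg.unique {D : Derivation k A A} {f : A} {n m : ℕ} (h : HasDeg D f n)
    (h' : HasDeg D f m) : n = m := by
  rcases lt_trichotomy n m with hl | hl | hl
  · exact absurd (iterate_eq_zero_of_le h.2 hl) h'.1
  · exact hl
  · exact absurd (iterate_eq_zero_of_le h'.2 hl) h.1

theorem HasDeg.isNilAt {D : Derivation k A A} {f : A} {n : ℕ} (h : HasDeg D f n) :
    IsNilAt D f := ⟨_, h.2⟩

theorem hasDeg_zero_iff {D : Derivation k A A} {f : A} :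
    HasDeg D f 0 ↔ f ≠ 0 ∧ D f = 0 := Iff.rfl

theorem HasDeg.derivation {D : Derivation k A A} {f : A} {n : ℕ} (h : HasDeg D f (n + 1)) :
    HasDeg D (D f) n := h

/-- In the Leibniz expansion of `D^N (f g)` only one term survives when `N` is the sum of the bounds
on the degrees. Additivity of the degree on a domain of characteristic zero follows. -/
theorem iterate_mul_eq (D : Derivation k A A) (N : ℕ) : ∀ (n m : ℕ) (f g : A), n + m = N →
    D^[n + 1] f = 0 → D^[m + 1] g = 0 →
    D^[N] (f * g) = (N.choose n : A) * (D^[n] f * D^[m] g) ∧ D^[N + 1] (f * g) = 0 := by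
  induction N with
  | zero =>
    intro n m f g h hf hg
    obtain ⟨rfl, rfl⟩ : n = 0 ∧ m = 0 := by omega
    have hf' : D f = 0 := hf
    have hg' : D g = 0 := hg
    simp [hf', hg']
  | succ N ih =>
    intro n m f g h hf hg
    have hD : D (f * g) = D f * g + f * D g := by
      rw [D.leibniz, smul_eq_mul, smul_eq_mul]; ring
    -- The case `n = 0` is separated because then `D f = 0`, while the truncated `n - 1` would
    -- produce a wrong binomial coefficient.
    have hl : D^[N] (D f * g) = ((if n = 0 then 0 else N.choose (n - 1) : ℕ) : A) *
        (D^[n] f * D^[m] g) ∧ D^[N + 1] (D f * g) = 0 := by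
      rcases Nat.eq_zero_or_pos n with rfl | hn
      · have hf' : D f = 0 := hf
        simp [hf', -Function.iterate_succ]
      · obtain ⟨n, rfl⟩ := Nat.exists_eq_succ_of_ne_zero hn.ne'
        have := ih n m (D f) g (by omega) hf hg
        simpa using this
    have hr : D^[N] (f * D g) = ((if m = 0 then 0 else N.choose n : ℕ) : A) *
        (D^[n] f * D^[m] g) ∧ D^[N + 1] (f * D g) = 0 := by
      rcases Nat.eq_zero_or_pos m with rfl | hm
      · have hg' : D g = 0 := hg
        simp [hg', -Function.iterate_succ]
      · obtain ⟨m, rfl⟩ := Nat.exists_eq_succ_of_ne_zero hm.ne'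
        have := ih n m f (D g) (by omega) hf hg
        simpa using this
    constructor
    · rw [Function.iterate_succ_apply, hD, iterate_map_add', hl.1, hr.1, ← add_mul, ← Nat.cast_add]
      congr 2
      rcases n with _ | n
      · have : m ≠ 0 := by omega
        simp [this]
      · rcases m with _ | m
        · obtain rfl : n = N := by omega
          simp
        · simp [Nat.choose_succ_succ]
    · rw [Function.iterate_succ_apply, hD, iterate_map_add', hl.2, hr.2, add_zero]

theorem IsNilAt.mul {D : Derivation k A A} {f g : A} (hf : IsNilAt D f) (hg : IsNilAt D g) :
    IsNilAt D (f * g) := by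
  obtain ⟨n, hn⟩ := hf
  obtain ⟨m, hm⟩ := hg
  exact ⟨_, (iterate_mul_eq D (n + m) n m f g rfl (iterate_eq_zero_of_le hn n.le_succ)
    (iterate_eq_zero_of_le hm m.le_succ)).2⟩

theorem IsNilAt.add {D : Derivation k A A} {f g : A} (hf : IsNilAt D f) (hg : IsNilAt D g) :
    IsNilAt D (f + g) := by
  obtain ⟨n, hn⟩ := hf
  obtain ⟨m, hm⟩ := hg
  refine ⟨n + m, ?_⟩
  rw [iterate_map_add', iterate_eq_zero_of_le hn (Nat.le_add_right n m),
    iterate_eq_zero_of_le hm (Nat.le_add_left m n), add_zero]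

theorem isNilAt_of_eq_zero {D : Derivation k A A} {f : A} (h : D f = 0) : IsNilAt D f := ⟨1, h⟩

theorem isNilAt_algebraMap (D : Derivation k A A) (c : k) : IsNilAt D (algebraMap k A c) :=
  isNilAt_of_eq_zero (D.map_algebraMap c)

/-- The subalgebra of elements at which a derivation is locally nilpotent. -/
def nilSubalgebra (D : Derivation k A A) : Subalgebra k A where
  carrier := {f | IsNilAt D f}
  mul_mem' := IsNilAt.mul
  add_mem' := IsNilAt.add
  algebraMap_mem' := isNilAt_algebraMap D

/-- The kernel of a derivation as a subalgebra. -/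
def kerSubalgebra (D : Derivation k A A) : Subalgebra k A where
  carrier := {f | D f = 0}
  mul_mem' := by
    intro f g hf hg
    have hf' : D f = 0 := hf
    have hg' : D g = 0 := hg
    simp [D.leibniz, hf', hg']
  add_mem' := by
    intro f g hf hg
    have hf' : D f = 0 := hf
    have hg' : D g = 0 := hg
    simp [hf', hg']
  algebraMap_mem' := fun c => D.map_algebraMap c

theorem mem_kerSubalgebra {D : Derivation k A A} {f : A} :
    f ∈ kerSubalgebra D ↔ D f = 0 := Iff.rfl

variable [IsDomain A] [CharZero A]

theorem HasDeg.mul {D : Derivation k A A} {f g : A} {n m : ℕ} (hf : HasDeg D f n)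
    (hg : HasDeg D g m) : HasDeg D (f * g) (n + m) := by
  obtain ⟨h1, h2⟩ := iterate_mul_eq D (n + m) n m f g rfl hf.2 hg.2
  refine ⟨?_, h2⟩
  rw [h1]
  have : ((n + m).choose n : A) ≠ 0 :=
    Nat.cast_ne_zero.2 (Nat.choose_pos (Nat.le_add_right n m)).ne'
  exact mul_ne_zero this (mul_ne_zero hf.1 hg.1)

theorem HasDeg.pow {D : Derivation k A A} {f : A} {n : ℕ} (hf : HasDeg D f n) (m : ℕ) :
    HasDeg D (f ^ m) (m * n) := by
  induction m with
  | zero => rw [pow_zero, zero_mul]; exact ⟨one_ne_zero, D.map_one_eq_zero⟩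
  | succ m ih => rw [pow_succ, Nat.succ_mul]; exact ih.mul hf

/-- Degrees are additive and nonnegative, so a product of degree zero has factors of degree zero:
the kernel is factorially closed. -/
theorem map_eq_zero_of_mul {D : Derivation k A A} {f g : A} (hf : IsNilAt D f)
    (hg : IsNilAt D g) (h0 : f * g ≠ 0) (h : D (f * g) = 0) : D f = 0 := by
  obtain ⟨n, hn⟩ := hf.exists_hasDeg (left_ne_zero_of_mul h0)
  obtain ⟨m, hm⟩ := hg.exists_hasDeg (right_ne_zero_of_mul h0)
  have := (hn.mul hm).unique (hasDeg_zero_iff.2 ⟨h0, h⟩)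
  obtain ⟨rfl, rfl⟩ : n = 0 ∧ m = 0 := by omega
  exact hn.2

theorem map_eq_zero_of_pow {D : Derivation k A A} {f : A} {n : ℕ} (hf : IsNilAt D f)
    (hn : n ≠ 0) (h : D (f ^ n) = 0) : D f = 0 := by
  rcases eq_or_ne f 0 with rfl | h0
  · exact map_zero D
  obtain ⟨n, rfl⟩ := Nat.exists_eq_succ_of_ne_zero hn
  rw [pow_succ'] at h
  refine map_eq_zero_of_mul hf ((nilSubalgebra D).pow_mem hf n) ?_ h
  exact mul_ne_zero h0 (pow_ne_zero n h0)


/-- If the degree of `f` is positive then it does not divide its derivative. -/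
theorem map_eq_zero_of_eq_mul {D : Derivation k A A} {f m : A} (hf : IsNilAt D f)
    (hm : IsNilAt D m) (h : D f = f * m) : D f = 0 := by
  by_contra h0
  have hf0 : f ≠ 0 := by rintro rfl; exact h0 (map_zero D)
  have hm0 : m ≠ 0 := by rintro rfl; rw [mul_zero] at h; exact h0 h
  obtain ⟨n, hn⟩ := hf.exists_hasDeg hf0
  obtain ⟨j, hj⟩ := hm.exists_hasDeg hm0
  rcases n with _ | n
  · exact h0 hn.2
  -- Here `D f` has degree one less than `f`, while `f * m` has at least the degree of `f`.
  · have h1 := hn.mul hj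
    rw [← h] at h1
    have := h1.unique hn.derivation
    omega

/-- If `u a^n + v b^m` is a nonzero constant of a derivation locally nilpotent at `a` and `b`, with
`u`, `v` nonzero constants and `n, m ≥ 2`, then `a` and `b` are constants. -/
theorem map_eq_zero_of_add_pow {D : Derivation k A A} {a b u v : A} {n m : ℕ} (hn : 2 ≤ n)
    (hm : 2 ≤ m) (ha : IsNilAt D a) (hb : IsNilAt D b) (hu : D u = 0) (hv : D v = 0)
    (hu0 : u ≠ 0) (hv0 : v ≠ 0) (h0 : u * a ^ n + v * b ^ m ≠ 0)
    (h : D (u * a ^ n + v * b ^ m) = 0) : D a = 0 ∧ D b = 0 := by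
  have hDa : D (u * a ^ n) = u * (n * a ^ (n - 1) * D a) := by
    rw [D.leibniz, D.leibniz_pow, hu]; simp only [smul_eq_mul, nsmul_eq_mul]; ring
  have hDb : D (v * b ^ m) = v * (m * b ^ (m - 1) * D b) := by
    rw [D.leibniz, D.leibniz_pow, hv]; simp only [smul_eq_mul, nsmul_eq_mul]; ring
  have hn0 : (n : A) ≠ 0 := Nat.cast_ne_zero.2 (by omega)
  have hm0 : (m : A) ≠ 0 := Nat.cast_ne_zero.2 (by omega)
  have hsum : u * (n * a ^ (n - 1) * D a) + v * (m * b ^ (m - 1) * D b) = 0 := by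
    rw [← hDa, ← hDb, ← map_add, h]
  have han : a ^ n = a ^ (n - 1) * a := by rw [← pow_succ]; congr 1; omega
  have hbm : b ^ m = b ^ (m - 1) * b := by rw [← pow_succ]; congr 1; omega
  -- Suppose neither is constant. Eliminating with `hsum` expresses both `w * D a` and `w * D b`
  -- through the same Wronskian `n b D a - m a D b`, multiplied by `b^(m-1)` and `a^(n-1)`
  -- respectively. Their degrees are then incompatible.
  have key : D a = 0 ∨ D b = 0 := by
    by_contra hcon
    push Not at hcon
    obtain ⟨ha1, hb1⟩ := hcon
    have ha0 : a ≠ 0 := by rintro rfl; exact ha1 (map_zero D)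
    have hb0 : b ≠ 0 := by rintro rfl; exact hb1 (map_zero D)
    obtain ⟨p, hp⟩ := ha.exists_hasDeg ha0
    obtain ⟨q, hq⟩ := hb.exists_hasDeg hb0
    obtain ⟨p, rfl⟩ := Nat.exists_eq_succ_of_ne_zero (show p ≠ 0 by
      rintro rfl; exact ha1 hp.2)
    obtain ⟨q, rfl⟩ := Nat.exists_eq_succ_of_ne_zero (show q ≠ 0 by
      rintro rfl; exact hb1 hq.2)
    have hw := hasDeg_zero_iff.2 ⟨h0, h⟩
    set w := u * a ^ n + v * b ^ m with hwdef
    have e1 : (n : A) * (w * D a) = (v * b ^ (m - 1)) * (n * (b * D a) - m * (a * D b)) := by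
      rw [hwdef, han, hbm]
      linear_combination a * hsum
    have e2 : (m : A) * (w * D b) = (u * a ^ (n - 1)) * (m * (a * D b) - n * (b * D a)) := by
      rw [hwdef, han, hbm]
      linear_combination b * hsum
    have nilc : IsNilAt D (n * (b * D a) - m * (a * D b)) := by
      have hDa' : D a ∈ nilSubalgebra D := hp.derivation.isNilAt
      have hDb' : D b ∈ nilSubalgebra D := hq.derivation.isNilAt
      have ha' : a ∈ nilSubalgebra D := ha
      have hb' : b ∈ nilSubalgebra D := hb
      exact sub_mem (mul_mem (natCast_mem _ n) (mul_mem hb' hDa'))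
        (mul_mem (natCast_mem _ m) (mul_mem ha' hDb'))
    have hnd : ∀ n : ℕ, (n : A) ≠ 0 → HasDeg D (n : A) 0 := fun n hn =>
      hasDeg_zero_iff.2 ⟨hn, D.map_natCast n⟩
    have hc0 : n * (b * D a) - m * (a * D b) ≠ 0 := by
      intro hc
      rw [hc, mul_zero] at e1
      exact mul_ne_zero hn0 (mul_ne_zero h0 ha1) e1
    obtain ⟨c, hc⟩ := nilc.exists_hasDeg hc0
    have hc' : HasDeg D (m * (a * D b) - n * (b * D a)) c := by
      have : m * (a * D b) - n * (b * D a) = -(n * (b * D a) - m * (a * D b)) := by ring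
      rw [this, ← neg_one_mul, ← zero_add c]
      exact HasDeg.mul (hasDeg_zero_iff.2 ⟨by simp, by simp⟩) hc
    have d1 := (hnd n hn0).mul (hw.mul hp.derivation)
    rw [e1] at d1
    have d1' := ((hasDeg_zero_iff.2 ⟨hv0, hv⟩).mul (hq.pow (m - 1))).mul hc
    have d2 := (hnd m hm0).mul (hw.mul hq.derivation)
    rw [e2] at d2
    have d2' := ((hasDeg_zero_iff.2 ⟨hu0, hu⟩).mul (hp.pow (n - 1))).mul hc'
    have r1 := d1.unique d1'
    have r2 := d2.unique d2'
    -- With `a`, `b` of degrees `p + 1`, `q + 1`, the comparisons read `p = (m-1)(q+1) + c` and `q =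
    -- (n-1)(p+1) + c`. As `n, m ≥ 2`, this gives `p > q` and `q > p`.
    have g1 : q + 1 ≤ (m - 1) * (q + 1) := Nat.le_mul_of_pos_left _ (by omega)
    have g2 : p + 1 ≤ (n - 1) * (p + 1) := Nat.le_mul_of_pos_left _ (by omega)
    simp only [Nat.succ_eq_add_one] at r1 r2
    omega
  rcases key with h1 | h1
  · refine ⟨h1, ?_⟩
    rw [h1, mul_zero, mul_zero, zero_add] at hsum
    rcases mul_eq_zero.1 ((mul_eq_zero.1 hsum).resolve_left hv0) with h2 | h2
    · have : b = 0 := eq_zero_of_pow_eq_zero ((mul_eq_zero.1 h2).resolve_left hm0)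
      rw [this, map_zero]
    · exact h2
  · refine ⟨?_, h1⟩
    rw [h1, mul_zero, mul_zero, add_zero] at hsum
    rcases mul_eq_zero.1 ((mul_eq_zero.1 hsum).resolve_left hu0) with h2 | h2
    · have : a = 0 := eq_zero_of_pow_eq_zero ((mul_eq_zero.1 h2).resolve_left hn0)
      rw [this, map_zero]
    · exact h2

end LocallyNilpotent

end KorasRussell

namespace KorasRussell

/-! ### Laurent polynomials: supports, leading forms and top parts of derivations. -/

section Laurent

set_option linter.unusedSectionVars false

/-- Laurent polynomials in `x, z, t` over the complex numbers. -/
abbrev Lau : Type := AddMonoidAlgebra ℂ (ℤ × ℤ × ℤ)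

/-- The Laurent polynomials whose exponents lie in `T`. -/
def supp (T : Set (ℤ × ℤ × ℤ)) : Submodule ℂ Lau where
  carrier := {f | ∀ m, f.coeff m ≠ 0 → m ∈ T}
  add_mem' := by
    intro f g hf hg m hm
    by_cases h : f.coeff m = 0
    · refine hg m fun h' => hm ?_
      rw [AddMonoidAlgebra.coeff_add, Finsupp.add_apply, h, h', add_zero]
    · exact hf m h
  zero_mem' := by intro m hm; simp at hm
  smul_mem' := by
    intro c f hf m hm
    refine hf m fun h => hm ?_
    rw [AddMonoidAlgebra.coeff_smul, Finsupp.smul_apply, h, smul_zero]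

theorem supp_mono {T U : Set (ℤ × ℤ × ℤ)} (h : T ⊆ U) {f : Lau} (hf : f ∈ supp T) :
    f ∈ supp U := fun m hm => h (hf m hm)

theorem single_mem_supp {T : Set (ℤ × ℤ × ℤ)} {m : ℤ × ℤ × ℤ} (hm : m ∈ T) (c : ℂ) :
    (AddMonoidAlgebra.single m c : Lau) ∈ supp T := by
  intro m' h
  by_cases h' : m = m'
  · exact h' ▸ hm
  · simp [h'] at h

theorem eq_sum_single (f : Lau) :
    f = ∑ m ∈ f.coeff.support, AddMonoidAlgebra.single m (f.coeff m) := by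
  conv_lhs => rw [← AddMonoidAlgebra.sum_coeff_single f]
  rfl

theorem mul_mem_supp {T U V : Set (ℤ × ℤ × ℤ)} {f g : Lau} (hf : f ∈ supp T) (hg : g ∈ supp U)
    (h : ∀ a ∈ T, ∀ b ∈ U, a + b ∈ V) : f * g ∈ supp V := by
  rw [eq_sum_single f, eq_sum_single g, Finset.sum_mul_sum]
  refine sum_mem fun a ha => sum_mem fun b hb => ?_
  rw [AddMonoidAlgebra.single_mul_single]
  exact single_mem_supp (h a (hf a (by simpa using ha)) b (hg b (by simpa using hb))) _

theorem eq_zero_of_mem_supp {T U : Set (ℤ × ℤ × ℤ)} {f : Lau} (hf : f ∈ supp T)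
    (hg : f ∈ supp U) (h : ∀ m ∈ T, m ∉ U) : f = 0 := by
  ext m
  by_contra hm
  exact h m (hf m hm) (hg m hm)

open Classical in
/-- The projection to the span of the monomials with exponents in `T`. -/
noncomputable def cut (T : Set (ℤ × ℤ × ℤ)) : Lau →+ Lau where
  toFun f := AddMonoidAlgebra.ofCoeff (f.coeff.filter (· ∈ T))
  map_zero' := congrArg AddMonoidAlgebra.ofCoeff (Finsupp.filter_zero _)
  map_add' _ _ := congrArg AddMonoidAlgebra.ofCoeff Finsupp.filter_add

open Classical in
theorem coeff_cut_of_mem {T : Set (ℤ × ℤ × ℤ)} (f : Lau) {m : ℤ × ℤ × ℤ} (hm : m ∈ T) :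
    (cut T f).coeff m = f.coeff m :=
  Finsupp.filter_apply_pos (· ∈ T) f.coeff hm

open Classical in
theorem coeff_cut_of_notMem {T : Set (ℤ × ℤ × ℤ)} (f : Lau) {m : ℤ × ℤ × ℤ} (hm : m ∉ T) :
    (cut T f).coeff m = 0 :=
  Finsupp.filter_apply_neg (· ∈ T) f.coeff hm

theorem cut_mem (T : Set (ℤ × ℤ × ℤ)) (f : Lau) : cut T f ∈ supp T := by
  intro m hm
  by_contra h
  exact hm (coeff_cut_of_notMem f h)

theorem sub_cut_mem {T U : Set (ℤ × ℤ × ℤ)} {f : Lau} (hf : f ∈ supp U) :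
    f - cut T f ∈ supp (U \ T) := by
  intro m hm
  rw [AddMonoidAlgebra.coeff_sub, Finsupp.sub_apply] at hm
  by_cases h : m ∈ T
  · exact absurd (by rw [coeff_cut_of_mem f h, sub_self]) hm
  · refine ⟨hf m fun h0 => hm ?_, h⟩
    rw [coeff_cut_of_notMem f h, h0, sub_zero]

theorem cut_ne_zero {T : Set (ℤ × ℤ × ℤ)} {f : Lau} {m : ℤ × ℤ × ℤ} (hm : m ∈ T)
    (h : f.coeff m ≠ 0) : cut T f ≠ 0 := by
  intro h0
  apply h
  rw [← coeff_cut_of_mem f hm, h0]; rfl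

/-- The derivation of the ring of Laurent polynomials with prescribed logarithmic derivatives
of the monomials. -/
noncomputable def derOfLog (a : ℤ × ℤ × ℤ →+ Lau) : Derivation ℂ Lau Lau :=
  Derivation.mk'
    { toFun := fun f => f.coeff.sum fun m c => AddMonoidAlgebra.single m c * a m
      map_add' := by
        intro f g
        rw [AddMonoidAlgebra.coeff_add, Finsupp.sum_add_index'] <;> simp [add_mul]
      map_smul' := by
        intro c f
        rw [AddMonoidAlgebra.coeff_smul, Finsupp.sum_smul_index (by simp)]
        simp only [RingHom.id_apply, Finsupp.smul_sum, ← smul_mul_assoc,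
          AddMonoidAlgebra.smul_single, smul_eq_mul] }
    (by
      intro f g
      induction f using AddMonoidAlgebra.induction_linear with
      | zero => simp
      | add f f' hf hf' => rw [add_mul, map_add, map_add, hf, hf', add_smul, smul_add]; abel
      | single m c =>
        induction g using AddMonoidAlgebra.induction_linear with
        | zero => simp
        | add f f' hf hf' => rw [mul_add, map_add, map_add, hf, hf', add_smul, smul_add]; abel
        | single m' c' =>
          rw [AddMonoidAlgebra.single_mul_single]
          simp only [LinearMap.coe_mk, AddHom.coe_mk, AddMonoidAlgebra.coeff_single, zero_mul,
            AddMonoidAlgebra.single_zero, Finsupp.sum_single_index, map_add, smul_eq_mul]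
          rw [← AddMonoidAlgebra.single_mul_single]
          ring)

theorem derOfLog_single (a : ℤ × ℤ × ℤ →+ Lau) (m : ℤ × ℤ × ℤ) (c : ℂ) :
    derOfLog a (AddMonoidAlgebra.single m c) = AddMonoidAlgebra.single m c * a m := by
  simp [derOfLog]

theorem derOfLog_apply (a : ℤ × ℤ × ℤ →+ Lau) (f : Lau) :
    derOfLog a f = ∑ m ∈ f.coeff.support, AddMonoidAlgebra.single m (f.coeff m) * a m := rfl

theorem derOfLog_mem {a : ℤ × ℤ × ℤ →+ Lau} {T U V : Set (ℤ × ℤ × ℤ)} {f : Lau}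
    (hf : f ∈ supp T) (ha : ∀ m, a m ∈ supp U) (h : ∀ p ∈ T, ∀ q ∈ U, p + q ∈ V) :
    derOfLog a f ∈ supp V := by
  rw [derOfLog_apply]
  exact sum_mem fun m hm =>
    mul_mem_supp (single_mem_supp (hf m (by simpa using hm)) _) (ha m) h

theorem single_mul_single_neg (m : ℤ × ℤ × ℤ) :
    (AddMonoidAlgebra.single m 1 : Lau) * AddMonoidAlgebra.single (-m) 1 = 1 := by
  rw [AddMonoidAlgebra.single_mul_single, add_neg_cancel, mul_one]; rfl

/-- The logarithmic derivatives of the monomials. -/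
noncomputable def logDer (δ : Derivation ℂ Lau Lau) : ℤ × ℤ × ℤ →+ Lau where
  toFun m := AddMonoidAlgebra.single (-m) 1 * δ (AddMonoidAlgebra.single m 1)
  map_zero' := by
    have : (AddMonoidAlgebra.single 0 1 : Lau) = 1 := rfl
    rw [this, δ.map_one_eq_zero, mul_zero]
  map_add' p q := by
    have h1 : (AddMonoidAlgebra.single (p + q) 1 : Lau)
        = AddMonoidAlgebra.single p 1 * AddMonoidAlgebra.single q 1 := by
      rw [AddMonoidAlgebra.single_mul_single, mul_one]
    have h2 : (AddMonoidAlgebra.single (-(p + q)) 1 : Lau)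
        = AddMonoidAlgebra.single (-p) 1 * AddMonoidAlgebra.single (-q) 1 := by
      rw [AddMonoidAlgebra.single_mul_single, mul_one, neg_add]
    rw [h1, h2, δ.leibniz, smul_eq_mul, smul_eq_mul]
    have hp := single_mul_single_neg p
    have hq := single_mul_single_neg q
    set sp : Lau := AddMonoidAlgebra.single p 1
    set sq : Lau := AddMonoidAlgebra.single q 1
    linear_combination
      (AddMonoidAlgebra.single (-q) 1 * δ sq) * hp + (AddMonoidAlgebra.single (-p) 1 * δ sp) * hq

theorem derOfLog_logDer (δ : Derivation ℂ Lau Lau) : derOfLog (logDer δ) = δ := by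
  refine Derivation.ext fun f => ?_
  induction f using AddMonoidAlgebra.induction_linear with
  | zero => simp
  | add f g hf hg => rw [map_add, map_add, hf, hg]
  | single m c =>
    have h : (AddMonoidAlgebra.single m c : Lau) = c • AddMonoidAlgebra.single m 1 := by simp
    rw [h, Derivation.map_smul, Derivation.map_smul, derOfLog_single]
    change c • (AddMonoidAlgebra.single m 1 *
      (AddMonoidAlgebra.single (-m) 1 * δ (AddMonoidAlgebra.single m 1))) = _
    rw [← mul_assoc, single_mul_single_neg, one_mul]

theorem addHom_eq (a : ℤ × ℤ × ℤ →+ Lau) (m : ℤ × ℤ × ℤ) :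
    a m = m.1 • a (1, 0, 0) + m.2.1 • a (0, 1, 0) + m.2.2 • a (0, 0, 1) := by
  rw [← map_zsmul, ← map_zsmul, ← map_zsmul, ← map_add, ← map_add]
  congr 1
  ext <;> simp

variable {Γ : Type*} [AddCommGroup Γ] [LinearOrder Γ] [IsOrderedAddMonoid Γ]

/-- The part of `f` of degree `μ` is `g`, and all other terms of `f` have smaller degree. -/
def Lead (deg : ℤ × ℤ × ℤ →+ Γ) (f g : Lau) (μ : Γ) : Prop :=
  g ∈ supp {m | deg m = μ} ∧ f - g ∈ supp {m | deg m < μ}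

theorem Lead.mul {deg : ℤ × ℤ × ℤ →+ Γ} {f g f' g' : Lau} {μ ν : Γ} (h : Lead deg f g μ)
    (h' : Lead deg f' g' ν) : Lead deg (f * f') (g * g') (μ + ν) := by
  refine ⟨mul_mem_supp h.1 h'.1 ?_, ?_⟩
  · intro a ha b hb
    simp only [Set.mem_ofPred_eq] at ha hb ⊢
    rw [map_add, ha, hb]
  · have e : f * f' - g * g' = (f - g) * (f' - g') + (f - g) * g' + g * (f' - g') := by ring
    rw [e]
    refine add_mem (add_mem (mul_mem_supp h.2 h'.2 ?_) (mul_mem_supp h.2 h'.1 ?_))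
      (mul_mem_supp h.1 h'.2 ?_)
    · intro a ha b hb
      simp only [Set.mem_ofPred_eq] at ha hb ⊢
      rw [map_add]; exact add_lt_add ha hb
    · intro a ha b hb
      simp only [Set.mem_ofPred_eq] at ha hb ⊢
      rw [map_add, hb]; exact add_lt_add_left ha _
    · intro a ha b hb
      simp only [Set.mem_ofPred_eq] at ha hb ⊢
      rw [map_add, ha]; exact add_lt_add_right hb _

theorem Lead.pow {deg : ℤ × ℤ × ℤ →+ Γ} {f g : Lau} {μ : Γ} (h : Lead deg f g μ) (n : ℕ) :
    Lead deg (f ^ n) (g ^ n) (n • μ) := by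
  induction n with
  | zero =>
    rw [pow_zero, pow_zero, zero_smul]
    exact ⟨single_mem_supp (by simp) 1, by simp⟩
  | succ n ih => rw [pow_succ, pow_succ, succ_nsmul]; exact ih.mul h

theorem exists_lead (deg : ℤ × ℤ × ℤ →+ Γ) {f : Lau} (hf : f ≠ 0) :
    ∃ μ g, g ≠ 0 ∧ Lead deg f g μ := by
  have hne : f.coeff.support.Nonempty := by
    rw [Finsupp.support_nonempty_iff]
    simpa using hf
  obtain ⟨m, hm, hmax⟩ := f.coeff.support.exists_max_image deg hne
  refine ⟨deg m, cut {p | deg p = deg m} f, cut_ne_zero rfl (by simpa using hm),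
    cut_mem _ _, ?_⟩
  have : f ∈ supp {p | deg p ≤ deg m} := fun p hp => hmax p (by simpa using hp)
  refine supp_mono ?_ (sub_cut_mem this)
  rintro p ⟨h1, h2⟩
  exact lt_of_le_of_ne h1 h2

theorem Lead.mem_le {deg : ℤ × ℤ × ℤ →+ Γ} {f g : Lau} {μ : Γ} (h : Lead deg f g μ) :
    f ∈ supp {m | deg m ≤ μ} := by
  rw [← sub_add_cancel f g]
  exact add_mem (supp_mono (fun m hm => le_of_lt hm) h.2) (supp_mono (fun m hm => le_of_eq hm) h.1)

theorem Lead.eq_zero_of_mem_lt {deg : ℤ × ℤ × ℤ →+ Γ} {f g : Lau} {μ ν : Γ} (h : Lead deg f g μ)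
    (hf : f ∈ supp {m | deg m < ν}) (hν : ν ≤ μ) : g = 0 := by
  refine eq_zero_of_mem_supp h.1 (U := {m | deg m < μ}) ?_ ?_
  · have : g = f - (f - g) := by ring
    rw [this]
    exact sub_mem (supp_mono (fun m hm => lt_of_lt_of_le hm hν) hf) h.2
  · intro m hm hm'
    exact absurd hm hm'.ne

theorem Lead.unique {deg : ℤ × ℤ × ℤ →+ Γ} {f g g' : Lau} {μ ν : Γ} (h : Lead deg f g μ)
    (h' : Lead deg f g' ν) (hg : g ≠ 0) (hg' : g' ≠ 0) : μ = ν ∧ g = g' := by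
  have key : ∀ {g g' : Lau} {μ ν : Γ}, Lead deg f g μ → Lead deg f g' ν → g ≠ 0 → μ ≤ ν := by
    intro g g' μ ν h h' hg
    by_contra hlt
    push Not at hlt
    exact hg (h.eq_zero_of_mem_lt (supp_mono (fun m hm => lt_of_le_of_lt hm hlt) h'.mem_le) le_rfl)
  obtain rfl := le_antisymm (key h h' hg) (key h' h hg')
  refine ⟨rfl, sub_eq_zero.1 ?_⟩
  refine eq_zero_of_mem_supp (sub_mem h.1 h'.1) (U := {m | deg m < μ}) ?_ ?_
  · have : g - g' = (f - g') - (f - g) := by ring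
    rw [this]; exact sub_mem h'.2 h.2
  · intro m hm hm'
    exact absurd hm hm'.ne

theorem Lead.eq_zero {deg : ℤ × ℤ × ℤ →+ Γ} {g : Lau} {μ : Γ} (h : Lead deg 0 g μ) : g = 0 :=
  h.eq_zero_of_mem_lt (zero_mem _) le_rfl

theorem lead_self {deg : ℤ × ℤ × ℤ →+ Γ} {f : Lau} {μ : Γ} (h : f ∈ supp {m | deg m = μ}) :
    Lead deg f f μ := ⟨h, by rw [sub_self]; exact zero_mem _⟩

/-- A nonzero derivation of the ring of Laurent polynomials has a nonzero homogeneous part of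
highest degree. -/
theorem exists_top_derivation (deg : ℤ × ℤ × ℤ →+ Γ) {δ : Derivation ℂ Lau Lau} (hδ : δ ≠ 0) :
    ∃ (γ : Γ) (D : Derivation ℂ Lau Lau),
      (∀ (f g : Lau) (μ : Γ), Lead deg f g μ → Lead deg (δ f) (D g) (μ + γ)) ∧
      ¬ (D (AddMonoidAlgebra.single (1, 0, 0) 1) = 0 ∧ D (AddMonoidAlgebra.single (0, 1, 0) 1) = 0 ∧
        D (AddMonoidAlgebra.single (0, 0, 1) 1) = 0) := by
  classical
  -- The logarithmic derivative is additive in the exponent, so all its values are supported in the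
  -- finite union `W` of the supports of three of them. The part of `a` in the maximal degree `γ` on
  -- `W` defines the top derivation.
  set a := logDer δ with ha
  have hδa : δ = derOfLog a := (derOfLog_logDer δ).symm
  set W : Finset (ℤ × ℤ × ℤ) := (a (1, 0, 0)).coeff.support ∪ (a (0, 1, 0)).coeff.support ∪
    (a (0, 0, 1)).coeff.support with hW
  have haW : ∀ m, a m ∈ supp (W : Set (ℤ × ℤ × ℤ)) := by
    intro m
    rw [addHom_eq a m]
    refine add_mem (add_mem (zsmul_mem ?_ _) (zsmul_mem ?_ _)) (zsmul_mem ?_ _) <;>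
    · intro p hp
      have : p ∈ W := by simp only [hW, Finset.mem_union, Finsupp.mem_support_iff]; tauto
      exact this
  have hne : W.Nonempty := by
    rw [Finset.nonempty_iff_ne_empty]
    intro h0
    apply hδ
    have : a = 0 := by
      ext m : 1
      have := haW m
      rw [h0] at this
      exact eq_zero_of_mem_supp this this (by simp)
    rw [hδa, this]
    ext f
    rw [derOfLog_apply]
    simp
  obtain ⟨m₀, hm₀, hmax⟩ := W.exists_max_image deg hne
  set γ := deg m₀ with hγ
  have hale : ∀ m, a m ∈ supp {p | deg p ≤ γ} := fun m => supp_mono (fun p hp => hmax p hp) (haW m)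
  set T : Set (ℤ × ℤ × ℤ) := {p | deg p = γ} with hT
  refine ⟨γ, derOfLog ((cut T).comp a), ?_, ?_⟩
  · intro f g μ h
    have hD : derOfLog ((cut T).comp a) g ∈ supp {m | deg m = μ + γ} := by
      refine derOfLog_mem h.1 (fun m => cut_mem T (a m)) ?_
      intro p hp q hq
      simp only [Set.mem_ofPred_eq, hT] at hp hq ⊢
      rw [map_add, hp, hq]
    refine ⟨hD, ?_⟩
    have e : δ f - derOfLog ((cut T).comp a) g
        = derOfLog a (f - g) + derOfLog (a - (cut T).comp a) g := by
      have e2 : derOfLog (a - (cut T).comp a) g = derOfLog a g - derOfLog ((cut T).comp a) g := by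
        simp only [derOfLog_apply, ← Finset.sum_sub_distrib, ← mul_sub, AddMonoidHom.sub_apply]
      rw [e2, hδa, map_sub]; ring
    rw [e]
    refine add_mem (derOfLog_mem h.2 hale ?_) (derOfLog_mem h.1 (U := {p | deg p < γ}) ?_ ?_)
    · intro p hp q hq
      simp only [Set.mem_ofPred_eq] at hp hq ⊢
      rw [map_add]; exact add_lt_add_of_lt_of_le hp hq
    · intro m
      rw [AddMonoidHom.sub_apply, AddMonoidHom.comp_apply]
      refine supp_mono ?_ (sub_cut_mem (hale m))
      rintro p ⟨h1, h2⟩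
      exact lt_of_le_of_ne h1 h2
    · intro p hp q hq
      simp only [Set.mem_ofPred_eq] at hp hq ⊢
      rw [map_add, hp]; exact add_lt_add_right hq _
  -- The exponent `m₀` of maximal degree occurs in the logarithmic derivative of one of the
  -- variables and survives the cut.
  · rintro ⟨h1, h2, h3⟩
    have key : ∀ m, derOfLog ((cut T).comp a) (AddMonoidAlgebra.single m 1) = 0 →
        (a m).coeff m₀ = 0 := by
      intro m h
      by_contra hcon
      rw [derOfLog_single] at h
      rcases mul_eq_zero.1 h with h | h
      · simp at h
      · exact cut_ne_zero (T := T) (show deg m₀ = γ from rfl) hcon h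
    have := key _ h1
    have := key _ h2
    have := key _ h3
    simp only [hW, Finset.mem_union, Finsupp.mem_support_iff] at hm₀
    tauto

/-- If `δ^n f = 0` then `D^n` kills the leading form of `f`, so local nilpotence passes to the top
part. Since `Lead` allows the form `g` to vanish, cancellation needs no separate treatment. -/
theorem Lead.iterate {deg : ℤ × ℤ × ℤ →+ Γ} {δ D : Derivation ℂ Lau Lau} {γ : Γ}
    (hD : ∀ (f g : Lau) (μ : Γ), Lead deg f g μ → Lead deg (δ f) (D g) (μ + γ))
    {f g : Lau} {μ : Γ} (h : Lead deg f g μ) (n : ℕ) :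
    Lead deg (δ^[n] f) (D^[n] g) (μ + n • γ) := by
  induction n with
  | zero => simpa using h
  | succ n ih =>
    rw [Function.iterate_succ_apply', Function.iterate_succ_apply', succ_nsmul, ← add_assoc]
    exact hD _ _ _ ih

end Laurent

end KorasRussell

namespace KorasRussell

/-! ### Factorisation of quasi-homogeneous polynomials. -/

section Laurent

/-- The monomial `x^a z^b t^c`. -/
noncomputable def monL (a b c : ℤ) : Lau := AddMonoidAlgebra.single (a, b, c) 1

theorem monL_mul (a b c a' b' c' : ℤ) :
    monL a b c * monL a' b' c' = monL (a + a') (b + b') (c + c') := by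
  rw [monL, monL, AddMonoidAlgebra.single_mul_single, mul_one]; rfl

theorem monL_zero : monL 0 0 0 = 1 := rfl

theorem monL_pow (a b c : ℤ) (n : ℕ) : monL a b c ^ n = monL (n * a) (n * b) (n * c) := by
  induction n with
  | zero => simp [monL_zero]
  | succ n ih => rw [pow_succ, ih, monL_mul]; congr 1 <;> push_cast <;> ring

theorem monL_ne_zero (a b c : ℤ) : monL a b c ≠ 0 := by
  rw [monL, Ne, AddMonoidAlgebra.single_eq_zero]; exact one_ne_zero

theorem monL_mem {T : Set (ℤ × ℤ × ℤ)} {a b c : ℤ} (h : (a, b, c) ∈ T) : monL a b c ∈ supp T :=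
  single_mem_supp h 1

/-- A quasi-homogeneous polynomial in `z, t` is a product of factors `z`, `t`, `z^k - μ t^l`. -/
theorem quasi_homogeneous_factor {k l : ℕ} (hk : 0 < k) (hl : 0 < l) (hcop : Nat.Coprime k l)
    {w : ℤ} {f : Lau} (hf0 : f ≠ 0)
    (hf : f ∈ supp {m | m.1 = 0 ∧ 0 ≤ m.2.1 ∧ 0 ≤ m.2.2 ∧ l * m.2.1 + k * m.2.2 = w}) :
    ∃ (c : ℂ) (β γ : ℕ) (s : Multiset ℂ), c ≠ 0 ∧
      f = c • (monL 0 1 0 ^ β * monL 0 0 1 ^ γ *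
        (s.map fun μ => monL 0 1 0 ^ k - μ • monL 0 0 1 ^ l).prod) := by
  obtain ⟨m₀, hm₀⟩ : f.coeff.support.Nonempty := by
    rw [Finsupp.support_nonempty_iff]; simpa using hf0
  have hmem : ∀ m ∈ f.coeff.support, m.1 = 0 ∧ 0 ≤ m.2.1 ∧ 0 ≤ m.2.2 ∧
    l * m.2.1 + k * m.2.2 = w := fun m hm => hf m (by simpa using hm)
  obtain ⟨-, h0b, h0c, h0w⟩ := hmem m₀ hm₀
  have hk' : (0 : ℤ) < k := by exact_mod_cast hk
  have hl' : (0 : ℤ) < l := by exact_mod_cast hl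
  -- By coprimality the exponents of weight `w` lie on a line with direction `(k, -l)`: they are
  -- `(b₀ + k j, c₀ - l j)`, with `b₀` the common residue modulo `k`.
  set b₀ : ℤ := m₀.2.1 % k with hb₀
  set c₀ : ℤ := m₀.2.2 + l * (m₀.2.1 / k) with hc₀
  have hb₀' : b₀ + k * (m₀.2.1 / k) = m₀.2.1 := Int.emod_add_mul_ediv _ _
  have hb₀0 : 0 ≤ b₀ := Int.emod_nonneg _ hk'.ne'
  have hc₀0 : 0 ≤ c₀ := add_nonneg h0c (mul_nonneg hl'.le (Int.ediv_nonneg h0b hk'.le))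
  have key : ∀ m ∈ f.coeff.support, m.2.1 = b₀ + k * (m.2.1 / k) ∧
      m.2.2 = c₀ - l * (m.2.1 / k) := by
    intro m hm
    obtain ⟨-, hb, hc, hw⟩ := hmem m hm
    have hdvd : (k : ℤ) ∣ m.2.1 - m₀.2.1 := by
      have : (k : ℤ) ∣ l * (m.2.1 - m₀.2.1) := ⟨m₀.2.2 - m.2.2, by linear_combination hw - h0w⟩
      exact (Int.isCoprime_iff_gcd_eq_one.2 (by simpa using hcop)).dvd_of_dvd_mul_left this
    have hmod : m.2.1 % k = b₀ := (Int.modEq_iff_dvd.2 hdvd).symm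
    have e1 : b₀ + k * (m.2.1 / k) = m.2.1 := by
      rw [← hmod]; exact Int.emod_add_mul_ediv _ _
    refine ⟨e1.symm, ?_⟩
    have : (k : ℤ) * m.2.2 = k * (c₀ - l * (m.2.1 / k)) := by
      rw [hc₀]
      linear_combination hw - h0w + l * e1 - l * hb₀'
    exact mul_left_cancel₀ hk'.ne' this
  set N : ℕ := (c₀ / l).toNat with hN
  have hN' : (N : ℤ) = c₀ / l := Int.toNat_of_nonneg (Int.ediv_nonneg hc₀0 hl'.le)
  have hγ : 0 ≤ c₀ - l * N := by
    rw [hN']; linarith [Int.mul_ediv_self_le (x := c₀) hl'.ne']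
  set j : ℤ × ℤ × ℤ → ℕ := fun m => (m.2.1 / k).toNat with hj
  have hj' : ∀ m ∈ f.coeff.support, (j m : ℤ) = m.2.1 / k := fun m hm =>
    Int.toNat_of_nonneg (Int.ediv_nonneg (hmem m hm).2.1 hk'.le)
  have hjN : ∀ m ∈ f.coeff.support, j m ≤ N := by
    intro m hm
    zify
    rw [hj' m hm, hN', Int.le_ediv_iff_mul_le hl']
    have h1 := (key m hm).2
    have h2 := (hmem m hm).2.2.1
    linarith
  -- Up to a monomial `f` is `t^(lN) P(z^k / t^l)`. The roots of `P` give the binomial factors, and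
  -- the deficit `N - deg P` turns into extra powers of `t^l`.
  set P : Polynomial ℂ := ∑ m ∈ f.coeff.support, Polynomial.monomial (j m) (f.coeff m) with hP
  set w₁ : Lau := monL 0 k (-l) with hw₁
  have hfP : f = monL 0 b₀ (c₀ - l * N) * (monL 0 0 l ^ N * Polynomial.aeval w₁ P) := by
    conv_lhs => rw [eq_sum_single f]
    rw [hP, map_sum, Finset.mul_sum, Finset.mul_sum]
    refine Finset.sum_congr rfl fun m hm => ?_
    rw [Polynomial.aeval_monomial, hw₁, monL_pow, monL_pow]
    have e1 : (AddMonoidAlgebra.single m (f.coeff m) : Lau) = algebraMap ℂ Lau (f.coeff m) *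
        monL 0 (b₀ + k * (j m)) (c₀ - l * (j m)) := by
      rw [← Algebra.smul_def, monL, AddMonoidAlgebra.smul_single, smul_eq_mul, mul_one, hj' m hm,
        ← (key m hm).1, ← (key m hm).2, ← (hmem m hm).1]
    rw [e1, mul_left_comm (monL _ _ _) (algebraMap _ _ _), mul_left_comm (monL _ _ _)
      (algebraMap _ _ _), monL_mul, monL_mul]
    congr 2 <;> ring
  have hP0 : P ≠ 0 := by
    intro h; rw [h, map_zero, mul_zero, mul_zero] at hfP; exact hf0 hfP
  have hdeg : P.natDegree ≤ N := by
    refine Polynomial.natDegree_sum_le_of_forall_le _ _ fun m hm => ?_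
    exact (Polynomial.natDegree_monomial_le _).trans (hjN m hm)
  have hsplit := (IsAlgClosed.splits P)
  have hroots := hsplit.eq_prod_roots
  have hcard : P.roots.card = P.natDegree := hsplit.natDegree_eq_card_roots.symm
  refine ⟨P.leadingCoeff, b₀.toNat, (c₀ - l * N).toNat + l * (N - P.natDegree), P.roots,
    Polynomial.leadingCoeff_ne_zero.2 hP0, ?_⟩
  have hprod : monL 0 0 l ^ P.natDegree * (P.roots.map fun μ => w₁ - algebraMap ℂ Lau μ).prod
      = (P.roots.map fun μ => monL 0 1 0 ^ k - μ • monL 0 0 1 ^ l).prod := by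
    rw [← hcard, ← Multiset.prod_replicate, ← Multiset.map_const', ← Multiset.prod_map_mul]
    congr 1
    refine Multiset.map_congr rfl fun μ _ => ?_
    rw [mul_sub, hw₁, monL_mul, monL_pow, monL_pow, Algebra.smul_def, mul_comm (monL 0 0 l)]
    simp
  have haev : Polynomial.aeval w₁ P = algebraMap ℂ Lau P.leadingCoeff *
      (P.roots.map fun μ => w₁ - algebraMap ℂ Lau μ).prod := by
    conv_lhs => rw [hroots]
    rw [map_mul, Polynomial.aeval_C, map_multiset_prod, Multiset.map_map]
    congr 2
    refine Multiset.map_congr rfl fun μ _ => ?_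
    simp
  rw [hfP, haev, ← hprod, Algebra.smul_def]
  have e2 : monL 0 b₀ (c₀ - l * N) = monL 0 1 0 ^ b₀.toNat * monL 0 0 1 ^ (c₀ - l * N).toNat := by
    rw [monL_pow, monL_pow, monL_mul, Int.toNat_of_nonneg hb₀0, Int.toNat_of_nonneg hγ]
    congr 1 <;> ring
  have e3 : monL 0 0 l = monL 0 0 1 ^ l := by rw [monL_pow]; simp
  have e4 : monL 0 0 l ^ N = monL 0 0 1 ^ (l * (N - P.natDegree)) * monL 0 0 l ^ P.natDegree := by
    rw [pow_mul, ← e3, ← pow_add, Nat.sub_add_cancel hdeg]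
  rw [e2, e4, pow_add]
  ring

end Laurent

end KorasRussell

namespace KorasRussell

/-! ### The coordinate ring as a ring of Laurent polynomials; leading terms along `x = 0`. -/

section LaurentModel

/-- The subalgebra of Laurent polynomials with exponents in a submonoid. -/
noncomputable def suppSubalgebra (T : AddSubmonoid (ℤ × ℤ × ℤ)) : Subalgebra ℂ Lau where
  carrier := supp (T : Set (ℤ × ℤ × ℤ))
  mul_mem' := fun hf hg => mul_mem_supp (SetLike.mem_coe.1 hf) (SetLike.mem_coe.1 hg)
    fun _ ha _ hb => T.add_mem ha hb
  add_mem' := fun hf hg => (supp (T : Set (ℤ × ℤ × ℤ))).add_mem hf hg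
  algebraMap_mem' := fun c => single_mem_supp T.zero_mem c

/-- Laurent polynomials without poles: the subring `ℂ[x, z, t]`. -/
noncomputable def polyL : Subalgebra ℂ Lau :=
  suppSubalgebra
    { carrier := {m | 0 ≤ m.1 ∧ 0 ≤ m.2.1 ∧ 0 ≤ m.2.2}
      add_mem' := by
        rintro a b ⟨h1, h2, h3⟩ ⟨h4, h5, h6⟩
        exact ⟨add_nonneg h1 h4, add_nonneg h2 h5, add_nonneg h3 h6⟩
      zero_mem' := ⟨le_rfl, le_rfl, le_rfl⟩ }

theorem mem_polyL {f : Lau} :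
    f ∈ polyL ↔ f ∈ supp {m | 0 ≤ m.1 ∧ 0 ≤ m.2.1 ∧ 0 ≤ m.2.2} := Iff.rfl

theorem monL_mem_polyL {a b c : ℤ} (ha : 0 ≤ a) (hb : 0 ≤ b) (hc : 0 ≤ c) :
    monL a b c ∈ polyL := mem_polyL.2 (monL_mem ⟨ha, hb, hc⟩)

theorem monL_pow_x (n : ℕ) : monL 1 0 0 ^ n = monL n 0 0 := by rw [monL_pow]; simp

variable (d k l : ℕ)

/-- The cuspidal polynomial `z^k + t^ℓ`. -/
noncomputable def cuspL : Lau := monL 0 1 0 ^ k + monL 0 0 1 ^ l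

/-- The function `y` on the threefold. -/
noncomputable def yL : Lau := -(monL (-d) 0 0 * (cuspL k l + monL 1 0 0))

/-- The leading form `(z^k + t^ℓ) / x^d` of `-y`. -/
noncomputable def yTop : Lau := monL (-d) 0 0 * cuspL k l

theorem x_pow_mul_yL : monL 1 0 0 ^ d * yL d k l = -(cuspL k l + monL 1 0 0) := by
  rw [yL, mul_neg, ← mul_assoc, monL_pow_x, monL_mul]; simp [monL_zero]

theorem x_pow_mul_yTop : monL 1 0 0 ^ d * yTop d k l = cuspL k l := by
  rw [yTop, ← mul_assoc, monL_pow_x, monL_mul]; simp [monL_zero]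

/-- The coordinate ring of the threefold. -/
noncomputable def coordL : Subalgebra ℂ Lau :=
  Algebra.adjoin ℂ {monL 1 0 0, yL d k l, monL 0 1 0, monL 0 0 1}

variable {d k l}

theorem x_mem_coordL : monL 1 0 0 ∈ coordL d k l := Algebra.subset_adjoin (by simp)

theorem y_mem_coordL : yL d k l ∈ coordL d k l := Algebra.subset_adjoin (by simp)

theorem z_mem_coordL : monL 0 1 0 ∈ coordL d k l := Algebra.subset_adjoin (by simp)

theorem t_mem_coordL : monL 0 0 1 ∈ coordL d k l := Algebra.subset_adjoin (by simp)

theorem monL_eq_pow (a b c : ℕ) :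
    monL a b c = monL 1 0 0 ^ a * monL 0 1 0 ^ b * monL 0 0 1 ^ c := by
  rw [monL_pow, monL_pow, monL_pow, monL_mul, monL_mul]; congr 1 <;> simp

theorem polyL_le_coordL : polyL ≤ coordL d k l := by
  intro f hf
  rw [eq_sum_single f]
  refine sum_mem fun m hm => ?_
  obtain ⟨h1, h2, h3⟩ := mem_polyL.1 hf m (by simpa using hm)
  have : (AddMonoidAlgebra.single m (f.coeff m) : Lau) = f.coeff m • monL m.1 m.2.1 m.2.2 := by
    simp [monL]
  rw [this]
  refine Subalgebra.smul_mem _ ?_ _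
  obtain ⟨a, ha⟩ := Int.eq_ofNat_of_zero_le h1
  obtain ⟨b, hb⟩ := Int.eq_ofNat_of_zero_le h2
  obtain ⟨c, hc⟩ := Int.eq_ofNat_of_zero_le h3
  rw [ha, hb, hc, monL_eq_pow]
  exact mul_mem (mul_mem (pow_mem x_mem_coordL _) (pow_mem z_mem_coordL _))
    (pow_mem t_mem_coordL _)

theorem cuspL_mem_polyL : cuspL k l ∈ polyL :=
  add_mem (pow_mem (monL_mem_polyL le_rfl zero_le_one le_rfl) k)
    (pow_mem (monL_mem_polyL le_rfl le_rfl zero_le_one) l)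

theorem exists_aeval_eq {b : Lau} (hb : b ∈ coordL d k l) :
    ∃ p : Polynomial polyL, Polynomial.aeval (yL d k l) p = b := by
  have : coordL d k l ≤
      ((Polynomial.aeval (yL d k l) : Polynomial polyL →ₐ[polyL] Lau).range).restrictScalars ℂ := by
    rw [coordL, Algebra.adjoin_le_iff]
    have hC : ∀ f ∈ polyL, f ∈ ((Polynomial.aeval (yL d k l) :
        Polynomial polyL →ₐ[polyL] Lau).range).restrictScalars ℂ := by
      intro f hf
      exact ⟨Polynomial.C ⟨f, hf⟩, by simp⟩
    rintro f (rfl | rfl | rfl | rfl)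
    · exact hC _ (monL_mem_polyL zero_le_one le_rfl le_rfl)
    · exact ⟨Polynomial.X, by simp⟩
    · exact hC _ (monL_mem_polyL le_rfl zero_le_one le_rfl)
    · exact hC _ (monL_mem_polyL le_rfl le_rfl zero_le_one)
  exact this hb

/-- The order of the pole along `x = 0`. -/
def poleDeg : ℤ × ℤ × ℤ →+ ℤ where
  toFun m := -m.1
  map_zero' := rfl
  map_add' a b := by simp [add_comm]

theorem Lead.mem_supp {Γ : Type*} [AddCommGroup Γ] [LinearOrder Γ]
    {deg : ℤ × ℤ × ℤ →+ Γ} {f g : Lau} {μ : Γ}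
    {U : Set (ℤ × ℤ × ℤ)} (h : Lead deg f g μ) (hf : f ∈ supp U) : g ∈ supp U := by
  intro m hm
  have hdeg : deg m = μ := h.1 m hm
  have h0 : (f - g).coeff m = 0 := by
    by_contra hcon
    exact absurd hdeg (ne_of_lt (h.2 m hcon))
  rw [AddMonoidAlgebra.coeff_sub, Finsupp.sub_apply, sub_eq_zero] at h0
  exact hf m (h0 ▸ hm)

theorem lead_yL : Lead poleDeg (yL d k l) (-yTop d k l) d := by
  constructor
  · refine neg_mem (mul_mem_supp (T := {m | m.1 = -d}) (U := {m | m.1 = 0}) (monL_mem rfl) ?_ ?_)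
    · rw [cuspL, monL_pow, monL_pow]
      exact add_mem (monL_mem (by simp)) (monL_mem (by simp))
    · intro a ha b hb
      simp only [Set.mem_ofPred_eq] at ha hb ⊢
      simp [poleDeg, ha, hb]
  · have : yL d k l - -yTop d k l = -(monL (-d) 0 0 * monL 1 0 0) := by
      rw [yL, yTop]; ring
    rw [this, monL_mul]
    refine neg_mem (monL_mem ?_)
    simp [poleDeg]

/-- One step of the reduction to normal form with respect to `x^d y = -(z^k + t^ℓ + x)`. -/
theorem lower_degree_or_lead {N : ℕ} {p : Polynomial polyL}
    (hp : p.natDegree ≤ N + 1) :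
    (∃ p' : Polynomial polyL, p'.natDegree ≤ N ∧
      Polynomial.aeval (yL d k l) p' = Polynomial.aeval (yL d k l) p) ∨
    ∃ (a : ℕ) (q : Lau), a < d ∧ q ≠ 0 ∧ q ∈ supp {m | m.1 = 0 ∧ 0 ≤ m.2.1 ∧ 0 ≤ m.2.2} ∧
      Lead poleDeg (Polynomial.aeval (yL d k l) p)
        (monL 1 0 0 ^ a * yTop d k l ^ (N + 1) * q) ((N + 1) * d - a) := by
  classical
  set y := yL d k l with hy
  set g : Lau := (p.coeff (N + 1)).1 with hg
  have hgmem : g ∈ supp {m | 0 ≤ m.1 ∧ 0 ≤ m.2.1 ∧ 0 ≤ m.2.2} :=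
    mem_polyL.1 (p.coeff (N + 1)).2
  -- Split the top coefficient as `u + x^d v` with all `x`-exponents of `u` below `d`. If `u = 0`,
  -- the relation for `x^d y` lowers the degree in `y`.
  set v' := cut {m | (d : ℤ) ≤ m.1} g with hv'
  set u := g - v' with hu
  have hu_mem : u ∈ supp {m | m.1 < d ∧ 0 ≤ m.1 ∧ 0 ≤ m.2.1 ∧ 0 ≤ m.2.2} := by
    refine supp_mono ?_ (sub_cut_mem (T := {m | (d : ℤ) ≤ m.1}) hgmem)
    rintro m ⟨h1, h2⟩
    exact ⟨not_le.1 h2, h1⟩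
  have hv'_mem : v' ∈ supp {m | (d : ℤ) ≤ m.1 ∧ 0 ≤ m.2.1 ∧ 0 ≤ m.2.2} := by
    have h1 : v' ∈ supp {m | 0 ≤ m.1 ∧ 0 ≤ m.2.1 ∧ 0 ≤ m.2.2} := by
      have : v' = g - u := by rw [hu]; ring
      rw [this]
      exact sub_mem hgmem (supp_mono (fun m hm => hm.2) hu_mem)
    intro m hm
    exact ⟨cut_mem _ _ m hm, (h1 m hm).2⟩
  set v := monL (-d) 0 0 * v' with hv
  have hv_mem : v ∈ polyL := by
    refine mem_polyL.2 (mul_mem_supp (T := {m | m = (-(d : ℤ), 0, 0)}) (monL_mem rfl) hv'_mem ?_)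
    rintro a ha b ⟨h1, h2, h3⟩
    obtain rfl : a = (-(d : ℤ), 0, 0) := ha
    refine ⟨?_, by simpa using h2, by simpa using h3⟩
    simp; linarith
  have hvv' : v' = monL 1 0 0 ^ d * v := by
    rw [hv, ← mul_assoc, monL_pow_x, monL_mul]; simp [monL_zero]
  -- the polynomial without its top coefficient
  set p₀ : Polynomial polyL := p.erase (N + 1) with hp₀
  have hp₀deg : p₀.natDegree ≤ N := by
    rw [Polynomial.natDegree_le_iff_coeff_eq_zero]
    intro i hi
    rw [hp₀, Polynomial.coeff_erase]
    split_ifs with h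
    · rfl
    · exact Polynomial.coeff_eq_zero_of_natDegree_lt (by omega)
  have hpsum : Polynomial.aeval y p = Polynomial.aeval y p₀ + g * y ^ (N + 1) := by
    conv_lhs => rw [← Polynomial.monomial_add_erase p (N + 1)]
    rw [map_add, Polynomial.aeval_monomial, add_comm]; rfl
  by_cases hu0 : u = 0
  · left
    have hs : -(v * (cuspL k l + monL 1 0 0)) ∈ polyL :=
      neg_mem (mul_mem hv_mem (add_mem cuspL_mem_polyL (monL_mem_polyL zero_le_one le_rfl le_rfl)))
    refine ⟨p₀ + Polynomial.monomial N ⟨_, hs⟩, ?_, ?_⟩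
    · exact (Polynomial.natDegree_add_le _ _).trans
        (max_le hp₀deg (Polynomial.natDegree_monomial_le _))
    · rw [map_add, Polynomial.aeval_monomial, hpsum]
      have h1 : algebraMap polyL Lau ⟨_, hs⟩ = -(v * (cuspL k l + monL 1 0 0)) := rfl
      have h2 : g = v' := sub_eq_zero.1 hu0
      rw [h1, h2, hvv', pow_succ]
      have := x_pow_mul_yL d k l
      rw [← hy] at this
      linear_combination -(v * y ^ N) * this
  -- The lowest power `x^a` in `u` has `a < d`, so `u y^(N+1)` has pole order `(N+1) d - a > N d`.
  -- Neither the lower powers of `y` nor `x^d v y^(N+1)` exceed pole order `N d`.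
  · right
    obtain ⟨μ, û, hû0, hlead⟩ := exists_lead poleDeg hu0
    have hû_mem := hlead.mem_supp hu_mem
    obtain ⟨m₀, hm₀⟩ : û.coeff.support.Nonempty := by
      rw [Finsupp.support_nonempty_iff]; simpa using hû0
    have hm₀' : û.coeff m₀ ≠ 0 := by simpa using hm₀
    have hμ : -m₀.1 = μ := hlead.1 m₀ hm₀'
    obtain ⟨ha1, ha2, -⟩ := hû_mem m₀ hm₀'
    obtain ⟨a, ha⟩ := Int.eq_ofNat_of_zero_le ha2
    have hμa : μ = -(a : ℤ) := by rw [← hμ, ha]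
    refine ⟨a, (-1) ^ (N + 1) * (monL (-a) 0 0 * û), by omega, ?_, ?_, ?_⟩
    · exact mul_ne_zero (pow_ne_zero _ (by simp)) (mul_ne_zero (monL_ne_zero _ _ _) hû0)
    · have h1 : monL (-a) 0 0 * û ∈ supp {m | m.1 = 0 ∧ 0 ≤ m.2.1 ∧ 0 ≤ m.2.2} := by
        have : û ∈ supp {m | m.1 = a ∧ 0 ≤ m.2.1 ∧ 0 ≤ m.2.2} := by
          intro m hm
          have h1 : -m.1 = μ := hlead.1 m hm
          obtain ⟨-, -, h2, h3⟩ := hû_mem m hm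
          exact ⟨by omega, h2, h3⟩
        refine mul_mem_supp (T := {m | m = (-(a : ℤ), 0, 0)}) (monL_mem rfl) this ?_
        rintro p hp b ⟨h1, h2, h3⟩
        obtain rfl : p = (-(a : ℤ), 0, 0) := hp
        refine ⟨?_, by simpa using h2, by simpa using h3⟩
        simp [h1]
      rcases neg_one_pow_eq_or Lau (N + 1) with h | h <;> rw [h]
      · rwa [one_mul]
      · rw [neg_one_mul]; exact neg_mem h1
    · have hy1 := ((lead_yL (d := d) (k := k) (l := l)).pow (N + 1))
      have hmain := hlead.mul hy1
      have e1 : monL 1 0 0 ^ a * yTop d k l ^ (N + 1) * ((-1) ^ (N + 1) * (monL (-a) 0 0 * û))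
          = û * (-yTop d k l) ^ (N + 1) := by
        have : monL 1 0 0 ^ a * monL (-a) 0 0 = 1 := by
          rw [monL_pow_x, monL_mul]; simp [monL_zero]
        rw [neg_pow (yTop d k l)]
        linear_combination (yTop d k l ^ (N + 1) * (-1) ^ (N + 1) * û) * this
      have e2 : μ + (N + 1) • (d : ℤ) = (N + 1) * d - a := by
        rw [hμa]; simp; ring
      rw [e2] at hmain
      rw [e1]
      refine ⟨hmain.1, ?_⟩
      have e3 : Polynomial.aeval y p - û * (-yTop d k l) ^ (N + 1) = Polynomial.aeval y p₀ +
          v' * y ^ (N + 1) + (u * y ^ (N + 1) - û * (-yTop d k l) ^ (N + 1)) := by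
        rw [hpsum, hu]; ring
      rw [e3]
      have hyN : ∀ i : ℕ, y ^ i ∈ supp {m | -(i * d : ℤ) ≤ m.1} := by
        intro i
        refine supp_mono ?_ ((lead_yL (d := d) (k := k) (l := l)).pow i).mem_le
        intro m hm
        have hm' : -m.1 ≤ i • (d : ℤ) := hm
        simp at hm'
        simp only [Set.mem_ofPred_eq]; linarith
      refine add_mem (add_mem ?_ ?_) hmain.2
      · rw [Polynomial.aeval_eq_sum_range]
        refine sum_mem fun i hi => ?_
        rw [Finset.mem_range] at hi
        rw [Algebra.smul_def]
        refine mul_mem_supp (mem_polyL.1 (p₀.coeff i).2) (hyN i) ?_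
        rintro m ⟨h1, -⟩ m' h2
        have h3 : -(i * d : ℤ) ≤ m'.1 := h2
        change -(m.1 + m'.1) < (N + 1 : ℤ) * d - a
        have h4 : (i : ℤ) * d ≤ N * d := by
          have : (i : ℤ) ≤ N := by exact_mod_cast (by omega : i ≤ N)
          gcongr
        have h5 : (a : ℤ) < d := by omega
        linarith
      · refine mul_mem_supp hv'_mem (hyN (N + 1)) ?_
        rintro m ⟨h1, -⟩ m' h2
        have h3 : -((N + 1 : ℕ) * d : ℤ) ≤ m'.1 := h2
        change -(m.1 + m'.1) < (N + 1 : ℤ) * d - a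
        push_cast at h3
        have h5 : (a : ℤ) < d := by omega
        linarith

/-- The leading coefficient along `x = 0` of a regular function on the threefold. -/
theorem exists_lead_of_mem_coordL {b : Lau} (hb : b ∈ coordL d k l) (hb0 : b ≠ 0) :
    ∃ (a i : ℕ) (q : Lau), q ≠ 0 ∧ q ∈ supp {m | m.1 = 0 ∧ 0 ≤ m.2.1 ∧ 0 ≤ m.2.2} ∧
      Lead poleDeg b (monL 1 0 0 ^ a * yTop d k l ^ i * q) (i * d - a) ∧
      (b ∈ polyL ∨ 1 ≤ i) := by
  obtain ⟨p, rfl⟩ := exists_aeval_eq hb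
  obtain ⟨N, hN⟩ : ∃ N, p.natDegree ≤ N := ⟨_, le_rfl⟩
  induction N generalizing p with
  | zero =>
    obtain ⟨c, rfl⟩ := Polynomial.natDegree_eq_zero.1 (Nat.le_zero.1 hN)
    rw [Polynomial.aeval_C] at hb0 ⊢
    have hc : algebraMap polyL Lau c ∈ polyL := c.2
    have hc' := mem_polyL.1 hc
    obtain ⟨μ, g, hg0, hlead⟩ := exists_lead poleDeg hb0
    have hg_mem := hlead.mem_supp hc'
    obtain ⟨m₀, hm₀⟩ : g.coeff.support.Nonempty := by
      rw [Finsupp.support_nonempty_iff]; simpa using hg0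
    have hm₀' : g.coeff m₀ ≠ 0 := by simpa using hm₀
    have hμ : -m₀.1 = μ := hlead.1 m₀ hm₀'
    obtain ⟨a, ha⟩ := Int.eq_ofNat_of_zero_le (hg_mem m₀ hm₀').1
    have e : monL 1 0 0 ^ a * yTop d k l ^ 0 * (monL (-a) 0 0 * g) = g := by
      have : monL 1 0 0 ^ a * monL (-a) 0 0 = 1 := by
        rw [monL_pow_x, monL_mul]; simp [monL_zero]
      rw [pow_zero, mul_one, ← mul_assoc, this, one_mul]
    refine ⟨a, 0, monL (-a) 0 0 * g, mul_ne_zero (monL_ne_zero _ _ _) hg0, ?_, ?_, Or.inl hc⟩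
    · have : g ∈ supp {m | m.1 = a ∧ 0 ≤ m.2.1 ∧ 0 ≤ m.2.2} := by
        intro m hm
        have h1 : -m.1 = μ := hlead.1 m hm
        obtain ⟨-, h2, h3⟩ := hg_mem m hm
        exact ⟨by omega, h2, h3⟩
      refine mul_mem_supp (T := {m | m = (-(a : ℤ), 0, 0)}) (monL_mem rfl) this ?_
      rintro p hp b ⟨h1, h2, h3⟩
      obtain rfl : p = (-(a : ℤ), 0, 0) := hp
      refine ⟨?_, by simpa using h2, by simpa using h3⟩
      simp [h1]
    · rw [e]
      have : ((0 : ℕ) : ℤ) * d - a = μ := by rw [← hμ, ha]; simp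
      rw [this]; exact hlead
  | succ N ih =>
    rcases lower_degree_or_lead (k := k) (l := l) hN with ⟨p', hp', he⟩ |
      ⟨a, q, ha, hq0, hq, hlead⟩
    · have := ih p' (by rwa [he]) (by rwa [he]) hp'
      rwa [he] at this
    · exact ⟨a, N + 1, q, hq0, hq, by exact_mod_cast hlead, Or.inr (by omega)⟩

end LaurentModel

end KorasRussell

namespace KorasRussell

/-! ### Kernels of locally nilpotent derivations consist of polynomials in `x, z, t`. -/

section LaurentKernel

/-- The weight on exponents for which `z^k + t^ℓ` is homogeneous of degree `kℓ`. -/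
def cuspWeight (k l : ℕ) : ℤ × ℤ × ℤ →+ ℤ where
  toFun m := l * m.2.1 + k * m.2.2
  map_zero' := by simp
  map_add' a b := by simp; ring

theorem cuspWeight_apply (k l : ℕ) (m : ℤ × ℤ × ℤ) :
    cuspWeight k l m = l * m.2.1 + k * m.2.2 := rfl

theorem poleDeg_apply (m : ℤ × ℤ × ℤ) : poleDeg m = -m.1 := rfl

/-- The lexicographic degree: first the pole order along `x = 0`, then the weight. -/
def lexDeg (k l : ℕ) : ℤ × ℤ × ℤ →+ ℤ ×ₗ ℤ where
  toFun m := toLex (poleDeg m, cuspWeight k l m)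
  map_zero' := by rw [map_zero, map_zero]; rfl
  map_add' a b := by rw [map_add, map_add]; rfl

theorem lexDeg_apply (k l : ℕ) (m : ℤ × ℤ × ℤ) :
    lexDeg k l m = toLex (poleDeg m, cuspWeight k l m) := rfl

instance : CharZero Lau := charZero_of_injective_algebraMap (algebraMap ℂ Lau).injective

variable {d k l : ℕ}

theorem cuspL_mem_supp : cuspL k l ∈ supp {m | m.1 = 0 ∧ cuspWeight k l m = k * l} := by
  rw [cuspL, monL_pow, monL_pow]
  refine add_mem (monL_mem ?_) (monL_mem ?_) <;> simp [cuspWeight_apply, mul_comm]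

theorem yTop_mem_supp : yTop d k l ∈ supp {m | poleDeg m = d ∧ cuspWeight k l m = k * l} := by
  rw [yTop]
  refine mul_mem_supp (T := {m | poleDeg m = d ∧ cuspWeight k l m = 0}) (monL_mem ?_)
    cuspL_mem_supp ?_
  · simp [poleDeg_apply, cuspWeight_apply]
  · rintro a ⟨h1, h2⟩ b ⟨h3, h4⟩
    refine ⟨?_, ?_⟩
    · rw [map_add, h1, poleDeg_apply, h3]; simp
    · rw [map_add, h2, h4, zero_add]

theorem mem_supp_bihom_mul {f g : Lau} {a b a' b' : ℤ}
    (hf : f ∈ supp {m | poleDeg m = a ∧ cuspWeight k l m = b})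
    (hg : g ∈ supp {m | poleDeg m = a' ∧ cuspWeight k l m = b'}) :
    f * g ∈ supp {m | poleDeg m = a + a' ∧ cuspWeight k l m = b + b'} := by
  refine mul_mem_supp hf hg ?_
  rintro p ⟨h1, h2⟩ q ⟨h3, h4⟩
  exact ⟨by rw [map_add, h1, h3], by rw [map_add, h2, h4]⟩

theorem mem_supp_bihom_pow {f : Lau} {a b : ℤ}
    (hf : f ∈ supp {m | poleDeg m = a ∧ cuspWeight k l m = b}) (n : ℕ) :
    f ^ n ∈ supp {m | poleDeg m = n * a ∧ cuspWeight k l m = n * b} := by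
  induction n with
  | zero => rw [pow_zero]; exact single_mem_supp (by simp) 1
  | succ n ih =>
    rw [pow_succ]
    have := mem_supp_bihom_mul ih hf
    push_cast
    simp only [add_mul, one_mul]
    exact this

/-- Powers of `x` and of `yTop` are already homogeneous for the cusp weight, so only the coefficient
`q` has to be replaced by its top part. Homogeneity of `q` is what permits factoring it into `z`,
`t` and binomials. -/
theorem exists_lexLead_of_mem_coordL {b : Lau} (hb : b ∈ coordL d k l) (hb0 : b ≠ 0) :
    ∃ (a i : ℕ) (q : Lau) (w : ℤ), q ≠ 0 ∧
      q ∈ supp {m | m.1 = 0 ∧ 0 ≤ m.2.1 ∧ 0 ≤ m.2.2 ∧ l * m.2.1 + k * m.2.2 = w} ∧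
      Lead (lexDeg k l) b (monL 1 0 0 ^ a * yTop d k l ^ i * q)
        (toLex (i * d - a, i * (k * l) + w)) ∧
      (b ∈ polyL ∨ 1 ≤ i) := by
  obtain ⟨a, i, q, hq0, hq, hlead, hi⟩ := exists_lead_of_mem_coordL hb hb0
  obtain ⟨w, q', hq'0, hq'⟩ := exists_lead (cuspWeight k l) hq0
  have hq'm := hq'.mem_supp hq
  have hbase : monL 1 0 0 ^ a * yTop d k l ^ i ∈
      supp {m | poleDeg m = i * d - a ∧ cuspWeight k l m = i * (k * l)} := by
    have h1 : monL 1 0 0 ∈ supp {m | poleDeg m = -1 ∧ cuspWeight k l m = 0} :=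
      monL_mem (by simp [poleDeg_apply, cuspWeight_apply])
    have := mem_supp_bihom_mul (mem_supp_bihom_pow h1 a) (mem_supp_bihom_pow (yTop_mem_supp
      (d := d) (k := k) (l := l)) i)
    refine supp_mono ?_ this
    rintro m ⟨h1, h2⟩
    exact ⟨by rw [h1]; ring, by rw [h2]; ring⟩
  refine ⟨a, i, q', w, hq'0, ?_, ⟨?_, ?_⟩, hi⟩
  · intro m hm
    obtain ⟨h1, h2, h3⟩ := hq'm m hm
    exact ⟨h1, h2, h3, hq'.1 m hm⟩
  · refine mul_mem_supp hbase (T := _) (U := {m | poleDeg m = 0 ∧ cuspWeight k l m = w}) ?_ ?_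
    · intro m hm
      exact ⟨by rw [poleDeg_apply, (hq'm m hm).1, neg_zero], hq'.1 m hm⟩
    · rintro p ⟨h1, h2⟩ m ⟨h3, h4⟩
      change lexDeg k l (p + m) = _
      rw [lexDeg_apply, map_add, map_add, h1, h2, h3, h4, add_zero]
  · have e : b - monL 1 0 0 ^ a * yTop d k l ^ i * q' =
        (b - monL 1 0 0 ^ a * yTop d k l ^ i * q) +
          monL 1 0 0 ^ a * yTop d k l ^ i * (q - q') := by ring
    rw [e]
    refine add_mem ?_ ?_
    · refine supp_mono ?_ hlead.2
      intro m hm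
      exact Prod.Lex.toLex_lt_toLex.2 (Or.inl hm)
    · refine mul_mem_supp hbase (U := {m | poleDeg m = 0 ∧ cuspWeight k l m < w}) ?_ ?_
      · intro m hm
        refine ⟨?_, hq'.2 m hm⟩
        rw [poleDeg_apply, (sub_mem hq hq'm m hm).1, neg_zero]
      · rintro p ⟨h1, h2⟩ m ⟨h3, h4⟩
        refine Prod.Lex.toLex_lt_toLex.2 (Or.inr ⟨?_, ?_⟩)
        · change poleDeg (p + m) = _
          rw [map_add, h1, h3, add_zero]
        · change cuspWeight k l (p + m) < _
          rw [map_add, h2]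
          exact add_lt_add_right h4 _

theorem cuspL_ne_zero (hl : 0 < l) : cuspL k l ≠ 0 := by
  intro h
  have h1 : (cuspL k l).coeff (0, 0, (l : ℤ)) ≠ 0 := by
    rw [cuspL, monL_pow, monL_pow, monL, monL]
    have : ¬ ((0 : ℤ) = l) := by omega
    simp [this, Prod.ext_iff]
  rw [h] at h1
  exact h1 rfl

theorem yTop_ne_zero (hl : 0 < l) : yTop d k l ≠ 0 :=
  mul_ne_zero (monL_ne_zero _ _ _) (cuspL_ne_zero hl)

theorem binom_ne_zero (hk : 0 < k) {c e : ℂ} (hc : c ≠ 0) :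
    c • monL 0 1 0 ^ k - e • monL 0 0 1 ^ l ≠ 0 := by
  intro h
  have h1 : (c • monL 0 1 0 ^ k - e • monL 0 0 1 ^ l : Lau).coeff (0, (k : ℤ), 0) ≠ 0 := by
    rw [monL_pow, monL_pow, monL, monL]
    have : ¬ ((0 : ℤ) = k) := by omega
    simp [this, hc, Prod.ext_iff]
  rw [h] at h1
  exact h1 rfl

theorem smul_eq_zero_derivation {D : Derivation ℂ Lau Lau} {c : ℂ} (hc : c ≠ 0) {f : Lau}
    (h : D (c • f) = 0) : D f = 0 := by
  rw [D.map_smul] at h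
  exact (smul_eq_zero.1 h).resolve_left hc

/-- A locally nilpotent derivation killing `y = (z^k + t^ℓ)/x^d` and one of `x`, `z`, `t` or
`z^k - μ t^ℓ` is zero. -/
theorem all_zero_of_kill (hd : 2 ≤ d) (hk : 2 ≤ k) (hl : 2 ≤ l) {D : Derivation ℂ Lau Lau}
    (hx : IsNilAt D (monL 1 0 0)) (hz : IsNilAt D (monL 0 1 0)) (ht : IsNilAt D (monL 0 0 1))
    (hy : D (yTop d k l) = 0)
    (h : D (monL 1 0 0) = 0 ∨ D (monL 0 1 0) = 0 ∨ D (monL 0 0 1) = 0 ∨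
      ∃ μ : ℂ, D (monL 0 1 0 ^ k - μ • monL 0 0 1 ^ l) = 0) :
    D (monL 1 0 0) = 0 ∧ D (monL 0 1 0) = 0 ∧ D (monL 0 0 1) = 0 := by
  have hy0 : yTop d k l ≠ 0 := yTop_ne_zero (by omega)
  have hrel : yTop d k l * monL 1 0 0 ^ d = monL 0 1 0 ^ k + monL 0 0 1 ^ l := by
    rw [mul_comm, x_pow_mul_yTop]; rfl
  have hneg : D (-1 : Lau) = 0 := by simp
  -- Once `z` is constant, `yTop x^d - t^l = z^k` is a nonzero constant written with two powers of
  -- exponents `d, l ≥ 2`, so `x` and `t` are constant as well.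
  have Kz : D (monL 0 1 0) = 0 → D (monL 1 0 0) = 0 ∧ D (monL 0 0 1) = 0 := by
    intro h
    have e : yTop d k l * monL 1 0 0 ^ d + (-1) * monL 0 0 1 ^ l = monL 0 1 0 ^ k := by
      rw [hrel]; ring
    refine map_eq_zero_of_add_pow hd hl hx ht hy hneg hy0 (by simp) ?_ ?_
    · rw [e]; exact pow_ne_zero _ (monL_ne_zero _ _ _)
    · rw [e, D.leibniz_pow, h]; simp
  have Kt : D (monL 0 0 1) = 0 → D (monL 1 0 0) = 0 ∧ D (monL 0 1 0) = 0 := by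
    intro h
    have e : yTop d k l * monL 1 0 0 ^ d + (-1) * monL 0 1 0 ^ k = monL 0 0 1 ^ l := by
      rw [hrel]; ring
    refine map_eq_zero_of_add_pow hd hk hx hz hy hneg hy0 (by simp) ?_ ?_
    · rw [e]; exact pow_ne_zero _ (monL_ne_zero _ _ _)
    · rw [e, D.leibniz_pow, h]; simp
  rcases h with h | h | h | ⟨μ, h⟩
  · have := map_eq_zero_of_add_pow (D := D) (u := 1) (v := 1) hk hl hz ht (by simp) (by simp)
      one_ne_zero one_ne_zero (by rw [one_mul, one_mul]; exact cuspL_ne_zero (by omega))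
      (by rw [one_mul, one_mul, ← hrel, D.leibniz, D.leibniz_pow, h, hy]; simp)
    exact ⟨h, this⟩
  · exact ⟨(Kz h).1, h, (Kz h).2⟩
  · exact ⟨(Kt h).1, (Kt h).2, h⟩
  · by_cases hμ : μ = 0
    · rw [hμ, zero_smul, sub_zero] at h
      have h' := map_eq_zero_of_pow hz (by omega) h
      exact ⟨(Kz h').1, h', (Kz h').2⟩
    · have e : 1 * monL 0 1 0 ^ k + algebraMap ℂ Lau (-μ) * monL 0 0 1 ^ l
          = monL 0 1 0 ^ k - μ • monL 0 0 1 ^ l := by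
        rw [← Algebra.smul_def, one_mul, neg_smul, sub_eq_add_neg]
      have := map_eq_zero_of_add_pow (D := D) (u := 1) (v := algebraMap ℂ Lau (-μ)) hk hl hz ht
        (by simp) (D.map_algebraMap _) one_ne_zero
        (by rw [Ne, FaithfulSMul.algebraMap_eq_zero_iff]; simpa using hμ)
        (by
          rw [e]
          simpa using binom_ne_zero (l := l) (e := μ) (by omega : 0 < k) (one_ne_zero (α := ℂ)))
        (by rw [e, h])
      exact ⟨(Kz this.1).1, this⟩

/-- The kernel of a nonzero locally nilpotent derivation of the coordinate ring of the threefold is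
contained in `ℂ[x, z, t]`. -/
theorem mem_polyL_of_derivation_eq_zero (hd : 2 ≤ d) (hk : 2 ≤ k) (hl : 2 ≤ l)
    (hcop : Nat.Coprime k l) {δ : Derivation ℂ Lau Lau}
    (hB : ∀ b ∈ coordL d k l, δ b ∈ coordL d k l) (hnil : ∀ b ∈ coordL d k l, IsNilAt δ b)
    (hδ : δ ≠ 0) {f : Lau} (hf : f ∈ coordL d k l) (hδf : δ f = 0) : f ∈ polyL := by
  by_contra hfR
  -- Local nilpotence of the top part `D` is available at leading forms of elements of the
  -- coordinate ring, though not on all Laurent polynomials. That is enough for every factor met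
  -- below.
  obtain ⟨e, D, hD, hD0⟩ := exists_top_derivation (lexDeg k l) hδ
  have hnilD : ∀ {b g : Lau} {μ}, b ∈ coordL d k l → Lead (lexDeg k l) b g μ → IsNilAt D g := by
    intro b g μ hb h
    obtain ⟨n, hn⟩ := hnil b hb
    have := h.iterate hD n
    rw [hn] at this
    exact ⟨n, this.eq_zero⟩
  have hmon : ∀ a b c : ℤ, Lead (lexDeg k l) (monL a b c) (monL a b c) (lexDeg k l (a, b, c)) :=
    fun a b c => lead_self (monL_mem rfl)
  have hx : IsNilAt D (monL 1 0 0) := hnilD x_mem_coordL (hmon _ _ _)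
  have hz : IsNilAt D (monL 0 1 0) := hnilD z_mem_coordL (hmon _ _ _)
  have ht : IsNilAt D (monL 0 0 1) := hnilD t_mem_coordL (hmon _ _ _)
  have hyn : IsNilAt D (yTop d k l) := by
    refine hnilD (b := -yL d k l) (μ := toLex ((d : ℤ), (k * l : ℤ))) (neg_mem y_mem_coordL) ⟨?_, ?_⟩
    · refine supp_mono ?_ (yTop_mem_supp (d := d) (k := k) (l := l))
      rintro m ⟨h1, h2⟩
      change lexDeg k l m = _
      rw [lexDeg_apply, h1, h2]
    · have : -yL d k l - yTop d k l = monL (-d) 0 0 * monL 1 0 0 := by rw [yL, yTop]; ring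
      rw [this, monL_mul]
      refine monL_mem (Prod.Lex.toLex_lt_toLex.2 (Or.inl ?_))
      simp [poleDeg_apply]
  -- elements of the kernel of `D` that are leading forms
  have hfac : ∀ {a i β γ : ℕ} {s : Multiset ℂ} {c : ℂ}, c ≠ 0 →
      D (monL 1 0 0 ^ a * yTop d k l ^ i * (c • (monL 0 1 0 ^ β * monL 0 0 1 ^ γ *
        (s.map fun μ => monL 0 1 0 ^ k - μ • monL 0 0 1 ^ l).prod))) = 0 →
      (i ≠ 0 → D (yTop d k l) = 0) ∧ (a ≠ 0 → D (monL 1 0 0) = 0) ∧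
      (β ≠ 0 → D (monL 0 1 0) = 0) ∧ (γ ≠ 0 → D (monL 0 0 1) = 0) ∧
      (∀ μ ∈ s, D (monL 0 1 0 ^ k - μ • monL 0 0 1 ^ l) = 0) := by
    intro a i β γ s c hc h
    rw [mul_smul_comm] at h
    replace h := smul_eq_zero_derivation hc h
    set p := (s.map fun μ => monL 0 1 0 ^ k - μ • monL 0 0 1 ^ l).prod with hp
    have nx := (nilSubalgebra D).pow_mem hx a
    have ny := (nilSubalgebra D).pow_mem hyn i
    have nz := (nilSubalgebra D).pow_mem hz β
    have nt := (nilSubalgebra D).pow_mem ht γ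
    have nb : ∀ μ : ℂ, monL 0 1 0 ^ k - μ • monL 0 0 1 ^ l ∈ nilSubalgebra D := fun μ =>
      sub_mem ((nilSubalgebra D).pow_mem hz k)
        (Subalgebra.smul_mem _ ((nilSubalgebra D).pow_mem ht l) μ)
    have np : p ∈ nilSubalgebra D := by
      refine Subalgebra.multiset_prod_mem _ fun g hg => ?_
      obtain ⟨μ, -, rfl⟩ := Multiset.mem_map.1 hg
      exact nb μ
    have x0 : monL 1 0 0 ^ a ≠ 0 := pow_ne_zero _ (monL_ne_zero _ _ _)
    have y0 : yTop d k l ^ i ≠ 0 := pow_ne_zero _ (yTop_ne_zero (by omega))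
    have z0 : monL 0 1 0 ^ β ≠ 0 := pow_ne_zero _ (monL_ne_zero _ _ _)
    have t0 : monL 0 0 1 ^ γ ≠ 0 := pow_ne_zero _ (monL_ne_zero _ _ _)
    have b0 : ∀ μ : ℂ, monL 0 1 0 ^ k - μ • monL 0 0 1 ^ l ≠ (0 : Lau) := fun μ => by
      simpa using binom_ne_zero (l := l) (e := μ) (by omega : 0 < k) (one_ne_zero (α := ℂ))
    have p0 : p ≠ 0 := by
      rw [hp, Ne, Multiset.prod_eq_zero_iff]
      intro hmem
      obtain ⟨μ, -, hμ⟩ := Multiset.mem_map.1 hmem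
      exact b0 μ hμ
    have key : ∀ {u v : Lau}, u ∈ nilSubalgebra D → v ∈ nilSubalgebra D → u ≠ 0 → v ≠ 0 →
        D (u * v) = 0 → D u = 0 ∧ D v = 0 := by
      intro u v hu hv hu0 hv0 h
      exact ⟨map_eq_zero_of_mul hu hv (mul_ne_zero hu0 hv0) h,
        map_eq_zero_of_mul hv hu (mul_ne_zero hv0 hu0) (by rwa [mul_comm])⟩
    obtain ⟨h1, h2⟩ := key (mul_mem nx ny) (mul_mem (mul_mem nz nt) np) (mul_ne_zero x0 y0)
      (mul_ne_zero (mul_ne_zero z0 t0) p0) h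
    obtain ⟨hx1, hy1⟩ := key nx ny x0 y0 h1
    obtain ⟨h3, h4⟩ := key (mul_mem nz nt) np (mul_ne_zero z0 t0) p0 h2
    obtain ⟨hz1, ht1⟩ := key nz nt z0 t0 h3
    refine ⟨fun hi => map_eq_zero_of_pow hyn hi hy1, fun ha => map_eq_zero_of_pow hx ha hx1,
      fun hβ => map_eq_zero_of_pow hz hβ hz1, fun hγ => map_eq_zero_of_pow ht hγ ht1, ?_⟩
    intro μ hμ
    obtain ⟨s', rfl⟩ := Multiset.exists_cons_of_mem hμ
    rw [hp, Multiset.map_cons, Multiset.prod_cons] at h4 p0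
    have np' : (s'.map fun μ => monL 0 1 0 ^ k - μ • monL 0 0 1 ^ l).prod ∈ nilSubalgebra D := by
      refine Subalgebra.multiset_prod_mem _ fun g hg => ?_
      obtain ⟨μ, -, rfl⟩ := Multiset.mem_map.1 hg
      exact nb μ
    exact (key (nb μ) np' (b0 μ) (right_ne_zero_of_mul p0) h4).1
  have hf0 : f ≠ 0 := by rintro rfl; exact hfR (zero_mem _)
  -- As `f` is not in `ℂ[x, z, t]`, its leading form contains `yTop` to a positive power. This form
  -- is killed by `D`, and constants have constant factors.
  have hyD : D (yTop d k l) = 0 := by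
    obtain ⟨a, i, q, w, hq0, hq, hlead, hi⟩ := exists_lexLead_of_mem_coordL hf hf0
    obtain ⟨c, β, γ, s, hc, rfl⟩ :=
      quasi_homogeneous_factor (by omega) (by omega) hcop hq0 hq
    have hDl := hD _ _ _ hlead
    rw [hδf] at hDl
    exact (hfac hc hDl.eq_zero).1 (by rcases hi with hi | hi; exacts [absurd hi hfR, by omega])
  have hno : ¬ (D (monL 1 0 0) = 0 ∨ D (monL 0 1 0) = 0 ∨ D (monL 0 0 1) = 0 ∨
      ∃ μ : ℂ, D (monL 0 1 0 ^ k - μ • monL 0 0 1 ^ l) = 0) := fun h =>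
    hD0 (all_zero_of_kill hd hk hl hx hz ht hyD h)
  -- iterates of homogeneous elements of degree `(0, k l)`
  have hiter : ∀ {u : Lau} {n : ℕ}, u ∈ coordL d k l →
      u ∈ supp {m | lexDeg k l m = toLex (0, (k * l : ℤ))} → HasDeg D u n →
      ∃ (c : ℂ) (i : ℕ), c ≠ 0 ∧ D^[n] u = c • yTop d k l ^ i ∧
        toLex (0, (k * l : ℤ)) + n • e = toLex ((i * d : ℤ), (i * (k * l) : ℤ)) := by
    intro u n hu hdeg hn
    have hlead := (lead_self hdeg).iterate hD n
    have hmem : ∀ n, δ^[n] u ∈ coordL d k l := by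
      intro n
      induction n with
      | zero => exact hu
      | succ n ih => rw [Function.iterate_succ_apply']; exact hB _ ih
    have hne : δ^[n] u ≠ 0 := by
      intro h
      rw [h] at hlead
      exact hn.1 hlead.eq_zero
    -- The last nonzero iterate is the leading form of `δ^n u`, so it factors into `x`, `yTop`, `z`,
    -- `t` and binomials. Each factor is killed by `D`, and `hno` leaves only powers of `yTop`.
    obtain ⟨a, i, q, w, hq0, hq, hlead', -⟩ := exists_lexLead_of_mem_coordL (hmem n) hne
    have hne' : monL 1 0 0 ^ a * yTop d k l ^ i * q ≠ 0 :=
      mul_ne_zero (mul_ne_zero (pow_ne_zero _ (monL_ne_zero _ _ _))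
        (pow_ne_zero _ (yTop_ne_zero (by omega)))) hq0
    obtain ⟨hμ, heq⟩ := hlead.unique hlead' hn.1 hne'
    have hker : D (monL 1 0 0 ^ a * yTop d k l ^ i * q) = 0 := by
      rw [← heq, ← Function.iterate_succ_apply' D n u]; exact hn.2
    obtain ⟨c, β, γ, s, hc, rfl⟩ :=
      quasi_homogeneous_factor (by omega) (by omega) hcop hq0 hq
    obtain ⟨-, h1, h2, h3, h4⟩ := hfac hc hker
    have ha : a = 0 := by by_contra h; exact hno (Or.inl (h1 h))
    have hβ : β = 0 := by by_contra h; exact hno (Or.inr (Or.inl (h2 h)))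
    have hγ : γ = 0 := by by_contra h; exact hno (Or.inr (Or.inr (Or.inl (h3 h))))
    have hs : s = 0 := Multiset.eq_zero_of_forall_notMem fun μ hμ =>
      hno (Or.inr (Or.inr (Or.inr ⟨μ, h4 μ hμ⟩)))
    subst ha hβ hγ hs
    have hw : w = 0 := by
      have h10 : (c • (monL 0 1 0 ^ 0 * monL 0 0 1 ^ 0 * (Multiset.map
          (fun μ : ℂ => (monL 0 1 0 ^ k - μ • monL 0 0 1 ^ l : Lau)) 0).prod) : Lau).coeff
          (0, 0, 0) ≠ 0 := by
        rw [show ((0, 0, 0) : ℤ × ℤ × ℤ) = 0 from rfl]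
        simpa [AddMonoidAlgebra.one_def] using hc
      have := (hq _ h10).2.2.2
      simpa using this.symm
    refine ⟨c, i, hc, ?_, ?_⟩
    · rw [heq]; simp
    · rw [hμ, hw]; simp
  have hZ : monL 0 1 0 ^ k ∈ supp {m | lexDeg k l m = toLex (0, (k * l : ℤ))} := by
    rw [monL_pow]; refine monL_mem ?_
    simp [lexDeg_apply, poleDeg_apply, cuspWeight_apply, mul_comm]
  have hT : monL 0 0 1 ^ l ∈ supp {m | lexDeg k l m = toLex (0, (k * l : ℤ))} := by
    rw [monL_pow]; refine monL_mem ?_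
    simp [lexDeg_apply, poleDeg_apply, cuspWeight_apply]
  have hZB : monL 0 1 0 ^ k ∈ coordL d k l := pow_mem z_mem_coordL k
  have hTB : monL 0 0 1 ^ l ∈ coordL d k l := pow_mem t_mem_coordL l
  -- Eliminating `i` between the two components of the degree gives `n * E = d * (k * l) ≠ 0`, which
  -- determines `n` and then `i`.
  have huniq : ∀ {n i n' i' : ℕ},
      toLex (0, (k * l : ℤ)) + n • e = toLex ((i * d : ℤ), (i * (k * l) : ℤ)) →
      toLex (0, (k * l : ℤ)) + n' • e = toLex ((i' * d : ℤ), (i' * (k * l) : ℤ)) →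
      n = n' ∧ i = i' := by
    intro n i n' i' h h'
    set E : ℤ := k * l * (ofLex e).1 - d * (ofLex e).2 with hE
    have hcomp : ∀ {n i : ℕ}, toLex (0, (k * l : ℤ)) + n • e
        = toLex ((i * d : ℤ), (i * (k * l) : ℤ)) → n * (ofLex e).1 = i * d ∧ n * E = d * (k * l) := by
      intro n i h
      have c1 : (0 : ℤ) + n • (ofLex e).1 = i * d := congrArg (fun p => (ofLex p).1) h
      have c2 : (k * l : ℤ) + n • (ofLex e).2 = i * (k * l) := congrArg (fun p => (ofLex p).2) h
      rw [nsmul_eq_mul] at c1 c2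
      refine ⟨by linarith, ?_⟩
      rw [hE]
      linear_combination (k * l : ℤ) * c1 - (d : ℤ) * c2
    obtain ⟨h1, h2⟩ := hcomp h
    obtain ⟨h3, h4⟩ := hcomp h'
    have hE0 : E ≠ 0 := by
      intro h0
      rw [h0, mul_zero] at h2
      have : (d : ℤ) * (k * l) ≠ 0 := by positivity
      exact this h2.symm
    have hnn : n = n' := by exact_mod_cast mul_right_cancel₀ hE0 (h2.trans h4.symm)
    subst hnn
    have hd0 : (d : ℤ) ≠ 0 := by positivity
    exact ⟨rfl, by exact_mod_cast mul_right_cancel₀ hd0 (h1.symm.trans h3)⟩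
  obtain ⟨n, hn⟩ := ((nilSubalgebra D).pow_mem hz k : IsNilAt D _).exists_hasDeg
    (pow_ne_zero _ (monL_ne_zero _ _ _))
  obtain ⟨n', hn'⟩ := ((nilSubalgebra D).pow_mem ht l : IsNilAt D _).exists_hasDeg
    (pow_ne_zero _ (monL_ne_zero _ _ _))
  obtain ⟨c, i, hc, hci, hdeg⟩ := hiter hZB hZ hn
  obtain ⟨c', i', hc', hci', hdeg'⟩ := hiter hTB hT hn'
  obtain ⟨rfl, rfl⟩ := huniq hdeg hdeg'
  -- In this combination the final iterates of `z^k` and `t^l` cancel. It is nonzero and homogeneous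
  -- of the same degree, so its own last nonzero iterate would occur at the same index: a
  -- contradiction.
  have hu0 : c' • monL 0 1 0 ^ k - c • monL 0 0 1 ^ l ≠ (0 : Lau) := binom_ne_zero (by omega) hc'
  have hu : IsNilAt D (c' • monL 0 1 0 ^ k - c • monL 0 0 1 ^ l) :=
    sub_mem (Subalgebra.smul_mem _ ((nilSubalgebra D).pow_mem hz k) c')
      (Subalgebra.smul_mem _ ((nilSubalgebra D).pow_mem ht l) c)
  obtain ⟨m, hm⟩ := hu.exists_hasDeg hu0
  obtain ⟨-, j, -, -, hdegm⟩ := hiter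
    (sub_mem (Subalgebra.smul_mem _ hZB c') (Subalgebra.smul_mem _ hTB c))
    (sub_mem (Submodule.smul_mem _ c' hZ) (Submodule.smul_mem _ c hT)) hm
  obtain ⟨rfl, -⟩ := huniq hdegm hdeg
  apply hm.1
  have hit : ∀ (a : ℂ) (g : Lau), D^[m] (a • g) = a • D^[m] g := by
    intro a g
    clear * -
    induction m generalizing g with
    | zero => rfl
    | succ m ih => rw [Function.iterate_succ_apply, Function.iterate_succ_apply, D.map_smul, ih]
  rw [sub_eq_add_neg, iterate_map_add', ← neg_smul, hit, hit, hci, hci', smul_smul, smul_smul,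
    neg_mul, neg_smul, mul_comm c, add_neg_cancel]

end LaurentKernel

end KorasRussell

namespace KorasRussell

/-! ### Transcendence degree of the kernel. -/

section TrdegKernel

set_option linter.unusedSectionVars false

variable {A : Type*} [CommRing A] [IsDomain A] [CharZero A] [Algebra ℂ A]

theorem iterate_mul_of_map_eq_zero (D : Derivation ℂ A A) {f : A} (hf : D f = 0) (n : ℕ) (g : A) :
    D^[n] (f * g) = f * D^[n] g := by
  induction n generalizing g with
  | zero => rfl
  | succ n ih =>
    have : D (f * g) = f * D g := by rw [D.leibniz, hf]; simp
    rw [Function.iterate_succ_apply, Function.iterate_succ_apply, this, ih]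

theorem iterate_pow_self (D : Derivation ℂ A A) {s : A} (hs : D (D s) = 0) (n : ℕ) :
    D^[n] (s ^ n) = n.factorial * D s ^ n ∧ D^[n + 1] (s ^ n) = 0 := by
  induction n with
  | zero => simp
  | succ n ih =>
    have := iterate_mul_eq D (n + 1) n 1 (s ^ n) s rfl ih.2 hs
    rw [pow_succ]
    refine ⟨?_, this.2⟩
    rw [this.1, ih.1]
    simp [Nat.factorial_succ, pow_succ]
    ring

/-- Every element is algebraic over the kernel with a local slice adjoined. -/
theorem exists_mul_mem_adjoin (D : Derivation ℂ A A) {s : A} (hs : D (D s) = 0) (hs0 : D s ≠ 0)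
    {S : Subalgebra ℂ A} (hS : kerSubalgebra D ≤ S) (hsS : s ∈ S)
    (n : ℕ) : ∀ b : A, D^[n] b = 0 → ∃ a ∈ kerSubalgebra D, a ≠ 0 ∧ a * b ∈ S := by
  induction n with
  | zero =>
    intro b hb
    have hb' : b = 0 := hb
    exact ⟨1, one_mem _, one_ne_zero, by rw [hb', mul_zero]; exact zero_mem _⟩
  | succ n ih =>
    intro b hb
    have hc : n.factorial * D s ^ n ∈ kerSubalgebra D :=
      mul_mem (natCast_mem (kerSubalgebra D) n.factorial)
        (pow_mem (show D s ∈ kerSubalgebra D from hs) n)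
    have hbn : D (D^[n] b) = 0 := by rw [← Function.iterate_succ_apply' D]; exact hb
    -- Since `D^n (s^n) = n! (D s)^n` and `D s`, `D^n b` are constants, this combination is killed
    -- by `D^n`.
    obtain ⟨a, haK, ha0, ha⟩ := ih (n.factorial * D s ^ n * b - D^[n] b * s ^ n) (by
      rw [sub_eq_add_neg, iterate_map_add', ← neg_mul, iterate_mul_of_map_eq_zero D hc,
        iterate_mul_of_map_eq_zero D (by rw [map_neg, hbn, neg_zero]), (iterate_pow_self D hs n).1]
      ring)
    refine ⟨a * (n.factorial * D s ^ n), mul_mem haK hc, mul_ne_zero ha0 (mul_ne_zero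
      (Nat.cast_ne_zero.2 n.factorial_ne_zero) (pow_ne_zero n hs0)), ?_⟩
    have e : a * (n.factorial * D s ^ n) * b
        = a * (n.factorial * D s ^ n * b - D^[n] b * s ^ n) + a * (D^[n] b * s ^ n) := by
      ring
    rw [e]
    exact add_mem ha (mul_mem (hS haK) (mul_mem (hS (mem_kerSubalgebra.2 hbn)) (pow_mem hsS n)))

theorem trdeg_le_add_one_of_exists_mul_mem (K : Subalgebra ℂ A) (s : A)
    (h : ∀ b : A, ∃ a ∈ K, a ≠ 0 ∧ a * b ∈ (Algebra.adjoin K {s}).restrictScalars ℂ) :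
    Algebra.trdeg ℂ A ≤ Algebra.trdeg ℂ K + 1 := by
  have halg : Algebra.IsAlgebraic (Algebra.adjoin K {s}) A := by
    refine ⟨fun b => ?_⟩
    obtain ⟨a, haK, ha0, ha⟩ := h b
    have ha' : a ∈ Algebra.adjoin K {s} := (Algebra.adjoin K {s}).algebraMap_mem ⟨a, haK⟩
    refine ⟨Polynomial.C ⟨a, ha'⟩ * Polynomial.X - Polynomial.C ⟨_, ha⟩, ?_, ?_⟩
    · intro h
      have := congrArg (fun p => Polynomial.coeff p 1) h
      simp [Polynomial.coeff_C] at this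
      exact ha0 (congrArg Subtype.val this)
    · rw [map_sub, map_mul, Polynomial.aeval_C, Polynomial.aeval_X, Polynomial.aeval_C]
      exact sub_self _
  have : FaithfulSMul ℂ K :=
    (faithfulSMul_iff_algebraMap_injective ℂ K).2 (algebraMap ℂ K).injective
  rw [← trdeg_add_eq ℂ K]
  gcongr
  have := Algebra.IsAlgebraic.trdeg_le_cardinalMk K ({s} : Set A)
  simpa using this

/-- The iterate just before the last nonzero one is a local slice: its derivative is a nonzero
constant. The ring is algebraic over the kernel with this single element adjoined. -/
theorem trdeg_le_trdeg_kerSubalgebra_add_one (D : Derivation ℂ A A) (hnil : ∀ a, IsNilAt D a)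
    (h0 : D ≠ 0) : Algebra.trdeg ℂ A ≤ Algebra.trdeg ℂ (kerSubalgebra D) + 1 := by
  obtain ⟨b, hb⟩ : ∃ b, D b ≠ 0 := by
    by_contra h
    push Not at h
    exact h0 (Derivation.ext h)
  obtain ⟨n, hn⟩ := (hnil b).exists_hasDeg (by rintro rfl; exact hb (map_zero D))
  obtain ⟨n, rfl⟩ := Nat.exists_eq_succ_of_ne_zero (show n ≠ 0 by rintro rfl; exact hb hn.2)
  have hs1 : D (D^[n] b) ≠ 0 := by rw [← Function.iterate_succ_apply' D]; exact hn.1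
  have hs2 : D (D (D^[n] b)) = 0 := by
    rw [← Function.iterate_succ_apply' D, ← Function.iterate_succ_apply' D]; exact hn.2
  refine trdeg_le_add_one_of_exists_mul_mem _ (D^[n] b) fun b' => ?_
  obtain ⟨m, hm⟩ := hnil b'
  have hsS : D^[n] b ∈ (Algebra.adjoin (kerSubalgebra D) {D^[n] b}).restrictScalars ℂ :=
    Algebra.subset_adjoin (R := kerSubalgebra D) rfl
  refine exists_mul_mem_adjoin D hs2 hs1 ?_ hsS m b' hm
  intro a ha
  exact (Algebra.adjoin (kerSubalgebra D) {D^[n] b}).algebraMap_mem ⟨a, ha⟩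

end TrdegKernel

end KorasRussell

namespace KorasRussell

/-! ### The cusp and the embedding of `ℂ[x, z, t]` in Laurent polynomials. -/

section CuspCurve

open MvPolynomial

/-- The restriction of polynomials to the curve `x = 0`, `z = s^ℓ`, `t = ω s^k`. -/
noncomputable def cuspHom (k l : ℕ) (ω : ℂ) : Rxzt →ₐ[ℂ] Polynomial ℂ :=
  aeval ![0, Polynomial.X ^ l, Polynomial.C ω * Polynomial.X ^ k]

/-- Division with remainder: set `x = 0` and replace `z^k` by `-t^l` until the exponent of `z` is
below `k`. -/
theorem exists_reduced_mod_cusp {k l : ℕ} (hk : 0 < k) (p : Rxzt) :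
    ∃ N : Rxzt, p - N ∈ Ideal.span {(X 0 : Rxzt), X 1 ^ k + X 2 ^ l} ∧
      ∀ m, N.coeff m ≠ 0 → m 0 = 0 ∧ m 1 < k := by
  set I : Ideal Rxzt := Ideal.span {(X 0 : Rxzt), X 1 ^ k + X 2 ^ l} with hI
  have hx : (X 0 : Rxzt) ∈ I := Ideal.subset_span (by simp)
  have hr : (X 1 ^ k + X 2 ^ l : Rxzt) ∈ I := Ideal.subset_span (by simp)
  induction p using MvPolynomial.induction_on' with
  | add p q hp hq =>
    obtain ⟨N, h1, h2⟩ := hp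
    obtain ⟨M, h3, h4⟩ := hq
    refine ⟨N + M, ?_, fun m hm => ?_⟩
    · have : p + q - (N + M) = (p - N) + (q - M) := by ring
      rw [this]; exact add_mem h1 h3
    · by_cases h : N.coeff m = 0
      · refine h4 m fun h' => hm ?_
        rw [coeff_add, h, h', add_zero]
      · exact h2 m h
  | monomial m c =>
    by_cases h0 : m 0 = 0
    · have hm : monomial m c = C c * X 1 ^ (m 1) * X 2 ^ (m 2) := by
        rw [monomial_eq, Finsupp.prod_fintype _ _ (by simp), Fin.prod_univ_three, h0]
        simp [mul_assoc]
      refine ⟨C (c * (-1) ^ (m 1 / k)) * X 1 ^ (m 1 % k) * X 2 ^ (l * (m 1 / k) + m 2), ?_, ?_⟩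
      · have h1 : ((X 1 : Rxzt) ^ k) ^ (m 1 / k) - (-(X 2 ^ l)) ^ (m 1 / k) ∈ I := by
          refine Ideal.mem_of_dvd _ (sub_dvd_pow_sub_pow _ _ _) ?_
          rw [sub_neg_eq_add]; exact hr
        have h2 : (X 1 : Rxzt) ^ (m 1) = X 1 ^ (m 1 % k) * (X 1 ^ k) ^ (m 1 / k) := by
          rw [← pow_mul, ← pow_add, Nat.mod_add_div]
        have e : monomial m c - C (c * (-1) ^ (m 1 / k)) * X 1 ^ (m 1 % k) *
            X 2 ^ (l * (m 1 / k) + m 2) = (C c * X 1 ^ (m 1 % k) * X 2 ^ (m 2)) *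
            (((X 1 : Rxzt) ^ k) ^ (m 1 / k) - (-(X 2 ^ l)) ^ (m 1 / k)) := by
          have hC : (C (c * (-1) ^ (m 1 / k)) : Rxzt) = C c * (-1) ^ (m 1 / k) := by simp
          rw [hm, h2, pow_add, pow_mul, neg_pow (X 2 ^ l : Rxzt), hC]
          ring
        rw [e]
        exact Ideal.mul_mem_left _ _ h1
      · intro m' hm'
        have e : (C (c * (-1) ^ (m 1 / k)) * X 1 ^ (m 1 % k) * X 2 ^ (l * (m 1 / k) + m 2) : Rxzt)
            = monomial (Finsupp.single 1 (m 1 % k) + Finsupp.single 2 (l * (m 1 / k) + m 2))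
              (c * (-1) ^ (m 1 / k)) := by
          rw [C_mul_X_pow_eq_monomial, X_pow_eq_monomial, monomial_mul, mul_one]
        rw [e, coeff_monomial] at hm'
        have := of_not_not fun h => hm' (if_neg h)
        rw [← this]
        simpa using Nat.mod_lt _ hk
    · refine ⟨0, ?_, fun m hm => absurd (coeff_zero m) hm⟩
      rw [sub_zero]
      refine Ideal.mem_of_dvd I ?_ hx
      exact X_dvd_monomial.2 (Or.inr h0)

/-- On the cusp `z^a t^b` becomes a nonzero multiple of `s^(la + kb)`. For `a < k` coprimality makes
these exponents distinct, so a reduced polynomial vanishing on the curve is zero. -/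
theorem cuspHom_eq_zero {k l : ℕ} (hk : 0 < k) (hcop : Nat.Coprime k l) {ω : ℂ}
    (hω : ω ≠ 0) {p : Rxzt} (hI : cuspHom k l ω (X 1 ^ k + X 2 ^ l) = 0)
    (hp : cuspHom k l ω p = 0) :
    p ∈ Ideal.span {(X 0 : Rxzt), X 1 ^ k + X 2 ^ l} := by
  obtain ⟨N, h1, h2⟩ := exists_reduced_mod_cusp (l := l) hk p
  have hker : Ideal.span {(X 0 : Rxzt), X 1 ^ k + X 2 ^ l} ≤ RingHom.ker (cuspHom k l ω) := by
    rw [Ideal.span_le]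
    rintro q (rfl | rfl)
    · simp [cuspHom]
    · exact hI
  have hN : cuspHom k l ω N = 0 := by
    have := hker h1
    rw [RingHom.mem_ker, map_sub, hp, zero_sub, neg_eq_zero] at this
    exact this
  suffices N = 0 by rwa [this, sub_zero] at h1
  ext m₀
  rw [coeff_zero]
  by_contra hm₀
  have hmon : ∀ m ∈ N.support, cuspHom k l ω (monomial m (N.coeff m)) =
      Polynomial.monomial (l * m 1 + k * m 2) (N.coeff m * ω ^ m 2) := by
    intro m hm
    obtain ⟨h0, -⟩ := h2 m (by simpa using hm)
    rw [cuspHom, aeval_monomial, Finsupp.prod_fintype _ _ (by simp), Fin.prod_univ_three, h0]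
    simp [← Polynomial.C_mul_X_pow_eq_monomial]
    ring
  rw [N.as_sum, map_sum, Finset.sum_congr rfl hmon] at hN
  have := congrArg (fun q => Polynomial.coeff q (l * m₀ 1 + k * m₀ 2)) hN
  simp only [Polynomial.finsetSum_coeff, Polynomial.coeff_monomial, Polynomial.coeff_zero] at this
  rw [Finset.sum_eq_single m₀, if_pos rfl] at this
  · exact mul_ne_zero hm₀ (pow_ne_zero _ hω) this
  · intro m hm hne
    refine if_neg fun heq => hne ?_
    obtain ⟨a0, a1⟩ := h2 m (by simpa using hm)
    obtain ⟨b0, b1⟩ := h2 m₀ hm₀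
    have hmod : l * m 1 ≡ l * m₀ 1 [MOD k] := by
      have : l * m 1 + k * m 2 ≡ l * m₀ 1 + k * m₀ 2 [MOD k] := by rw [heq]
      simpa [Nat.ModEq] using this
    have e1 : m 1 = m₀ 1 := by
      have := Nat.ModEq.cancel_left_of_coprime (by simpa using hcop) hmod
      rwa [Nat.ModEq, Nat.mod_eq_of_lt a1, Nat.mod_eq_of_lt b1] at this
    have e2 : m 2 = m₀ 2 := by
      rw [e1] at heq
      exact Nat.eq_of_mul_eq_mul_left hk (by omega)
    ext i
    fin_cases i
    · simpa using a0.trans b0.symm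
    · simpa using e1
    · simpa using e2
  · intro h
    exact absurd (by simpa using h) hm₀

theorem exists_pow_eq_neg_one {l : ℕ} (hl : 0 < l) : ∃ ω : ℂ, ω ^ l = -1 ∧ ω ≠ 0 := by
  obtain ⟨ω, hω⟩ := IsAlgClosed.exists_pow_nat_eq (-1 : ℂ) hl
  refine ⟨ω, hω, ?_⟩
  rintro rfl
  rw [zero_pow hl.ne'] at hω
  norm_num at hω

theorem cuspHom_cusp {k l : ℕ} {ω : ℂ} (hω : ω ^ l = -1) :
    cuspHom k l ω (X 1 ^ k + X 2 ^ l) = 0 := by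
  rw [cuspHom, map_add, map_pow, map_pow, aeval_X, aeval_X]
  simp only [Matrix.cons_val_one, Matrix.cons_val]
  rw [mul_pow, ← Polynomial.C_pow, hω, ← pow_mul, ← pow_mul, mul_comm k l]
  simp

/-- The embedding of `ℂ[x, z, t]` in the ring of Laurent polynomials. -/
noncomputable def toLau : Rxzt →ₐ[ℂ] Lau := aeval ![monL 1 0 0, monL 0 1 0, monL 0 0 1]

@[simp] theorem toLau_X_zero : toLau (X 0) = monL 1 0 0 := by simp [toLau]

@[simp] theorem toLau_X_one : toLau (X 1) = monL 0 1 0 := by simp [toLau]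

@[simp] theorem toLau_X_two : toLau (X 2) = monL 0 0 1 := by simp [toLau]

theorem toLau_monomial (m : Fin 3 →₀ ℕ) (c : ℂ) :
    toLau (monomial m c) = AddMonoidAlgebra.single ((m 0 : ℤ), (m 1 : ℤ), (m 2 : ℤ)) c := by
  rw [toLau, aeval_monomial, Finsupp.prod_fintype _ _ (by simp), Fin.prod_univ_three]
  simp only [Matrix.cons_val_zero, Matrix.cons_val_one, Matrix.cons_val]
  rw [← monL_eq_pow, ← Algebra.smul_def, monL, AddMonoidAlgebra.smul_single, smul_eq_mul, mul_one]

theorem coeff_toLau (p : Rxzt) (m : Fin 3 →₀ ℕ) :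
    (toLau p).coeff ((m 0 : ℤ), (m 1 : ℤ), (m 2 : ℤ)) = p.coeff m := by
  induction p using MvPolynomial.induction_on' with
  | add p q hp hq => rw [map_add, AddMonoidAlgebra.coeff_add, Finsupp.add_apply, hp, hq, coeff_add]
  | monomial m' c =>
    rw [toLau_monomial, AddMonoidAlgebra.coeff_single, coeff_monomial]
    by_cases h : m' = m
    · rw [h, if_pos rfl, Finsupp.single_eq_same]
    · rw [if_neg h, Finsupp.single_eq_of_ne]
      intro h'
      apply h
      simp only [Prod.mk.injEq, Nat.cast_inj] at h'
      ext i
      fin_cases i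
      · exact h'.1.symm
      · exact h'.2.1.symm
      · exact h'.2.2.symm

theorem toLau_injective : Function.Injective toLau := by
  rw [injective_iff_map_eq_zero]
  intro p hp
  ext m
  rw [← coeff_toLau, hp]
  rfl

theorem toLau_mem (p : Rxzt) : toLau p ∈ polyL := by
  induction p using MvPolynomial.induction_on' with
  | add p q hp hq => rw [map_add]; exact add_mem hp hq
  | monomial m c =>
    rw [toLau_monomial]
    exact mem_polyL.2 (single_mem_supp (T := {m | 0 ≤ m.1 ∧ 0 ≤ m.2.1 ∧ 0 ≤ m.2.2})
      ⟨by simp, by simp, by simp⟩ c)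

theorem exists_toLau_eq {f : Lau} (hf : f ∈ polyL) : ∃ p, toLau p = f := by
  change f ∈ toLau.range
  rw [eq_sum_single f]
  refine sum_mem fun m hm => ?_
  obtain ⟨h1, h2, h3⟩ := mem_polyL.1 hf m (by simpa using hm)
  have : (AddMonoidAlgebra.single m (f.coeff m) : Lau) = f.coeff m • monL m.1 m.2.1 m.2.2 := by
    simp [monL]
  rw [this]
  refine Subalgebra.smul_mem _ ?_ _
  obtain ⟨a, ha⟩ := Int.eq_ofNat_of_zero_le h1
  obtain ⟨b, hb⟩ := Int.eq_ofNat_of_zero_le h2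
  obtain ⟨c, hc⟩ := Int.eq_ofNat_of_zero_le h3
  rw [ha, hb, hc, monL_eq_pow]
  exact ⟨X 0 ^ a * X 1 ^ b * X 2 ^ c, by simp⟩

theorem toLau_cusp (k l : ℕ) : toLau (X 1 ^ k + X 2 ^ l) = cuspL k l := by
  rw [map_add, map_pow, map_pow, toLau_X_one, toLau_X_two]; rfl

end CuspCurve

/-! ### Kernels of locally nilpotent derivations contain `x`. -/

section KernelOnCoordinateRing

open MvPolynomial

variable {d k l : ℕ}

/-- The logarithmic derivatives of the monomials determined by those of the variables. -/
noncomputable def logOfVars (A B C : Lau) : ℤ × ℤ × ℤ →+ Lau where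
  toFun m := m.1 • A + m.2.1 • B + m.2.2 • C
  map_zero' := by simp
  map_add' m n := by
    simp only [Prod.fst_add, Prod.snd_add, add_smul]; abel

/-- Derivations of the coordinate ring of the threefold extend to Laurent polynomials. -/
theorem exists_extension_derivation (D : Derivation ℂ (coordL d k l) (coordL d k l)) :
    ∃ δ : Derivation ℂ Lau Lau, ∀ b : coordL d k l, δ b = D b := by
  set x : coordL d k l := ⟨monL 1 0 0, x_mem_coordL⟩ with hx
  set z : coordL d k l := ⟨monL 0 1 0, z_mem_coordL⟩ with hz
  set t : coordL d k l := ⟨monL 0 0 1, t_mem_coordL⟩ with ht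
  set y : coordL d k l := ⟨yL d k l, y_mem_coordL⟩ with hy
  set δ := derOfLog (logOfVars (monL (-1) 0 0 * D x) (monL 0 (-1) 0 * D z) (monL 0 0 (-1) * D t))
    with hδ
  have hxδ : δ (monL 1 0 0) = D x := by
    rw [monL, hδ, derOfLog_single]
    simp only [logOfVars, AddMonoidHom.coe_mk, ZeroHom.coe_mk, one_smul, zero_smul, add_zero]
    change monL 1 0 0 * _ = _
    rw [← mul_assoc, monL_mul]; simp [monL_zero]
  have hzδ : δ (monL 0 1 0) = D z := by
    rw [monL, hδ, derOfLog_single]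
    simp only [logOfVars, AddMonoidHom.coe_mk, ZeroHom.coe_mk, one_smul, zero_smul, add_zero,
      zero_add]
    change monL 0 1 0 * _ = _
    rw [← mul_assoc, monL_mul]; simp [monL_zero]
  have htδ : δ (monL 0 0 1) = D t := by
    rw [monL, hδ, derOfLog_single]
    simp only [logOfVars, AddMonoidHom.coe_mk, ZeroHom.coe_mk, one_smul, zero_smul, add_zero,
      zero_add]
    change monL 0 0 1 * _ = _
    rw [← mul_assoc, monL_mul]; simp [monL_zero]
  refine ⟨δ, fun b => ?_⟩
  have hadd : ∀ u v : coordL d k l, δ u.1 = (D u).1 → δ v.1 = (D v).1 →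
      δ (u + v).1 = (D (u + v)).1 := by
    intro u v hu hv
    rw [map_add D]
    exact (map_add δ u.1 v.1).trans (congrArg₂ (· + ·) hu hv)
  have hmul : ∀ u v : coordL d k l, δ u.1 = (D u).1 → δ v.1 = (D v).1 →
      δ (u * v).1 = (D (u * v)).1 := by
    intro u v hu hv
    rw [D.leibniz]
    exact (δ.leibniz u.1 v.1).trans
      (congrArg₂ (· + ·) (congrArg (u.1 * ·) hv) (congrArg (v.1 * ·) hu))
  have hpow : ∀ (u : coordL d k l) (n : ℕ), δ u.1 = (D u).1 → δ (u ^ n).1 = (D (u ^ n)).1 := by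
    intro u n hu
    induction n with
    | zero =>
      rw [pow_zero, D.map_one_eq_zero]
      exact δ.map_one_eq_zero
    | succ n ih => rw [pow_succ]; exact hmul _ _ ih hu
  -- The value at `y` is forced: apply both derivations to the relation and cancel `x^d`.
  have hyδ : δ (yL d k l) = D y := by
    have hrel : x ^ d * y = (-1) * (z ^ k + t ^ l + x) := by
      apply Subtype.ext
      exact (x_pow_mul_yL d k l).trans (neg_one_mul (cuspL k l + monL 1 0 0)).symm
    have hone : δ (-1 : coordL d k l).1 = (D (-1)).1 := by
      rw [map_neg D, D.map_one_eq_zero, neg_zero]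
      change δ (-1) = 0
      rw [map_neg, δ.map_one_eq_zero, neg_zero]
    have h1 : δ (x ^ d * y).1 = (D (x ^ d * y)).1 := by
      rw [hrel]
      exact hmul _ _ hone (hadd _ _ (hadd _ _ (hpow z k hzδ) (hpow t l htδ)) hxδ)
    have h2 := hpow x d hxδ
    have e1 : (D (x ^ d * y)).1 = (x ^ d).1 * (D y).1 + y.1 * (D (x ^ d)).1 := by
      rw [D.leibniz]; rfl
    have e2 : δ (x ^ d * y).1 = (x ^ d).1 * δ y.1 + y.1 * δ (x ^ d).1 := δ.leibniz _ _
    rw [e1, e2, h2] at h1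
    exact mul_left_cancel₀ (pow_ne_zero d (monL_ne_zero 1 0 0)) (add_right_cancel h1)
  obtain ⟨b, hb⟩ := b
  induction hb using Algebra.adjoin_induction with
  | mem f hf =>
    rcases hf with rfl | rfl | rfl | rfl
    exacts [hxδ, hyδ, hzδ, htδ]
  | algebraMap c =>
    have h1 : D (algebraMap ℂ (coordL d k l) c) = 0 := D.map_algebraMap c
    rw [δ.map_algebraMap]
    exact (congrArg Subtype.val h1).symm
  | add f g hf hg h1 h2 =>
    have h3 := congrArg Subtype.val (map_add D ⟨f, hf⟩ ⟨g, hg⟩)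
    rw [map_add]
    exact (congrArg₂ (· + ·) h1 h2).trans h3.symm
  | mul f g hf hg h1 h2 => exact hmul ⟨f, hf⟩ ⟨g, hg⟩ h1 h2

theorem trdeg_le_one_of_injective {K : Type} [CommRing K] [Algebra ℂ K]
    (G : K →ₐ[ℂ] Polynomial ℂ) (hG : Function.Injective G) : Algebra.trdeg ℂ K ≤ 1 :=
  (trdeg_le_of_injective G hG).trans_eq Polynomial.trdeg_of_isDomain

/-- Locally nilpotent derivations of the coordinate ring of the threefold: the kernel is contained
in `ℂ[x, z, t]` and contains `x`. -/
theorem kernel_of_locally_nilpotent (hd : 2 ≤ d) (hk : 2 ≤ k) (hl : 2 ≤ l)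
    (hcop : Nat.Coprime k l) (D : Derivation ℂ (coordL d k l) (coordL d k l))
    (hnil : ∀ b, IsNilAt D b) (hD : D ≠ 0) :
    (∀ b, D b = 0 → (b : Lau) ∈ polyL) ∧ D ⟨monL 1 0 0, x_mem_coordL⟩ = 0 := by
  have hker : ∀ b, D b = 0 → (b : Lau) ∈ polyL := by
    obtain ⟨δ, hδ⟩ := exists_extension_derivation D
    have hit : ∀ (n : ℕ) (b : coordL d k l), δ^[n] (b : Lau) = (D^[n] b : coordL d k l) := by
      intro n
      induction n with
      | zero => intro b; rfl
      | succ n ih => intro b; rw [Function.iterate_succ_apply, hδ, ih]; rfl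
    intro b hb
    refine mem_polyL_of_derivation_eq_zero hd hk hl hcop (δ := δ) ?_ ?_ ?_ b.2 ?_
    · intro c hc
      rw [hδ ⟨c, hc⟩]; exact (D ⟨c, hc⟩).2
    · intro c hc
      obtain ⟨n, hn⟩ := hnil ⟨c, hc⟩
      exact ⟨n, by rw [hit n ⟨c, hc⟩, hn]; rfl⟩
    · rintro rfl
      refine hD (Derivation.ext fun c => Subtype.ext ?_)
      rw [← hδ c]; rfl
    · rw [hδ, hb]; rfl
  refine ⟨hker, ?_⟩
  -- If `x` is not constant, no nonzero constant is divisible by `x` in the coordinate ring. Since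
  -- `z^k + t^l = -x (1 + x^(d-1) y)`, a kernel element vanishing on the cusp is divisible by `x`.
  -- So the kernel embeds in `ℂ[s]` and has transcendence degree at most one, while it should be at
  -- least `3 - 1`.
  by_contra hx
  set x : coordL d k l := ⟨monL 1 0 0, x_mem_coordL⟩ with hxdef
  obtain ⟨ω, hω, hω0⟩ := exists_pow_eq_neg_one (show 0 < l by omega)
  -- the kernel embeds in the polynomial ring in one variable
  choose g hg using fun b : kerSubalgebra D => exists_toLau_eq (hker b.1 b.2)
  have hginj : ∀ {p q : Rxzt}, toLau p = toLau q → p = q := fun h => toLau_injective h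
  obtain ⟨G, hG⟩ : ∃ G : kerSubalgebra D →ₐ[ℂ] Rxzt, ∀ b, toLau (G b) = b.1 := ⟨
    { toFun := g
      map_one' := hginj (by rw [hg, map_one]; rfl)
      map_mul' := fun a b => hginj (by rw [hg, map_mul, hg, hg]; rfl)
      map_zero' := hginj (by rw [hg, map_zero]; rfl)
      map_add' := fun a b => hginj (by rw [hg, map_add, hg, hg]; rfl)
      commutes' := fun c => hginj (by rw [hg, AlgHom.commutes]; rfl) }, hg⟩
  have hinj : Function.Injective ((cuspHom k l ω).comp G) := by
    rw [injective_iff_map_eq_zero]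
    intro b hb
    have hmem := cuspHom_eq_zero (p := G b) (by omega) hcop hω0 (cuspHom_cusp hω) hb
    obtain ⟨u, v, huv⟩ := Ideal.mem_span_pair.1 hmem
    have hub : toLau u ∈ coordL d k l := polyL_le_coordL (toLau_mem u)
    have hvb : toLau v ∈ coordL d k l := polyL_le_coordL (toLau_mem v)
    have hbx : b.1 = x * (⟨toLau u, hub⟩ - ⟨toLau v, hvb⟩ *
        (1 + x ^ (d - 1) * ⟨yL d k l, y_mem_coordL⟩)) := by
      apply Subtype.ext
      rw [← hG b, ← huv, map_add, map_mul, map_mul, toLau_cusp, toLau_X_zero]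
      push_cast
      have h1 := x_pow_mul_yL d k l
      have h2 : (monL 1 0 0 : Lau) ^ d = monL 1 0 0 * monL 1 0 0 ^ (d - 1) := by
        rw [← pow_succ']; congr 1; omega
      rw [h2] at h1
      change _ = monL 1 0 0 * (toLau u - toLau v * (1 + monL 1 0 0 ^ (d - 1) * yL d k l))
      linear_combination toLau v * h1
    by_contra hb0
    have hb0' : b.1 ≠ 0 := fun h => hb0 (Subtype.ext h)
    apply hx
    have hDb : D b.1 = 0 := b.2
    rw [hbx] at hb0' hDb
    exact map_eq_zero_of_mul (hnil _) (hnil _) hb0' hDb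
  have h1 := trdeg_le_trdeg_kerSubalgebra_add_one D hnil hD
  have h2 : Algebra.trdeg ℂ (kerSubalgebra D) ≤ 1 := by
    exact trdeg_le_one_of_injective ((cuspHom k l ω).comp G) hinj
  let T : Rxzt →ₐ[ℂ] coordL d k l :=
    toLau.codRestrict _ fun p => polyL_le_coordL (toLau_mem p)
  have hT : Function.Injective T := fun p q h => toLau_injective (congrArg Subtype.val h)
  have h3 : (3 : Cardinal) ≤ Algebra.trdeg ℂ (coordL d k l) := by
    have := trdeg_le_of_injective T hT
    rw [MvPolynomial.trdeg_of_isDomain] at this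
    simpa using this
  have h4 : (3 : Cardinal) ≤ 1 + 1 := h3.trans (h1.trans (by gcongr))
  norm_num at h4

end KernelOnCoordinateRing

end KorasRussell

namespace KorasRussell

/-! ### Polynomial functions on the threefold and the ideal of its equation. -/

section CoordinateRing

open MvPolynomial

/-- The defining polynomial of the threefold. -/
noncomputable def defPoly (d k l : ℕ) : MvPolynomial (Fin 4) ℂ :=
  X 0 ^ d * X 1 + (X 2 ^ k + X 3 ^ l + X 0)

/-- The inclusion of `ℂ[x, z, t]` in `ℂ[x, y, z, t]`. -/
noncomputable def inclXZT : Rxzt →ₐ[ℂ] MvPolynomial (Fin 4) ℂ := rename ![0, 2, 3]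

/-- The polynomial `z^k + t^ℓ + x`. -/
noncomputable def polyS (k l : ℕ) : Rxzt := X 1 ^ k + X 2 ^ l + X 0

/-- The map `ℂ[x, y, z, t] → ℂ[x^±, z^±, t^±]` whose image is the coordinate ring. -/
noncomputable def toCoord (d k l : ℕ) : MvPolynomial (Fin 4) ℂ →ₐ[ℂ] Lau :=
  aeval ![monL 1 0 0, yL d k l, monL 0 1 0, monL 0 0 1]

variable {d k l : ℕ}

theorem toCoord_inclXZT (p : Rxzt) : toCoord d k l (inclXZT p) = toLau p := by
  rw [toCoord, inclXZT, aeval_rename, toLau]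
  congr 2
  funext i
  fin_cases i <;> rfl

theorem eval_inclXZT (p : Rxzt) (v : Fin 4 → ℂ) : eval v (inclXZT p) = eval (proj v) p := by
  rw [inclXZT, eval_rename]
  congr 2
  funext i
  fin_cases i <;> rfl

theorem toLau_polyS : toLau (polyS k l) = cuspL k l + monL 1 0 0 := by
  rw [polyS, map_add, toLau_cusp, toLau_X_zero]

theorem inclXZT_X : inclXZT (X 0) = X 0 ∧ inclXZT (X 1) = X 2 ∧ inclXZT (X 2) = X 3 := by
  refine ⟨?_, ?_, ?_⟩ <;> simp [inclXZT]

theorem defPoly_eq : defPoly d k l = X 0 ^ d * X 1 + inclXZT (polyS k l) := by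
  obtain ⟨h0, h1, h2⟩ := inclXZT_X
  rw [polyS, map_add, map_add, map_pow, map_pow, h0, h1, h2, defPoly]

theorem toCoord_X_zero : toCoord d k l (X 0) = monL 1 0 0 := by simp [toCoord]

theorem toCoord_X_one : toCoord d k l (X 1) = yL d k l := by simp [toCoord]

theorem toCoord_defPoly : toCoord d k l (defPoly d k l) = 0 := by
  rw [defPoly_eq, map_add, map_mul, map_pow, toCoord_inclXZT, toCoord_X_zero, toCoord_X_one,
    x_pow_mul_yL, toLau_polyS, neg_add_cancel]

theorem mem_threefold_iff {v : Fin 4 → ℂ} :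
    v ∈ threefold d k l ↔ eval v (defPoly d k l) = 0 := by
  simp [threefold, defPoly, add_assoc]

theorem toCoord_mem (F : MvPolynomial (Fin 4) ℂ) : toCoord d k l F ∈ coordL d k l := by
  induction F using MvPolynomial.induction_on with
  | C a => rw [← algebraMap_eq, AlgHom.commutes]; exact Subalgebra.algebraMap_mem _ a
  | add p q hp hq => rw [map_add]; exact add_mem hp hq
  | mul_X p i hp =>
    rw [map_mul]
    refine mul_mem hp ?_
    fin_cases i <;> simp [toCoord, x_mem_coordL, y_mem_coordL, z_mem_coordL, t_mem_coordL]

theorem exists_toCoord_eq {b : Lau} (hb : b ∈ coordL d k l) : ∃ F, toCoord d k l F = b := by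
  have : coordL d k l ≤ (toCoord d k l).range := by
    rw [coordL, Algebra.adjoin_le_iff]
    rintro f (rfl | rfl | rfl | rfl)
    · exact ⟨X 0, by simp [toCoord]⟩
    · exact ⟨X 1, by simp [toCoord]⟩
    · exact ⟨X 2, by simp [toCoord]⟩
    · exact ⟨X 3, by simp [toCoord]⟩
  exact this hb

/-- Modulo the equation, multiplication by `x^d` turns each factor `y` into `-(z^k + t^l + x)`. -/
theorem exists_clear_y (F : MvPolynomial (Fin 4) ℂ) :
    ∃ (N : ℕ) (p : Rxzt), defPoly d k l ∣ X 0 ^ N * F - inclXZT p := by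
  induction F using MvPolynomial.induction_on with
  | C a =>
    refine ⟨0, C a, ?_⟩
    simp [inclXZT]
  | add F G hF hG =>
    obtain ⟨N, p, u, hu⟩ := hF
    obtain ⟨M, q, v, hv⟩ := hG
    refine ⟨N + M, X 0 ^ M * p + X 0 ^ N * q, X 0 ^ M * u + X 0 ^ N * v, ?_⟩
    rw [map_add, map_mul, map_mul, map_pow, map_pow, inclXZT_X.1, pow_add]
    linear_combination X 0 ^ M * hu + X 0 ^ N * hv
  | mul_X F i hF =>
    obtain ⟨N, p, u, hu⟩ := hF
    have key : ∀ (i : Fin 4) (j : Fin 3), inclXZT (X j) = X i →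
        ∃ (N : ℕ) (p : Rxzt), defPoly d k l ∣ X 0 ^ N * (F * X i) - inclXZT p := by
      intro i j hij
      refine ⟨N, p * X j, u * X i, ?_⟩
      rw [map_mul, hij]
      linear_combination X i * hu
    obtain ⟨h0, h1, h2⟩ := inclXZT_X
    fin_cases i
    · exact key 0 0 h0
    · refine ⟨N + d, -(p * polyS k l), u * X 0 ^ d * X 1 + inclXZT p, ?_⟩
      rw [map_neg, map_mul, pow_add]
      have h3 := defPoly_eq (d := d) (k := k) (l := l)
      change X 0 ^ N * X 0 ^ d * (F * X 1) - _ = _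
      linear_combination X 0 ^ d * X 1 * hu - inclXZT p * h3
    · exact key 2 1 h1
    · exact key 3 2 h2

theorem exists_pow_mul_eq_toLau (F : MvPolynomial (Fin 4) ℂ) :
    ∃ (N : ℕ) (p : Rxzt), monL 1 0 0 ^ N * toCoord d k l F = toLau p ∧
      ∀ v ∈ threefold d k l, v 0 ^ N * eval v F = eval (proj v) p := by
  obtain ⟨N, p, u, hu⟩ := exists_clear_y (d := d) (k := k) (l := l) F
  refine ⟨N, p, ?_, fun v hv => ?_⟩
  · have h := congrArg (toCoord d k l) hu
    rw [map_sub, map_mul, map_mul, map_pow, toCoord_defPoly, toCoord_inclXZT, toCoord_X_zero,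
      zero_mul] at h
    exact sub_eq_zero.1 h
  · have h := congrArg (eval v) hu
    rw [map_sub, map_mul, map_mul, map_pow, mem_threefold_iff.1 hv, eval_inclXZT, eval_X,
      zero_mul] at h
    exact sub_eq_zero.1 h

/-- The part `x ≠ 0` of the threefold projects onto all points of 3-space with `x ≠ 0`, so `x p`
vanishes identically. -/
theorem eq_zero_of_eval_eq_zero {p : Rxzt}
    (h : ∀ v ∈ threefold d k l, v 0 ≠ 0 → eval (proj v) p = 0) : p = 0 := by
  have h2 : X 0 * p = 0 := by
    apply MvPolynomial.funext
    intro w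
    rw [map_mul, eval_X, map_zero]
    by_cases hw : w 0 = 0
    · rw [hw, zero_mul]
    · have h3 := h ![w 0, -(w 1 ^ k + w 2 ^ l + w 0) / w 0 ^ d, w 1, w 2] ?_ hw
      · have : proj ![w 0, -(w 1 ^ k + w 2 ^ l + w 0) / w 0 ^ d, w 1, w 2] = w := by
          funext i; fin_cases i <;> rfl
        rw [this] at h3
        rw [h3, mul_zero]
      · simp only [threefold, Set.mem_ofPred_eq, Matrix.cons_val]
        field_simp
        ring
  exact (mul_eq_zero.1 h2).resolve_left (X_ne_zero 0)

theorem toCoord_eq_zero_of_eval {F : MvPolynomial (Fin 4) ℂ}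
    (h : ∀ v ∈ threefold d k l, v 0 ≠ 0 → eval v F = 0) : toCoord d k l F = 0 := by
  obtain ⟨N, p, h1, h2⟩ := exists_pow_mul_eq_toLau (d := d) (k := k) (l := l) F
  have hp : p = 0 := eq_zero_of_eval_eq_zero fun v hv hv0 => by
    rw [← h2 v hv, h v hv hv0, mul_zero]
  rw [hp, map_zero] at h1
  exact (mul_eq_zero.1 h1).resolve_left (pow_ne_zero _ (monL_ne_zero _ _ _))

/-- After clearing `y`, the equation divides `x^N F`. Since `x` is prime and does not divide the
equation, `x^N` can be cancelled. -/
theorem dvd_of_toCoord_eq_zero (hd : 0 < d) {F : MvPolynomial (Fin 4) ℂ}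
    (h : toCoord d k l F = 0) : defPoly d k l ∣ F := by
  obtain ⟨N, p, u, hu⟩ := exists_clear_y (d := d) (k := k) (l := l) F
  have hp : p = 0 := by
    have h1 := congrArg (toCoord d k l) hu
    rw [map_sub, map_mul, map_mul, h, toCoord_defPoly, toCoord_inclXZT, mul_zero, zero_mul,
      zero_sub, neg_eq_zero] at h1
    exact toLau_injective (h1.trans (map_zero _).symm)
  rw [hp, map_zero, sub_zero] at hu
  have hprime : Prime (X 0 : MvPolynomial (Fin 4) ℂ) := X_prime
  have hnd : ¬ (X 0 : MvPolynomial (Fin 4) ℂ) ∣ defPoly d k l := by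
    rintro ⟨q, hq⟩
    have := congrArg (eval ![0, 0, 1, 1]) hq
    simp [defPoly, hd.ne', one_add_one_eq_two] at this
  obtain ⟨q, hq⟩ := hprime.pow_dvd_of_dvd_mul_left N hnd (Dvd.intro _ hu)
  refine ⟨q, ?_⟩
  rw [hq] at hu
  refine mul_left_cancel₀ (pow_ne_zero N (X_ne_zero 0)) (hu.trans ?_)
  ring

theorem toCoord_eq_iff (hd : 0 < d) {F G : MvPolynomial (Fin 4) ℂ} :
    toCoord d k l F = toCoord d k l G ↔ ∀ v ∈ threefold d k l, eval v F = eval v G := by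
  rw [← sub_eq_zero, ← map_sub]
  refine ⟨fun h v hv => ?_, fun h => toCoord_eq_zero_of_eval fun v hv _ => ?_⟩
  · obtain ⟨q, hq⟩ := dvd_of_toCoord_eq_zero hd h
    rw [← sub_eq_zero, ← map_sub, hq, map_mul, mem_threefold_iff.1 hv, zero_mul]
  · rw [map_sub, h v hv, sub_self]

theorem eval_eq_of_eval_eq (hd : 0 < d) {F G : MvPolynomial (Fin 4) ℂ}
    (h : ∀ v ∈ threefold d k l, v 0 ≠ 0 → eval v F = eval v G) :
    ∀ v ∈ threefold d k l, eval v F = eval v G := by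
  rw [← toCoord_eq_iff hd, ← sub_eq_zero, ← map_sub]
  exact toCoord_eq_zero_of_eval fun v hv hv0 => by rw [map_sub, h v hv hv0, sub_self]

/-- The ideal is `x^d B ∩ ℂ[x, z, t]` for `B` the coordinate ring. This intrinsic form shows that
automorphisms scaling `x` preserve it. -/
theorem mem_idealJ_iff (hd : 0 < d) {p : Rxzt} :
    p ∈ idealJ d k l ↔ ∃ b ∈ coordL d k l, toLau p = monL 1 0 0 ^ d * b := by
  constructor
  · intro h
    obtain ⟨u, v, rfl⟩ := Ideal.mem_span_pair.1 h
    refine ⟨toLau u - toLau v * yL d k l, sub_mem (polyL_le_coordL (toLau_mem u))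
      (mul_mem (polyL_le_coordL (toLau_mem v)) y_mem_coordL), ?_⟩
    have h1 := x_pow_mul_yL d k l
    have h2 := toLau_polyS (k := k) (l := l)
    rw [polyS] at h2
    rw [map_add, map_mul, map_mul, h2, map_pow, toLau_X_zero]
    linear_combination toLau v * h1
  · rintro ⟨b, hb, h⟩
    obtain ⟨F, rfl⟩ := exists_toCoord_eq hb
    have h1 : toCoord d k l (X 0 ^ d * F - inclXZT p) = 0 := by
      rw [map_sub, toCoord_inclXZT, h, map_mul, map_pow, toCoord_X_zero, sub_self]
    obtain ⟨q, hq⟩ := dvd_of_toCoord_eq_zero hd h1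
    -- Setting `y = 0` in the polynomial identity exhibits `p` as a combination of `x^d` and `z^k +
    -- t^l + x`.
    let θ : MvPolynomial (Fin 4) ℂ →ₐ[ℂ] Rxzt := aeval ![X 0, 0, X 1, X 2]
    have hθ : ∀ p, θ (inclXZT p) = p := by
      intro p
      have : θ.comp inclXZT = AlgHom.id ℂ Rxzt := by
        ext i : 1
        fin_cases i <;> simp [inclXZT, θ]
      exact DFunLike.congr_fun this p
    have h2 := congrArg θ hq
    rw [defPoly_eq, map_sub, map_mul, map_mul, map_add, hθ, hθ, map_mul, map_pow] at h2
    have h3 : θ (X 0) = X 0 := by simp [θ]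
    have h4 : θ (X 1) = 0 := by simp [θ]
    rw [h3, h4] at h2
    refine Ideal.mem_span_pair.2 ⟨θ F, -θ q, ?_⟩
    rw [polyS] at h2
    linear_combination h2

end CoordinateRing

end KorasRussell

namespace KorasRussell

/-! ### Automorphisms of the threefold and of its coordinate ring. -/

section Pullback

open MvPolynomial

variable {d k l : ℕ}

/-- The surjection from `ℂ[x, y, z, t]` to the coordinate ring of the threefold. -/
noncomputable def toCoordRing (d k l : ℕ) : MvPolynomial (Fin 4) ℂ →ₐ[ℂ] coordL d k l :=
  (toCoord d k l).codRestrict _ toCoord_mem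

theorem coe_toCoordRing (F : MvPolynomial (Fin 4) ℂ) :
    (toCoordRing d k l F : Lau) = toCoord d k l F := rfl

theorem toCoordRing_surjective : Function.Surjective (toCoordRing d k l) := fun b => by
  obtain ⟨F, hF⟩ := exists_toCoord_eq b.2
  exact ⟨F, Subtype.ext hF⟩

theorem toCoordRing_eq_iff (hd : 0 < d) {F G : MvPolynomial (Fin 4) ℂ} :
    toCoordRing d k l F = toCoordRing d k l G ↔
      ∀ v : threefold d k l, eval v.1 F = eval v.1 G := by
  rw [Subtype.ext_iff, coe_toCoordRing, coe_toCoordRing, toCoord_eq_iff hd]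
  exact ⟨fun h v => h v.1 v.2, fun h v hv => h ⟨v, hv⟩⟩

theorem exists_lift_of_surjective {A B C : Type} [CommRing A] [CommRing B] [CommRing C]
    [Algebra ℂ A] [Algebra ℂ B] [Algebra ℂ C] (f : A →ₐ[ℂ] B) (hf : Function.Surjective f)
    (g : A →ₐ[ℂ] C) (h : ∀ a, f a = 0 → g a = 0) : ∃ τ : B →ₐ[ℂ] C, ∀ a, τ (f a) = g a :=
  ⟨AlgHom.liftOfSurjective f hf g h, fun a => AlgHom.liftOfSurjective_apply f hf g h a⟩

theorem exists_comp (ψ : Aut (threefold d k l)) (F : MvPolynomial (Fin 4) ℂ) :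
    ∃ G, ∀ v : threefold d k l, eval (ψ • v).1 F = eval v.1 G := by
  obtain ⟨H, hH⟩ := ψ.2.1
  refine ⟨bind₁ H F, fun v => ?_⟩
  have h : (ψ • v).1 = fun j => eval v.1 (H j) := funext (hH v)
  rw [h]
  exact (eval₂Hom_bind₁ (RingHom.id ℂ) v.1 H F).symm

/-- The pullback of functions by a morphism of the threefold to itself. -/
theorem exists_pullback_hom (hd : 0 < d) (ψ : Aut (threefold d k l)) :
    ∃ σ : coordL d k l →ₐ[ℂ] coordL d k l, ∀ F G, (∀ v : threefold d k l,
      eval (ψ • v).1 F = eval v.1 G) → σ (toCoordRing d k l F) = toCoordRing d k l G := by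
  choose H hH using fun i => exists_comp ψ (X i)
  have hb : ∀ (F) (v : threefold d k l), eval (ψ • v).1 F = eval v.1 (bind₁ H F) := by
    intro F v
    have h : (ψ • v).1 = fun j => eval v.1 (H j) := funext fun i => by
      rw [← hH i v, eval_X]
    rw [h]
    exact (eval₂Hom_bind₁ (RingHom.id ℂ) v.1 H F).symm
  obtain ⟨σ, hσ⟩ := exists_lift_of_surjective (toCoordRing d k l) toCoordRing_surjective
    ((toCoordRing d k l).comp (bind₁ H)) (fun F hF => by
      rw [← map_zero (toCoordRing d k l), toCoordRing_eq_iff hd] at hF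
      rw [AlgHom.comp_apply, ← map_zero (toCoordRing d k l), toCoordRing_eq_iff hd]
      intro v
      rw [← hb, hF (ψ • v), map_zero, map_zero])
  refine ⟨σ, fun F G hFG => ?_⟩
  rw [hσ, AlgHom.comp_apply, toCoordRing_eq_iff hd]
  intro v
  rw [← hb, hFG]

/-- The pullback of functions by an automorphism of the threefold. -/
theorem exists_pullback (hd : 0 < d) (ψ : Aut (threefold d k l)) :
    ∃ σ : coordL d k l ≃ₐ[ℂ] coordL d k l, ∀ F G, (∀ v : threefold d k l,
      eval (ψ • v).1 F = eval v.1 G) ↔ σ (toCoordRing d k l F) = toCoordRing d k l G := by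
  obtain ⟨σ, hσ⟩ := exists_pullback_hom hd ψ
  obtain ⟨τ, hτ⟩ := exists_pullback_hom hd ψ⁻¹
  have h1 : ∀ b, σ (τ b) = b := by
    intro b
    obtain ⟨F, rfl⟩ := toCoordRing_surjective b
    obtain ⟨G, hG⟩ := exists_comp ψ⁻¹ F
    rw [hτ F G hG, hσ G F]
    intro v
    rw [← hG (ψ • v), inv_smul_smul]
  have h2 : ∀ b, τ (σ b) = b := by
    intro b
    obtain ⟨F, rfl⟩ := toCoordRing_surjective b
    obtain ⟨G, hG⟩ := exists_comp ψ F
    rw [hσ F G hG, hτ G F]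
    intro v
    rw [← hG (ψ⁻¹ • v), smul_inv_smul]
  refine ⟨AlgEquiv.ofAlgHom σ τ (AlgHom.ext h1) (AlgHom.ext h2), fun F G => ⟨hσ F G, fun h v => ?_⟩⟩
  obtain ⟨G', hG'⟩ := exists_comp ψ F
  rw [hG' v]
  exact (toCoordRing_eq_iff hd).1 ((hσ F G' hG').symm.trans h) v

end Pullback

/-! ### The locally nilpotent derivations `x^d ∂_z` and `x^d ∂_t`. -/

section StandardDerivations

open MvPolynomial

variable {d k l : ℕ}

theorem exists_restrict_derivation {δ : Derivation ℂ Lau Lau}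
    (hx : δ (monL 1 0 0) ∈ coordL d k l) (hy : δ (yL d k l) ∈ coordL d k l)
    (hz : δ (monL 0 1 0) ∈ coordL d k l) (ht : δ (monL 0 0 1) ∈ coordL d k l) :
    ∃ D : Derivation ℂ (coordL d k l) (coordL d k l), ∀ b, (D b : Lau) = δ b := by
  have hmem : ∀ b ∈ coordL d k l, δ b ∈ coordL d k l := by
    intro b hb
    induction hb using Algebra.adjoin_induction with
    | mem f hf =>
      rcases hf with rfl | rfl | rfl | rfl
      exacts [hx, hy, hz, ht]
    | algebraMap c => rw [δ.map_algebraMap]; exact zero_mem _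
    | add f g hf hg h1 h2 => rw [map_add]; exact add_mem h1 h2
    | mul f g hf hg h1 h2 =>
      rw [δ.leibniz]
      exact add_mem (mul_mem hf h2) (mul_mem hg h1)
  refine ⟨Derivation.mk' ((δ.toLinearMap.comp (coordL d k l).val.toLinearMap).codRestrict
    (Subalgebra.toSubmodule (coordL d k l)) fun b => hmem b b.2) ?_, fun b => rfl⟩
  intro a b
  exact Subtype.ext (δ.leibniz a.1 b.1)

theorem isNilAt_of_generators {δ : Derivation ℂ Lau Lau} (hx : IsNilAt δ (monL 1 0 0))
    (hy : IsNilAt δ (yL d k l)) (hz : IsNilAt δ (monL 0 1 0)) (ht : IsNilAt δ (monL 0 0 1))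
    {D : Derivation ℂ (coordL d k l) (coordL d k l)} (hD : ∀ b, (D b : Lau) = δ b) (b) :
    IsNilAt D b := by
  have h : coordL d k l ≤ nilSubalgebra δ := by
    rw [coordL, Algebra.adjoin_le_iff]
    rintro f (rfl | rfl | rfl | rfl)
    exacts [hx, hy, hz, ht]
  obtain ⟨n, hn⟩ := h b.2
  have hit : ∀ (n : ℕ) (b : coordL d k l), (D^[n] b : Lau) = δ^[n] b := by
    intro n
    induction n with
    | zero => intro b; rfl
    | succ n ih => intro b; rw [Function.iterate_succ_apply, Function.iterate_succ_apply, ih, hD]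
  exact ⟨n, Subtype.ext ((hit n b).trans hn)⟩

/-- The derivation of Laurent polynomials with prescribed values on the variables. -/
noncomputable def derL (p q r : Lau) : Derivation ℂ Lau Lau :=
  derOfLog (logOfVars (p * monL (-1) 0 0) (q * monL 0 (-1) 0) (r * monL 0 0 (-1)))

theorem derL_apply (p q r : Lau) :
    derL p q r (monL 1 0 0) = p ∧ derL p q r (monL 0 1 0) = q ∧ derL p q r (monL 0 0 1) = r := by
  have h : ∀ a b c, derL p q r (monL a b c) = monL a b c * logOfVars (p * monL (-1) 0 0)
      (q * monL 0 (-1) 0) (r * monL 0 0 (-1)) (a, b, c) := fun a b c => derOfLog_single _ _ _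
  refine ⟨?_, ?_, ?_⟩ <;>
  · rw [h]
    simp only [logOfVars, AddMonoidHom.coe_mk, ZeroHom.coe_mk, one_smul, zero_smul, add_zero,
      zero_add]
    rw [mul_left_comm, monL_mul]
    simp [monL_zero]

theorem toLau_derL (p q r : Lau) (f : Rxzt) :
    derL p q r (toLau f) = toLau (pderiv 0 f) * p + toLau (pderiv 1 f) * q +
      toLau (pderiv 2 f) * r := by
  obtain ⟨h0, h1, h2⟩ := derL_apply p q r
  induction f using MvPolynomial.induction_on with
  | C a => rw [← algebraMap_eq, AlgHom.commutes, Derivation.map_algebraMap]; simp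
  | add f g hf hg => simp only [map_add, hf, hg]; ring
  | mul_X f i hf =>
    have hX : derL p q r (toLau (X i)) = toLau (pderiv 0 (X i)) * p + toLau (pderiv 1 (X i)) * q +
      toLau (pderiv 2 (X i)) * r := by
      fin_cases i
      · change derL p q r (toLau (X 0)) = toLau (pderiv 0 (X 0)) * p + toLau (pderiv 1 (X 0)) * q +
          toLau (pderiv 2 (X 0)) * r
        rw [toLau_X_zero, h0]; simp [pderiv_X]
      · change derL p q r (toLau (X 1)) = toLau (pderiv 0 (X 1)) * p + toLau (pderiv 1 (X 1)) * q +
          toLau (pderiv 2 (X 1)) * r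
        rw [toLau_X_one, h1]; simp [pderiv_X]
      · change derL p q r (toLau (X 2)) = toLau (pderiv 0 (X 2)) * p + toLau (pderiv 1 (X 2)) * q +
          toLau (pderiv 2 (X 2)) * r
        rw [toLau_X_two, h2]; simp [pderiv_X]
    simp only [map_mul, Derivation.leibniz, hf, hX, smul_eq_mul, map_add]
    ring

/-- The two basic locally nilpotent derivations of the coordinate ring. -/
theorem exists_standard_derivations (d k l : ℕ) :
    (∃ D : Derivation ℂ (coordL d k l) (coordL d k l), (∀ b, IsNilAt D b) ∧ D ≠ 0 ∧
      ∀ (p : Rxzt) (b : coordL d k l), (b : Lau) = toLau p → (D b = 0 ↔ pderiv 1 p = 0)) ∧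
    (∃ D : Derivation ℂ (coordL d k l) (coordL d k l), (∀ b, IsNilAt D b) ∧ D ≠ 0 ∧
      ∀ (p : Rxzt) (b : coordL d k l), (b : Lau) = toLau p → (D b = 0 ↔ pderiv 2 p = 0)) := by
  have key : ∀ (q r : Lau) (i : Fin 3) (hi : (i = 1 ∧ q = monL 1 0 0 ^ d ∧ r = 0) ∨
      (i = 2 ∧ q = 0 ∧ r = monL 1 0 0 ^ d)), 
      (∃ D : Derivation ℂ (coordL d k l) (coordL d k l), (∀ b, IsNilAt D b) ∧ D ≠ 0 ∧
      ∀ (p : Rxzt) (b : coordL d k l), (b : Lau) = toLau p → (D b = 0 ↔ pderiv i p = 0)) := by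
    intro q r i hi
    -- On `ℂ[x, z, t]` this is `x^d ∂_i`. The factor `x^d` makes its value `-∂_i (z^k + t^l + x)` at
    -- `y` regular, and it is triangular, hence locally nilpotent.
    set δ := derL 0 q r
    obtain ⟨h0, h1, h2⟩ := derL_apply 0 q r
    have hval : ∀ p, δ (toLau p) = monL 1 0 0 ^ d * toLau (pderiv i p) := by
      intro p
      rw [toLau_derL]
      rcases hi with ⟨rfl, rfl, rfl⟩ | ⟨rfl, rfl, rfl⟩ <;> ring
    have hx : δ (monL 1 0 0) = 0 := h0
    have hxd : δ (monL 1 0 0 ^ d) = 0 := by rw [Derivation.leibniz_pow, hx]; simp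
    have hy : δ (yL d k l) = -toLau (pderiv i (polyS k l)) := by
      have e := congrArg δ (x_pow_mul_yL d k l)
      rw [← toLau_polyS, Derivation.leibniz, map_neg, hval, hxd, smul_zero, add_zero,
        smul_eq_mul, ← mul_neg] at e
      exact mul_left_cancel₀ (pow_ne_zero _ (monL_ne_zero _ _ _)) e
    have nil_of_sq : ∀ p, pderiv i (pderiv i p) = 0 → IsNilAt δ (toLau p) := by
      intro p hp
      refine ⟨2, ?_⟩
      change δ (δ (toLau p)) = 0
      rw [hval, Derivation.leibniz, hxd, hval, hp]
      simp
    have hXnil : ∀ j, IsNilAt δ (toLau (X j)) := fun j => by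
      apply nil_of_sq
      rw [pderiv_X]
      by_cases h : i = j
      · subst h; simp
      · simp [h]
    have hXnil' : ∀ p, IsNilAt δ (toLau p) := by
      intro p
      induction p using MvPolynomial.induction_on with
      | C a => rw [← algebraMap_eq, AlgHom.commutes]; exact isNilAt_algebraMap δ a
      | add f g hf hg => rw [map_add]; exact hf.add hg
      | mul_X f j hf => rw [map_mul]; exact hf.mul (hXnil j)
    have nilx := hXnil 0
    have nilz := hXnil 1
    have nilt := hXnil 2
    rw [toLau_X_zero] at nilx
    rw [toLau_X_one] at nilz
    rw [toLau_X_two] at nilt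
    have memval : ∀ p, δ (toLau p) ∈ coordL d k l := fun p => by
      rw [hval]
      exact mul_mem (pow_mem x_mem_coordL d) (polyL_le_coordL (toLau_mem _))
    have hmx := memval (X 0)
    have hmz := memval (X 1)
    have hmt := memval (X 2)
    rw [toLau_X_zero] at hmx
    rw [toLau_X_one] at hmz
    rw [toLau_X_two] at hmt
    obtain ⟨D, hD⟩ := exists_restrict_derivation (δ := δ) hmx
      (by rw [hy]; exact neg_mem (polyL_le_coordL (toLau_mem _))) hmz hmt
    have hker : ∀ (p : Rxzt) (b : coordL d k l), (b : Lau) = toLau p → (D b = 0 ↔ pderiv i p = 0) := by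
      intro p b hb
      rw [← Subtype.coe_inj, hD, hb, hval]
      change _ = (0 : Lau) ↔ _
      rw [mul_eq_zero, or_iff_right (pow_ne_zero _ (monL_ne_zero _ _ _))]
      exact ⟨fun h => toLau_injective (h.trans (map_zero _).symm), fun h => by rw [h, map_zero]⟩
    refine ⟨D, isNilAt_of_generators nilx ?_ nilz nilt hD, ?_, hker⟩
    · obtain ⟨n, hn⟩ := hXnil' (-pderiv i (polyS k l))
      refine ⟨n + 1, ?_⟩
      rw [Function.iterate_succ_apply, hy, ← map_neg]
      exact hn
    · intro h
      have := (hker (X i) ⟨toLau (X i), polyL_le_coordL (toLau_mem (X i))⟩ rfl).1 (by rw [h]; rfl)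
      simp [pderiv_X] at this
  exact ⟨key _ _ 1 (Or.inl ⟨rfl, rfl, rfl⟩), key _ _ 2 (Or.inr ⟨rfl, rfl, rfl⟩)⟩

end StandardDerivations

end KorasRussell

namespace KorasRussell

/-! ### Automorphisms preserve `ℂ[x, z, t]` and the line `ℂ x`. -/

section ActionOnPolynomials

open MvPolynomial

variable {d k l : ℕ}

/-- The conjugate of a derivation by an automorphism. -/
def conjDerivation {A : Type*} [CommRing A] [Algebra ℂ A] (σ : A ≃ₐ[ℂ] A)
    (D : Derivation ℂ A A) : Derivation ℂ A A :=
  Derivation.mk' (σ.toLinearMap ∘ₗ D.toLinearMap ∘ₗ σ.symm.toLinearMap) fun a b => by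
    simp [Derivation.leibniz]

theorem conjDerivation_apply {A : Type*} [CommRing A] [Algebra ℂ A] (σ : A ≃ₐ[ℂ] A)
    (D : Derivation ℂ A A) (a : A) : conjDerivation σ D (σ a) = σ (D a) := by
  change σ (D (σ.symm (σ a))) = _
  rw [σ.symm_apply_apply]

theorem conjDerivation_iterate {A : Type*} [CommRing A] [Algebra ℂ A] (σ : A ≃ₐ[ℂ] A)
    (D : Derivation ℂ A A) (n : ℕ) (a : A) :
    (conjDerivation σ D)^[n] (σ a) = σ (D^[n] a) := by
  induction n generalizing a with
  | zero => rfl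
  | succ n ih => rw [Function.iterate_succ_apply, conjDerivation_apply, ih,
      Function.iterate_succ_apply]

/-- The conjugate `σ D σ⁻¹` is again locally nilpotent and nonzero, and its kernel is the image of
the kernel of `D`. -/
theorem kernel_of_conjugate (hd : 2 ≤ d) (hk : 2 ≤ k) (hl : 2 ≤ l) (hcop : Nat.Coprime k l)
    (σ : coordL d k l ≃ₐ[ℂ] coordL d k l) {D : Derivation ℂ (coordL d k l) (coordL d k l)}
    (hnil : ∀ b, IsNilAt D b) (hD : D ≠ 0) :
    (∀ b, D b = 0 → (σ b : Lau) ∈ polyL) ∧ D (σ.symm ⟨monL 1 0 0, x_mem_coordL⟩) = 0 := by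
  have h := kernel_of_locally_nilpotent hd hk hl hcop (conjDerivation σ D) ?_ ?_
  · refine ⟨fun b hb => h.1 _ (by rw [conjDerivation_apply, hb, map_zero]), ?_⟩
    have h2 := h.2
    rw [← σ.apply_symm_apply ⟨monL 1 0 0, x_mem_coordL⟩, conjDerivation_apply] at h2
    exact σ.injective (h2.trans (map_zero σ).symm)
  · intro b
    obtain ⟨n, hn⟩ := hnil (σ.symm b)
    refine ⟨n, ?_⟩
    rw [← σ.apply_symm_apply b, conjDerivation_iterate, hn, map_zero]
  · intro h
    apply hD
    ext1 b
    have h3 := conjDerivation_apply σ D b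
    rw [h] at h3
    exact σ.injective (h3.symm.trans (map_zero σ).symm)

/-- Elements of the coordinate ring of the threefold coming from `ℂ[x, z, t]`. -/
noncomputable def ofPoly (d k l : ℕ) : Rxzt →ₐ[ℂ] coordL d k l :=
  toLau.codRestrict _ fun p => polyL_le_coordL (toLau_mem p)

theorem ofPoly_injective : Function.Injective (ofPoly d k l) := fun _ _ h =>
  toLau_injective (congrArg Subtype.val h)

theorem toCoordRing_inclXZT (p : Rxzt) : toCoordRing d k l (inclXZT p) = ofPoly d k l p :=
  Subtype.ext (toCoord_inclXZT p)

theorem ofPoly_X_zero : ofPoly d k l (X 0) = ⟨monL 1 0 0, x_mem_coordL⟩ :=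
  Subtype.ext toLau_X_zero

/-- Automorphisms of the coordinate ring preserve `ℂ[x, z, t]`. -/
theorem exists_apply_ofPoly_eq (hd : 2 ≤ d) (hk : 2 ≤ k) (hl : 2 ≤ l) (hcop : Nat.Coprime k l)
    (σ : coordL d k l ≃ₐ[ℂ] coordL d k l) (p : Rxzt) :
    ∃ q, σ (ofPoly d k l p) = ofPoly d k l q := by
  obtain ⟨⟨D₁, hn1, h01, hk1⟩, ⟨D₂, hn2, h02, hk2⟩⟩ := exists_standard_derivations d k l
  -- Every variable is killed by one of the two standard derivations: `x, t` by the first and `x, z`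
  -- by the second.
  have hX : ∀ i, (σ (ofPoly d k l (X i)) : Lau) ∈ polyL := by
    have hA : ∀ i, i ≠ 1 → (σ (ofPoly d k l (X i)) : Lau) ∈ polyL := fun i hi =>
      (kernel_of_conjugate hd hk hl hcop σ hn1 h01).1 _
        ((hk1 (X i) _ rfl).2 (by rw [pderiv_X_of_ne hi]))
    have hB : ∀ i, i ≠ 2 → (σ (ofPoly d k l (X i)) : Lau) ∈ polyL := fun i hi =>
      (kernel_of_conjugate hd hk hl hcop σ hn2 h02).1 _
        ((hk2 (X i) _ rfl).2 (by rw [pderiv_X_of_ne hi]))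
    intro i
    by_cases hi : i = 1
    · exact hB i (by subst hi; decide)
    · exact hA i hi
  have hmem : (σ (ofPoly d k l p) : Lau) ∈ polyL := by
    induction p using MvPolynomial.induction_on with
    | C a =>
      rw [← algebraMap_eq, AlgHom.commutes, AlgEquiv.commutes]
      exact Subalgebra.algebraMap_mem _ a
    | add p q hp hq => rw [map_add, map_add]; exact add_mem hp hq
    | mul_X p i hp => rw [map_mul, map_mul]; exact mul_mem hp (hX i)
  obtain ⟨q, hq⟩ := exists_toLau_eq hmem
  exact ⟨q, Subtype.ext hq.symm⟩

/-- The restriction to `ℂ[x, z, t]` of an automorphism of the coordinate ring. -/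
theorem exists_restriction (hd : 2 ≤ d) (hk : 2 ≤ k) (hl : 2 ≤ l) (hcop : Nat.Coprime k l)
    (σ : coordL d k l ≃ₐ[ℂ] coordL d k l) :
    ∃ φ : Rxzt ≃ₐ[ℂ] Rxzt, (∀ p, σ (ofPoly d k l p) = ofPoly d k l (φ p)) := by
  have key : ∀ σ : coordL d k l ≃ₐ[ℂ] coordL d k l,
      ∃ φ : Rxzt →ₐ[ℂ] Rxzt, ∀ p, σ (ofPoly d k l p) = ofPoly d k l (φ p) := by
    intro σ
    choose g hg using exists_apply_ofPoly_eq hd hk hl hcop σ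
    have hinj : ∀ {p q : Rxzt}, ofPoly d k l p = ofPoly d k l q → p = q :=
      fun h => ofPoly_injective h
    exact ⟨{ toFun := g
             map_one' := hinj (by rw [← hg, map_one, map_one])
             map_mul' := fun p q => hinj (by rw [← hg, map_mul, map_mul, map_mul, hg, hg])
             map_zero' := hinj (by rw [← hg, map_zero, map_zero])
             map_add' := fun p q => hinj (by rw [← hg, map_add, map_add, map_add, hg, hg])
             commutes' := fun c => hinj (by
              rw [← hg, AlgHom.commutes, AlgEquiv.commutes]) }, hg⟩
  obtain ⟨φ, hφ⟩ := key σ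
  obtain ⟨φ', hφ'⟩ := key σ.symm
  refine ⟨AlgEquiv.ofAlgHom φ φ' (AlgHom.ext fun p => ?_) (AlgHom.ext fun p => ?_), hφ⟩
  · apply ofPoly_injective (d := d) (k := k) (l := l)
    rw [AlgHom.comp_apply, ← hφ, ← hφ', AlgEquiv.apply_symm_apply]; rfl
  · apply ofPoly_injective (d := d) (k := k) (l := l)
    rw [AlgHom.comp_apply, ← hφ', ← hφ, AlgEquiv.symm_apply_apply]; rfl

theorem coeff_eq_zero_of_pderiv_eq_zero {τ : Type*} {i : τ} {p : MvPolynomial τ ℂ}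
    (h : pderiv i p = 0) {m : τ →₀ ℕ} (hm : m i ≠ 0) : coeff m p = 0 := by
  have h1 := coeff_pderiv (i := i) p (m - Finsupp.single i 1)
  have h2 : m - Finsupp.single i 1 + Finsupp.single i 1 = m :=
    tsub_add_cancel_of_le (Finsupp.single_le_iff.2 (Nat.one_le_iff_ne_zero.2 hm))
  rw [h, h2, coeff_zero] at h1
  refine (mul_eq_zero.1 h1.symm).resolve_right ?_
  exact Nat.cast_add_one_ne_zero _

theorem exists_eq_aeval_X_zero {p : Rxzt} (h1 : pderiv 1 p = 0) (h2 : pderiv 2 p = 0) :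
    ∃ f : Polynomial ℂ, p = Polynomial.aeval (X 0) f := by
  refine ⟨∑ m ∈ p.support, Polynomial.C (coeff m p) * Polynomial.X ^ m 0, ?_⟩
  conv_lhs => rw [p.as_sum]
  rw [map_sum]
  refine Finset.sum_congr rfl fun m hm => ?_
  rw [mem_support_iff] at hm
  have e1 : m 1 = 0 := by
    by_contra h; exact hm (coeff_eq_zero_of_pderiv_eq_zero h1 h)
  have e2 : m 2 = 0 := by
    by_contra h; exact hm (coeff_eq_zero_of_pderiv_eq_zero h2 h)
  rw [monomial_eq, Finsupp.prod_fintype _ _ (by simp), Fin.prod_univ_three, e1, e2]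
  simp [algebraMap_eq]

/-- The images of `x` under `φ` and its inverse are killed by both standard derivations, so they are
polynomials in `x`. These are inverse to each other under composition, hence of degree one. -/
theorem exists_affine_image (hd : 2 ≤ d) (hk : 2 ≤ k) (hl : 2 ≤ l) (hcop : Nat.Coprime k l)
    {σ : coordL d k l ≃ₐ[ℂ] coordL d k l} {φ : Rxzt ≃ₐ[ℂ] Rxzt}
    (h : ∀ p, σ (ofPoly d k l p) = ofPoly d k l (φ p)) :
    ∃ c m : ℂ, c ≠ 0 ∧ φ (X 0) = C c * X 0 + C m := by
  obtain ⟨⟨D₁, hn1, h01, hk1⟩, ⟨D₂, hn2, h02, hk2⟩⟩ := exists_standard_derivations d k l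
  have key : ∀ (σ : coordL d k l ≃ₐ[ℂ] coordL d k l) (φ : Rxzt ≃ₐ[ℂ] Rxzt),
      (∀ p, σ (ofPoly d k l p) = ofPoly d k l (φ p)) →
      ∃ f : Polynomial ℂ, φ.symm (X 0) = Polynomial.aeval (X 0) f := by
    intro σ φ h
    have e : σ.symm ⟨monL 1 0 0, x_mem_coordL⟩ = ofPoly d k l (φ.symm (X 0)) := by
      rw [σ.symm_apply_eq, h, φ.apply_symm_apply, ofPoly_X_zero]
    refine exists_eq_aeval_X_zero ?_ ?_
    · have := (kernel_of_conjugate hd hk hl hcop σ hn1 h01).2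
      rw [e] at this
      exact (hk1 _ _ rfl).1 this
    · have := (kernel_of_conjugate hd hk hl hcop σ hn2 h02).2
      rw [e] at this
      exact (hk2 _ _ rfl).1 this
  obtain ⟨g, hg⟩ := key σ φ h
  obtain ⟨f, hf⟩ := key σ.symm φ.symm fun p => by
    rw [σ.symm_apply_eq, h, φ.apply_symm_apply]
  rw [AlgEquiv.symm_symm] at hf
  have hcomp : g.comp f = Polynomial.X := by
    have h3 : φ (φ.symm (X 0)) = X 0 := φ.apply_symm_apply _
    rw [hg, ← Polynomial.aeval_algHom_apply, hf, ← Polynomial.aeval_comp] at h3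
    have h4 := congrArg (aeval ![Polynomial.X, 0, 0] : Rxzt →ₐ[ℂ] Polynomial ℂ) h3
    rw [← Polynomial.aeval_algHom_apply] at h4
    simpa using h4
  have hdeg := congrArg Polynomial.natDegree hcomp
  rw [Polynomial.natDegree_comp, Polynomial.natDegree_X] at hdeg
  have hf1 : f.natDegree = 1 := Nat.eq_one_of_mul_eq_one_left hdeg
  have hfe := Polynomial.eq_X_add_C_of_natDegree_le_one hf1.le
  refine ⟨f.coeff 1, f.coeff 0, ?_, ?_⟩
  · rw [← hf1]
    exact Polynomial.leadingCoeff_ne_zero.2 (by rintro rfl; simp at hf1)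
  · rw [hf, hfe]; simp [algebraMap_eq]

/-- Applying the automorphism to `x^d y = -S`, with `S = z^k + t^l + x`, and clearing denominators,
the prime `φ(x) = c x + m` divides some `x^N φ(S)`. It does not divide `φ(S)`, because `x` does not
divide `S`. So it divides a power of `x`. -/
theorem const_eq_zero (hd : 0 < d)
    {σ : coordL d k l ≃ₐ[ℂ] coordL d k l} {φ : Rxzt ≃ₐ[ℂ] Rxzt}
    (h : ∀ p, σ (ofPoly d k l p) = ofPoly d k l (φ p)) {c m : ℂ} (hc : c ≠ 0)
    (hφ : φ (X 0) = C c * X 0 + C m) : m = 0 := by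
  by_contra hm
  obtain ⟨F, hF⟩ := toCoordRing_surjective (σ ⟨yL d k l, y_mem_coordL⟩)
  obtain ⟨N, p, hp, -⟩ := exists_pow_mul_eq_toLau (d := d) (k := k) (l := l) F
  have hy : (⟨monL 1 0 0, x_mem_coordL⟩ : coordL d k l) ^ d * ⟨yL d k l, y_mem_coordL⟩ =
      -ofPoly d k l (polyS k l) := by
    apply Subtype.ext
    change monL 1 0 0 ^ d * yL d k l = -toLau _
    rw [x_pow_mul_yL, toLau_polyS]
  have hy2 := congrArg Subtype.val (congrArg σ hy)
  rw [map_mul, map_pow, ← hF, map_neg, h, ← ofPoly_X_zero, h] at hy2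
  change toLau (φ (X 0)) ^ d * toCoord d k l F = -toLau (φ (polyS k l)) at hy2
  have hdvd : φ (X 0) ^ d * p = X 0 ^ N * -φ (polyS k l) := by
    apply toLau_injective
    rw [map_mul, map_mul, map_neg, map_pow, map_pow, toLau_X_zero, ← hp]
    linear_combination monL 1 0 0 ^ N * hy2
  have hprime : Prime (φ (X 0)) := (MulEquiv.prime_iff φ.toMulEquiv).2 X_prime
  have h1 : φ (X 0) ∣ X 0 ^ N * -φ (polyS k l) := by
    rw [← hdvd]; exact Dvd.dvd.mul_right (dvd_pow_self _ hd.ne') _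
  rcases hprime.dvd_or_dvd h1 with h2 | h2
  · obtain ⟨q, hq⟩ := hprime.dvd_of_dvd_pow h2
    have := congrArg (eval ![-m / c, 0, 0]) hq
    rw [hφ] at this
    simp [mul_div_cancel₀ _ hc, hc, hm] at this
  · rw [dvd_neg, map_dvd_iff] at h2
    obtain ⟨q, hq⟩ := h2
    have := congrArg (eval ![0, 1, 1]) hq
    simp [polyS, one_add_one_eq_two] at this

/-- Every automorphism of the threefold induces an element of the group `𝒜`. -/
theorem exists_induces (hd : 2 ≤ d) (hk : 2 ≤ k) (hl : 2 ≤ l) (hcop : Nat.Coprime k l)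
    (ψ : Aut (threefold d k l)) : ∃ φ ∈ groupA d k l, Induces ψ φ ∧
      ∃ c : ℂ, c ≠ 0 ∧ φ (X 0) = C c * X 0 := by
  have hd0 : 0 < d := by omega
  obtain ⟨σ, hσ⟩ := exists_pullback hd0 ψ
  obtain ⟨φ, hφ⟩ := exists_restriction hd hk hl hcop σ
  obtain ⟨c, m, hc, hcm⟩ := exists_affine_image hd hk hl hcop hφ
  obtain rfl := const_eq_zero hd0 hφ hc hcm
  rw [C_0, add_zero] at hcm
  refine ⟨φ, ⟨fun p => ?_, fun p => ?_⟩, fun p v => ?_, c, hc, hcm⟩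
  · rw [idealX, Ideal.mem_span_singleton, Ideal.mem_span_singleton, ← map_dvd_iff φ (a := X 0) (b := p),
      hcm]
    exact (((Ne.isUnit hc).map C).mul_left_dvd).symm
  · rw [mem_idealJ_iff hd0, mem_idealJ_iff hd0]
    have hJ : ∀ q, (∃ b ∈ coordL d k l, toLau q = monL 1 0 0 ^ d * b) ↔
        ofPoly d k l (X 0) ^ d ∣ ofPoly d k l q := by
      intro q
      rw [ofPoly_X_zero]
      constructor
      · rintro ⟨b, hb, h⟩
        exact ⟨⟨b, hb⟩, Subtype.ext h⟩
      · rintro ⟨b, h⟩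
        exact ⟨b.1, b.2, congrArg Subtype.val h⟩
    rw [hJ, hJ, ← map_dvd_iff σ (a := ofPoly d k l (X 0) ^ d) (b := ofPoly d k l p),
      map_pow, hφ, hφ, hcm, map_mul,
      mul_pow]
    exact ((((Ne.isUnit hc).map C).map (ofPoly d k l)).pow d).mul_left_dvd.symm
  · rw [← eval_inclXZT, ← eval_inclXZT]
    refine (hσ _ _).2 ?_ v
    rw [toCoordRing_inclXZT, toCoordRing_inclXZT, hφ]

theorem mem_threefold_iff' {v : Fin 4 → ℂ} :
    v ∈ threefold d k l ↔ v 0 ^ d * v 1 + v 2 ^ k + v 3 ^ l + v 0 = 0 := Iff.rfl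

theorem induces_unique {ψ : Aut (threefold d k l)} {φ φ' : Rxzt ≃ₐ[ℂ] Rxzt}
    (h : Induces ψ φ) (h' : Induces ψ φ') : φ = φ' := by
  ext1 p
  rw [← sub_eq_zero]
  refine eq_zero_of_eval_eq_zero (d := d) (k := k) (l := l) fun v hv _ => ?_
  rw [map_sub, ← h p ⟨v, hv⟩, ← h' p ⟨v, hv⟩, sub_self]

/-- Where `x ≠ 0` the coordinate `y` is determined by the others. This set is preserved because `x`
is only scaled, and functions agreeing there agree on the whole threefold. -/
theorem induces_injective (hd : 0 < d) {ψ ψ' : Aut (threefold d k l)} {φ : Rxzt ≃ₐ[ℂ] Rxzt}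
    {c : ℂ} (hc : c ≠ 0) (hφ : φ (X 0) = C c * X 0) (h : Induces ψ φ) (h' : Induces ψ' φ) :
    ψ = ψ' := by
  have hproj : ∀ v : threefold d k l, proj (ψ • v).1 = proj (ψ' • v).1 := fun v => by
    funext i
    have := (h (X i) v).trans (h' (X i) v).symm
    simpa using this
  have hx : ∀ v : threefold d k l, (ψ • v).1 0 = c * v.1 0 := fun v => by
    have := h (X 0) v
    rw [hφ] at this
    simpa [proj] using this
  have hX : ∀ (v : threefold d k l) (i : Fin 4), (ψ • v).1 i = (ψ' • v).1 i := by
    intro v i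
    obtain ⟨G, hG⟩ := exists_comp ψ (X i)
    obtain ⟨G', hG'⟩ := exists_comp ψ' (X i)
    have := eval_eq_of_eval_eq hd (F := G) (G := G') (fun w hw hw0 => ?_) v.1 v.2
    · simpa [← hG v, ← hG' v] using this
    · rw [← hG ⟨w, hw⟩, ← hG' ⟨w, hw⟩, eval_X, eval_X]
      have hp := hproj ⟨w, hw⟩
      have e0 : (ψ • (⟨w, hw⟩ : threefold d k l)).1 0 = (ψ' • (⟨w, hw⟩ : threefold d k l)).1 0 :=
        congrFun hp 0
      have e2 : (ψ • (⟨w, hw⟩ : threefold d k l)).1 2 = (ψ' • (⟨w, hw⟩ : threefold d k l)).1 2 :=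
        congrFun hp 1
      have e3 : (ψ • (⟨w, hw⟩ : threefold d k l)).1 3 = (ψ' • (⟨w, hw⟩ : threefold d k l)).1 3 :=
        congrFun hp 2
      have m1 := (ψ • (⟨w, hw⟩ : threefold d k l)).2
      have m2 := (ψ' • (⟨w, hw⟩ : threefold d k l)).2
      rw [mem_threefold_iff'] at m1 m2
      rw [← e0, ← e2, ← e3] at m2
      have hne : (ψ • (⟨w, hw⟩ : threefold d k l)).1 0 ≠ 0 := by
        rw [hx]; exact mul_ne_zero hc hw0
      fin_cases i
      · exact e0
      · refine mul_left_cancel₀ (pow_ne_zero d hne) ?_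
        change _ * (ψ • (⟨w, hw⟩ : threefold d k l)).1 1 =
          _ * (ψ' • (⟨w, hw⟩ : threefold d k l)).1 1
        linear_combination m1 - m2
      · exact e2
      · exact e3
  exact MulAction.toPerm_injective (α := Aut (threefold d k l)) (β := threefold d k l)
    (Equiv.ext fun v => Subtype.ext (funext (hX v)))

end ActionOnPolynomials

end KorasRussell

namespace KorasRussell

/-! ### Plane automorphisms preserving a cusp are diagonal. -/

section WeightedDegree

open MvPolynomial

/-- The polynomial ring `ℂ[z, t]`. -/
abbrev Rzt : Type := MvPolynomial (Fin 2) ℂ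

/-- The homomorphism `z ↦ z s^a`, `t ↦ t s^b` that computes weighted degrees. -/
noncomputable def weightHom (a b : ℕ) : Rzt →ₐ[ℂ] Polynomial Rzt :=
  aeval ![Polynomial.C (X 0) * Polynomial.X ^ a, Polynomial.C (X 1) * Polynomial.X ^ b]

/-- The weighted degree where `z`, `t` have weights `a`, `b`. -/
noncomputable def wdeg (a b : ℕ) (p : Rzt) : ℕ := (weightHom a b p).natDegree

theorem weightHom_monomial (a b : ℕ) (m : Fin 2 →₀ ℕ) (c : ℂ) :
    weightHom a b (monomial m c) =
      Polynomial.C (monomial m c) * Polynomial.X ^ (a * m 0 + b * m 1) := by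
  rw [weightHom, aeval_monomial, Finsupp.prod_fintype _ _ (by simp), Fin.prod_univ_two,
    monomial_eq, Finsupp.prod_fintype _ _ (by simp), Fin.prod_univ_two]
  simp only [Matrix.cons_val_zero, Matrix.cons_val_one, mul_pow, map_mul, map_pow, pow_add,
    pow_mul]
  have : algebraMap ℂ (Polynomial Rzt) c = Polynomial.C (C c) := rfl
  rw [this]
  ring

theorem coeff_weightHom (a b : ℕ) (p : Rzt) (n : ℕ) (m : Fin 2 →₀ ℕ) :
    coeff m ((weightHom a b p).coeff n) = if a * m 0 + b * m 1 = n then coeff m p else 0 := by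
  induction p using MvPolynomial.induction_on' with
  | monomial u c =>
    rw [weightHom_monomial, Polynomial.coeff_C_mul_X_pow]
    by_cases h : n = a * u 0 + b * u 1
    · rw [if_pos h, coeff_monomial]
      by_cases hum : u = m
      · subst hum; rw [if_pos rfl, if_pos h.symm]
      · rw [if_neg hum, ite_self]
    · rw [if_neg h, coeff_zero, coeff_monomial]
      by_cases hum : u = m
      · subst hum; rw [if_neg (Ne.symm h)]
      · rw [if_neg hum, ite_self]
  | add p q hp hq =>
    rw [map_add, Polynomial.coeff_add, coeff_add, hp, hq, coeff_add]
    split_ifs <;> simp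

theorem weightHom_injective (a b : ℕ) : Function.Injective (weightHom a b) := by
  intro p q h
  ext m
  have := coeff_weightHom a b p (a * m 0 + b * m 1) m
  rw [h, coeff_weightHom, if_pos rfl, if_pos rfl] at this
  exact this.symm

theorem wdeg_le_iff {a b : ℕ} {p : Rzt} {N : ℕ} :
    wdeg a b p ≤ N ↔ ∀ m, coeff m p ≠ 0 → a * m 0 + b * m 1 ≤ N := by
  rw [wdeg, Polynomial.natDegree_le_iff_coeff_eq_zero]
  constructor
  · intro h m hm
    by_contra hlt
    have := coeff_weightHom a b p (a * m 0 + b * m 1) m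
    rw [h _ (not_le.1 hlt), if_pos rfl, coeff_zero] at this
    exact hm this.symm
  · intro h n hn
    ext m
    rw [coeff_weightHom, coeff_zero]
    split_ifs with h1
    · by_contra h2
      have := h m h2
      omega
    · rfl

theorem wdeg_mul {a b : ℕ} {p q : Rzt} (hp : p ≠ 0) (hq : q ≠ 0) :
    wdeg a b (p * q) = wdeg a b p + wdeg a b q := by
  rw [wdeg, map_mul, Polynomial.natDegree_mul]
  · rfl
  · exact (map_ne_zero_iff _ (weightHom_injective a b)).2 hp
  · exact (map_ne_zero_iff _ (weightHom_injective a b)).2 hq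

theorem wdeg_mul_le {a b : ℕ} (p q : Rzt) : wdeg a b (p * q) ≤ wdeg a b p + wdeg a b q := by
  rw [wdeg, map_mul]
  exact Polynomial.natDegree_mul_le

theorem wdeg_pow (a b : ℕ) (p : Rzt) (n : ℕ) : wdeg a b (p ^ n) = n * wdeg a b p := by
  rw [wdeg, map_pow, Polynomial.natDegree_pow]
  rfl

theorem wdeg_C (a b : ℕ) (c : ℂ) : wdeg a b (C c) = 0 := by
  rw [← Nat.le_zero, wdeg_le_iff]
  intro m hm
  rw [coeff_C] at hm
  split_ifs at hm with h
  · subst h; simp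
  · exact absurd rfl hm

theorem wdeg_X_zero (a b : ℕ) : wdeg a b (X 0) = a := by
  rw [wdeg, weightHom, aeval_X]
  exact Polynomial.natDegree_C_mul_X_pow a _ (X_ne_zero 0)

theorem wdeg_X_one (a b : ℕ) : wdeg a b (X 1) = b := by
  rw [wdeg, weightHom, aeval_X]
  exact Polynomial.natDegree_C_mul_X_pow b _ (X_ne_zero 1)

theorem wdeg_sub_le {a b N : ℕ} {p q : Rzt} (hp : wdeg a b p ≤ N) (hq : wdeg a b q ≤ N) :
    wdeg a b (p - q) ≤ N := by
  rw [wdeg, map_sub]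
  exact (Polynomial.natDegree_sub_le _ _).trans (max_le hp hq)

theorem wdeg_X_mul_pderiv_le (a b : ℕ) (i : Fin 2) (p : Rzt) :
    wdeg a b (X i * pderiv i p) ≤ wdeg a b p := by
  rw [wdeg_le_iff]
  intro m hm
  refine wdeg_le_iff.1 le_rfl m fun h => hm ?_
  rw [coeff_X_mul']
  split_ifs with hi
  · rw [coeff_pderiv, tsub_add_cancel_of_le
      (Finsupp.single_le_iff.2 (Nat.one_le_iff_ne_zero.2 (Finsupp.mem_support_iff.1 hi))), h,
      zero_mul]
  · rfl

/-- The Jacobian determinant of two polynomials in `z`, `t`. -/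
noncomputable def jac (p q : Rzt) : Rzt := pderiv 0 p * pderiv 1 q - pderiv 1 p * pderiv 0 q

/-- The equation of the cusp. -/
noncomputable def cuspR (k l : ℕ) : Rzt := X 0 ^ k + X 1 ^ l

theorem pderiv_cuspR (k l : ℕ) : pderiv 0 (cuspR k l) = C (k : ℂ) * X 0 ^ (k - 1) ∧
    pderiv 1 (cuspR k l) = C (l : ℂ) * X 1 ^ (l - 1) := by
  constructor <;> simp [cuspR, pderiv_X, Derivation.leibniz_pow]

/-- The Euler operators `z ∂_z` and `t ∂_t` do not raise the weighted degree. Multiplying the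
Jacobian by `z t` produces these operators and avoids subtracting degrees. -/
theorem wdeg_jac_cuspR (k l : ℕ) (hk : 0 < k) (hl : 0 < l) (p : Rzt) :
    wdeg l k (X 0 * X 1 * jac p (cuspR k l)) ≤ wdeg l k p + k * l := by
  have e : X 0 * X 1 * jac p (cuspR k l) =
      (X 0 * pderiv 0 p) * (C (l : ℂ) * X 1 ^ l) - (X 1 * pderiv 1 p) * (C (k : ℂ) * X 0 ^ k) := by
    obtain ⟨h0, h1⟩ := pderiv_cuspR k l
    have e1 : (X 1 : Rzt) ^ l = X 1 * X 1 ^ (l - 1) := by rw [← pow_succ']; congr 1; omega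
    have e0 : (X 0 : Rzt) ^ k = X 0 * X 0 ^ (k - 1) := by rw [← pow_succ']; congr 1; omega
    rw [jac, h0, h1, e0, e1]; ring
  rw [e]
  refine wdeg_sub_le ?_ ?_
  · refine (wdeg_mul_le _ _).trans (add_le_add (wdeg_X_mul_pderiv_le _ _ _ _) ?_)
    refine (wdeg_mul_le _ _).trans ?_
    rw [wdeg_C, wdeg_pow, wdeg_X_one, zero_add, mul_comm]
  · refine (wdeg_mul_le _ _).trans (add_le_add (wdeg_X_mul_pderiv_le _ _ _ _) ?_)
    refine (wdeg_mul_le _ _).trans ?_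
    rw [wdeg_C, wdeg_pow, wdeg_X_zero, zero_add]

theorem jac_add_pow (Z T : Rzt) (k l : ℕ) :
    jac Z (Z ^ k + T ^ l) = C (l : ℂ) * T ^ (l - 1) * jac Z T ∧
    jac T (Z ^ k + T ^ l) = -(C (k : ℂ) * Z ^ (k - 1) * jac Z T) := by
  constructor <;>
  · simp only [jac, map_add, Derivation.leibniz_pow, smul_eq_mul, nsmul_eq_mul, map_natCast]
    ring

theorem eq_C_mul_X_of_pow {i : Fin 2} {p : Rzt} {n : ℕ} (hn : 0 < n) {c : ℂ} (hc : c ≠ 0)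
    (h : p ^ n = C c * X i ^ n) : ∃ a, a ≠ 0 ∧ p = C a * X i := by
  have h1 : X i ∣ p := (X_prime (i := i)).dvd_of_dvd_pow
    (h ▸ Dvd.dvd.mul_left (dvd_pow_self _ hn.ne') _)
  obtain ⟨q, rfl⟩ := h1
  rw [mul_pow, mul_comm] at h
  have h2 := mul_right_cancel₀ (pow_ne_zero n (X_ne_zero i)) h
  have h3 : IsUnit q := by
    rw [← isUnit_pow_iff hn.ne', h2]
    exact (Ne.isUnit hc).map C
  obtain ⟨a, -, ha⟩ := isUnit_iff_eq_C_of_isReduced.1 h3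
  refine ⟨a, ?_, ?_⟩
  · rintro rfl
    rw [ha] at h3
    simp at h3
  · rw [ha, mul_comm]

/-- The hypotheses say `(l-1)(b-k) ≤ a-l` and `(k-1)(a-l) ≤ b-k`. If `b > k` they combine to
`(k-1)(l-1) ≤ 1`, impossible for `k ≥ 2`, `l ≥ 3`. -/
theorem weight_bound {k l a b : ℕ} (hk : 2 ≤ k) (hkl : k < l)
    (h1 : l + k + (l - 1) * b ≤ a + k * l) (h2 : l + k + (k - 1) * a ≤ b + k * l) : b ≤ k := by
  obtain ⟨k', rfl⟩ : ∃ k', k = k' + 2 := ⟨k - 2, by omega⟩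
  obtain ⟨l', rfl⟩ : ∃ l', l = l' + 3 := ⟨l - 3, by omega⟩
  have e1 : l' + 3 - 1 = l' + 2 := rfl
  have e2 : k' + 2 - 1 = k' + 1 := rfl
  rw [e1] at h1
  rw [e2] at h2
  by_contra hb
  have h3 := Nat.mul_le_mul_left (k' + 1) h1
  have h4 : k' + 3 ≤ b := by omega
  have h5 : (k' * l' + 2 * k' + l' + 1) * (k' + 3) ≤ (k' * l' + 2 * k' + l' + 1) * b :=
    Nat.mul_le_mul_left _ h4
  nlinarith [h5, h3, h2]

/-- Polynomial maps of the plane of constant Jacobian that preserve a cusp are diagonal. -/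
theorem diagonal_of_cusp {k l : ℕ} (hk : 2 ≤ k) (hkl : k < l) {Z T : Rzt} {c j : ℂ} (hc : c ≠ 0)
    (hj : j ≠ 0) (h : Z ^ k + T ^ l = C c * cuspR k l) (hJ : jac Z T = C j) :
    ∃ a b, a ≠ 0 ∧ b ≠ 0 ∧ Z = C a * X 0 ∧ T = C b * X 1 ∧ a ^ k = c ∧ b ^ l = c := by
  have hk0 : (k : ℂ) ≠ 0 := by exact_mod_cast (by omega : k ≠ 0)
  have hl0 : (l : ℂ) ≠ 0 := by exact_mod_cast (by omega : l ≠ 0)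
  -- Bracketing `Z` and `T` with `Z^k + T^l` yields `T^(l-1)` and `Z^(k-1)` up to constants, because
  -- the Jacobian of the pair is constant. The left side is a bracket with the cusp equation, whose
  -- weight is under control.
  obtain ⟨hZ, hT⟩ := jac_add_pow Z T k l
  have hcj : ∀ p, jac p (C c * cuspR k l) = C c * jac p (cuspR k l) := fun p => by
    simp only [jac, pderiv_C_mul]; ring
  rw [h, hJ, hcj] at hZ hT
  have hX01 : (X 0 * X 1 : Rzt) ≠ 0 := mul_ne_zero (X_ne_zero 0) (X_ne_zero 1)
  have hZ0 : Z ≠ 0 := by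
    rintro rfl
    rw [jac, map_zero, map_zero, zero_mul, zero_mul, sub_zero] at hJ
    exact hj (C_eq_zero.1 hJ.symm)
  have hT0 : T ≠ 0 := by
    rintro rfl
    rw [jac, map_zero, map_zero, mul_zero, mul_zero, sub_zero] at hJ
    exact hj (C_eq_zero.1 hJ.symm)
  have hCne : ∀ {x : ℂ}, x ≠ 0 → (C x : Rzt) ≠ 0 := fun hx => by
    rwa [Ne, C_eq_zero]
  have hwC : ∀ (x : ℂ) (p : Rzt), x ≠ 0 → p ≠ 0 → wdeg l k (C x * p) = wdeg l k p := by
    intro x p hx hp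
    rw [wdeg_mul (hCne hx) hp, wdeg_C, zero_add]
  -- the degree estimates
  have b1 : l + k + (l - 1) * wdeg l k T ≤ wdeg l k Z + k * l := by
    have := wdeg_jac_cuspR k l (by omega) (by omega) Z
    have e : C c * (X 0 * X 1 * jac Z (cuspR k l)) = C (l * j) * (X 0 * X 1 * T ^ (l - 1)) := by
      rw [C_mul]; linear_combination X 0 * X 1 * hZ
    have hne : jac Z (cuspR k l) ≠ 0 := by
      intro h0
      rw [h0, mul_zero] at hZ
      exact mul_ne_zero (mul_ne_zero (hCne hl0) (pow_ne_zero _ hT0)) (hCne hj) hZ.symm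
    have e2 := congrArg (wdeg l k) e
    rw [hwC _ _ hc (mul_ne_zero hX01 hne), hwC _ _ (mul_ne_zero hl0 hj)
      (mul_ne_zero hX01 (pow_ne_zero _ hT0)), wdeg_mul hX01 (pow_ne_zero _ hT0),
      wdeg_mul (X_ne_zero 0) (X_ne_zero 1), wdeg_X_zero, wdeg_X_one, wdeg_pow] at e2
    omega
  have b2 : l + k + (k - 1) * wdeg l k Z ≤ wdeg l k T + k * l := by
    have := wdeg_jac_cuspR k l (by omega) (by omega) T
    have e : C c * (X 0 * X 1 * jac T (cuspR k l)) = C (-(k * j)) * (X 0 * X 1 * Z ^ (k - 1)) := by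
      rw [C_neg, C_mul]; linear_combination X 0 * X 1 * hT
    have hne : jac T (cuspR k l) ≠ 0 := by
      intro h0
      rw [h0, mul_zero] at hT
      exact neg_ne_zero.2 (mul_ne_zero (mul_ne_zero (hCne hk0) (pow_ne_zero _ hZ0)) (hCne hj))
        hT.symm
    have e2 := congrArg (wdeg l k) e
    rw [hwC _ _ hc (mul_ne_zero hX01 hne), hwC _ _ (neg_ne_zero.2 (mul_ne_zero hk0 hj))
      (mul_ne_zero hX01 (pow_ne_zero _ hZ0)), wdeg_mul hX01 (pow_ne_zero _ hZ0),
      wdeg_mul (X_ne_zero 0) (X_ne_zero 1), wdeg_X_zero, wdeg_X_one, wdeg_pow] at e2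
    omega
  have hTk : wdeg l k T ≤ k := weight_bound hk hkl b1 b2
  -- `T` is affine in `t`
  have hdT0 : pderiv 0 T = 0 := by
    ext m
    rw [coeff_pderiv, coeff_zero]
    by_contra hm
    have := wdeg_le_iff.1 hTk _ (left_ne_zero_of_mul hm)
    simp at this
    nlinarith
  obtain ⟨b₀, hdT1⟩ : ∃ b₀, pderiv 1 T = C b₀ := by
    refine ⟨coeff 0 (pderiv 1 T), ?_⟩
    ext m
    rw [coeff_C]
    split_ifs with h0
    · rw [h0]
    · by_contra hm
      rw [coeff_pderiv] at hm
      have := wdeg_le_iff.1 hTk _ (left_ne_zero_of_mul hm)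
      simp [mul_add] at this
      apply h0
      ext i
      fin_cases i
      · have h3 : l * m 0 = 0 := by omega
        exact ((Nat.mul_eq_zero.1 h3).resolve_left (by omega)).symm
      · have h3 : k * m 1 = 0 := by omega
        exact ((Nat.mul_eq_zero.1 h3).resolve_left (by omega)).symm
  obtain ⟨hr0, hr1⟩ := pderiv_cuspR k l
  have hb₀ : b₀ ≠ 0 := by
    rintro rfl
    rw [jac, hdT0, hdT1, C_0, mul_zero, mul_zero, sub_zero] at hJ
    exact hj (C_eq_zero.1 hJ.symm)
  -- With `T` affine in `t` alone, its bracket with the cusp equation is a multiple of `z^(k-1)`, so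
  -- `Z^(k-1)` is one too. The same argument then fixes `T`.
  obtain ⟨a, ha, hZa⟩ : ∃ a, a ≠ 0 ∧ Z = C a * X 0 := by
    refine eq_C_mul_X_of_pow (n := k - 1) (by omega) (c := c * b₀ / j)
      (div_ne_zero (mul_ne_zero hc hb₀) hj) ?_
    rw [jac, hdT0, hdT1, hr0] at hT
    refine mul_left_cancel₀ (mul_ne_zero (hCne hk0) (hCne hj)) ?_
    have : (C (c * b₀ / j) : Rzt) * C j = C c * C b₀ := by
      rw [← C_mul, ← C_mul]; congr 1; field_simp
    linear_combination hT - C (k : ℂ) * X 0 ^ (k - 1) * this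
  obtain ⟨b, hb, hTb⟩ : ∃ b, b ≠ 0 ∧ T = C b * X 1 := by
    refine eq_C_mul_X_of_pow (n := l - 1) (by omega) (c := c * a / j)
      (div_ne_zero (mul_ne_zero hc ha) hj) ?_
    have hp0 : pderiv 0 Z = C a := by rw [hZa, pderiv_C_mul, pderiv_X_self, mul_one]
    have hp1 : pderiv 1 Z = 0 := by
      rw [hZa, pderiv_C_mul, pderiv_X_of_ne (by decide), mul_zero]
    rw [jac, hp0, hp1, hr1] at hZ
    refine mul_left_cancel₀ (mul_ne_zero (hCne hl0) (hCne hj)) ?_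
    have : (C (c * a / j) : Rzt) * C j = C c * C a := by
      rw [← C_mul, ← C_mul]; congr 1; field_simp
    linear_combination -hZ - C (l : ℂ) * X 1 ^ (l - 1) * this
  refine ⟨a, b, ha, hb, hZa, hTb, ?_, ?_⟩
  · have := congrArg (eval ![1, 0]) h
    rw [hZa, hTb] at this
    simpa [cuspR, show k ≠ 0 by omega, show l ≠ 0 by omega] using this
  · have := congrArg (eval ![0, 1]) h
    rw [hZa, hTb] at this
    simpa [cuspR, show k ≠ 0 by omega, show l ≠ 0 by omega] using this

/-- For Bézout coefficients `u k + v l = 1`, the parameter is `a^v b^u`. It parametrises the torus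
acting on the cusp. -/
theorem exists_pow_eq_of_coprime {k l : ℕ} (hcop : Nat.Coprime k l) {a b : ℂ} (ha : a ≠ 0)
    (hb : b ≠ 0) (h : a ^ k = b ^ l) : ∃ α, α ≠ 0 ∧ α ^ l = a ∧ α ^ k = b := by
  have hbez := Nat.gcd_eq_gcd_ab k l
  rw [hcop.gcd_eq_one] at hbez
  set u := Nat.gcdA k l
  set v := Nat.gcdB k l
  push_cast at hbez
  have hz : a ^ (k : ℤ) = b ^ (l : ℤ) := by rw [zpow_natCast, zpow_natCast, h]
  refine ⟨a ^ v * b ^ u, mul_ne_zero (zpow_ne_zero _ ha) (zpow_ne_zero _ hb), ?_, ?_⟩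
  · rw [← zpow_natCast, mul_zpow, ← zpow_mul, ← zpow_mul, mul_comm u, zpow_mul b, ← hz, ← zpow_mul,
      ← zpow_add₀ ha, show v * (l : ℤ) + k * u = 1 by linarith, zpow_one]
  · rw [← zpow_natCast, mul_zpow, ← zpow_mul, ← zpow_mul, mul_comm v, zpow_mul a, hz, ← zpow_mul,
      ← zpow_add₀ hb, show (l : ℤ) * v + u * k = 1 by linarith, zpow_one]

end WeightedDegree

end KorasRussell

namespace KorasRussell

/-! ### Reduction modulo `x` and the torus character. -/

section ReductionModX

open MvPolynomial

variable {d k l : ℕ}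

/-- Setting `x = 0`. -/
noncomputable def modX : Rxzt →ₐ[ℂ] Rzt := aeval ![0, X 0, X 1]

/-- The inclusion of `ℂ[z, t]` in `ℂ[x, z, t]`. -/
noncomputable def liftX : Rzt →ₐ[ℂ] Rxzt := aeval ![X 1, X 2]

theorem modX_liftX (p : Rzt) : modX (liftX p) = p := by
  have : modX.comp liftX = AlgHom.id ℂ Rzt := by
    ext i : 1
    fin_cases i <;> simp [modX, liftX]
  exact DFunLike.congr_fun this p

theorem modX_X_zero : modX (X 0) = 0 := by simp [modX]

theorem modX_polyS : modX (polyS k l) = cuspR k l := by simp [modX, polyS, cuspR]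

theorem X_zero_dvd_sub (p : Rxzt) : X 0 ∣ p - liftX (modX p) := by
  induction p using MvPolynomial.induction_on with
  | C a => simp [liftX, modX]
  | add p q hp hq =>
    rw [map_add, map_add, add_sub_add_comm]
    exact dvd_add hp hq
  | mul_X p i hp =>
    have hi : X 0 ∣ (X i : Rxzt) - liftX (modX (X i)) := by
      fin_cases i <;> simp [modX, liftX]
    rw [map_mul, map_mul]
    have e : p * X i - liftX (modX p) * liftX (modX (X i)) =
      (p - liftX (modX p)) * X i + liftX (modX p) * (X i - liftX (modX (X i))) := by ring
    rw [e]
    exact dvd_add (hp.mul_right _) (hi.mul_left _)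

theorem modX_eq_zero_iff {p : Rxzt} : modX p = 0 ↔ X 0 ∣ p := by
  constructor
  · intro h
    have := X_zero_dvd_sub p
    rwa [h, map_zero, sub_zero] at this
  · rintro ⟨q, rfl⟩
    rw [map_mul, modX_X_zero, zero_mul]

theorem modX_eq_iff {p q : Rxzt} : modX p = modX q ↔ X 0 ∣ p - q := by
  rw [← sub_eq_zero, ← map_sub, modX_eq_zero_iff]

theorem modX_apply_eq {φ : Rxzt ≃ₐ[ℂ] Rxzt} {c : ℂ} (hφ : φ (X 0) = C c * X 0) {p q : Rxzt}
    (h : modX p = modX q) : modX (φ p) = modX (φ q) := by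
  rw [modX_eq_iff] at h ⊢
  obtain ⟨u, hu⟩ := h
  refine ⟨C c * φ u, ?_⟩
  rw [← map_sub, hu, map_mul, hφ]; ring

/-- The automorphism of `ℂ[z, t]` induced by an automorphism of `ℂ[x, z, t]`. -/
theorem exists_reduction {φ : Rxzt ≃ₐ[ℂ] Rxzt} {c : ℂ} (hc : c ≠ 0)
    (hφ : φ (X 0) = C c * X 0) :
    ∃ f : Rzt ≃ₐ[ℂ] Rzt, ∀ p, f (modX p) = modX (φ p) := by
  have hφ' : φ.symm (X 0) = C c⁻¹ * X 0 := by
    rw [φ.symm_apply_eq, map_mul, hφ]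
    have : φ (C c⁻¹) = C c⁻¹ := φ.commutes _
    rw [this, ← mul_assoc, ← C_mul, inv_mul_cancel₀ hc, C_1, one_mul]
  let f : Rzt →ₐ[ℂ] Rzt := modX.comp (φ.toAlgHom.comp liftX)
  let g : Rzt →ₐ[ℂ] Rzt := modX.comp (φ.symm.toAlgHom.comp liftX)
  have hf : ∀ p, f (modX p) = modX (φ p) := fun p => modX_apply_eq hφ (modX_liftX _)
  have hg : ∀ p, g (modX p) = modX (φ.symm p) := fun p => modX_apply_eq hφ' (modX_liftX _)
  refine ⟨AlgEquiv.ofAlgHom f g (AlgHom.ext fun p => ?_) (AlgHom.ext fun p => ?_), hf⟩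
  · rw [← modX_liftX p, AlgHom.comp_apply, hg, hf, φ.apply_symm_apply]; rfl
  · rw [← modX_liftX p, AlgHom.comp_apply, hf, hg, φ.symm_apply_apply]; rfl

theorem derivation_aeval_two (D : Derivation ℂ Rzt Rzt) (f : Rzt →ₐ[ℂ] Rzt) (p : Rzt) :
    D (f p) = f (pderiv 0 p) * D (f (X 0)) + f (pderiv 1 p) * D (f (X 1)) := by
  induction p using MvPolynomial.induction_on with
  | C a =>
    rw [← algebraMap_eq, AlgHom.commutes, Derivation.map_algebraMap]; simp
  | add p q hp hq => simp only [map_add, hp, hq]; ring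
  | mul_X p i hp =>
    have hX : D (f (X i)) = f (pderiv 0 (X i)) * D (f (X 0)) + f (pderiv 1 (X i)) * D (f (X 1)) := by
      fin_cases i <;> simp [pderiv_X]
    simp only [map_mul, Derivation.leibniz, hp, smul_eq_mul, map_add]
    linear_combination f p * hX

theorem jac_comp (f : Rzt →ₐ[ℂ] Rzt) (p q : Rzt) :
    jac (f p) (f q) = f (jac p q) * jac (f (X 0)) (f (X 1)) := by
  simp only [jac]
  rw [derivation_aeval_two (pderiv 0) f p, derivation_aeval_two (pderiv 1) f p,
    derivation_aeval_two (pderiv 0) f q, derivation_aeval_two (pderiv 1) f q]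
  simp only [map_sub, map_mul]
  ring

theorem exists_jac_eq_C (f : Rzt ≃ₐ[ℂ] Rzt) : ∃ j : ℂ, j ≠ 0 ∧ jac (f (X 0)) (f (X 1)) = C j := by
  have h := jac_comp f.toAlgHom (f.symm (X 0)) (f.symm (X 1))
  have h1 : jac (X 0 : Rzt) (X 1) = 1 := by simp [jac, pderiv_X]
  change jac (f (f.symm (X 0))) (f (f.symm (X 1))) = _ * jac (f (X 0)) (f (X 1)) at h
  rw [f.apply_symm_apply, f.apply_symm_apply, h1] at h
  obtain ⟨j, hj, he⟩ := isUnit_iff_eq_C_of_isReduced.1 (IsUnit.of_mul_eq_one_right _ h.symm)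
  exact ⟨j, hj.ne_zero, he⟩

/-- Elements of `𝒜` act modulo `x` through a one-dimensional torus. -/
theorem exists_torus_parameter (hd : 2 ≤ d) (hk : 2 ≤ k) (hkl : k < l) (hcop : Nat.Coprime k l)
    {φ : Rxzt ≃ₐ[ℂ] Rxzt} (hA : φ ∈ groupA d k l) {c : ℂ} (hc : c ≠ 0)
    (hφ : φ (X 0) = C c * X 0) : ∃ α : ℂ, α ≠ 0 ∧ c = α ^ (k * l) ∧
      modX (φ (X 1)) = C (α ^ l) * X 0 ∧ modX (φ (X 2)) = C (α ^ k) * X 1 := by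
  obtain ⟨f, hf⟩ := exists_reduction hc hφ
  have hS : polyS k l ∈ idealJ d k l := Ideal.subset_span (by simp [polyS])
  have hmodJ : ∀ p ∈ idealJ d k l, cuspR k l ∣ modX p := by
    intro p hp
    obtain ⟨u, v, rfl⟩ := Ideal.mem_span_pair.1 hp
    rw [map_add, map_mul, map_mul, map_pow, modX_X_zero, zero_pow (by omega), mul_zero, zero_add,
      ← polyS, modX_polyS]
    exact Dvd.intro_left _ rfl
  -- Modulo `x` the relation `φ(S) = u x^d + v S` says that the plane automorphism multiplies the
  -- cusp equation by `modX v`. The inverse automorphism shows that this factor is a unit, hence a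
  -- constant.
  obtain ⟨u, v, huv⟩ := Ideal.mem_span_pair.1 ((hA.2 _).2 hS)
  rw [← polyS] at huv
  have hr : f (cuspR k l) = modX v * cuspR k l := by
    rw [← modX_polyS, hf, ← huv, map_add, map_mul, map_mul, map_pow, modX_X_zero,
      zero_pow (by omega), mul_zero, zero_add, modX_polyS]
  have hr0 : cuspR k l ≠ 0 := by
    intro h
    have := congrArg (eval ![1, 0]) h
    simp [cuspR, show l ≠ 0 by omega] at this
  have hunit : IsUnit (modX v) := by
    have h1 : cuspR k l ∣ f.symm (cuspR k l) := by
      have := hmodJ _ ((hA.2 (φ.symm (polyS k l))).1 (by rwa [φ.apply_symm_apply]))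
      rwa [← f.symm_apply_apply (modX _), hf, φ.apply_symm_apply, modX_polyS] at this
    obtain ⟨w, hw⟩ := h1
    rw [f.symm_apply_eq, map_mul, hr] at hw
    refine IsUnit.of_mul_eq_one (f w) (mul_right_cancel₀ hr0 ?_)
    linear_combination -hw
  obtain ⟨c₁, hc₁, hv⟩ := isUnit_iff_eq_C_of_isReduced.1 hunit
  obtain ⟨j, hj, hJ⟩ := exists_jac_eq_C f
  have hcusp : f (X 0) ^ k + f (X 1) ^ l = C c₁ * cuspR k l := by
    rw [← hv, ← hr, cuspR, map_add, map_pow, map_pow]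
  obtain ⟨a, b, ha, hb, hZ, hT, hak, hbl⟩ := diagonal_of_cusp hk hkl hc₁.ne_zero hj hcusp hJ
  obtain ⟨α, hα, hαa, hαb⟩ := exists_pow_eq_of_coprime hcop ha hb (hak.trans hbl.symm)
  have h1 : modX (X 1) = X 0 := by simp [modX]
  have h2 : modX (X 2) = X 1 := by simp [modX]
  rw [← h1, hf, ← hαa] at hZ
  rw [← h2, hf, ← hαb] at hT
  refine ⟨α, hα, ?_, by rw [hZ, h1], by rw [hT, h2]⟩
  -- compare the coefficients of `x` at `z = t = 0`
  let θ : Rxzt →ₐ[ℂ] Polynomial ℂ := aeval ![Polynomial.X, 0, 0]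
  have hθX : θ (X 0) = Polynomial.X := by simp [θ]
  have hθS : θ (polyS k l) = Polynomial.X := by
    simp [θ, polyS, show k ≠ 0 by omega, show l ≠ 0 by omega]
  have hθ0 : ∀ p, (θ p).coeff 0 = eval ![0, 0] (modX p) := by
    intro p
    rw [Polynomial.coeff_zero_eq_aeval_zero]
    change ((Polynomial.aeval (0 : ℂ)).comp θ) p = ((aeval ![0, 0] : Rzt →ₐ[ℂ] ℂ).comp modX) p
    congr 1
    ext i : 1
    fin_cases i <;> simp [θ, modX]
  -- At `z = t = 0` the images of `z` and `t` have no constant term, so their `k`-th and `l`-th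
  -- powers contribute nothing to the coefficient of `x`. Neither does `u x^d`, as `d ≥ 2`.
  have hdvd : ∀ (n : ℕ) (p : Rxzt), 2 ≤ n → eval ![0, 0] (modX p) = 0 → (θ p ^ n).coeff 1 = 0 := by
    intro n p hn hp
    rw [← hθ0, ← Polynomial.X_dvd_iff] at hp
    exact Polynomial.X_pow_dvd_iff.1 ((pow_dvd_pow_of_dvd hp 2).trans (pow_dvd_pow _ hn)) 1
      one_lt_two
  have h3 := congrArg (fun p => (θ p).coeff 1) huv
  have hφS : φ (polyS k l) = φ (X 1) ^ k + φ (X 2) ^ l + C c * X 0 := by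
    rw [polyS, map_add, map_add, map_pow, map_pow, hφ]
  simp only [hφS, map_add, map_mul, map_pow, hθX, hθS] at h3
  rw [ Polynomial.coeff_add, Polynomial.coeff_add, Polynomial.coeff_add,
    hdvd k _ hk (by rw [hZ, h1]; simp), hdvd l _ (by omega) (by rw [hT, h2]; simp),
    Polynomial.coeff_mul_X, hθ0, hv, Polynomial.coeff_mul_X, eval_C] at h3
  have hθC : θ (C c) = Polynomial.C c := by simp [θ]
  have h4 : (θ u * Polynomial.X ^ d).coeff 1 = 0 := by
    rw [Polynomial.coeff_mul_X_pow', if_neg (by omega)]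
  rw [h4, hθC, Polynomial.coeff_C_zero] at h3
  rw [mul_comm, pow_mul, hαa, hak]
  linear_combination -h3

/-- The automorphism `ψ` acts on `ℂ[x, z, t]` modulo `x` as the element `α` of the torus. -/
def HasChar (ψ : Aut (threefold d k l)) (α : ℂ) : Prop :=
  α ≠ 0 ∧ ∃ φ ∈ groupA d k l, Induces ψ φ ∧ φ (X 0) = C (α ^ (k * l)) * X 0 ∧
    modX (φ (X 1)) = C (α ^ l) * X 0 ∧ modX (φ (X 2)) = C (α ^ k) * X 1

theorem exists_hasChar (hd : 2 ≤ d) (hk : 2 ≤ k) (hkl : k < l) (hcop : Nat.Coprime k l)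
    (ψ : Aut (threefold d k l)) : ∃ α, HasChar ψ α := by
  obtain ⟨φ, hA, hI, c, hc, hφ⟩ := exists_induces hd hk (by omega) hcop ψ
  obtain ⟨α, hα, rfl, h1, h2⟩ := exists_torus_parameter hd hk hkl hcop hA hc hφ
  exact ⟨α, hα, φ, hA, hI, hφ, h1, h2⟩

theorem HasChar.unique (hcop : Nat.Coprime k l) {ψ : Aut (threefold d k l)} {α β : ℂ}
    (h : HasChar ψ α) (h' : HasChar ψ β) : α = β := by
  obtain ⟨hα, φ, -, hI, -, h1, h2⟩ := h
  obtain ⟨hβ, φ', -, hI', -, h1', h2'⟩ := h'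
  obtain rfl := induces_unique hI hI'
  have el : α ^ l = β ^ l := by
    have := congrArg (eval ![1, 1]) (h1.symm.trans h1')
    simpa using this
  have ek : α ^ k = β ^ k := by
    have := congrArg (eval ![1, 1]) (h2.symm.trans h2')
    simpa using this
  have hbez := Nat.gcd_eq_gcd_ab k l
  rw [hcop.gcd_eq_one] at hbez
  have key : ∀ x : ℂ, x ≠ 0 → x = (x ^ k) ^ Nat.gcdA k l * (x ^ l) ^ Nat.gcdB k l := by
    intro x hx
    rw [← zpow_natCast, ← zpow_natCast, ← zpow_mul, ← zpow_mul, ← zpow_add₀ hx, ← hbez]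
    simp
  rw [key α hα, key β hβ, ek, el]

/-- Pullback is contravariant, whence the reversed order of the factors. -/
theorem Induces.mul {ψ ψ' : Aut (threefold d k l)} {φ φ' : Rxzt ≃ₐ[ℂ] Rxzt} (h : Induces ψ φ)
    (h' : Induces ψ' φ') : Induces (ψ * ψ') (φ' * φ) := fun p v => by
  rw [mul_smul, h, h', AlgEquiv.mul_apply]

theorem Induces.inv {ψ : Aut (threefold d k l)} {φ : Rxzt ≃ₐ[ℂ] Rxzt} (h : Induces ψ φ) :
    Induces ψ⁻¹ φ⁻¹ := fun p v => by
  have h := h (φ⁻¹ p) (ψ⁻¹ • v)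
  rw [smul_inv_smul, ← AlgEquiv.mul_apply, mul_inv_cancel, AlgEquiv.one_apply] at h
  exact h.symm

theorem HasChar.mul {ψ ψ' : Aut (threefold d k l)} {α β : ℂ}
    (h : HasChar ψ α) (h' : HasChar ψ' β) : HasChar (ψ * ψ') (α * β) := by
  obtain ⟨hα, φ, hA, hI, h0, h1, h2⟩ := h
  obtain ⟨hβ, φ', hA', hI', h0', h1', h2'⟩ := h'
  have hC : ∀ a : ℂ, φ' (C a) = C a := φ'.commutes
  refine ⟨mul_ne_zero hα hβ, φ' * φ, mul_mem hA' hA, hI.mul hI', ?_, ?_, ?_⟩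
  · rw [AlgEquiv.mul_apply, h0, map_mul, h0', hC, mul_pow, C_mul]; ring
  · have : modX (φ (X 1)) = modX (C (α ^ l) * X 1) := by
      rw [h1]; simp [modX]
    rw [AlgEquiv.mul_apply, modX_apply_eq h0' this, map_mul, hC, map_mul, h1']
    simp [modX, mul_pow, mul_assoc]
  · have : modX (φ (X 2)) = modX (C (α ^ k) * X 2) := by
      rw [h2]; simp [modX]
    rw [AlgEquiv.mul_apply, modX_apply_eq h0' this, map_mul, hC, map_mul, h2']
    simp [modX, mul_pow, mul_assoc]

theorem modX_apply_eq_self {φ : Rxzt ≃ₐ[ℂ] Rxzt} (h0 : modX (φ (X 0)) = 0)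
    (h1 : modX (φ (X 1)) = X 0) (h2 : modX (φ (X 2)) = X 1) (p : Rxzt) :
    modX (φ p) = modX p := by
  have : modX.comp φ.toAlgHom = modX := by
    ext i : 1
    fin_cases i
    · exact h0.trans modX_X_zero.symm
    · exact h1.trans (by simp [modX])
    · exact h2.trans (by simp [modX])
  exact DFunLike.congr_fun this p

/-- Identifies the kernel of the torus character with `𝒜₁`: the parameter `1` means acting trivially
modulo `x`. -/
theorem hasChar_one_iff {ψ : Aut (threefold d k l)} :
    HasChar ψ 1 ↔ ψ ∈ subgroupA d k l 1 := by
  constructor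
  · rintro ⟨-, φ, hA, hI, h0, h1, h2⟩
    rw [one_pow, C_1, one_mul] at h0 h1 h2
    refine ⟨φ, ⟨hA, h0, fun p => ?_⟩, hI⟩
    rw [pow_one, Ideal.mem_span_singleton, ← modX_eq_iff]
    exact modX_apply_eq_self (by rw [h0, modX_X_zero]) h1 h2 p
  · rintro ⟨φ, ⟨hA, h0, h⟩, hI⟩
    have h' : ∀ p, modX (φ p) = modX p := fun p => by
      have := h p
      rwa [pow_one, Ideal.mem_span_singleton, ← modX_eq_iff] at this
    refine ⟨one_ne_zero, φ, hA, hI, ?_, ?_, ?_⟩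
    · rw [h0, one_pow, C_1, one_mul]
    · rw [h']; simp [modX]
    · rw [h']; simp [modX]

end ReductionModX

end KorasRussell

namespace KorasRussell

/-! ### Poisson brackets in two of the variables. -/

section PoissonBracket

open MvPolynomial

variable {τ : Type} {i j : τ}

/-- The Poisson bracket of polynomials with respect to two of the variables. -/
noncomputable def bracket (i j : τ) (p q : MvPolynomial τ ℂ) : MvPolynomial τ ℂ :=
  pderiv i p * pderiv j q - pderiv j p * pderiv i q

theorem bracket_add_left (p p' q : MvPolynomial τ ℂ) :
    bracket i j (p + p') q = bracket i j p q + bracket i j p' q := by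
  simp only [bracket, map_add]; ring

theorem bracket_add_right (p q q' : MvPolynomial τ ℂ) :
    bracket i j p (q + q') = bracket i j p q + bracket i j p q' := by
  simp only [bracket, map_add]; ring

theorem bracket_mul_right (p q q' : MvPolynomial τ ℂ) :
    bracket i j p (q * q') = bracket i j p q * q' + q * bracket i j p q' := by
  simp only [bracket, Derivation.leibniz, smul_eq_mul]; ring

theorem bracket_mul_left (p p' q : MvPolynomial τ ℂ) :
    bracket i j (p * p') q = bracket i j p q * p' + p * bracket i j p' q := by
  simp only [bracket, Derivation.leibniz, smul_eq_mul]; ring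

theorem bracket_C_left (c : ℂ) (q : MvPolynomial τ ℂ) : bracket i j (C c) q = 0 := by
  simp [bracket]

theorem bracket_self (p : MvPolynomial τ ℂ) : bracket i j p p = 0 := by
  simp only [bracket]; ring

/-- The bracket with a fixed first argument as a derivation. -/
noncomputable def hamiltonian (i j : τ) (h : MvPolynomial τ ℂ) :
    Derivation ℂ (MvPolynomial τ ℂ) (MvPolynomial τ ℂ) :=
  (pderiv i h) • pderiv j - (pderiv j h) • pderiv i

theorem hamiltonian_apply (h p : MvPolynomial τ ℂ) :
    hamiltonian i j h p = bracket i j h p := rfl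

theorem pderiv_comm (a b : τ) (p : MvPolynomial τ ℂ) :
    pderiv a (pderiv b p) = pderiv b (pderiv a p) := by
  have : ⁅(pderiv a : Derivation ℂ (MvPolynomial τ ℂ) (MvPolynomial τ ℂ)),
      (pderiv b : Derivation ℂ (MvPolynomial τ ℂ) (MvPolynomial τ ℂ))⁆ = 0 := by
    classical
    refine MvPolynomial.derivation_ext fun c => ?_
    rw [Derivation.commutator_apply, pderiv_X, pderiv_X]
    simp only [Pi.single_apply]
    split_ifs <;> simp
  rw [← sub_eq_zero, ← Derivation.commutator_apply, this]
  rfl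

/-- The Jacobi identity. -/
theorem bracket_bracket (h p q : MvPolynomial τ ℂ) :
    bracket i j h (bracket i j p q) =
      bracket i j (bracket i j h p) q + bracket i j p (bracket i j h q) := by
  simp only [bracket, map_sub, Derivation.leibniz, smul_eq_mul, pderiv_comm j i]
  ring

/-- The subalgebra of polynomials in the variables other than `i`, `j`. -/
noncomputable def otherVars (i j : τ) : Subalgebra ℂ (MvPolynomial τ ℂ) :=
  Algebra.adjoin ℂ {p | ∃ m, m ≠ i ∧ m ≠ j ∧ p = X m}

theorem X_mem_otherVars {m : τ} (h : m ≠ i) (h' : m ≠ j) :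
    (X m : MvPolynomial τ ℂ) ∈ otherVars i j :=
  Algebra.subset_adjoin ⟨m, h, h', rfl⟩

theorem pderiv_of_mem_otherVars {w : MvPolynomial τ ℂ} (hw : w ∈ otherVars i j) :
    pderiv i w = 0 ∧ pderiv j w = 0 := by
  have key : ∀ e, e = i ∨ e = j → pderiv e w = 0 := by
    intro e he
    induction hw using Algebra.adjoin_induction with
    | mem f hf =>
      obtain ⟨m, hm, hm', rfl⟩ := hf
      refine pderiv_X_of_ne ?_
      rcases he with rfl | rfl <;> assumption
    | algebraMap c => exact pderiv_C
    | add f g _ _ h1 h2 => rw [map_add, h1, h2, add_zero]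
    | mul f g _ _ h1 h2 => rw [pderiv_mul, h1, h2]; simp
  exact ⟨key i (Or.inl rfl), key j (Or.inr rfl)⟩

theorem bracket_of_mem_otherVars {w : MvPolynomial τ ℂ} (hw : w ∈ otherVars i j)
    (p : MvPolynomial τ ℂ) : bracket i j w p = 0 ∧ bracket i j p w = 0 := by
  obtain ⟨h1, h2⟩ := pderiv_of_mem_otherVars hw
  simp [bracket, h1, h2]

theorem bracket_smul_left {w : MvPolynomial τ ℂ} (hw : w ∈ otherVars i j)
    (p q : MvPolynomial τ ℂ) : bracket i j (w * p) q = w * bracket i j p q := by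
  rw [bracket_mul_left, (bracket_of_mem_otherVars hw _).1, zero_mul, zero_add]

theorem bracket_smul_right {w : MvPolynomial τ ℂ} (hw : w ∈ otherVars i j)
    (p q : MvPolynomial τ ℂ) : bracket i j p (w * q) = w * bracket i j p q := by
  rw [bracket_mul_right, (bracket_of_mem_otherVars hw _).2, zero_mul, zero_add]

/-- The homomorphism fixes the variables other than `i`, `j`. -/
def FixesOthers (i j : τ) (f : MvPolynomial τ ℂ →ₐ[ℂ] MvPolynomial τ ℂ) : Prop :=
  ∀ m, m ≠ i → m ≠ j → f (X m) = X m

theorem FixesOthers.apply_eq {f : MvPolynomial τ ℂ →ₐ[ℂ] MvPolynomial τ ℂ}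
    (hf : FixesOthers i j f) {w : MvPolynomial τ ℂ} (hw : w ∈ otherVars i j) : f w = w := by
  induction hw using Algebra.adjoin_induction with
  | mem p hp =>
    obtain ⟨m, hm, hm', rfl⟩ := hp
    exact hf m hm hm'
  | algebraMap c => exact f.commutes c
  | add p q _ _ h1 h2 => rw [map_add, h1, h2]
  | mul p q _ _ h1 h2 => rw [map_mul, h1, h2]

theorem FixesOthers.chain {f : MvPolynomial τ ℂ →ₐ[ℂ] MvPolynomial τ ℂ} (hij : i ≠ j)
    (hf : FixesOthers i j f) {e : τ} (he : e = i ∨ e = j) (p : MvPolynomial τ ℂ) :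
    pderiv e (f p) =
      f (pderiv i p) * pderiv e (f (X i)) + f (pderiv j p) * pderiv e (f (X j)) := by
  induction p using MvPolynomial.induction_on with
  | C a =>
    rw [← algebraMap_eq, AlgHom.commutes, Derivation.map_algebraMap]; simp
  | add p q hp hq => simp only [map_add, hp, hq]; ring
  | mul_X p m hp =>
    have hX : pderiv e (f (X m)) = f (pderiv i (X m)) * pderiv e (f (X i)) +
        f (pderiv j (X m)) * pderiv e (f (X j)) := by
      by_cases h1 : m = i
      · subst h1
        rw [pderiv_X_self, pderiv_X_of_ne hij]; simp
      · by_cases h2 : m = j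
        · subst h2
          rw [pderiv_X_self, pderiv_X_of_ne hij.symm]; simp
        · rw [pderiv_X_of_ne h1, pderiv_X_of_ne h2, hf m h1 h2, pderiv_X_of_ne]
          · simp
          · rcases he with rfl | rfl <;> assumption
    simp only [map_mul, Derivation.leibniz, hp, smul_eq_mul, map_add]
    linear_combination f p * hX

theorem FixesOthers.bracket_apply {f : MvPolynomial τ ℂ →ₐ[ℂ] MvPolynomial τ ℂ} (hij : i ≠ j)
    (hf : FixesOthers i j f) (p q : MvPolynomial τ ℂ) :
    bracket i j (f p) (f q) = f (bracket i j p q) * bracket i j (f (X i)) (f (X j)) := by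
  simp only [bracket, hf.chain hij (Or.inl rfl) p, hf.chain hij (Or.inr rfl) p,
    hf.chain hij (Or.inl rfl) q, hf.chain hij (Or.inr rfl) q, map_sub, map_mul]
  ring

theorem bracket_X (hij : i ≠ j) (p : MvPolynomial τ ℂ) : bracket i j p (X i) = -pderiv j p ∧
    bracket i j p (X j) = pderiv i p := by
  simp [bracket, pderiv_X_of_ne hij, pderiv_X_of_ne hij.symm]

/-- The automorphisms preserving the bracket and the variables other than `i`, `j`. -/
noncomputable def poissonGroup (i j : τ) :
    Subgroup (MvPolynomial τ ℂ ≃ₐ[ℂ] MvPolynomial τ ℂ) where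
  carrier := {Θ | FixesOthers i j Θ.toAlgHom ∧
    ∀ p q, bracket i j (Θ p) (Θ q) = Θ (bracket i j p q)}
  mul_mem' := by
    rintro a b ⟨ha, ha'⟩ ⟨hb, hb'⟩
    refine ⟨fun m h h' => ?_, fun p q => ?_⟩
    · change a (b (X m)) = X m
      rw [show b (X m) = X m from hb m h h']
      exact ha m h h'
    · rw [AlgEquiv.mul_apply, AlgEquiv.mul_apply, ha', hb', AlgEquiv.mul_apply]
  one_mem' := ⟨fun m _ _ => rfl, fun p q => rfl⟩
  inv_mem' := by
    rintro a ⟨ha, ha'⟩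
    refine ⟨fun m h h' => ?_, fun p q => ?_⟩
    · change a.symm (X m) = X m
      rw [a.symm_apply_eq]
      exact (ha m h h').symm
    · change bracket i j (a.symm p) (a.symm q) = a.symm _
      rw [eq_comm, a.symm_apply_eq, ← ha', a.apply_symm_apply, a.apply_symm_apply]

theorem mem_poissonGroup_of_bracket_eq_one (hij : i ≠ j)
    {Θ : MvPolynomial τ ℂ ≃ₐ[ℂ] MvPolynomial τ ℂ} (hf : FixesOthers i j Θ.toAlgHom)
    (h : bracket i j (Θ (X i)) (Θ (X j)) = 1) : Θ ∈ poissonGroup i j := by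
  refine ⟨hf, fun p q => ?_⟩
  have := hf.bracket_apply hij p q
  change bracket i j (Θ p) (Θ q) = Θ (bracket i j p q) * bracket i j (Θ (X i)) (Θ (X j)) at this
  rw [this, h, mul_one]

end PoissonBracket

/-! ### Antiderivatives and Hamiltonian vector fields. -/

section Primitive

open MvPolynomial

variable {τ : Type} {i j : τ}

/-- The antiderivative with respect to a variable. -/
noncomputable def antideriv (i : τ) : MvPolynomial τ ℂ →ₗ[ℂ] MvPolynomial τ ℂ :=
  (basisMonomials τ ℂ).constr ℂ fun m => monomial (m + Finsupp.single i 1) ((m i : ℂ) + 1)⁻¹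

theorem antideriv_monomial (m : τ →₀ ℕ) (c : ℂ) :
    antideriv i (monomial m c) = monomial (m + Finsupp.single i 1) (c * ((m i : ℂ) + 1)⁻¹) := by
  have h : monomial m c = c • (basisMonomials τ ℂ m) := by
    rw [coe_basisMonomials, smul_monomial, smul_eq_mul, mul_one]
  rw [h, map_smul, antideriv, Module.Basis.constr_basis, smul_monomial, smul_eq_mul]

theorem pderiv_antideriv (i : τ) (p : MvPolynomial τ ℂ) : pderiv i (antideriv i p) = p := by
  induction p using MvPolynomial.induction_on' with
  | monomial m c =>
    rw [antideriv_monomial, pderiv_monomial]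
    have : ((m i : ℂ) + 1) ≠ 0 := Nat.cast_add_one_ne_zero _
    simp [mul_assoc, inv_mul_cancel₀ this]
  | add p q hp hq => rw [map_add, map_add, hp, hq]

theorem pderiv_antideriv_of_ne (hij : i ≠ j) (p : MvPolynomial τ ℂ) :
    pderiv i (antideriv j p) = antideriv j (pderiv i p) := by
  induction p using MvPolynomial.induction_on' with
  | monomial m c =>
    classical
    rw [antideriv_monomial, pderiv_monomial, pderiv_monomial, antideriv_monomial]
    have e1 : (m + Finsupp.single j 1 : τ →₀ ℕ) i = m i := by simp [hij.symm]
    have e2 : (m - Finsupp.single i 1 : τ →₀ ℕ) j = m j := by simp [hij]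
    rw [e1, e2]
    by_cases hm : m i = 0
    · simp [hm]
    · have e3 : m + Finsupp.single j 1 - Finsupp.single i 1 =
          m - Finsupp.single i 1 + Finsupp.single j 1 := by
        ext a
        simp only [Finsupp.coe_tsub, Finsupp.coe_add, Pi.sub_apply, Pi.add_apply]
        by_cases ha : a = i
        · subst ha; simp [hij]
        · simp [Ne.symm ha]
      rw [e3]
      congr 1
      ring
  | add p q hp hq => rw [map_add, map_add, map_add, map_add, hp, hq]

/-- Divergence-free vector fields in the plane are Hamiltonian. -/
theorem exists_hamiltonian (hij : i ≠ j) {a b : MvPolynomial τ ℂ}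
    (h : pderiv i a + pderiv j b = 0) :
    ∃ p, a = bracket i j p (X i) ∧ b = bracket i j p (X j) := by
  set u := antideriv i b
  have hu : pderiv i u = b := pderiv_antideriv i b
  -- The Hamiltonian needs `∂_i p = b` and `∂_j p = -a`. The primitive `u` of `b` solves the first;
  -- the correction does not disturb it, because `∂_i (a + ∂_j u)` is the divergence, which
  -- vanishes.
  refine ⟨u - antideriv j (a + pderiv j u), ?_⟩
  rw [(bracket_X hij _).1, (bracket_X hij _).2, map_sub, map_sub, pderiv_antideriv,
    pderiv_antideriv_of_ne hij, map_add, pderiv_comm i j, hu, h, map_zero]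
  constructor <;> ring

end Primitive

/-! ### Spanning polynomials by powers of linear forms. -/

section PowersOfLinearForms

open MvPolynomial

variable {τ : Type} {i j : τ}

/-- Polynomials are sums of powers of linear forms in two variables with coefficients
in the other variables. -/
theorem mem_span_powers (p : MvPolynomial τ ℂ) :
    p ∈ Submodule.span ℂ {q : MvPolynomial τ ℂ | ∃ w ∈ otherVars i j, ∃ (β : ℂ) (n : ℕ),
      q = w * (X i + C β * X j) ^ n} := by
  set V := Submodule.span ℂ {q : MvPolynomial τ ℂ | ∃ w ∈ otherVars i j, ∃ (β : ℂ) (n : ℕ),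
      q = w * (X i + C β * X j) ^ n} with hV
  have key : ∀ w ∈ otherVars i j, ∀ a b : ℕ, w * (X i ^ a * X j ^ b) ∈ V := by
    intro w hw a b
    by_contra hnot
    -- A functional `L` killing all `w (X_i + β X_j)^n` gives a polynomial in `β` with only zeros.
    -- Its coefficients are binomial multiples of the values of `L` on monomials, so these vanish in
    -- characteristic zero.
    obtain ⟨L, hL0, hLV⟩ := Submodule.exists_le_ker_of_notMem hnot
    let F : Polynomial ℂ := ∑ m ∈ Finset.range (a + b + 1),
      Polynomial.C (L (w * (X j ^ m * X i ^ (a + b - m) * C ((a + b).choose m : ℂ)))) *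
        Polynomial.X ^ m
    have hF : F = 0 := by
      apply Polynomial.funext
      intro β
      have h1 : w * (X i + C β * X j) ^ (a + b) ∈ V :=
        Submodule.subset_span ⟨w, hw, β, a + b, rfl⟩
      have h2 := hLV h1
      rw [LinearMap.mem_ker, add_comm (X i), add_pow, Finset.mul_sum, map_sum] at h2
      rw [Polynomial.eval_zero, ← h2, Polynomial.eval_finsetSum]
      refine Finset.sum_congr rfl fun m _ => ?_
      rw [Polynomial.eval_mul, Polynomial.eval_C, Polynomial.eval_pow, Polynomial.eval_X, mul_comm,
        ← smul_eq_mul, ← map_smul, smul_eq_C_mul, mul_pow, C_pow, map_natCast]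
      congr 1
      ring
    have hc := congrArg (fun f => Polynomial.coeff f b) hF
    simp only [F, Polynomial.finsetSum_coeff, Polynomial.coeff_C_mul_X_pow, Polynomial.coeff_zero]
      at hc
    rw [Finset.sum_ite_eq, if_pos (by simp), Nat.add_sub_cancel] at hc
    have e : w * (X j ^ b * X i ^ a * C ((a + b).choose b : ℂ)) =
        ((a + b).choose b : ℂ) • (w * (X i ^ a * X j ^ b)) := by
      rw [smul_eq_C_mul]; ring
    rw [e, map_smul, smul_eq_mul] at hc
    refine (mul_ne_zero ?_ hL0) hc
    exact_mod_cast (Nat.choose_pos (Nat.le_add_left b a)).ne'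
  have hgen : p ∈ Submodule.span ℂ {q : MvPolynomial τ ℂ | ∃ w ∈ otherVars i j,
      ∃ a b : ℕ, q = w * (X i ^ a * X j ^ b)} := by
    induction p using MvPolynomial.induction_on with
    | C c => exact Submodule.subset_span ⟨C c, Subalgebra.algebraMap_mem _ c, 0, 0, by simp⟩
    | add p q hp hq => exact add_mem hp hq
    | mul_X p m hp =>
      induction hp using Submodule.span_induction with
      | mem q hq =>
        obtain ⟨w, hw, a, b, rfl⟩ := hq
        refine Submodule.subset_span ?_
        by_cases hi : m = i
        · subst hi
          exact ⟨w, hw, a + 1, b, by ring⟩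
        · by_cases hj : m = j
          · subst hj
            exact ⟨w, hw, a, b + 1, by ring⟩
          · exact ⟨w * X m, mul_mem hw (X_mem_otherVars hi hj), a, b, by ring⟩
      | zero => rw [zero_mul]; exact zero_mem _
      | add p q _ _ hp hq => rw [add_mul]; exact add_mem hp hq
      | smul c p _ hp => rw [smul_mul_assoc]; exact Submodule.smul_mem _ c hp
  refine Submodule.span_le.2 ?_ hgen
  rintro q ⟨w, hw, a, b, rfl⟩
  exact key w hw a b

end PowersOfLinearForms

end KorasRussell

namespace KorasRussell

/-! ### Lifting symplectic maps modulo powers of `x` to automorphisms. -/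

section Lifting

open MvPolynomial

variable {τ : Type} {i j : τ}

/-- Checking the variables suffices: in a product the cross term of the first order parts is
divisible by `x^(2m)`, and `2m ≥ m + 1`. -/
theorem first_order {x : MvPolynomial τ ℂ} {m : ℕ} (hm : 1 ≤ m)
    {f : MvPolynomial τ ℂ →ₐ[ℂ] MvPolynomial τ ℂ}
    {D : Derivation ℂ (MvPolynomial τ ℂ) (MvPolynomial τ ℂ)}
    (h : ∀ a, x ^ (m + 1) ∣ f (X a) - X a - x ^ m * D (X a)) (p : MvPolynomial τ ℂ) :
    x ^ (m + 1) ∣ f p - p - x ^ m * D p := by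
  induction p using MvPolynomial.induction_on with
  | C c =>
    rw [← algebraMap_eq, AlgHom.commutes, Derivation.map_algebraMap]; simp
  | add p q hp hq =>
    obtain ⟨u, hu⟩ := hp
    obtain ⟨v, hv⟩ := hq
    refine ⟨u + v, ?_⟩
    rw [map_add, map_add]
    linear_combination hu + hv
  | mul_X p a hp =>
    obtain ⟨u, hu⟩ := hp
    obtain ⟨v, hv⟩ := h a
    obtain ⟨m, rfl⟩ : ∃ m', m = m' + 1 := ⟨m - 1, by omega⟩
    refine ⟨u * f (X a) + p * v + x ^ m * D p * (D (X a) + x * v), ?_⟩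
    rw [map_mul, Derivation.leibniz, smul_eq_mul, smul_eq_mul]
    have e1 : f p = p + x ^ (m + 1) * D p + x ^ (m + 1 + 1) * u := by linear_combination hu
    have e2 : f (X a) = X a + x ^ (m + 1) * D (X a) + x ^ (m + 1 + 1) * v := by
      linear_combination hv
    rw [e1, e2]
    ring

theorem dvd_apply_of_fixes {Θ : MvPolynomial τ ℂ ≃ₐ[ℂ] MvPolynomial τ ℂ} {x : τ}
    (hx : Θ (X x) = X x) {n : ℕ} {p : MvPolynomial τ ℂ} (h : X x ^ n ∣ p) : X x ^ n ∣ Θ p := by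
  have := map_dvd Θ h
  rwa [map_pow, hx] at this

theorem poissonGroup_X {Θ : MvPolynomial τ ℂ ≃ₐ[ℂ] MvPolynomial τ ℂ} (hΘ : Θ ∈ poissonGroup i j)
    {x : τ} (hi : x ≠ i) (hj : x ≠ j) : Θ (X x) = X x := hΘ.1 x hi hj

/-- The Jacobian of a perturbation of the identity: the linear term is the divergence of the vector
field `(a, b)`. -/
theorem bracket_perturbation (hij : i ≠ j) {w : MvPolynomial τ ℂ} (hw : w ∈ otherVars i j)
    (a b : MvPolynomial τ ℂ) : bracket i j (X i + w * a) (X j + w * b) =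
      1 + w * (pderiv i a + pderiv j b) + w * (w * bracket i j a b) := by
  have e3 : bracket i j (X i) b = pderiv j b := by
    simp [bracket, pderiv_X_of_ne hij]
  have e4 : bracket i j (X i) (X j : MvPolynomial τ ℂ) = 1 := by
    simp [bracket, pderiv_X_of_ne hij]
  rw [bracket_add_left, bracket_add_right, bracket_add_right, bracket_smul_left hw,
    bracket_smul_left hw, bracket_smul_right hw, bracket_smul_right hw, e3, e4,
    (bracket_X hij a).2]
  ring

theorem pderiv_power (hij : i ≠ j) (β : ℂ) {w : MvPolynomial τ ℂ} (hw : w ∈ otherVars i j)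
    (n : ℕ) :
    pderiv i (w * (X i + C β * X j) ^ n) = w * (C (n : ℂ) * (X i + C β * X j) ^ (n - 1)) ∧
    pderiv j (w * (X i + C β * X j) ^ n) =
      C β * (w * (C (n : ℂ) * (X i + C β * X j) ^ (n - 1))) := by
  obtain ⟨h1, h2⟩ := pderiv_of_mem_otherVars hw
  constructor
  · rw [pderiv_mul, h1, pderiv_pow, map_add, pderiv_X_self, pderiv_C_mul,
      pderiv_X_of_ne hij.symm, map_natCast]
    ring
  · rw [pderiv_mul, h2, pderiv_pow, map_add, pderiv_X_of_ne hij, pderiv_C_mul,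
      pderiv_X_self, map_natCast]
    ring

/-- The Hamiltonian vector field of `h` is, to first order, given by Poisson automorphisms. -/
def Realizable (i j x : τ) (h : MvPolynomial τ ℂ) : Prop :=
  ∀ m, 1 ≤ m → ∃ E ∈ poissonGroup i j, ∀ p,
    (X x : MvPolynomial τ ℂ) ^ (m + 1) ∣ E p - p - X x ^ m * bracket i j h p

/-- Composition adds first order terms, since the outer automorphism acts trivially on the inner
term modulo `x`. -/
theorem Realizable.add {x : τ} (hi : x ≠ i) (hj : x ≠ j) {h h' : MvPolynomial τ ℂ}
    (H : Realizable i j x h) (H' : Realizable i j x h') : Realizable i j x (h + h') := by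
  intro m hm
  obtain ⟨E, hE, hEp⟩ := H m hm
  obtain ⟨E', hE', hEp'⟩ := H' m hm
  refine ⟨E * E', mul_mem hE hE', fun p => ?_⟩
  have hx := poissonGroup_X hE hi hj
  have h1 := dvd_apply_of_fixes hx (hEp' p)
  have h2 := hEp p
  have h3 : X x ∣ E (bracket i j h' p) - bracket i j h' p := by
    have h4 := hEp (bracket i j h' p)
    have h5 : X x ∣ E (bracket i j h' p) - bracket i j h' p
        - X x ^ m * bracket i j h (bracket i j h' p) := (dvd_pow_self _ (by omega)).trans h4
    have h6 : X x ∣ X x ^ m * bracket i j h (bracket i j h' p) :=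
      (dvd_pow_self _ (by omega)).mul_right _
    exact (dvd_sub_left h6).1 h5
  obtain ⟨u, hu⟩ := h1
  obtain ⟨v, hv⟩ := h2
  obtain ⟨w, hw⟩ := h3
  refine ⟨u + v + w, ?_⟩
  rw [map_sub, map_sub, map_mul, map_pow, hx] at hu
  rw [AlgEquiv.mul_apply, bracket_add_left]
  linear_combination hu + hv + X x ^ m * hw

/-- A shear in the direction of a linear form in two variables. -/
noncomputable def shearHom [DecidableEq τ] (i j : τ) (β : ℂ) (v : MvPolynomial τ ℂ) :
    MvPolynomial τ ℂ →ₐ[ℂ] MvPolynomial τ ℂ :=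
  aeval fun m => if m = i then X i - C β * v else if m = j then X j + v else X m

variable [DecidableEq τ]

theorem shearHom_X (hij : i ≠ j) (β : ℂ) (v : MvPolynomial τ ℂ) :
    shearHom i j β v (X i) = X i - C β * v ∧ shearHom i j β v (X j) = X j + v ∧
      FixesOthers i j (shearHom i j β v) := by
  refine ⟨by simp [shearHom], by simp [shearHom, hij.symm], fun m h h' => by simp [shearHom, h, h']⟩

/-- The shear moves along the level sets of the linear form `X_i + β X_j`. Shears with the same form
therefore compose by adding, which provides inverses. -/
theorem shearHom_apply (hij : i ≠ j) (β : ℂ) (v : MvPolynomial τ ℂ) {w : MvPolynomial τ ℂ}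
    (hw : w ∈ otherVars i j) (n : ℕ) :
    shearHom i j β v (w * (X i + C β * X j) ^ n) = w * (X i + C β * X j) ^ n := by
  obtain ⟨h1, h2, h3⟩ := shearHom_X hij β v
  have hC : shearHom i j β v (C β) = C β := AlgHom.commutes _ _
  rw [map_mul, h3.apply_eq hw, map_pow, map_add, map_mul, h1, h2, hC]
  congr 2
  ring

theorem shearHom_comp_neg (hij : i ≠ j) (β : ℂ) {w : MvPolynomial τ ℂ}
    (hw : w ∈ otherVars i j) (n : ℕ) :
    (shearHom i j β (w * (X i + C β * X j) ^ n)).comp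
      (shearHom i j β (-w * (X i + C β * X j) ^ n)) = AlgHom.id ℂ _ := by
  obtain ⟨h1, h2, h3⟩ := shearHom_X hij β (w * (X i + C β * X j) ^ n)
  obtain ⟨g1, g2, g3⟩ := shearHom_X hij β (-w * (X i + C β * X j) ^ n)
  have hC : shearHom i j β (w * (X i + C β * X j) ^ n) (C β) = C β := AlgHom.commutes _ _
  ext m : 1
  rw [AlgHom.comp_apply, AlgHom.id_apply]
  by_cases hi : m = i
  · subst hi
    rw [g1, map_sub, map_mul, h1, shearHom_apply hij β _ (neg_mem hw), hC]
    ring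
  · by_cases hj : m = j
    · subst hj
      rw [g2, map_add, h2, shearHom_apply hij β _ (neg_mem hw)]
      ring
    · rw [g3 m hi hj, h3 m hi hj]

theorem exists_shear (hij : i ≠ j) (β : ℂ) {w : MvPolynomial τ ℂ} (hw : w ∈ otherVars i j)
    (n : ℕ) : ∃ E ∈ poissonGroup i j, E.toAlgHom = shearHom i j β (w * (X i + C β * X j) ^ n) := by
  have h := shearHom_comp_neg hij β hw n
  have h' := shearHom_comp_neg hij β (neg_mem hw) n
  rw [neg_neg] at h'
  refine ⟨AlgEquiv.ofAlgHom _ _ h h', mem_poissonGroup_of_bracket_eq_one hij ?_ ?_, rfl⟩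
  · exact (shearHom_X hij β _).2.2
  · obtain ⟨h1, h2, -⟩ := shearHom_X hij β (w * (X i + C β * X j) ^ n)
    change bracket i j (shearHom i j β (w * (X i + C β * X j) ^ n) (X i))
      (shearHom i j β (w * (X i + C β * X j) ^ n) (X j)) = 1
    obtain ⟨d1, d2⟩ := pderiv_power hij β hw n
    rw [h1, h2, bracket, map_sub, map_sub, map_add, map_add, pderiv_C_mul, pderiv_C_mul, d1, d2,
      pderiv_X_self, pderiv_X_self, pderiv_X_of_ne hij, pderiv_X_of_ne hij.symm]
    ring

/-- The Hamiltonian field of a power of a linear form is the velocity of a shear. The shear with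
parameter scaled by `x^m` matches the required expansion on the variables exactly. -/
theorem realizable_power (hij : i ≠ j) {x : τ} (hi : x ≠ i) (hj : x ≠ j) (β : ℂ)
    {w : MvPolynomial τ ℂ} (hw : w ∈ otherVars i j) (n : ℕ) :
    Realizable i j x (w * (X i + C β * X j) ^ n) := by
  intro m hm
  obtain ⟨E, hE, hEh⟩ := exists_shear hij β (w := X x ^ m * w * C (n : ℂ))
    (mul_mem (mul_mem (pow_mem (X_mem_otherVars hi hj) m) hw) (Subalgebra.algebraMap_mem _ _))
    (n - 1)
  refine ⟨E, hE, fun p => ?_⟩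
  obtain ⟨h1, h2, h3⟩ := shearHom_X hij β
    (X x ^ m * w * C (n : ℂ) * (X i + C β * X j) ^ (n - 1))
  rw [← hEh] at h1 h2 h3
  obtain ⟨d1, d2⟩ := pderiv_power hij β hw n
  refine first_order (f := E.toAlgHom) (D := hamiltonian i j (w * (X i + C β * X j) ^ n)) hm
    (fun a => ?_) p
  rw [hamiltonian_apply]
  by_cases hai : a = i
  · subst hai
    rw [h1, (bracket_X hij _).1, d2]
    refine ⟨0, by ring⟩
  · by_cases haj : a = j
    · subst haj
      rw [h2, (bracket_X hij _).2, d1]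
      refine ⟨0, by ring⟩
    · rw [h3 a hai haj, (bracket_of_mem_otherVars (X_mem_otherVars hai haj) _).2]
      simp

theorem realizable (hij : i ≠ j) {x : τ} (hi : x ≠ i) (hj : x ≠ j) (h : MvPolynomial τ ℂ) :
    Realizable i j x h := by
  have key : ∀ c : ℂ, Realizable i j x (c • h) := by
    induction mem_span_powers (i := i) (j := j) h using Submodule.span_induction with
    | mem q hq =>
      intro c
      obtain ⟨w, hw, β, n, rfl⟩ := hq
      rw [← smul_mul_assoc]
      exact realizable_power hij hi hj β (Subalgebra.smul_mem _ hw c) n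
    | zero =>
      intro c m hm
      refine ⟨1, one_mem _, fun p => ?_⟩
      rw [smul_zero]
      simp [bracket]
    | add p q _ _ hp hq => intro c; rw [smul_add]; exact (hp c).add hi hj (hq c)
    | smul a p _ hp => intro c; rw [smul_smul]; exact hp _
  simpa using key 1

/-- Endomorphisms that are symplectic modulo a power of a variable lift to symplectic
automorphisms. -/
theorem exists_poisson_lift (hij : i ≠ j) {x : τ} (hi : x ≠ i) (hj : x ≠ j)
    {f : MvPolynomial τ ℂ →ₐ[ℂ] MvPolynomial τ ℂ} (hf : FixesOthers i j f)
    (hid : ∀ p, X x ∣ f p - p) {N : ℕ}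
    (hJ : X x ^ N ∣ bracket i j (f (X i)) (f (X j)) - 1) {m : ℕ} (hm : 1 ≤ m) (hmN : m ≤ N) :
    ∃ Θ ∈ poissonGroup i j, ∀ p, X x ^ m ∣ Θ p - f p := by
  have hxo : (X x : MvPolynomial τ ℂ) ∈ otherVars i j := X_mem_otherVars hi hj
  induction m, hm using Nat.le_induction with
  | base =>
    refine ⟨1, one_mem _, fun p => ?_⟩
    rw [pow_one, AlgEquiv.one_apply, dvd_sub_comm]
    exact hid p
  | succ m hm ih =>
    obtain ⟨Θ, hΘ, hΘf⟩ := ih (by omega)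
    have hΘ' : Θ⁻¹ ∈ poissonGroup i j := inv_mem hΘ
    have hx' : Θ⁻¹ (X x) = X x := poissonGroup_X hΘ' hi hj
    have hΘinv : ∀ p, Θ⁻¹ (Θ p) = p := fun p => by
      rw [← AlgEquiv.mul_apply, inv_mul_cancel, AlgEquiv.one_apply]
    have hΘinv' : ∀ p, Θ (Θ⁻¹ p) = p := fun p => by
      rw [← AlgEquiv.mul_apply, mul_inv_cancel, AlgEquiv.one_apply]
    let g : MvPolynomial τ ℂ →ₐ[ℂ] MvPolynomial τ ℂ := (Θ⁻¹).toAlgHom.comp f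
    have hg : ∀ p, g p = Θ⁻¹ (f p) := fun p => rfl
    have hgfix : FixesOthers i j g := fun a h h' => by
      rw [hg, hf a h h']; exact hΘ'.1 a h h'
    have hgid : ∀ p, X x ^ m ∣ g p - p := fun p => by
      have := dvd_apply_of_fixes hx' (hΘf p)
      rw [map_sub, hΘinv] at this
      rwa [hg, dvd_sub_comm]
    obtain ⟨a, ha⟩ := hgid (X i)
    obtain ⟨b, hb⟩ := hgid (X j)
    -- After composing with `Θ⁻¹` the map is the identity modulo `x^m`, and its Jacobian is still
    -- `1` modulo `x^N`. So the coefficient of `x^m` has divergence zero modulo `x`.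
    have hgJ : X x ^ N ∣ bracket i j (g (X i)) (g (X j)) - 1 := by
      rw [hg, hg, hΘ'.2, ← map_one Θ⁻¹, ← map_sub]
      exact dvd_apply_of_fixes hx' hJ
    have hxm : (X x : MvPolynomial τ ℂ) ^ m ∈ otherVars i j := pow_mem hxo m
    have hexp : bracket i j (g (X i)) (g (X j)) - 1 = X x ^ m * (pderiv i a + pderiv j b) +
        X x ^ m * (X x ^ m * bracket i j a b) := by
      have e1 : g (X i) = X i + X x ^ m * a := by rw [← ha]; ring
      have e2 : g (X j) = X j + X x ^ m * b := by rw [← hb]; ring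
      rw [e1, e2, bracket_perturbation hij hxm]
      ring
    have hdiv : X x ∣ pderiv i a + pderiv j b := by
      have h1 : (X x : MvPolynomial τ ℂ) ^ (m + 1) ∣ X x ^ m * (pderiv i a + pderiv j b) +
          X x ^ m * (X x ^ m * bracket i j a b) := by
        rw [← hexp]; exact (pow_dvd_pow _ hmN).trans hgJ
      have h2 : (X x : MvPolynomial τ ℂ) ^ (m + 1) ∣ X x ^ m * (X x ^ m * bracket i j a b) := by
        rw [pow_succ]
        exact mul_dvd_mul_left _ ((dvd_pow_self _ (by omega)).mul_right _)
      rw [dvd_add_left h2, pow_succ] at h1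
      exact (mul_dvd_mul_iff_left (pow_ne_zero m (X_ne_zero x))).1 h1
    obtain ⟨e, he⟩ := hdiv
    -- Subtracting a multiple of `x` from `a` makes the divergence exactly zero. The change is of
    -- order `x^(m+1)` and does not affect this stage.
    obtain ⟨h, h1, h2⟩ := exists_hamiltonian (i := i) (j := j) hij
      (a := a - X x * antideriv i e) (b := b) (by
        rw [map_sub, pderiv_mul, (pderiv_of_mem_otherVars hxo).1, pderiv_antideriv]
        linear_combination he)
    obtain ⟨E, hE, hEh⟩ := realizable hij hi hj h m hm
    refine ⟨Θ * E, mul_mem hΘ hE, fun p => ?_⟩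
    have hgp : X x ^ (m + 1) ∣ g p - p - X x ^ m * bracket i j h p := by
      refine first_order (D := hamiltonian i j h) hm (fun c => ?_) p
      rw [hamiltonian_apply]
      by_cases hci : c = i
      · subst hci
        refine ⟨antideriv c e, ?_⟩
        rw [← h1]
        linear_combination ha
      · by_cases hcj : c = j
        · subst hcj
          refine ⟨0, ?_⟩
          rw [← h2]
          linear_combination hb
        · rw [hgfix c hci hcj, (bracket_of_mem_otherVars (X_mem_otherVars hci hcj) _).2]
          simp
    have hdiff : X x ^ (m + 1) ∣ E p - g p := by
      have := dvd_sub (hEh p) hgp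
      have e : E p - p - X x ^ m * bracket i j h p - (g p - p - X x ^ m * bracket i j h p) =
        E p - g p := by ring
      rwa [e] at this
    have := dvd_apply_of_fixes (poissonGroup_X hΘ hi hj) hdiff
    rwa [map_sub, hg, hΘinv'] at this

end Lifting

end KorasRussell

namespace KorasRussell

/-! ### Truncated exponentials of derivations. -/

section TruncatedExponential

variable {A : Type*} [CommRing A] [Algebra ℂ A]

/-- The divided powers of an endomorphism. -/
noncomputable def divPow (E : Module.End ℂ A) (n : ℕ) : Module.End ℂ A :=
  ((n.factorial : ℂ)⁻¹) • E ^ n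

theorem divPow_zero (E : Module.End ℂ A) : divPow E 0 = 1 := by simp [divPow]

theorem divPow_one (E : Module.End ℂ A) : divPow E 1 = E := by simp [divPow]

theorem smul_divPow_succ (E : Module.End ℂ A) (n : ℕ) (p : A) :
    ((n : ℂ) + 1) • divPow E (n + 1) p = E (divPow E n p) := by
  have h1 : (n : ℂ) + 1 ≠ 0 := Nat.cast_add_one_ne_zero _
  rw [divPow, divPow, LinearMap.smul_apply, LinearMap.smul_apply, map_smul, smul_smul, pow_succ',
    Module.End.mul_apply, Nat.factorial_succ]
  congr 1
  push_cast
  field_simp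

/-- Leibniz rule for divided powers, stated for any bilinear operation obeying a product rule so
that it covers both multiplication and the Poisson bracket. -/
theorem divPow_bilinear {E : Module.End ℂ A} {B : A →ₗ[ℂ] A →ₗ[ℂ] A}
    (hE : ∀ p q, E (B p q) = B (E p) q + B p (E q)) (n : ℕ) (p q : A) :
    divPow E n (B p q) =
      ∑ ab ∈ Finset.HasAntidiagonal.antidiagonal n, B (divPow E ab.1 p) (divPow E ab.2 q) := by
  induction n with
  | zero => simp [divPow_zero]
  | succ n ih =>
    have h1 : (n : ℂ) + 1 ≠ 0 := Nat.cast_add_one_ne_zero _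
    refine smul_right_injective A h1 ?_
    change ((n : ℂ) + 1) • _ = ((n : ℂ) + 1) • _
    rw [smul_divPow_succ, ih, map_sum, Finset.smul_sum]
    have e : ∀ ab ∈ Finset.HasAntidiagonal.antidiagonal (n + 1),
        ((n : ℂ) + 1) • B (divPow E ab.1 p) (divPow E ab.2 q) =
          (ab.1 : ℂ) • B (divPow E ab.1 p) (divPow E ab.2 q) +
          (ab.2 : ℂ) • B (divPow E ab.1 p) (divPow E ab.2 q) := by
      intro ab hab
      rw [Finset.HasAntidiagonal.mem_antidiagonal] at hab
      rw [← add_smul]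
      congr 1
      exact_mod_cast hab.symm
    rw [Finset.sum_congr rfl e, Finset.sum_add_distrib, Finset.Nat.sum_antidiagonal_succ,
      Finset.Nat.sum_antidiagonal_succ']
    simp only [Nat.cast_zero, zero_smul, zero_add]
    rw [← Finset.sum_add_distrib]
    refine Finset.sum_congr rfl fun ab _ => ?_
    rw [hE, ← smul_divPow_succ, ← smul_divPow_succ, map_smul, map_smul, LinearMap.smul_apply]
    push_cast
    rfl

/-- The truncated exponential of an endomorphism. -/
noncomputable def truncExp (E : Module.End ℂ A) (N : ℕ) (p : A) : A :=
  ∑ n ∈ Finset.range (N + 1), divPow E n p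

theorem dvd_divPow {E : Module.End ℂ A} {x : A} (hx : ∀ p, x ∣ E p)
    (hxE : ∀ p, E (x * p) = x * E p) (n : ℕ) (p : A) : x ^ n ∣ divPow E n p := by
  have h : ∀ n, ∃ q, (E ^ n) p = x ^ n * q := by
    intro n
    induction n with
    | zero => exact ⟨p, by simp⟩
    | succ n ih =>
      obtain ⟨q, hq⟩ := ih
      obtain ⟨r, hr⟩ := hx q
      refine ⟨r, ?_⟩
      have hpow : ∀ (m : ℕ) (q : A), E (x ^ m * q) = x ^ m * E q := by
        intro m
        induction m with
        | zero => intro q; simp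
        | succ m ih => intro q; rw [pow_succ', mul_assoc, hxE, ih, mul_assoc]
      rw [pow_succ', Module.End.mul_apply, hq, hpow, hr]
      ring
  obtain ⟨q, hq⟩ := h n
  rw [divPow, LinearMap.smul_apply, hq, ← mul_smul_comm]
  exact Dvd.intro _ rfl

/-- The two sides differ by the terms with total order above `N`, and a term of orders `a`, `b` is
divisible by `x^(a+b)`. -/
theorem truncExp_bilinear {E : Module.End ℂ A} {B : A →ₗ[ℂ] A →ₗ[ℂ] A}
    (hE : ∀ p q, E (B p q) = B (E p) q + B p (E q)) {x : A} (hx : ∀ p, x ∣ E p)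
    (hxE : ∀ p, E (x * p) = x * E p) (hB1 : ∀ p q, B (x * p) q = x * B p q)
    (hB2 : ∀ p q, B p (x * q) = x * B p q) (N : ℕ) (p q : A) :
    x ^ (N + 1) ∣ B (truncExp E N p) (truncExp E N q) - truncExp E N (B p q) := by
  have hpow1 : ∀ (m : ℕ) (p q : A), B (x ^ m * p) q = x ^ m * B p q := by
    intro m
    induction m with
    | zero => intro p q; simp
    | succ m ih => intro p q; rw [pow_succ', mul_assoc, hB1, ih, mul_assoc]
  have hpow2 : ∀ (m : ℕ) (p q : A), B p (x ^ m * q) = x ^ m * B p q := by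
    intro m
    induction m with
    | zero => intro p q; simp
    | succ m ih => intro p q; rw [pow_succ', mul_assoc, hB2, ih, mul_assoc]
  have e1 : B (truncExp E N p) (truncExp E N q) =
      ∑ ab ∈ Finset.range (N + 1) ×ˢ Finset.range (N + 1),
        B (divPow E ab.1 p) (divPow E ab.2 q) := by
    rw [truncExp, truncExp, map_sum, Finset.sum_product_right]
    refine Finset.sum_congr rfl fun b _ => ?_
    rw [map_sum, LinearMap.sum_apply]
  have e2 : truncExp E N (B p q) =
      ∑ ab ∈ (Finset.range (N + 1) ×ˢ Finset.range (N + 1)).filter (fun ab => ab.1 + ab.2 ≤ N),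
        B (divPow E ab.1 p) (divPow E ab.2 q) := by
    rw [truncExp, ← Finset.sum_fiberwise_of_maps_to (t := Finset.range (N + 1))
      (g := fun ab : ℕ × ℕ => ab.1 + ab.2)]
    · refine Finset.sum_congr rfl fun n hn => ?_
      rw [divPow_bilinear hE]
      refine Finset.sum_congr ?_ fun _ _ => rfl
      ext ⟨a, b⟩
      simp only [Finset.HasAntidiagonal.mem_antidiagonal, Finset.mem_filter, Finset.mem_product, Finset.mem_range]
        at hn ⊢
      omega
    · intro ab hab
      simp only [Finset.mem_filter, Finset.mem_range] at hab ⊢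
      omega
  rw [e1, e2, ← Finset.sum_filter_add_sum_filter_not
    (Finset.range (N + 1) ×ˢ Finset.range (N + 1)) (fun ab => ab.1 + ab.2 ≤ N), add_sub_cancel_left]
  refine Finset.dvd_sum fun ab hab => ?_
  have hlt : N + 1 ≤ ab.1 + ab.2 := by
    simp only [Finset.mem_filter] at hab
    omega
  obtain ⟨u, hu⟩ := dvd_divPow hx hxE ab.1 p
  obtain ⟨v, hv⟩ := dvd_divPow hx hxE ab.2 q
  rw [hu, hv, hpow1, hpow2, ← mul_assoc, ← pow_add]
  exact (pow_dvd_pow x hlt).mul_right _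

theorem truncExp_add (E : Module.End ℂ A) (N : ℕ) (p q : A) :
    truncExp E N (p + q) = truncExp E N p + truncExp E N q := by
  simp only [truncExp, map_add, Finset.sum_add_distrib]

theorem truncExp_of_apply_eq_zero {E : Module.End ℂ A} {p : A} (h : E p = 0) (N : ℕ) :
    truncExp E N p = p := by
  rw [truncExp, Finset.sum_range_succ', divPow_zero]
  rw [Finset.sum_eq_zero, zero_add]
  · rfl
  · intro n _
    rw [divPow, pow_succ, LinearMap.smul_apply, Module.End.mul_apply, h, map_zero, smul_zero]

/-- First order expansion of the truncated exponential of an endomorphism divisible by `x ^ n`. -/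
theorem truncExp_first_order {E F : Module.End ℂ A} {x : A} {n : ℕ} (hn : 1 ≤ n)
    (hEF : ∀ p, E p = x ^ n * F p) (hxF : ∀ p, F (x * p) = x * F p) {N : ℕ} (hN : 1 ≤ N) (p : A) :
    x ^ (n + 1) ∣ truncExp E N p - p - x ^ n * F p := by
  have hxF' : ∀ (m : ℕ) (q : A), F (x ^ m * q) = x ^ m * F q := by
    intro m
    induction m with
    | zero => intro q; simp
    | succ m ih => intro q; rw [pow_succ', mul_assoc, hxF, ih, mul_assoc]
  obtain ⟨N, rfl⟩ : ∃ N', N = N' + 1 := ⟨N - 1, by omega⟩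
  rw [truncExp, Finset.sum_range_succ', Finset.sum_range_succ', divPow_zero, zero_add, divPow_one,
    ← hEF, Module.End.one_apply]
  have e : ∀ S : A, S + E p + p - p - E p = S := fun S => by ring
  rw [e]
  refine Finset.dvd_sum fun m _ => ?_
  have h2 := dvd_divPow (E := E) (x := x ^ n) (fun p => ⟨F p, hEF p⟩)
    (fun q => by rw [hEF, hEF, hxF']) (m + 1 + 1) p
  rw [← pow_mul] at h2
  refine (pow_dvd_pow x ?_).trans h2
  nlinarith

end TruncatedExponential

/-! ### Symplectic automorphisms approximating Hamiltonian flows. -/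

section ExponentialAutomorphism

open MvPolynomial

variable {τ : Type} {i j : τ}

/-- The bracket as a bilinear map. -/
noncomputable def bracketBilin (i j : τ) :
    MvPolynomial τ ℂ →ₗ[ℂ] MvPolynomial τ ℂ →ₗ[ℂ] MvPolynomial τ ℂ :=
  LinearMap.mk₂ ℂ (bracket i j) bracket_add_left
    (fun c p q => by simp only [bracket, Derivation.map_smul, smul_mul_assoc, smul_sub])
    bracket_add_right
    (fun c p q => by simp only [bracket, Derivation.map_smul, mul_smul_comm, smul_sub])

/-- For a Hamiltonian `h` there is a symplectic automorphism which agrees with the exponential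
of the vector field of `x^n h` modulo a power of `x`. If `s` divides `h`, then it preserves the
ideal `(s)` modulo that power. -/
theorem exists_exponential (hij : i ≠ j) {x : τ} (hi : x ≠ i) (hj : x ≠ j)
    (s g : MvPolynomial τ ℂ) {n N : ℕ} (hn : 1 ≤ n) (hnN : n ≤ N) :
    ∃ Θ ∈ poissonGroup i j,
      (∀ p, X x ^ (n + 1) ∣ Θ p - p - X x ^ n * bracket i j (s * g) p) ∧
      ∃ u, X x ^ (N + 1) ∣ Θ s - u * s := by
  classical
  have hxo : (X x : MvPolynomial τ ℂ) ∈ otherVars i j := X_mem_otherVars hi hj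
  obtain ⟨F, hF⟩ : ∃ F : Module.End ℂ (MvPolynomial τ ℂ), ∀ p, F p = bracket i j (s * g) p :=
    ⟨bracketBilin i j (s * g), fun p => rfl⟩
  obtain ⟨E, hE⟩ : ∃ E : Module.End ℂ (MvPolynomial τ ℂ),
      ∀ p, E p = bracket i j (X x ^ n * (s * g)) p :=
    ⟨bracketBilin i j (X x ^ n * (s * g)), fun p => rfl⟩
  have hEF : ∀ p, E p = X x ^ n * F p := fun p => by
    rw [hE, bracket_smul_left (pow_mem hxo n), hF]
  have hxF : ∀ p, F (X x * p) = X x * F p := fun p => by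
    rw [hF, bracket_smul_right hxo, hF]
  have hxE : ∀ p, E (X x * p) = X x * E p := fun p => by
    rw [hE, bracket_smul_right hxo, hE]
  have hdvd : ∀ p, X x ∣ E p := fun p => by
    rw [hEF]; exact (dvd_pow_self _ (by omega)).mul_right _
  have hfirst := truncExp_first_order (x := X x) hn hEF hxF (show 1 ≤ N by omega)
  have hmul : ∀ p q, X x ^ (N + 1) ∣
      truncExp E N p * truncExp E N q - truncExp E N (p * q) := by
    exact truncExp_bilinear (B := LinearMap.mul ℂ (MvPolynomial τ ℂ)) (E := E) (x := X x)
      (fun p q => by simp only [LinearMap.mul_apply', hE, bracket_mul_right]) hdvd hxE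
      (fun p q => mul_assoc _ _ _) (fun p q => mul_left_comm _ _ _) N
  have hbr : ∀ p q, X x ^ (N + 1) ∣
      bracket i j (truncExp E N p) (truncExp E N q) - truncExp E N (bracket i j p q) := by
    have hB : ∀ p q, bracketBilin i j p q = bracket i j p q := fun p q => rfl
    exact truncExp_bilinear (B := bracketBilin i j) (E := E) (x := X x)
      (fun p q => by rw [hB, hB, hB, hE, hE, hE, bracket_bracket]) hdvd hxE
      (fun p q => bracket_smul_left hxo _ _) (fun p q => bracket_smul_right hxo _ _) N
  have hEother : ∀ w ∈ otherVars i j, E w = 0 := fun w hw => by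
    rw [hE, (bracket_of_mem_otherVars hw _).2]
  -- The truncated exponential is multiplicative only modulo `x^(N+1)`. The algebra endomorphism
  -- with the same values on the variables agrees with it to that order and can be fed to the
  -- lifting theorem.
  let f : MvPolynomial τ ℂ →ₐ[ℂ] MvPolynomial τ ℂ := aeval fun m => truncExp E N (X m)
  have hfX : ∀ m, f (X m) = truncExp E N (X m) := fun m => by simp [f]
  have hfix : FixesOthers i j f := fun m h h' => by
    rw [hfX, truncExp_of_apply_eq_zero (hEother _ (X_mem_otherVars h h'))]
  have hf : ∀ p, X x ^ (N + 1) ∣ f p - truncExp E N p := by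
    intro p
    induction p using MvPolynomial.induction_on with
    | C c =>
      rw [truncExp_of_apply_eq_zero (hEother (C c) (Subalgebra.algebraMap_mem _ c)),
        ← algebraMap_eq, AlgHom.commutes, sub_self]
      exact dvd_zero _
    | add p q hp hq =>
      rw [map_add, truncExp_add, add_sub_add_comm]
      exact dvd_add hp hq
    | mul_X p m hp =>
      have e : f (p * X m) - truncExp E N (p * X m) = (f p - truncExp E N p) * f (X m) +
          (truncExp E N p * truncExp E N (X m) - truncExp E N (p * X m)) := by
        rw [map_mul, hfX]; ring
      rw [e]
      exact dvd_add (hp.mul_right _) (hmul _ _)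
  have hid : ∀ p, X x ∣ f p - p := by
    intro p
    have h1 := (dvd_pow_self (X x : MvPolynomial τ ℂ) (Nat.succ_ne_zero N)).trans (hf p)
    have h2 := (dvd_pow_self (X x : MvPolynomial τ ℂ) (Nat.succ_ne_zero n)).trans (hfirst p)
    have h3 : (X x : MvPolynomial τ ℂ) ∣ X x ^ n * F p :=
      (dvd_pow_self _ (by omega)).mul_right _
    have e : f p - p = (f p - truncExp E N p) + (truncExp E N p - p - X x ^ n * F p) +
      X x ^ n * F p := by ring
    rw [e]
    exact dvd_add (dvd_add h1 h2) h3
  have hJ : X x ^ (N + 1) ∣ bracket i j (f (X i)) (f (X j)) - 1 := by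
    have h1 := hbr (X i) (X j)
    have h2 : bracket i j (X i) (X j : MvPolynomial τ ℂ) = 1 := by
      rw [(bracket_X hij _).2, pderiv_X_self]
    rwa [h2, truncExp_of_apply_eq_zero (hEother 1 (one_mem _)), ← hfX, ← hfX] at h1
  obtain ⟨Θ, hΘ, hΘf⟩ := exists_poisson_lift hij hi hj hfix hid hJ (m := N + 1) (by omega) le_rfl
  have hΘE : ∀ p, X x ^ (N + 1) ∣ Θ p - truncExp E N p := fun p => by
    have := dvd_add (hΘf p) (hf p)
    rwa [sub_add_sub_cancel] at this
  refine ⟨Θ, hΘ, fun p => ?_, ?_⟩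
  · have h1 := (pow_dvd_pow (X x : MvPolynomial τ ℂ) (by omega : n + 1 ≤ N + 1)).trans (hΘE p)
    have e : Θ p - p - X x ^ n * bracket i j (s * g) p = (Θ p - truncExp E N p) +
      (truncExp E N p - p - X x ^ n * F p) := by rw [hF]; ring
    rw [e]
    exact dvd_add h1 (hfirst p)
  -- Because the Hamiltonian is divisible by `s`, the bracket `{s g, s w}` is again divisible by
  -- `s`. So the ideal `(s)` is stable under every iterate.
  · have hs : ∀ m, s ∣ (E ^ m) s := by
      intro m
      induction m with
      | zero => simp
      | succ m ih =>
        obtain ⟨w, hw⟩ := ih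
        rw [pow_succ', Module.End.mul_apply, hw, hEF, hF, bracket_mul_left, bracket_mul_right,
          bracket_mul_right, bracket_self]
        refine ⟨X x ^ n * (bracket i j s w * g + bracket i j g s * w + s * bracket i j g w), ?_⟩
        ring
    have hs' : s ∣ truncExp E N s := by
      refine Finset.dvd_sum fun m _ => ?_
      obtain ⟨w, hw⟩ := hs m
      rw [divPow, LinearMap.smul_apply, hw, ← mul_smul_comm]
      exact Dvd.intro _ rfl
    obtain ⟨u, hu⟩ := hs'
    refine ⟨u, ?_⟩
    rw [mul_comm u, ← hu]
    exact hΘE s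

end ExponentialAutomorphism

end KorasRussell

namespace KorasRussell

/-! ### Point maps of polynomial automorphisms. -/

section PointMaps

open MvPolynomial

/-- The polynomial self-map of affine space whose pullback is a given endomorphism. -/
noncomputable def pointMap {n : ℕ} (Φ : MvPolynomial (Fin n) ℂ →ₐ[ℂ] MvPolynomial (Fin n) ℂ)
    (v : Fin n → ℂ) : Fin n → ℂ := fun i => eval v (Φ (X i))

theorem eval_pointMap {n : ℕ} (Φ : MvPolynomial (Fin n) ℂ →ₐ[ℂ] MvPolynomial (Fin n) ℂ)
    (v : Fin n → ℂ) (p : MvPolynomial (Fin n) ℂ) : eval (pointMap Φ v) p = eval v (Φ p) := by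
  induction p using MvPolynomial.induction_on with
  | C a => rw [← algebraMap_eq, AlgHom.commutes, algebraMap_eq, eval_C, eval_C]
  | add p q hp hq => rw [map_add, map_add, map_add, hp, hq]
  | mul_X p i hp => rw [map_mul, map_mul, map_mul, hp, eval_X]; rfl

theorem pointMap_pointMap {n : ℕ} {Φ Φ' : MvPolynomial (Fin n) ℂ →ₐ[ℂ] MvPolynomial (Fin n) ℂ}
    (h : ∀ p, Φ (Φ' p) = p) (v : Fin n → ℂ) : pointMap Φ' (pointMap Φ v) = v := by
  funext i
  rw [pointMap, eval_pointMap, h, eval_X]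

/-- The automorphism of an affine variety given by an automorphism of the polynomial ring. -/
noncomputable def autOfAlgEquiv {n : ℕ} (Z : Set (Fin n → ℂ))
    (Φ : MvPolynomial (Fin n) ℂ ≃ₐ[ℂ] MvPolynomial (Fin n) ℂ)
    (h : ∀ v ∈ Z, pointMap Φ.toAlgHom v ∈ Z) (h' : ∀ v ∈ Z, pointMap Φ.symm.toAlgHom v ∈ Z) :
    Aut Z :=
  ⟨{ toFun := fun v => ⟨pointMap Φ.toAlgHom v.1, h v.1 v.2⟩
     invFun := fun v => ⟨pointMap Φ.symm.toAlgHom v.1, h' v.1 v.2⟩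
     left_inv := fun v => Subtype.ext (pointMap_pointMap Φ.apply_symm_apply v.1)
     right_inv := fun v => Subtype.ext (pointMap_pointMap Φ.symm_apply_apply v.1) },
    ⟨fun i => Φ (X i), fun _ _ => rfl⟩, ⟨fun i => Φ.symm (X i), fun _ _ => rfl⟩⟩

end PointMaps

/-! ### From the family of hypersurfaces with equation `c` to affine 4-space. -/

section Extension

open MvPolynomial

variable {d k l : ℕ}

/-- The automorphism of the threefold extends to affine space. -/
def Extends (ψ : Aut (threefold d k l)) : Prop :=
  ∃ Φ : Aut (Set.univ : Set (Fin 4 → ℂ)), ∀ v : threefold d k l,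
    (Φ • (⟨v.1, Set.mem_univ v.1⟩ : (Set.univ : Set (Fin 4 → ℂ)))).1 = (ψ • v).1

theorem Extends.mul {ψ ψ' : Aut (threefold d k l)} (h : Extends ψ) (h' : Extends ψ') :
    Extends (ψ * ψ') := by
  obtain ⟨Φ, hΦ⟩ := h
  obtain ⟨Φ', hΦ'⟩ := h'
  refine ⟨Φ * Φ', fun v => ?_⟩
  rw [mul_smul, mul_smul, ← hΦ]
  congr 2
  exact Subtype.ext (hΦ' v)

/-- Automorphisms of the polynomial ring preserving the equation of the threefold up to a
constant restrict to the threefold. -/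
theorem exists_aut_of_defPoly {Φ : MvPolynomial (Fin 4) ℂ ≃ₐ[ℂ] MvPolynomial (Fin 4) ℂ} {c : ℂ}
    (hc : c ≠ 0) (hΦ : Φ (defPoly d k l) = C c * defPoly d k l) :
    ∃ ψ : Aut (threefold d k l),
      (∀ v : threefold d k l, (ψ • v).1 = pointMap Φ.toAlgHom v.1) ∧ Extends ψ := by
  have hΦ' : Φ.symm (defPoly d k l) = C c⁻¹ * defPoly d k l := by
    rw [Φ.symm_apply_eq, map_mul, hΦ]
    have : Φ (C c⁻¹) = C c⁻¹ := Φ.commutes _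
    rw [this, ← mul_assoc, ← C_mul, inv_mul_cancel₀ hc, C_1, one_mul]
  have h1 : ∀ v ∈ threefold d k l, pointMap Φ.toAlgHom v ∈ threefold d k l := fun v hv => by
    rw [mem_threefold_iff, eval_pointMap]
    change eval v (Φ _) = 0
    rw [hΦ, map_mul, mem_threefold_iff.1 hv, mul_zero]
  have h2 : ∀ v ∈ threefold d k l, pointMap Φ.symm.toAlgHom v ∈ threefold d k l := fun v hv => by
    rw [mem_threefold_iff, eval_pointMap]
    change eval v (Φ.symm _) = 0
    rw [hΦ', map_mul, mem_threefold_iff.1 hv, mul_zero]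
  exact ⟨autOfAlgEquiv _ Φ h1 h2, fun v => rfl,
    autOfAlgEquiv _ Φ (fun _ _ => Set.mem_univ _) (fun _ _ => Set.mem_univ _), fun v => rfl⟩

/-- The polynomial `z^k + t^ℓ + x - c` in the variables `x`, `c`, `z`, `t`. -/
noncomputable def polySc (k l : ℕ) : MvPolynomial (Fin 4) ℂ := inclXZT (polyS k l) - X 1

/-- Substituting the equation of the threefold for the variable `c`. -/
noncomputable def substC (d k l : ℕ) : MvPolynomial (Fin 4) ℂ →ₐ[ℂ] MvPolynomial (Fin 4) ℂ :=
  aeval ![X 0, defPoly d k l, X 2, X 3]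

/-- Setting `c = 0`. -/
noncomputable def setC : MvPolynomial (Fin 4) ℂ →ₐ[ℂ] Rxzt := aeval ![X 0, 0, X 1, X 2]

theorem algHom_ext_inclXZT {B : Type*} [CommRing B] [Algebra ℂ B]
    {f g : MvPolynomial (Fin 4) ℂ →ₐ[ℂ] B} (h : ∀ i, f (inclXZT (X i)) = g (inclXZT (X i)))
    (h1 : f (X 1) = g (X 1)) : f = g := by
  obtain ⟨e0, e1, e2⟩ := inclXZT_X
  have h0 := h 0
  have h2 := h 1
  have h3 := h 2
  rw [e0] at h0
  rw [e1] at h2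
  rw [e2] at h3
  ext i : 1
  fin_cases i
  exacts [h0, h1, h2, h3]

theorem setC_inclXZT (p : Rxzt) : setC (inclXZT p) = p := by
  have : setC.comp inclXZT = AlgHom.id ℂ Rxzt := by
    ext i : 1
    fin_cases i <;> simp [inclXZT, setC]
  exact DFunLike.congr_fun this p

theorem setC_X_one : setC (X 1) = 0 := by simp [setC]

theorem substC_X_one : substC d k l (X 1) = defPoly d k l := by simp [substC]

theorem substC_inclXZT (p : Rxzt) : substC d k l (inclXZT p) = inclXZT p := by
  have : (substC d k l).comp inclXZT = inclXZT := by
    ext i : 1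
    fin_cases i <;> simp [inclXZT, substC]
  exact DFunLike.congr_fun this p

theorem eval_substC (v : threefold d k l) (p : MvPolynomial (Fin 4) ℂ) :
    eval v.1 (substC d k l p) = eval (proj v.1) (setC p) := by
  have : ((aeval v.1 : MvPolynomial (Fin 4) ℂ →ₐ[ℂ] ℂ).comp (substC d k l)) =
      (aeval (proj v.1) : Rxzt →ₐ[ℂ] ℂ).comp setC := by
    refine algHom_ext_inclXZT (fun i => ?_) ?_
    · rw [AlgHom.comp_apply, AlgHom.comp_apply, substC_inclXZT, setC_inclXZT]
      exact eval_inclXZT _ _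
    · rw [AlgHom.comp_apply, AlgHom.comp_apply, substC_X_one, setC_X_one, map_zero]
      exact mem_threefold_iff.1 v.2
  exact DFunLike.congr_fun this p

theorem substC_polySc : substC d k l (polySc k l) = -(X 0 ^ d * X 1) := by
  rw [polySc, map_sub, substC_inclXZT, substC_X_one, defPoly_eq]; ring

/-- The endomorphism of `ℂ[x, y, z, t]` induced by an endomorphism of `ℂ[x, c, z, t]` that
preserves the ideal `(x^d, z^k + t^ℓ + x - c)`. -/
theorem exists_extension_hom {Θ : MvPolynomial (Fin 4) ℂ →ₐ[ℂ] MvPolynomial (Fin 4) ℂ}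
    (h0 : Θ (X 0) = X 0) (h1 : Θ (X 1) = X 1) {u v : MvPolynomial (Fin 4) ℂ}
    (hs : Θ (polySc k l) = u * polySc k l + X 0 ^ d * v) :
    ∃ Φ : MvPolynomial (Fin 4) ℂ →ₐ[ℂ] MvPolynomial (Fin 4) ℂ,
      Φ (X 1) = substC d k l u * X 1 - substC d k l v ∧
      ∀ p, Φ (substC d k l p) = substC d k l (Θ p) := by
  obtain ⟨e0, e1, e2⟩ := inclXZT_X
  -- When the equation is substituted for `c`, the polynomial `polySc` becomes `-x^d y`. Dividing
  -- the image of `hs` by `-x^d` forces `y ↦ u y - v`.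
  set Φ : MvPolynomial (Fin 4) ℂ →ₐ[ℂ] MvPolynomial (Fin 4) ℂ :=
    aeval ![X 0, substC d k l u * X 1 - substC d k l v, substC d k l (Θ (X 2)),
      substC d k l (Θ (X 3))] with hΦ
  have hΦ1 : Φ (X 1) = substC d k l u * X 1 - substC d k l v := by simp [hΦ]
  have hΦ0 : Φ (X 0) = X 0 := by simp [hΦ]
  have hincl : ∀ p, Φ (inclXZT p) = substC d k l (Θ (inclXZT p)) := by
    intro p
    have : Φ.comp inclXZT = ((substC d k l).comp Θ).comp inclXZT := by
      ext i : 1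
      fin_cases i
      · change Φ (inclXZT (X 0)) = substC d k l (Θ (inclXZT (X 0)))
        rw [e0, h0, hΦ0]
        simp [substC]
      · change Φ (inclXZT (X 1)) = substC d k l (Θ (inclXZT (X 1)))
        rw [e1]
        simp [hΦ]
      · change Φ (inclXZT (X 2)) = substC d k l (Θ (inclXZT (X 2)))
        rw [e2]
        simp [hΦ]
    exact DFunLike.congr_fun this p
  refine ⟨Φ, hΦ1, fun p => ?_⟩
  have : Φ.comp (substC d k l) = (substC d k l).comp Θ := by
    refine algHom_ext_inclXZT (fun i => ?_) ?_
    · rw [AlgHom.comp_apply, AlgHom.comp_apply, substC_inclXZT, hincl]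
    · rw [AlgHom.comp_apply, AlgHom.comp_apply, h1, substC_X_one, defPoly_eq, map_add, map_mul,
        map_pow, hΦ0, hΦ1, hincl]
      have e3 : inclXZT (polyS k l) = polySc k l + X 1 := by rw [polySc]; ring
      rw [e3, map_add, hs, h1, map_add, map_add, map_mul, map_mul, map_pow, substC_polySc,
        substC_X_one, defPoly_eq, e3]
      have e4 : substC d k l (X 0) = X 0 := by simp [substC]
      rw [e4]
      ring
  exact DFunLike.congr_fun this p

/-- As `u` is `1` modulo `x`, its image under the inverse is invertible modulo `x^d`, with inverse a
geometric sum. -/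
theorem exists_symm_expansion {Θ : MvPolynomial (Fin 4) ℂ ≃ₐ[ℂ] MvPolynomial (Fin 4) ℂ}
    (h0 : Θ (X 0) = X 0) {u v s : MvPolynomial (Fin 4) ℂ} (hu : X 0 ∣ u - 1)
    (hs : Θ s = u * s + X 0 ^ d * v) : ∃ u' v', Θ.symm s = u' * s + X 0 ^ d * v' := by
  have h0' : Θ.symm (X 0) = X 0 := by rw [Θ.symm_apply_eq, h0]
  obtain ⟨w, hw⟩ := hu
  have hq : 1 - Θ.symm u = -(X 0 * Θ.symm w) := by
    have := congrArg Θ.symm hw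
    rw [map_sub, map_one, map_mul, h0'] at this
    linear_combination -this
  have hs' := congrArg Θ.symm hs
  rw [Θ.symm_apply_apply, map_add, map_mul, map_mul, map_pow, h0'] at hs'
  have hgeom := mul_neg_geom_sum (1 - Θ.symm u) d
  rw [sub_sub_cancel] at hgeom
  set G := ∑ i ∈ Finset.range d, (1 - Θ.symm u) ^ i
  have hpow : (1 - Θ.symm u) ^ d = X 0 ^ d * (-Θ.symm w) ^ d := by
    rw [hq, ← mul_pow]; congr 1; ring
  rw [hpow] at hgeom
  refine ⟨G, (-Θ.symm w) ^ d * Θ.symm s - G * Θ.symm v, ?_⟩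
  linear_combination -G * hs' - Θ.symm s * hgeom

/-- Since `Θ` fixes `c`, the automorphism of affine 4-space fixes the equation and restricts to the
threefold, where `c = 0`. The formula for `y` serves to check that the origin is fixed. -/
theorem exists_extension {Θ : MvPolynomial (Fin 4) ℂ ≃ₐ[ℂ] MvPolynomial (Fin 4) ℂ}
    (h0 : Θ (X 0) = X 0) (h1 : Θ (X 1) = X 1) {u v : MvPolynomial (Fin 4) ℂ}
    (hu : X 0 ∣ u - 1) (hs : Θ (polySc k l) = u * polySc k l + X 0 ^ d * v)
    {φ : Rxzt ≃ₐ[ℂ] Rxzt} (hφ : ∀ p, φ p = setC (Θ (inclXZT p))) :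
    ∃ ψ : Aut (threefold d k l), Induces ψ φ ∧ Extends ψ ∧ ∀ w : threefold d k l,
      (ψ • w).1 1 = eval (proj w.1) (setC u) * w.1 1 - eval (proj w.1) (setC v) := by
  have h0' : Θ.symm (X 0) = X 0 := by rw [Θ.symm_apply_eq, h0]
  have h1' : Θ.symm (X 1) = X 1 := by rw [Θ.symm_apply_eq, h1]
  obtain ⟨u', v', hs'⟩ := exists_symm_expansion h0 hu hs
  obtain ⟨Φ, hΦ1, hΦ⟩ := exists_extension_hom (Θ := Θ.toAlgHom) h0 h1 hs
  obtain ⟨Φ', hΦ1', hΦ'⟩ := exists_extension_hom (Θ := Θ.symm.toAlgHom) h0' h1' hs'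
  have hX0 : substC d k l (X 0) = X 0 := by simp [substC]
  have hinv : ∀ {Θ₁ Θ₂ Φ₁ Φ₂ : MvPolynomial (Fin 4) ℂ →ₐ[ℂ] MvPolynomial (Fin 4) ℂ},
      (∀ p, Φ₁ (substC d k l p) = substC d k l (Θ₁ p)) →
      (∀ p, Φ₂ (substC d k l p) = substC d k l (Θ₂ p)) → (∀ p, Θ₁ (Θ₂ p) = p) →
      Φ₁.comp Φ₂ = AlgHom.id ℂ _ := by
    intro Θ₁ Θ₂ Φ₁ Φ₂ H1 H2 H
    have e : ∀ p, Φ₁ (Φ₂ (substC d k l p)) = substC d k l p := fun p => by rw [H2, H1, H]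
    have ei : ∀ p, Φ₁ (Φ₂ (inclXZT p)) = inclXZT p := fun p => by
      have := e (inclXZT p)
      rwa [substC_inclXZT] at this
    refine algHom_ext_inclXZT (fun i => ei _) ?_
    rw [AlgHom.comp_apply, AlgHom.id_apply]
    have e2 := e (X 1)
    rw [substC_X_one, defPoly_eq, map_add, map_add, ei, map_mul, map_mul, map_pow, map_pow] at e2
    have e3 := e (X 0)
    rw [hX0] at e3
    rw [e3] at e2
    exact mul_left_cancel₀ (pow_ne_zero d (X_ne_zero 0)) (add_right_cancel e2)
  let Ψ : MvPolynomial (Fin 4) ℂ ≃ₐ[ℂ] MvPolynomial (Fin 4) ℂ := AlgEquiv.ofAlgHom Φ Φ'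
    (hinv hΦ hΦ' Θ.apply_symm_apply) (hinv hΦ' hΦ Θ.symm_apply_apply)
  obtain ⟨ψ, hψ, hext⟩ := exists_aut_of_defPoly (d := d) (k := k) (l := l) (Φ := Ψ) one_ne_zero (by
    have := hΦ (X 1)
    rw [substC_X_one] at this
    rw [C_1, one_mul]
    refine this.trans ?_
    change substC d k l (Θ (X 1)) = _
    rw [h1, substC_X_one])
  refine ⟨ψ, fun p w => ?_, hext, fun w => ?_⟩
  · rw [← eval_inclXZT, hψ, eval_pointMap]
    change eval w.1 (Φ (inclXZT p)) = _
    have := hΦ (inclXZT p)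
    rw [substC_inclXZT] at this
    rw [this, eval_substC, hφ]
    rfl
  · rw [hψ]
    change eval w.1 (Φ (X 1)) = _
    rw [hΦ1, map_sub, map_mul, eval_X, eval_substC, eval_substC]

end Extension

end KorasRussell

namespace KorasRussell

/-! ### First order Hamiltonians of elements of `𝒜_n`. -/

section Hamiltonians

open MvPolynomial

variable {d k l : ℕ}

theorem derivative_cuspHom (k l : ℕ) (ω : ℂ) (p : Rxzt) :
    Polynomial.derivative (cuspHom k l ω p) =
      cuspHom k l ω (pderiv 1 p) * (Polynomial.C (l : ℂ) * Polynomial.X ^ (l - 1)) +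
      cuspHom k l ω (pderiv 2 p) *
        (Polynomial.C ω * (Polynomial.C (k : ℂ) * Polynomial.X ^ (k - 1))) := by
  induction p using MvPolynomial.induction_on with
  | C a =>
    rw [← algebraMap_eq, AlgHom.commutes, Derivation.map_algebraMap, Derivation.map_algebraMap]
    simp
  | add p q hp hq => simp only [map_add, hp, hq]; ring
  | mul_X p i hp =>
    have hX : Polynomial.derivative (cuspHom k l ω (X i)) =
        cuspHom k l ω (pderiv 1 (X i)) * (Polynomial.C (l : ℂ) * Polynomial.X ^ (l - 1)) +
        cuspHom k l ω (pderiv 2 (X i)) *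
          (Polynomial.C ω * (Polynomial.C (k : ℂ) * Polynomial.X ^ (k - 1))) := by
      fin_cases i <;> simp [cuspHom, pderiv_X, Polynomial.derivative_X_pow]
    simp only [map_mul, Derivation.leibniz, Polynomial.derivative_mul, hp, hX, smul_eq_mul, map_add]
    ring

/-- The Hamiltonian field of the cusp equation is tangent to the cusp, so the bracket restricts to a
multiple of the derivative along the curve. Its vanishing there means that `h` is constant on the
cusp. -/
theorem cuspHom_bracket {k l : ℕ} (hk : 0 < k) (hl : 0 < l) {ω : ℂ} (hω : ω ^ l = -1) (h : Rxzt) :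
    cuspHom k l ω (bracket 1 2 h (polyS k l)) = Polynomial.C (ω ^ (l - 1)) *
      Polynomial.X ^ ((k - 1) * (l - 1)) * Polynomial.derivative (cuspHom k l ω h) := by
  obtain ⟨k, rfl⟩ : ∃ k', k = k' + 1 := ⟨k - 1, by omega⟩
  obtain ⟨l, rfl⟩ : ∃ l', l = l' + 1 := ⟨l - 1, by omega⟩
  have e1 : pderiv 1 (polyS (k + 1) (l + 1)) = C ((k + 1 : ℕ) : ℂ) * X 1 ^ k := by
    simp [polyS, pderiv_X, Derivation.leibniz_pow]
  have e2 : pderiv 2 (polyS (k + 1) (l + 1)) = C ((l + 1 : ℕ) : ℂ) * X 2 ^ l := by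
    simp [polyS, pderiv_X, Derivation.leibniz_pow]
  have c1 : cuspHom (k + 1) (l + 1) ω (X 1) = Polynomial.X ^ (l + 1) := by simp [cuspHom]
  have c2 : cuspHom (k + 1) (l + 1) ω (X 2) = Polynomial.C ω * Polynomial.X ^ (k + 1) := by
    simp [cuspHom]
  have c3 : ∀ c, cuspHom (k + 1) (l + 1) ω (C c) = Polynomial.C c := fun c => by simp [cuspHom]
  have hω' : Polynomial.C (ω ^ l) * Polynomial.C ω = -1 := by
    rw [← Polynomial.C_mul, ← pow_succ, hω]; simp
  rw [derivative_cuspHom, bracket, e1, e2, map_sub, map_mul, map_mul, map_mul, map_mul, map_pow,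
    map_pow, c1, c2, c3, c3, mul_pow, ← Polynomial.C_pow]
  simp only [Nat.add_sub_cancel]
  have hx1 : (Polynomial.X : Polynomial ℂ) ^ (k * l) * Polynomial.X ^ l =
      (Polynomial.X ^ (k + 1)) ^ l := by ring
  have hx2 : (Polynomial.X : Polynomial ℂ) ^ (k * l) * Polynomial.X ^ k =
      (Polynomial.X ^ (l + 1)) ^ k := by ring
  rw [← hx1, ← hx2]
  linear_combination (-(cuspHom (k + 1) (l + 1) ω) ((pderiv 2) h) *
    (Polynomial.C ((k + 1 : ℕ) : ℂ) * (Polynomial.X ^ (k * l) * Polynomial.X ^ k))) * hω'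

theorem not_X_dvd_polyS : ¬ (X 0 : Rxzt) ∣ polyS k l := by
  rintro ⟨q, hq⟩
  have := congrArg (eval ![0, 1, 1]) hq
  simp [polyS, one_add_one_eq_two] at this

/-- Elements of `𝒜_n` are, to first order, given by Hamiltonians divisible by `z^k + t^ℓ + x`. -/
theorem exists_first_order_hamiltonian (hk : 2 ≤ k) (hl : 2 ≤ l) (hcop : Nat.Coprime k l)
    {n : ℕ} (hn : 1 ≤ n) (hnd : n < d) {φ : Rxzt ≃ₐ[ℂ] Rxzt} (hφ : φ ∈ groupAn d k l n) :
    ∃ g : Rxzt, ∀ p, X 0 ^ (n + 1) ∣ φ p - p - X 0 ^ n * bracket 1 2 (polyS k l * g) p := by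
  obtain ⟨hA, h0, hid⟩ := hφ
  simp only [Ideal.mem_span_singleton] at hid
  have h12 : (1 : Fin 3) ≠ 2 := by decide
  have hfix : FixesOthers 1 2 φ.toAlgHom := by
    intro m hm hm'
    have : m = 0 := by omega
    rw [this]
    exact h0
  have hxo : (X 0 : Rxzt) ∈ otherVars 1 2 := X_mem_otherVars (by decide) (by decide)
  obtain ⟨a, ha⟩ := hid (X 1)
  obtain ⟨b, hb⟩ := hid (X 2)
  have ea : φ (X 1) = X 1 + X 0 ^ n * a := by rw [← ha]; ring
  have eb : φ (X 2) = X 2 + X 0 ^ n * b := by rw [← hb]; ring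
  have hexp := bracket_perturbation h12 (pow_mem hxo n) a b
  -- the Jacobian determinant is one
  have hJ : bracket 1 2 (φ (X 1)) (φ (X 2)) = 1 := by
    have h := hfix.bracket_apply h12 (φ.symm (X 1)) (φ.symm (X 2))
    change bracket 1 2 (φ (φ.symm (X 1))) (φ (φ.symm (X 2))) =
      _ * bracket 1 2 (φ (X 1)) (φ (X 2)) at h
    rw [φ.apply_symm_apply, φ.apply_symm_apply, (bracket_X h12 _).2, pderiv_X_self] at h
    -- The Jacobian is a unit, hence a constant; evaluation at the origin shows that it is `1`,
    -- because `n ≥ 1`.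
    obtain ⟨j, -, hj⟩ := isUnit_iff_eq_C_of_isReduced.1 (IsUnit.of_mul_eq_one_right _ h.symm)
    rw [hj]
    rw [← ea, ← eb, hj] at hexp
    have := congrArg (eval 0) hexp
    simp [show n ≠ 0 by omega] at this
    rw [this, C_1]
  rw [← ea, ← eb, hJ] at hexp
  have hdiv : pderiv 1 a + pderiv 2 b = -(X 0 ^ n * bracket 1 2 a b) := by
    have : X 0 ^ n * (pderiv 1 a + pderiv 2 b) = X 0 ^ n * -(X 0 ^ n * bracket 1 2 a b) := by
      linear_combination -hexp
    exact mul_left_cancel₀ (pow_ne_zero n (X_ne_zero 0)) this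
  obtain ⟨e, he⟩ : X 0 ∣ pderiv 1 a + pderiv 2 b := by
    rw [hdiv, dvd_neg]; exact (dvd_pow_self _ (by omega)).mul_right _
  obtain ⟨h, h1, h2⟩ := exists_hamiltonian (i := (1 : Fin 3)) (j := 2) h12
    (a := a - X 0 * antideriv 1 e) (b := b) (by
      rw [map_sub, pderiv_mul, (pderiv_of_mem_otherVars hxo).1, pderiv_antideriv]
      linear_combination he)
  have hfirst : ∀ p, X 0 ^ (n + 1) ∣ φ p - p - X 0 ^ n * bracket 1 2 h p := by
    refine first_order (f := φ.toAlgHom) (D := hamiltonian 1 2 h) hn fun c => ?_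
    rw [hamiltonian_apply]
    change X 0 ^ (n + 1) ∣ φ (X c) - X c - _
    fin_cases c
    · change X 0 ^ (n + 1) ∣ φ (X 0) - X 0 - X 0 ^ n * bracket 1 2 h (X 0)
      rw [h0, (bracket_of_mem_otherVars hxo _).2]
      simp
    · change X 0 ^ (n + 1) ∣ φ (X 1) - X 1 - X 0 ^ n * bracket 1 2 h (X 1)
      refine ⟨antideriv 1 e, ?_⟩
      rw [← h1]
      linear_combination ha
    · change X 0 ^ (n + 1) ∣ φ (X 2) - X 2 - X 0 ^ n * bracket 1 2 h (X 2)
      refine ⟨0, ?_⟩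
      rw [← h2]
      linear_combination hb
  -- the Hamiltonian is constant on the cusp
  have hS : polyS k l ∈ idealJ d k l := Ideal.subset_span (by simp [polyS])
  obtain ⟨u, v, huv⟩ := Ideal.mem_span_pair.1 ((hA.2 _).2 hS)
  rw [← polyS] at huv
  -- Compare `φ(S) = u x^d + v S` with the first order expansion of `φ(S)`; the term `u x^d` drops
  -- out because `n < d`.
  have hdvd : X 0 ^ (n + 1) ∣ (v - 1) * polyS k l - X 0 ^ n * bracket 1 2 h (polyS k l) := by
    have e1 : (v - 1) * polyS k l - X 0 ^ n * bracket 1 2 h (polyS k l) =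
        (φ (polyS k l) - polyS k l - X 0 ^ n * bracket 1 2 h (polyS k l)) - u * X 0 ^ d := by
      rw [← huv]; ring
    rw [e1]
    exact dvd_sub (hfirst _) ((pow_dvd_pow _ hnd).mul_left _)
  obtain ⟨e₂, he₂⟩ : X 0 ^ n ∣ v - 1 := by
    have h3 : X 0 ^ n ∣ (v - 1) * polyS k l := by
      have := (pow_dvd_pow (X 0 : Rxzt) (Nat.le_succ n)).trans hdvd
      exact (dvd_sub_left (Dvd.intro _ rfl)).1 this
    exact X_prime.pow_dvd_of_dvd_mul_right n not_X_dvd_polyS h3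
  obtain ⟨ω, hω, hω0⟩ := exists_pow_eq_neg_one (show 0 < l by omega)
  have hcS : cuspHom k l ω (polyS k l) = 0 := by
    have := cuspHom_cusp (k := k) hω
    rw [polyS, map_add, this, zero_add]
    simp [cuspHom]
  have hcb : cuspHom k l ω (bracket 1 2 h (polyS k l)) = 0 := by
    have h4 : X 0 ∣ e₂ * polyS k l - bracket 1 2 h (polyS k l) := by
      rw [he₂, mul_assoc, ← mul_sub, pow_succ] at hdvd
      exact (mul_dvd_mul_iff_left (pow_ne_zero n (X_ne_zero 0))).1 hdvd
    obtain ⟨q, hq⟩ := h4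
    have h5 := congrArg (cuspHom k l ω) hq
    rw [map_sub, map_mul, map_mul, hcS] at h5
    have h6 : cuspHom k l ω (X 0) = 0 := by simp [cuspHom]
    rw [h6, mul_zero, zero_mul, zero_sub, neg_eq_zero] at h5
    exact h5
  rw [cuspHom_bracket (by omega) (by omega) hω] at hcb
  have hder : Polynomial.derivative (cuspHom k l ω h) = 0 := by
    refine (mul_eq_zero.1 hcb).resolve_left (mul_ne_zero ?_ (pow_ne_zero _ Polynomial.X_ne_zero))
    rw [Ne, Polynomial.C_eq_zero]
    exact pow_ne_zero _ hω0
  have hconst := Polynomial.eq_C_of_natDegree_eq_zero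
    (Polynomial.derivative_eq_zero.1 hder)
  set c₀ := (cuspHom k l ω h).coeff 0
  have hmem := cuspHom_eq_zero (p := h - C c₀) (by omega) hcop hω0 (cuspHom_cusp hω) (by
    rw [map_sub, hconst]
    simp [cuspHom])
  -- Up to a constant `h` lies in `(x, z^k + t^l)`. Writing `z^k + t^l = S - x` replaces `h` by `S
  -- g` up to multiples of `x`, which are invisible at order `n`.
  obtain ⟨a₁, g, hg⟩ := Ideal.mem_span_pair.1 hmem
  refine ⟨g, fun p => ?_⟩
  have hbr : bracket 1 2 h p - bracket 1 2 (polyS k l * g) p =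
      X 0 * (bracket 1 2 a₁ p - bracket 1 2 g p) := by
    have e1 : h = C c₀ + X 0 * a₁ + (polyS k l * g - X 0 * g) := by
      rw [polyS]; linear_combination -hg
    have e2 : bracket 1 2 h p = X 0 * bracket 1 2 a₁ p +
        bracket 1 2 (polyS k l * g) p - X 0 * bracket 1 2 g p := by
      conv_lhs => rw [e1]
      rw [sub_eq_add_neg, ← mul_neg, bracket_add_left, bracket_add_left, bracket_add_left,
        bracket_C_left, bracket_smul_left hxo, bracket_smul_left hxo, ← neg_one_mul g,
        bracket_smul_left (neg_mem (one_mem _))]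
      ring
    rw [e2]; ring
  have e3 : φ p - p - X 0 ^ n * bracket 1 2 (polyS k l * g) p =
      (φ p - p - X 0 ^ n * bracket 1 2 h p) + X 0 ^ (n + 1) *
        (bracket 1 2 a₁ p - bracket 1 2 g p) := by
    rw [pow_succ]
    linear_combination X 0 ^ n * hbr
  rw [e3]
  exact dvd_add (hfirst p) (Dvd.intro _ rfl)

end Hamiltonians

end KorasRussell

namespace KorasRussell

/-! ### Realising Hamiltonians and extending the elements of `𝒜₁`. -/

section UnipotentExtension

open MvPolynomial

variable {d k l : ℕ}

/-- Automorphisms of `ℂ[x, c, z, t]` fixing `x` and `c` induce automorphisms of `ℂ[x, z, t]`. -/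
theorem exists_specialization {Θ : MvPolynomial (Fin 4) ℂ ≃ₐ[ℂ] MvPolynomial (Fin 4) ℂ}
    (h1 : Θ (X 1) = X 1) : ∃ φ : Rxzt ≃ₐ[ℂ] Rxzt, ∀ p, φ (setC p) = setC (Θ p) := by
  have key : ∀ Θ : MvPolynomial (Fin 4) ℂ →ₐ[ℂ] MvPolynomial (Fin 4) ℂ, Θ (X 1) = X 1 →
      ∃ f : Rxzt →ₐ[ℂ] Rxzt, ∀ p, f (setC p) = setC (Θ p) := by
    intro Θ h1
    refine ⟨(setC.comp Θ).comp inclXZT, fun p => ?_⟩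
    have : (((setC.comp Θ).comp inclXZT).comp setC) = setC.comp Θ := by
      refine algHom_ext_inclXZT (fun i => ?_) ?_
      · simp only [AlgHom.comp_apply, setC_inclXZT]
      · simp only [AlgHom.comp_apply, setC_X_one, map_zero, h1]
    exact DFunLike.congr_fun this p
  obtain ⟨f, hf⟩ := key Θ.toAlgHom h1
  obtain ⟨f', hf'⟩ := key Θ.symm.toAlgHom (by
    change Θ.symm (X 1) = X 1
    rw [Θ.symm_apply_eq, h1])
  refine ⟨AlgEquiv.ofAlgHom f f' (AlgHom.ext fun p => ?_) (AlgHom.ext fun p => ?_), hf⟩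
  · rw [← setC_inclXZT p, AlgHom.comp_apply, hf', hf]
    exact congrArg setC (Θ.apply_symm_apply _)
  · rw [← setC_inclXZT p, AlgHom.comp_apply, hf, hf']
    exact congrArg setC (Θ.symm_apply_apply _)

/-- Automorphisms of `ℂ[x, z, t]` extend to `ℂ[x, c, z, t]`. -/
theorem exists_prolongation (φ : Rxzt ≃ₐ[ℂ] Rxzt) :
    ∃ Θ : MvPolynomial (Fin 4) ℂ ≃ₐ[ℂ] MvPolynomial (Fin 4) ℂ, Θ (X 1) = X 1 ∧
      ∀ p, Θ (inclXZT p) = inclXZT (φ p) := by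
  have key : ∀ φ : Rxzt →ₐ[ℂ] Rxzt, ∃ f : MvPolynomial (Fin 4) ℂ →ₐ[ℂ] MvPolynomial (Fin 4) ℂ,
      f (X 1) = X 1 ∧ ∀ p, f (inclXZT p) = inclXZT (φ p) := by
    intro φ
    obtain ⟨e0, e1, e2⟩ := inclXZT_X
    refine ⟨aeval ![inclXZT (φ (X 0)), X 1, inclXZT (φ (X 1)), inclXZT (φ (X 2))], by simp,
      fun p => ?_⟩
    have : (aeval ![inclXZT (φ (X 0)), X 1, inclXZT (φ (X 1)), inclXZT (φ (X 2))] :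
        MvPolynomial (Fin 4) ℂ →ₐ[ℂ] MvPolynomial (Fin 4) ℂ).comp inclXZT = inclXZT.comp φ := by
      ext i : 1
      fin_cases i
      · change aeval _ (inclXZT (X 0)) = _
        rw [e0, aeval_X]; rfl
      · change aeval _ (inclXZT (X 1)) = _
        rw [e1, aeval_X]; rfl
      · change aeval _ (inclXZT (X 2)) = _
        rw [e2, aeval_X]; rfl
    exact DFunLike.congr_fun this p
  obtain ⟨f, hf1, hf⟩ := key φ.toAlgHom
  obtain ⟨f', hf1', hf'⟩ := key φ.symm.toAlgHom
  refine ⟨AlgEquiv.ofAlgHom f f' ?_ ?_, hf1, hf⟩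
  · refine algHom_ext_inclXZT (fun i => ?_) ?_
    · rw [AlgHom.comp_apply, hf', hf]
      exact congrArg inclXZT (φ.apply_symm_apply _)
    · rw [AlgHom.comp_apply, hf1', hf1]; rfl
  · refine algHom_ext_inclXZT (fun i => ?_) ?_
    · rw [AlgHom.comp_apply, hf, hf']
      exact congrArg inclXZT (φ.symm_apply_apply _)
    · rw [AlgHom.comp_apply, hf1, hf1']; rfl

/-- Automorphisms of `ℂ[x, z, t]` over `ℂ[x]` that fix `z^k + t^ℓ + x` modulo `x^d` come from
the threefold. -/
theorem exists_aut_of_congr {φ : Rxzt ≃ₐ[ℂ] Rxzt} (h0 : φ (X 0) = X 0) {w : Rxzt}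
    (hw : φ (polyS k l) = polyS k l + X 0 ^ d * w) :
    ∃ ψ : Aut (threefold d k l), Induces ψ φ ∧ Extends ψ ∧ ∀ v : threefold d k l,
      (ψ • v).1 1 = v.1 1 - eval (proj v.1) w := by
  obtain ⟨Θ, h1, hΘ⟩ := exists_prolongation φ
  have hX0 : Θ (X 0) = X 0 := by rw [← inclXZT_X.1, hΘ, h0]
  have hs : Θ (polySc k l) = 1 * polySc k l + X 0 ^ d * inclXZT w := by
    rw [polySc, map_sub, hΘ, h1, hw, map_add, map_mul, map_pow, inclXZT_X.1]; ring
  obtain ⟨ψ, hI, hE, hy⟩ := exists_extension (d := d) hX0 h1 (by simp) hs (φ := φ)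
    (fun p => by rw [hΘ, setC_inclXZT])
  refine ⟨ψ, hI, hE, fun v => ?_⟩
  rw [hy, map_one, map_one, one_mul, setC_inclXZT]

/-- The exponent is at least two, so the cofactor vanishes at the origin. This cofactor is the shift
of `y`, and its vanishing keeps the origin fixed. -/
theorem exists_pow_add_eq {n m : ℕ} (hn : 2 ≤ n) (hm : 1 ≤ m) {z : Rxzt} (hz : eval 0 z = 0)
    (a : Rxzt) : ∃ w, eval 0 w = 0 ∧ (z + X 0 ^ m * a) ^ n = z ^ n + X 0 ^ m * w := by
  refine ⟨a * ∑ i ∈ Finset.range n, (z + X 0 ^ m * a) ^ i * z ^ (n - 1 - i), ?_, ?_⟩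
  · rw [map_mul, map_sum, Finset.sum_eq_zero, mul_zero]
    intro i hi
    rw [Finset.mem_range] at hi
    rw [map_mul, map_pow, map_pow, map_add, map_mul, map_pow, hz]
    rcases Nat.eq_zero_or_pos i with rfl | h
    · simp [show n - 1 ≠ 0 by omega]
    · simp [h.ne', show m ≠ 0 by omega]
  · have := (Commute.all (z + X 0 ^ m * a) z).geom_sum₂_mul n
    rw [add_sub_cancel_left] at this
    linear_combination -this

theorem eq_zero_of_induces {ψ : Aut (threefold d k l)} {φ : Rxzt ≃ₐ[ℂ] Rxzt} (hI : Induces ψ φ)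
    (hφ : ∀ p, X 0 ∣ φ p - p) {v : threefold d k l} (hv : v.1 = 0) (hy : (ψ • v).1 1 = 0) :
    (ψ • v).1 = 0 := by
  have hp : ∀ i, proj (ψ • v).1 i = 0 := by
    intro i
    have h1 := hI (X i) v
    obtain ⟨q, hq⟩ := hφ (X i)
    have hpv : proj v.1 = 0 := by
      rw [hv]; funext i; fin_cases i <;> rfl
    have h2 := congrArg (eval (proj v.1)) hq
    rw [map_sub, map_mul, ← h1, eval_X, eval_X, eval_X, hpv] at h2
    simpa using h2
  funext i
  fin_cases i
  exacts [hp 0, hy, hp 1, hp 2]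

theorem bracket_inclXZT (p q : Rxzt) :
    bracket 2 3 (inclXZT p) (inclXZT q) = inclXZT (bracket 1 2 p q) := by
  have hinj : Function.Injective (![0, 2, 3] : Fin 3 → Fin 4) := by decide
  have h1 : ∀ p, pderiv 2 (inclXZT p) = inclXZT (pderiv 1 p) := fun p =>
    pderiv_rename hinj (1 : Fin 3) p
  have h2 : ∀ p, pderiv 3 (inclXZT p) = inclXZT (pderiv 2 p) := fun p =>
    pderiv_rename hinj (2 : Fin 3) p
  simp only [bracket, h1, h2, map_sub, map_mul]

/-- Every Hamiltonian divisible by `z^k + t^ℓ + x` is, to first order, given by automorphisms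
of the threefold. -/
theorem exists_aut_of_hamiltonian (g : Rxzt) {n : ℕ} (hn : 1 ≤ n) (hnd : n ≤ d) :
    ∃ (ψ : Aut (threefold d k l)) (φ : Rxzt ≃ₐ[ℂ] Rxzt), φ (X 0) = X 0 ∧ Induces ψ φ ∧
      Extends ψ ∧ (∀ v : threefold d k l, v.1 = 0 → (ψ • v).1 = 0) ∧
      ∀ p, X 0 ^ (n + 1) ∣ φ p - p - X 0 ^ n * bracket 1 2 (polyS k l * g) p := by
  -- The exponential is taken with `N = d`, hence modulo `x^(d+1)` rather than `x^d`. The remainder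
  -- is then `x^d` times a multiple of `x`, so `y` is not shifted at `x = 0`.
  obtain ⟨Θ, hΘ, hfirst, u, v, huv⟩ := exists_exponential (i := (2 : Fin 4)) (j := 3) (x := 0)
    (by decide) (by decide) (by decide) (polySc k l) (inclXZT g) hn hnd
  have h0 : Θ (X 0) = X 0 := poissonGroup_X hΘ (by decide) (by decide)
  have h1 : Θ (X 1) = X 1 := poissonGroup_X hΘ (by decide) (by decide)
  have hid : ∀ p, X 0 ∣ Θ p - p := by
    intro p
    have h2 := (dvd_pow_self (X 0 : MvPolynomial (Fin 4) ℂ) (Nat.succ_ne_zero n)).trans (hfirst p)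
    exact (dvd_sub_left ((dvd_pow_self _ (by omega)).mul_right _)).1 h2
  have hs : Θ (polySc k l) = u * polySc k l + X 0 ^ d * (X 0 * v) := by
    rw [pow_succ] at huv
    linear_combination huv
  -- Modulo `x` the automorphism is the identity, and `x` is a prime not dividing `polySc`.
  have hu : X 0 ∣ u - 1 := by
    have h2 : X 0 ∣ (u - 1) * polySc k l := by
      have e : (u - 1) * polySc k l = (Θ (polySc k l) - polySc k l) - X 0 * (X 0 ^ d * v) := by
        rw [hs]; ring
      rw [e]
      exact dvd_sub (hid _) (Dvd.intro _ rfl)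
    refine (X_prime.dvd_or_dvd h2).resolve_right ?_
    rintro ⟨q, hq⟩
    have := congrArg setC hq
    rw [polySc, map_sub, setC_inclXZT, setC_X_one, sub_zero, map_mul] at this
    refine not_X_dvd_polyS (k := k) (l := l) ⟨setC q, ?_⟩
    rw [this]
    simp [setC]
  obtain ⟨φ, hφ⟩ := exists_specialization h1
  have hX0 : setC (X 0) = X 0 := by simp [setC]
  have hφ0 : φ (X 0) = X 0 := by rw [← hX0, hφ, h0]
  obtain ⟨ψ, hI, hE, hy⟩ := exists_extension h0 h1 hu hs (φ := φ) fun p => by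
    rw [← hφ, setC_inclXZT]
  have hφid : ∀ p, X 0 ^ (n + 1) ∣ φ p - p - X 0 ^ n * bracket 1 2 (polyS k l * g) p := by
    intro p
    have h2 := map_dvd setC (hfirst (inclXZT p))
    rw [map_sub, map_sub, ← hφ, setC_inclXZT, map_mul, map_pow, map_pow, hX0] at h2
    have e : setC (bracket 2 3 (polySc k l * inclXZT g) (inclXZT p)) =
        bracket 1 2 (polyS k l * g) p := by
      have hX1 : (X 1 : MvPolynomial (Fin 4) ℂ) ∈ otherVars 2 3 :=
        X_mem_otherVars (by decide) (by decide)
      have e1 : polySc k l * inclXZT g = inclXZT (polyS k l * g) + X 1 * (-inclXZT g) := by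
        rw [polySc, map_mul]; ring
      rw [e1, bracket_add_left, bracket_smul_left hX1, map_add, map_mul setC,
        setC_X_one, zero_mul, add_zero, bracket_inclXZT, setC_inclXZT]
    rwa [e] at h2
  refine ⟨ψ, φ, hφ0, hI, hE, fun w hw => ?_, hφid⟩
  refine eq_zero_of_induces hI (fun p => ?_) hw ?_
  · have h2 := (dvd_pow_self (X 0 : Rxzt) (Nat.succ_ne_zero n)).trans (hφid p)
    exact (dvd_sub_left ((dvd_pow_self _ (by omega)).mul_right _)).1 h2
  · have hp0 : proj w.1 0 = 0 := by rw [hw]; rfl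
    have hw1 : w.1 1 = 0 := by rw [hw]; rfl
    rw [hy, hw1, mul_zero, map_mul, hX0, map_mul, eval_X, hp0, zero_mul, sub_zero]

/-- Unipotent automorphisms of the threefold extend to affine space and fix the origin. -/
theorem extends_and_fixes (hd : 1 ≤ d) (hk : 2 ≤ k) (hl : 2 ≤ l) (hcop : Nat.Coprime k l)
    {n : ℕ} (hn : 1 ≤ n) (hnd : n ≤ d) {ψ : Aut (threefold d k l)} (hψ : ψ ∈ subgroupA d k l n) :
    Extends ψ ∧ ∀ v : threefold d k l, v.1 = 0 → (ψ • v).1 = 0 := by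
  -- Below `d`, dividing by an automorphism with the same first order Hamiltonian passes from `n` to
  -- `n + 1`. At `n = d` the polynomial `S` is fixed modulo `x^d`, and the extension merely shifts
  -- `y`.
  induction hm : d - n generalizing n ψ with
  | zero =>
    obtain rfl : n = d := by omega
    obtain ⟨φ, ⟨hA, h0, hid⟩, hI⟩ := hψ
    simp only [Ideal.mem_span_singleton] at hid
    obtain ⟨a, ha⟩ := hid (X 1)
    obtain ⟨b, hb⟩ := hid (X 2)
    obtain ⟨w₁, hw₁, hz⟩ := exists_pow_add_eq hk hd (z := X 1) (by simp) a
    obtain ⟨w₂, hw₂, ht⟩ := exists_pow_add_eq hl hd (z := X 2) (by simp) b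
    rw [← ha, add_sub_cancel] at hz
    rw [← hb, add_sub_cancel] at ht
    obtain ⟨ψ', hI', hE, hy⟩ := exists_aut_of_congr (d := n) (k := k) (l := l) (φ := φ) h0
      (w := w₁ + w₂) (by
        rw [polyS, map_add, map_add, map_pow, map_pow, hz, ht, h0]; ring)
    obtain rfl : ψ = ψ' := induces_injective hd one_ne_zero (by rw [h0, C_1, one_mul]) hI hI'
    refine ⟨hE, fun v hv => eq_zero_of_induces hI
      (fun p => (dvd_pow_self _ (by omega)).trans (hid p)) hv ?_⟩
    have hpv : proj v.1 = 0 := by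
      rw [hv]; funext i; fin_cases i <;> rfl
    rw [hy, hpv, hv, map_add, hw₁, hw₂]; simp
  | succ m ih =>
    have hnd' : n < d := by omega
    obtain ⟨φ, hφ, hI⟩ := hψ
    obtain ⟨g, hg⟩ := exists_first_order_hamiltonian hk hl hcop hn hnd' hφ
    obtain ⟨ψ', φ', h0', hI', hE', hfix', hφ'⟩ := exists_aut_of_hamiltonian (d := d) (k := k)
      (l := l) g hn (le_of_lt hnd')
    have hinv0 : φ'⁻¹ (X 0) = X 0 := by
      change φ'.symm (X 0) = X 0
      rw [φ'.symm_apply_eq, h0']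
    have hmem : ψ * ψ'⁻¹ ∈ subgroupA d k l (n + 1) := by
      refine ⟨φ'⁻¹ * φ, ⟨?_, ?_, fun p => ?_⟩, hI.mul hI'.inv⟩
      · obtain ⟨φ'', hA'', hI'', -⟩ := exists_induces (by omega) hk hl hcop ψ'
        rw [induces_unique hI' hI'']
        exact mul_mem (inv_mem hA'') hφ.1
      · rw [AlgEquiv.mul_apply, hφ.2.1, hinv0]
      · rw [Ideal.mem_span_singleton, AlgEquiv.mul_apply]
        have h1 : X 0 ^ (n + 1) ∣ φ p - φ' p := by
          have := dvd_sub (hg p) (hφ' p)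
          have e : φ p - p - X 0 ^ n * bracket 1 2 (polyS k l * g) p -
            (φ' p - p - X 0 ^ n * bracket 1 2 (polyS k l * g) p) = φ p - φ' p := by ring
          rwa [e] at this
        have h2 := dvd_apply_of_fixes (Θ := φ'⁻¹) hinv0 h1
        rw [map_sub] at h2
        have e : φ'⁻¹ (φ' p) = p := φ'.symm_apply_apply p
        rwa [e] at h2
    obtain ⟨hE, hfix⟩ := ih (n := n + 1) (by omega) (by omega) hmem (by omega)
    have e : ψ = ψ * ψ'⁻¹ * ψ' := by group
    rw [e]
    refine ⟨hE.mul hE', fun v hv => ?_⟩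
    rw [mul_smul]
    exact hfix _ (hfix' v hv)

end UnipotentExtension

end KorasRussell

namespace KorasRussell

/-! ### The torus splitting the character. -/

section Torus

open MvPolynomial

variable {d k l : ℕ}

/-- Rescaling of the variables. -/
theorem exists_scaling {n : ℕ} {w : Fin n → ℂ} (hw : ∀ i, w i ≠ 0) :
    ∃ Φ : MvPolynomial (Fin n) ℂ ≃ₐ[ℂ] MvPolynomial (Fin n) ℂ, ∀ i, Φ (X i) = C (w i) * X i := by
  have hC : ∀ (f : MvPolynomial (Fin n) ℂ →ₐ[ℂ] MvPolynomial (Fin n) ℂ) (a : ℂ), f (C a) = C a :=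
    fun f a => f.commutes a
  refine ⟨AlgEquiv.ofAlgHom (aeval fun i => C (w i) * X i) (aeval fun i => C (w i)⁻¹ * X i)
    (MvPolynomial.algHom_ext fun i => ?_) (MvPolynomial.algHom_ext fun i => ?_),
    fun i => aeval_X _ _⟩
  · rw [AlgHom.comp_apply, aeval_X, map_mul, hC, aeval_X, ← mul_assoc, ← C_mul,
      inv_mul_cancel₀ (hw i), C_1, one_mul]; rfl
  · rw [AlgHom.comp_apply, aeval_X, map_mul, hC, aeval_X, ← mul_assoc, ← C_mul,
      mul_inv_cancel₀ (hw i), C_1, one_mul]; rfl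

/-- The weights `kl`, `-kl(d-1)`, `l`, `k` of `x, y, z, t` make the equation homogeneous of weight
`kl`. -/
theorem exists_torus (hd : 2 ≤ d) (hk : 2 ≤ k) (hl : 2 ≤ l) (hcop : Nat.Coprime k l) {α : ℂ}
    (hα : α ≠ 0) : ∃ ψ : Aut (threefold d k l), HasChar ψ α ∧ Extends ψ ∧
      ∀ v : threefold d k l, (ψ • v).1 = ![α ^ (k * l) * v.1 0, (α ^ (k * l * (d - 1)))⁻¹ * v.1 1,
        α ^ l * v.1 2, α ^ k * v.1 3] := by
  obtain ⟨Φ, hΦ⟩ := exists_scaling (w := ![α ^ (k * l), (α ^ (k * l * (d - 1)))⁻¹, α ^ l, α ^ k])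
    (by intro i; fin_cases i <;> simp [hα])
  have h0 : Φ (X 0) = C (α ^ (k * l)) * X 0 := hΦ 0
  have h1 : Φ (X 1) = C (α ^ (k * l * (d - 1)))⁻¹ * X 1 := hΦ 1
  have h2 : Φ (X 2) = C (α ^ l) * X 2 := hΦ 2
  have h3 : Φ (X 3) = C (α ^ k) * X 3 := hΦ 3
  have hP : Φ (defPoly d k l) = C (α ^ (k * l)) * defPoly d k l := by
    rw [defPoly, map_add, map_add, map_add, map_mul, map_pow, map_pow, map_pow, h0, h1, h2, h3]
    have e1 : (C (α ^ (k * l)) : MvPolynomial (Fin 4) ℂ) ^ d * C (α ^ (k * l * (d - 1)))⁻¹ =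
        C (α ^ (k * l)) := by
      rw [← C_pow, ← C_mul]
      congr 1
      obtain ⟨d, rfl⟩ : ∃ d', d = d' + 1 := ⟨d - 1, by omega⟩
      rw [Nat.add_sub_cancel, ← pow_mul, mul_add, pow_add, mul_one]
      field_simp
    have e2 : (C (α ^ l) : MvPolynomial (Fin 4) ℂ) ^ k = C (α ^ (k * l)) := by
      rw [← C_pow, ← pow_mul, mul_comm]
    have e3 : (C (α ^ k) : MvPolynomial (Fin 4) ℂ) ^ l = C (α ^ (k * l)) := by
      rw [← C_pow, ← pow_mul]
    rw [mul_pow, mul_pow, mul_pow, e2, e3]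
    linear_combination X 0 ^ d * X 1 * e1
  obtain ⟨ψ, hψ, hE⟩ := exists_aut_of_defPoly (pow_ne_zero (k * l) hα) hP
  have hv : ∀ v : threefold d k l, (ψ • v).1 = ![α ^ (k * l) * v.1 0,
      (α ^ (k * l * (d - 1)))⁻¹ * v.1 1, α ^ l * v.1 2, α ^ k * v.1 3] := by
    intro v
    rw [hψ]
    funext i
    change eval v.1 (Φ (X i)) = _
    rw [hΦ i]
    fin_cases i <;> simp
  refine ⟨ψ, ⟨hα, ?_⟩, hE, hv⟩
  obtain ⟨φ, hA, hI, -⟩ := exists_induces hd hk hl hcop ψ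
  have key : ∀ (i : Fin 3) (c : ℂ), (∀ v : threefold d k l, proj (ψ • v).1 i = c * proj v.1 i) →
      φ (X i) = C c * X i := by
    intro i c h
    rw [← sub_eq_zero]
    refine eq_zero_of_eval_eq_zero (d := d) (k := k) (l := l) fun v hv _ => ?_
    rw [map_sub, ← hI (X i) ⟨v, hv⟩, eval_X, h, map_mul, eval_C, eval_X, sub_self]
  have k0 := key 0 (α ^ (k * l)) fun v => by rw [hv]; rfl
  have k1 := key 1 (α ^ l) fun v => by rw [hv]; rfl
  have k2 := key 2 (α ^ k) fun v => by rw [hv]; rfl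
  refine ⟨φ, hA, hI, k0, ?_, ?_⟩
  · rw [k1]; simp [modX]
  · rw [k2]; simp [modX]

theorem hasChar_one : HasChar (1 : Aut (threefold d k l)) 1 :=
  hasChar_one_iff.2 (one_mem _)

theorem HasChar.inv (hd : 2 ≤ d) (hk : 2 ≤ k) (hkl : k < l) (hcop : Nat.Coprime k l)
    {ψ : Aut (threefold d k l)} {α : ℂ} (h : HasChar ψ α) : HasChar ψ⁻¹ α⁻¹ := by
  obtain ⟨β, hβ⟩ := exists_hasChar hd hk hkl hcop ψ⁻¹
  have h1 := h.mul hβ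
  rw [mul_inv_cancel] at h1
  have h2 := h1.unique hcop hasChar_one
  rwa [← eq_inv_of_mul_eq_one_right h2]

/-- Automorphisms of the threefold extend to affine space and fix the origin. -/
theorem extends_and_fixes_of_aut (hd : 2 ≤ d) (hk : 2 ≤ k) (hkl : k < l) (hcop : Nat.Coprime k l)
    (ψ : Aut (threefold d k l)) :
    Extends ψ ∧ ∀ v : threefold d k l, v.1 = 0 → (ψ • v).1 = 0 := by
  obtain ⟨α, hα⟩ := exists_hasChar hd hk hkl hcop ψ
  obtain ⟨τ, hτ, hE, hv⟩ := exists_torus hd hk (by omega) hcop hα.1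
  -- Dividing by the torus element with the same character leaves an element of `𝒜₁`.
  have h1 : HasChar (ψ * τ⁻¹) 1 := by
    have := hα.mul (hτ.inv hd hk hkl hcop)
    rwa [mul_inv_cancel₀ hα.1] at this
  obtain ⟨hE', hfix⟩ := extends_and_fixes (by omega) hk (by omega) hcop le_rfl (by omega)
    (hasChar_one_iff.1 h1)
  have e : ψ = ψ * τ⁻¹ * τ := by group
  rw [e]
  refine ⟨hE'.mul hE, fun v hv0 => ?_⟩
  rw [mul_smul]
  refine hfix _ ?_
  rw [hv, hv0]
  funext i
  fin_cases i <;> simp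

end Torus

/-! ### Transitivity on the strata. -/

section Strata

open MvPolynomial

variable {d k l : ℕ}

/-- Adding multiples of `x^d` to `z` and `t` changes `z^k + t^l` by a multiple of `x^d`, which `y`
absorbs. At `x = 0` only the first derivatives of `z^k` and `t^l` remain in the shift of `y`. -/
theorem exists_translation (hd : 1 ≤ d) (a b : ℂ) : ∃ ψ : Aut (threefold d k l),
    ∀ v : threefold d k l, (ψ • v).1 0 = v.1 0 ∧ (ψ • v).1 2 = v.1 2 + a * v.1 0 ^ d ∧
      (ψ • v).1 3 = v.1 3 + b * v.1 0 ^ d ∧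
      (v.1 0 = 0 → (ψ • v).1 1 = v.1 1 - a * (k * v.1 2 ^ (k - 1)) -
        b * (l * v.1 3 ^ (l - 1))) := by
  let f : ℂ → ℂ → Rxzt →ₐ[ℂ] Rxzt := fun a b =>
    aeval ![X 0, X 1 + C a * X 0 ^ d, X 2 + C b * X 0 ^ d]
  have hcomp : ∀ a b a' b', a + a' = 0 → b + b' = 0 →
      (f a b).comp (f a' b') = AlgHom.id ℂ _ := by
    intro a b a' b' ha hb
    have hC : ∀ c, f a b (C c) = C c := (f a b).commutes
    have h0 : ∀ a b, f a b (X 0) = X 0 := fun a b => by simp [f]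
    have h1 : ∀ a b, f a b (X 1) = X 1 + C a * X 0 ^ d := fun a b => by simp [f]
    have h2 : ∀ a b, f a b (X 2) = X 2 + C b * X 0 ^ d := fun a b => by simp [f]
    have ha' : (C a : Rxzt) + C a' = 0 := by rw [← C_add, ha, C_0]
    have hb' : (C b : Rxzt) + C b' = 0 := by rw [← C_add, hb, C_0]
    refine MvPolynomial.algHom_ext fun i => ?_
    fin_cases i
    · change f a b (f a' b' (X 0)) = X 0
      rw [h0, h0]
    · change f a b (f a' b' (X 1)) = X 1
      rw [h1, map_add, map_mul, map_pow, h0, h1, hC]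
      linear_combination X 0 ^ d * ha'
    · change f a b (f a' b' (X 2)) = X 2
      rw [h2, map_add, map_mul, map_pow, h0, h2, hC]
      linear_combination X 0 ^ d * hb'
  let φ : Rxzt ≃ₐ[ℂ] Rxzt := AlgEquiv.ofAlgHom (f a b) (f (-a) (-b))
    (hcomp _ _ _ _ (by ring) (by ring)) (hcomp _ _ _ _ (by ring) (by ring))
  have h0 : φ (X 0) = X 0 := by change f a b (X 0) = _; simp [f]
  have h1 : φ (X 1) = X 1 + C a * X 0 ^ d := by change f a b (X 1) = _; simp [f]
  have h2 : φ (X 2) = X 2 + C b * X 0 ^ d := by change f a b (X 2) = _; simp [f]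
  have hpow : ∀ (n : ℕ) (z h : Rxzt), (z + h) ^ n =
      z ^ n + h * ∑ i ∈ Finset.range n, (z + h) ^ i * z ^ (n - 1 - i) := by
    intro n z h
    have := (Commute.all (z + h) z).geom_sum₂_mul n
    rw [add_sub_cancel_left] at this
    linear_combination -this
  obtain ⟨ψ, hI, -, hy⟩ := exists_aut_of_congr (d := d) (k := k) (l := l) h0
    (w := C a * (∑ i ∈ Finset.range k, (X 1 + C a * X 0 ^ d) ^ i * X 1 ^ (k - 1 - i)) +
      C b * (∑ i ∈ Finset.range l, (X 2 + C b * X 0 ^ d) ^ i * X 2 ^ (l - 1 - i))) (by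
    rw [polyS, map_add, map_add, map_pow, map_pow, h0, h1, h2, hpow k, hpow l]
    ring)
  refine ⟨ψ, fun v => ⟨?_, ?_, ?_, fun hv => ?_⟩⟩
  · have := hI (X 0) v
    rw [h0] at this
    simpa [proj] using this
  · have := hI (X 1) v
    rw [h1] at this
    simpa [proj] using this
  · have := hI (X 2) v
    rw [h2] at this
    simpa [proj] using this
  · have hsum : ∀ (n : ℕ) (z : ℂ), ∑ i ∈ Finset.range n, z ^ i * z ^ (n - 1 - i) =
        n * z ^ (n - 1) := by
      intro n z
      rw [Finset.sum_congr rfl (g := fun _ => z ^ (n - 1)), Finset.sum_const, Finset.card_range,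
        nsmul_eq_mul]
      intro i hi
      rw [Finset.mem_range] at hi
      rw [← pow_add]; congr 1; omega
    rw [hy]
    simp only [map_add, map_mul, map_sum, map_pow, eval_C, eval_X, proj, Matrix.cons_val, hv,
      zero_pow (show d ≠ 0 by omega), mul_zero, add_zero, hsum]
    ring

/-- The torus adjusts `x` through a `kl`-th root, a translation adjusts `z` and `t`, and the
equation determines `y`. -/
theorem openStratum_transitive (hd : 2 ≤ d) (hk : 2 ≤ k) (hl : 2 ≤ l) (hcop : Nat.Coprime k l)
    {v w : threefold d k l} (hv : v.1 0 ≠ 0) (hw : w.1 0 ≠ 0) :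
    ∃ ψ : Aut (threefold d k l), ψ • v = w := by
  obtain ⟨α, hα⟩ := IsAlgClosed.exists_pow_nat_eq (w.1 0 / v.1 0) (n := k * l)
    (Nat.mul_pos (by omega) (by omega))
  have hα0 : α ≠ 0 := by
    rintro rfl
    rw [zero_pow (Nat.mul_ne_zero (by omega) (by omega))] at hα
    exact div_ne_zero hw hv hα.symm
  obtain ⟨τ, -, -, hτ⟩ := exists_torus hd hk hl hcop hα0
  have hτ0 : (τ • v).1 0 = w.1 0 := by
    rw [hτ]
    change α ^ (k * l) * v.1 0 = _
    rw [hα, div_mul_cancel₀ _ hv]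
  obtain ⟨ψ, hψ⟩ := exists_translation (d := d) (k := k) (l := l) (by omega)
    ((w.1 2 - (τ • v).1 2) / w.1 0 ^ d) ((w.1 3 - (τ • v).1 3) / w.1 0 ^ d)
  obtain ⟨e0, e2, e3, -⟩ := hψ (τ • v)
  have hwd : w.1 0 ^ d ≠ 0 := pow_ne_zero d hw
  rw [hτ0] at e0
  rw [hτ0, div_mul_cancel₀ _ hwd, add_sub_cancel] at e2 e3
  refine ⟨ψ * τ, ?_⟩
  rw [mul_smul]
  have m1 := mem_threefold_iff'.1 (ψ • τ • v).2
  have m2 := mem_threefold_iff'.1 w.2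
  rw [e0, e2, e3] at m1
  refine Subtype.ext (funext fun i => ?_)
  fin_cases i
  · exact e0
  · refine mul_left_cancel₀ hwd ?_
    change w.1 0 ^ d * (ψ • τ • v).1 1 = w.1 0 ^ d * w.1 1
    linear_combination m1 - m2
  · exact e2
  · exact e3

/-- The torus is transitive on the punctured cusp. A translation then moves `y` freely, because `k
z^(k-1) ≠ 0`. -/
theorem surfaceStratum_transitive (hd : 2 ≤ d) (hk : 2 ≤ k) (hl : 2 ≤ l) (hcop : Nat.Coprime k l)
    {v w : threefold d k l} (hv0 : v.1 0 = 0) (hv : v.1 2 ≠ 0) (hw0 : w.1 0 = 0)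
    (hw : w.1 2 ≠ 0) : ∃ ψ : Aut (threefold d k l), ψ • v = w := by
  have hcusp : ∀ u : threefold d k l, u.1 0 = 0 → u.1 2 ^ k = -u.1 3 ^ l := by
    intro u hu
    have := mem_threefold_iff'.1 u.2
    rw [hu, zero_pow (by omega), zero_mul] at this
    linear_combination this
  have ht : ∀ u : threefold d k l, u.1 0 = 0 → u.1 2 ≠ 0 → u.1 3 ≠ 0 := by
    intro u hu hz h
    have := hcusp u hu
    rw [h, zero_pow (by omega), neg_zero] at this
    exact pow_ne_zero k hz this
  obtain ⟨α, hα0, hαl, hαk⟩ := exists_pow_eq_of_coprime hcop (div_ne_zero hw hv)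
    (div_ne_zero (ht w hw0 hw) (ht v hv0 hv)) (by
      rw [div_pow, div_pow, hcusp v hv0, hcusp w hw0, neg_div_neg_eq])
  obtain ⟨τ, -, -, hτ⟩ := exists_torus hd hk hl hcop hα0
  have t0 : (τ • v).1 0 = 0 := by
    rw [hτ]
    change α ^ (k * l) * v.1 0 = _
    rw [hv0, mul_zero]
  have t2 : (τ • v).1 2 = w.1 2 := by
    rw [hτ]
    change α ^ l * v.1 2 = _
    rw [hαl, div_mul_cancel₀ _ hv]
  have t3 : (τ • v).1 3 = w.1 3 := by
    rw [hτ]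
    change α ^ k * v.1 3 = _
    rw [hαk, div_mul_cancel₀ _ (ht v hv0 hv)]
  have hne : (k : ℂ) * w.1 2 ^ (k - 1) ≠ 0 :=
    mul_ne_zero (Nat.cast_ne_zero.2 (by omega)) (pow_ne_zero _ hw)
  obtain ⟨ψ, hψ⟩ := exists_translation (d := d) (k := k) (l := l) (by omega)
    (((τ • v).1 1 - w.1 1) / (k * w.1 2 ^ (k - 1))) 0
  obtain ⟨e0, e2, e3, e1⟩ := hψ (τ • v)
  have e1 := e1 t0
  rw [t2, div_mul_cancel₀ _ hne] at e1
  rw [t0, zero_pow (by omega), mul_zero, add_zero] at e2 e3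
  refine ⟨ψ * τ, ?_⟩
  rw [mul_smul]
  refine Subtype.ext (funext fun i => ?_)
  fin_cases i
  · exact (e0.trans t0).trans hw0.symm
  · have e1' : (ψ • τ • v).1 1 = w.1 1 := e1.trans (by ring)
    exact e1'
  · exact e2.trans t2
  · exact e3.trans t3

/-- The torus acts on `y` with weight `-kl(d-1)`, which is nonzero because `d ≥ 2`. -/
theorem puncturedLine_transitive (hd : 2 ≤ d) (hk : 2 ≤ k) (hl : 2 ≤ l) (hcop : Nat.Coprime k l)
    {v w : threefold d k l} (hv : v.1 ∈ puncturedLine) (hw : w.1 ∈ puncturedLine) :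
    ∃ ψ : Aut (threefold d k l), ψ • v = w := by
  have hne : ∀ u ∈ puncturedLine, u 1 ≠ 0 := by
    rintro u ⟨h0, h2, h3, hu⟩ h1
    refine hu (funext fun i => ?_)
    fin_cases i
    exacts [h0, h1, h2, h3]
  have hpos : 0 < k * l * (d - 1) := Nat.mul_pos (Nat.mul_pos (by omega) (by omega)) (by omega)
  obtain ⟨α, hα⟩ := IsAlgClosed.exists_pow_nat_eq (v.1 1 / w.1 1) hpos
  have hα0 : α ≠ 0 := by
    rintro rfl
    rw [zero_pow hpos.ne'] at hα
    exact div_ne_zero (hne _ hv) (hne _ hw) hα.symm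
  obtain ⟨τ, -, -, hτ⟩ := exists_torus hd hk hl hcop hα0
  refine ⟨τ, Subtype.ext ?_⟩
  have hv1 := hne _ hv
  have hw1 := hne _ hw
  obtain ⟨v0, v2, v3, -⟩ := hv
  obtain ⟨w0, w2, w3, -⟩ := hw
  rw [hτ, v0, v2, v3, hα]
  funext i
  fin_cases i
  · simp [w0]
  · change (v.1 1 / w.1 1)⁻¹ * v.1 1 = w.1 1
    field_simp
  · simp [w2]
  · simp [w3]

end Strata

end KorasRussell

namespace KorasRussell

/-! ### The four orbits and their isomorphism types. -/

section Orbits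

open MvPolynomial

variable {d k l : ℕ}

theorem eval_proj_of_eq_zero {v : Fin 4 → ℂ} (hv : v 0 = 0) (p : Rxzt) :
    eval (proj v) p = eval ![v 2, v 3] (modX p) := by
  have : (aeval (proj v) : Rxzt →ₐ[ℂ] ℂ) = (aeval ![v 2, v 3] : Rzt →ₐ[ℂ] ℂ).comp modX := by
    ext i : 1
    fin_cases i <;> simp [proj, modX, hv]
  exact DFunLike.congr_fun this p

theorem HasChar.coords {ψ : Aut (threefold d k l)} {α : ℂ} (h : HasChar ψ α)
    (v : threefold d k l) : (ψ • v).1 0 = α ^ (k * l) * v.1 0 ∧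
      (v.1 0 = 0 → (ψ • v).1 2 = α ^ l * v.1 2 ∧ (ψ • v).1 3 = α ^ k * v.1 3) := by
  obtain ⟨-, φ, -, hI, h0, h1, h2⟩ := h
  refine ⟨?_, fun hv => ⟨?_, ?_⟩⟩
  · have := hI (X 0) v
    rw [h0] at this
    simpa [proj] using this
  · have := hI (X 1) v
    rw [eval_proj_of_eq_zero hv, h1] at this
    simpa [proj] using this
  · have := hI (X 2) v
    rw [eval_proj_of_eq_zero hv, h2] at this
    simpa [proj] using this

theorem image_orbit_eq {G : Type*} {n : ℕ} {Z : Set (Fin n → ℂ)} [Group G] [MulAction G Z]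
    {S : Set (Fin n → ℂ)} (hS : S ⊆ Z) (hinv : ∀ (g : G) (v : Z), v.1 ∈ S → (g • v).1 ∈ S)
    (htrans : ∀ v w : Z, v.1 ∈ S → w.1 ∈ S → ∃ g : G, g • v = w) {v : Z} (hv : v.1 ∈ S) :
    Subtype.val '' MulAction.orbit G v = S := by
  ext w
  constructor
  · rintro ⟨_, ⟨g, rfl⟩, rfl⟩
    exact hinv g v hv
  · intro hw
    obtain ⟨g, hg⟩ := htrans v ⟨w, hS hw⟩ hv hw
    exact ⟨⟨w, hS hw⟩, ⟨g, hg⟩, rfl⟩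

theorem cusp_of_mem (hd : 1 ≤ d) {v : Fin 4 → ℂ} (h : v ∈ threefold d k l) (h0 : v 0 = 0) :
    v 2 ^ k + v 3 ^ l = 0 := by
  have := mem_threefold_iff'.1 h
  rw [h0, zero_pow (by omega), zero_mul, zero_add, add_zero] at this
  exact this

theorem puncturedLine_subset (hd : 1 ≤ d) (hk : 1 ≤ k) (hl : 1 ≤ l) :
    puncturedLine ⊆ threefold d k l := by
  rintro v ⟨h0, h2, h3, -⟩
  rw [mem_threefold_iff', h0, h2, h3, zero_pow (by omega), zero_pow (by omega),
    zero_pow (by omega)]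
  ring

theorem zero_mem_threefold (hd : 1 ≤ d) (hk : 1 ≤ k) (hl : 1 ≤ l) :
    (0 : Fin 4 → ℂ) ∈ threefold d k l := by
  rw [mem_threefold_iff']
  simp [show d ≠ 0 by omega, show k ≠ 0 by omega, show l ≠ 0 by omega]

theorem mem_strata (hd : 1 ≤ d) (hk : 1 ≤ k) (hl : 1 ≤ l) {v : Fin 4 → ℂ}
    (hv : v ∈ threefold d k l) :
    v ∈ openStratum d k l ∨ v ∈ surfaceStratum d k l ∨ v ∈ puncturedLine ∨ v = 0 := by
  by_cases h0 : v 0 = 0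
  · by_cases h2 : v 2 = 0
    · have h3 : v 3 = 0 := by
        have := cusp_of_mem hd hv h0
        rw [h2, zero_pow (by omega), zero_add] at this
        exact pow_eq_zero_iff (by omega) |>.1 this
      by_cases hv0 : v = 0
      · exact Or.inr (Or.inr (Or.inr hv0))
      · exact Or.inr (Or.inr (Or.inl ⟨h0, h2, h3, hv0⟩))
    · exact Or.inr (Or.inl ⟨hv, h0, h2⟩)
  · exact Or.inl ⟨hv, h0⟩

theorem strata_nonempty (hk : 1 ≤ k) (hl : 1 ≤ l) :
    (openStratum d k l).Nonempty ∧ (surfaceStratum d k l).Nonempty ∧ puncturedLine.Nonempty := by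
  obtain ⟨ω, hω⟩ := IsAlgClosed.exists_pow_nat_eq (-1 : ℂ) (n := l) (by omega)
  refine ⟨⟨![1, -1, 0, 0], ?_, ?_⟩, ⟨![0, 0, 1, ω], ?_, ?_, ?_⟩, ⟨![0, 1, 0, 0], ?_, ?_, ?_, ?_⟩⟩
  · rw [mem_threefold_iff']
    simp [show k ≠ 0 by omega, show l ≠ 0 by omega]
  · simp
  · rw [mem_threefold_iff']
    simp [hω]
  · simp
  · simp
  · simp
  · simp
  · simp
  · intro h
    simpa using congrFun h 1

theorem range_orbits (hd : 2 ≤ d) (hk : 2 ≤ k) (hkl : k < l) (hcop : Nat.Coprime k l) :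
    Set.range (fun v : threefold d k l =>
        (Subtype.val '' MulAction.orbit (Aut (threefold d k l)) v : Set (Fin 4 → ℂ))) =
      {openStratum d k l, surfaceStratum d k l, puncturedLine, {0}} := by
  have hl : 2 ≤ l := by omega
  have h1 : ∀ v : threefold d k l, v.1 ∈ openStratum d k l →
      Subtype.val '' MulAction.orbit (Aut (threefold d k l)) v = openStratum d k l := by
    intro v
    refine image_orbit_eq (S := openStratum d k l) (fun _ h => h.1)
      (fun ψ v hv => ⟨(ψ • v).2, ?_⟩) (fun v w hv hw => openStratum_transitive hd hk hl hcop hv.2 hw.2)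
    obtain ⟨α, hα⟩ := exists_hasChar hd hk hkl hcop ψ
    rw [(hα.coords v).1]
    exact mul_ne_zero (pow_ne_zero _ hα.1) hv.2
  have h2 : ∀ v : threefold d k l, v.1 ∈ surfaceStratum d k l →
      Subtype.val '' MulAction.orbit (Aut (threefold d k l)) v = surfaceStratum d k l := by
    intro v
    refine image_orbit_eq (S := surfaceStratum d k l) (fun _ h => h.1)
      (fun ψ v hv => ⟨(ψ • v).2, ?_⟩)
      (fun v w hv hw => surfaceStratum_transitive hd hk hl hcop hv.2.1 hv.2.2 hw.2.1 hw.2.2)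
    obtain ⟨α, hα⟩ := exists_hasChar hd hk hkl hcop ψ
    rw [(hα.coords v).1, ((hα.coords v).2 hv.2.1).1, hv.2.1]
    exact ⟨mul_zero _, mul_ne_zero (pow_ne_zero _ hα.1) hv.2.2⟩
  have h3 : ∀ v : threefold d k l, v.1 ∈ puncturedLine →
      Subtype.val '' MulAction.orbit (Aut (threefold d k l)) v = puncturedLine := by
    intro v
    refine image_orbit_eq (puncturedLine_subset (by omega) (by omega) (by omega))
      (fun ψ v hv => ?_) (fun v w hv hw => puncturedLine_transitive hd hk hl hcop hv hw)
    obtain ⟨α, hα⟩ := exists_hasChar hd hk hkl hcop ψ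
    refine ⟨?_, ?_, ?_, fun h => hv.2.2.2 ?_⟩
    · rw [(hα.coords v).1, hv.1, mul_zero]
    · rw [((hα.coords v).2 hv.1).1, hv.2.1, mul_zero]
    · rw [((hα.coords v).2 hv.1).2, hv.2.2.1, mul_zero]
    -- The inverse automorphism also fixes the origin, so no other point is sent to it.
    · have := (extends_and_fixes_of_aut hd hk hkl hcop ψ⁻¹).2 (ψ • v) h
      rwa [inv_smul_smul] at this
  have h4 : ∀ v : threefold d k l, v.1 ∈ ({0} : Set (Fin 4 → ℂ)) →
      Subtype.val '' MulAction.orbit (Aut (threefold d k l)) v = {0} := by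
    intro v
    refine image_orbit_eq ?_ (fun ψ v hv =>
      (extends_and_fixes_of_aut hd hk hkl hcop ψ).2 v hv) (fun v w hv hw => ⟨1, ?_⟩)
    · rintro _ rfl
      exact zero_mem_threefold (by omega) (by omega) (by omega)
    · rw [one_smul]
      exact Subtype.ext (hv.trans hw.symm)
  obtain ⟨⟨p1, m1⟩, ⟨p2, m2⟩, ⟨p3, m3⟩⟩ :=
    strata_nonempty (d := d) (k := k) (l := l) (by omega) (by omega)
  ext S
  constructor
  · rintro ⟨v, rfl⟩
    rcases mem_strata (by omega) (by omega) (by omega) v.2 with h | h | h | h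
    · exact Or.inl (h1 v h)
    · exact Or.inr (Or.inl (h2 v h))
    · exact Or.inr (Or.inr (Or.inl (h3 v h)))
    · exact Or.inr (Or.inr (Or.inr (h4 v h)))
  · rintro (rfl | rfl | rfl | rfl)
    · exact ⟨⟨p1, m1.1⟩, h1 _ m1⟩
    · exact ⟨⟨p2, m2.1⟩, h2 _ m2⟩
    · exact ⟨⟨p3, puncturedLine_subset (by omega) (by omega) (by omega) m3⟩, h3 _ m3⟩
    · exact ⟨⟨0, zero_mem_threefold (by omega) (by omega) (by omega)⟩, h4 _ rfl⟩

theorem ncard_strata (hk : 1 ≤ k) (hl : 1 ≤ l) :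
    ({openStratum d k l, surfaceStratum d k l, puncturedLine, {0}} :
      Set (Set (Fin 4 → ℂ))).ncard = 4 := by
  obtain ⟨⟨p1, m1⟩, ⟨p2, m2⟩, ⟨p3, m3⟩⟩ := strata_nonempty (d := d) hk hl
  have ne {S T : Set (Fin 4 → ℂ)} (p : Fin 4 → ℂ) (hS : p ∈ S) (hT : p ∉ T) : S ≠ T :=
    fun h => hT (h ▸ hS)
  have h12 := ne p1 m1 (T := surfaceStratum d k l) fun h => m1.2 h.2.1
  have h13 := ne p1 m1 (T := puncturedLine) fun h => m1.2 h.1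
  have h14 := ne p1 m1 (T := {0}) fun h => m1.2 (by rw [Set.mem_singleton_iff.1 h]; rfl)
  have h23 := ne p2 m2 (T := puncturedLine) fun h => m2.2.2 h.2.1
  have h24 := ne p2 m2 (T := {0}) fun h => m2.2.2 (by rw [Set.mem_singleton_iff.1 h]; rfl)
  have h34 := ne p3 m3 (T := {0}) fun h => m3.2.2.2 h
  rw [Set.ncard_insert_of_notMem, Set.ncard_insert_of_notMem, Set.ncard_pair h34]
  · simp [h23, h24]
  · simp [h12, h13, h14]

theorem isRegularFunction_div {n : ℕ} {S : Set (Fin n → ℂ)} {f : S → ℂ}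
    (g h : MvPolynomial (Fin n) ℂ) (hh : ∀ p : S, eval p.1 h ≠ 0)
    (hf : ∀ p : S, f p = eval p.1 g / eval p.1 h) : IsRegularFunction S f :=
  fun p => ⟨g, h, hh p, fun q _ => hf q⟩

theorem isRegularFunction_eval {n : ℕ} {S : Set (Fin n → ℂ)} {f : S → ℂ}
    (g : MvPolynomial (Fin n) ℂ) (hf : ∀ p : S, f p = eval p.1 g) : IsRegularFunction S f :=
  isRegularFunction_div g 1 (fun p => by simp) (fun p => by simp [hf])

theorem openStratum_areIsomorphic :
    AreIsomorphic (openStratum d k l) {w : Fin 3 → ℂ | w 0 ≠ 0} := by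
  refine ⟨⟨fun v => ⟨proj v.1, v.2.2⟩, fun w => ⟨![w.1 0,
    -(w.1 1 ^ k + w.1 2 ^ l + w.1 0) / w.1 0 ^ d, w.1 1, w.1 2], ?_, w.2⟩, fun v => ?_,
    fun w => ?_⟩, fun i => isRegularFunction_eval (![X 0, X 2, X 3] i) fun v => ?_, fun j => ?_⟩
  · have hw : w.1 0 ^ d ≠ 0 := pow_ne_zero d w.2
    change w.1 0 ^ d * (-(w.1 1 ^ k + w.1 2 ^ l + w.1 0) / w.1 0 ^ d) + w.1 1 ^ k + w.1 2 ^ l +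
      w.1 0 = 0
    rw [mul_div_cancel₀ _ hw]
    ring
  · have hv : v.1 0 ^ d ≠ 0 := pow_ne_zero d v.2.2
    have h := mem_threefold_iff'.1 v.2.1
    refine Subtype.ext (funext fun i => ?_)
    fin_cases i
    · rfl
    · change -(v.1 2 ^ k + v.1 3 ^ l + v.1 0) / v.1 0 ^ d = v.1 1
      rw [div_eq_iff hv]
      linear_combination -h
    · rfl
    · rfl
  · refine Subtype.ext (funext fun i => ?_)
    fin_cases i <;> rfl
  · fin_cases i <;> simp [proj]
  · refine isRegularFunction_div (![X 0, -(X 1 ^ k + X 2 ^ l + X 0), X 1, X 2] j)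
      (![1, X 0 ^ d, 1, 1] j) (fun w => ?_) (fun w => ?_)
    · have hw : w.1 0 ^ d ≠ 0 := pow_ne_zero d w.2
      fin_cases j <;> simp [w.2.out]
    · fin_cases j <;> simp

/-- The punctured cusp is `α ↦ (α^l, ω α^k)` with `ω^l = -1`. For `l a = k b + 1` the inverse is
`z^a / (t/ω)^b`, regular because `t ≠ 0`. -/
theorem surfaceStratum_areIsomorphic (hd : 1 ≤ d) (hk : 2 ≤ k) (hl : 1 ≤ l)
    (hcop : Nat.Coprime k l) :
    AreIsomorphic (surfaceStratum d k l) {w : Fin 2 → ℂ | w 0 ≠ 0} := by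
  obtain ⟨ω, hω⟩ := IsAlgClosed.exists_pow_nat_eq (-1 : ℂ) (n := l) (by omega)
  have hω0 : ω ≠ 0 := by
    rintro rfl
    rw [zero_pow (by omega)] at hω
    norm_num at hω
  obtain ⟨a, b, hab⟩ : ∃ a b, l * a = k * b + 1 := by
    obtain ⟨a, -, ha⟩ := Nat.exists_mul_mod_eq_one_of_coprime hcop.symm (by omega)
    exact ⟨a, l * a / k, by rw [← ha, Nat.div_add_mod]⟩
  have hkey : ∀ α : ℂ, α ≠ 0 → (α ^ l) ^ a / (ω * α ^ k / ω) ^ b = α := by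
    intro α hα
    rw [mul_div_cancel_left₀ _ hω0, ← pow_mul, ← pow_mul, hab, pow_succ]
    have := pow_ne_zero (k * b) hα
    field_simp
  have hparam : ∀ v : surfaceStratum d k l, ∃ α, α ≠ 0 ∧ α ^ l = v.1 2 ∧ ω * α ^ k = v.1 3 := by
    intro v
    have hc := cusp_of_mem hd v.2.1 v.2.2.1
    have ht : v.1 3 ≠ 0 := by
      intro h
      rw [h, zero_pow (by omega), add_zero] at hc
      exact pow_ne_zero k v.2.2.2 hc
    obtain ⟨α, hα, h1, h2⟩ := exists_pow_eq_of_coprime hcop v.2.2.2 (div_ne_zero ht hω0) (by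
      rw [div_pow, hω]
      linear_combination hc)
    exact ⟨α, hα, h1, by rw [h2, mul_div_cancel₀ _ hω0]⟩
  have hne : ∀ v : surfaceStratum d k l, (v.1 3 / ω) ^ b ≠ 0 := by
    intro v
    obtain ⟨α, hα, -, h2⟩ := hparam v
    rw [← h2, mul_div_cancel_left₀ _ hω0]
    exact pow_ne_zero _ (pow_ne_zero _ hα)
  refine ⟨⟨fun v => ⟨![v.1 2 ^ a / (v.1 3 / ω) ^ b, v.1 1],
      div_ne_zero (pow_ne_zero a v.2.2.2) (hne v)⟩,
    fun w => ⟨![0, w.1 1, w.1 0 ^ l, ω * w.1 0 ^ k], ?_, rfl, pow_ne_zero l w.2⟩, fun v => ?_,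
    fun w => ?_⟩, fun i => ?_,
    fun j => isRegularFunction_eval (![0, X 1, X 0 ^ l, C ω * X 0 ^ k] j) fun w => ?_⟩
  · change (0 : ℂ) ^ d * w.1 1 + (w.1 0 ^ l) ^ k + (ω * w.1 0 ^ k) ^ l + 0 = 0
    rw [zero_pow (by omega), mul_pow, hω]
    ring
  · obtain ⟨α, hα, h1, h2⟩ := hparam v
    have h : v.1 2 ^ a / (v.1 3 / ω) ^ b = α := by
      rw [← h1, ← h2]
      exact hkey α hα
    refine Subtype.ext (funext fun i => ?_)
    fin_cases i
    · exact v.2.2.1.symm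
    · rfl
    · change (v.1 2 ^ a / (v.1 3 / ω) ^ b) ^ l = v.1 2
      rw [h, h1]
    · change ω * (v.1 2 ^ a / (v.1 3 / ω) ^ b) ^ k = v.1 3
      rw [h, h2]
  · refine Subtype.ext (funext fun i => ?_)
    fin_cases i
    · exact hkey _ w.2
    · rfl
  · refine isRegularFunction_div (![X 2 ^ a, X 1] i) (![(C ω⁻¹ * X 3) ^ b, 1] i) (fun v => ?_)
      (fun v => ?_)
    · have := hne v
      rw [div_eq_inv_mul] at this
      fin_cases i
      · simpa using this
      · simp
    · fin_cases i
      · simp [div_eq_inv_mul]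
      · simp
  · fin_cases j <;> simp

end Orbits

end KorasRussell

namespace KorasRussell

/-! ### Finite subgroups. -/

section FiniteSubgroups

open MvPolynomial

variable {d k l : ℕ}

theorem X_dvd_sub_of_mem {n : ℕ} {φ : Rxzt ≃ₐ[ℂ] Rxzt} (h : φ ∈ groupAn d k l n) (p : Rxzt) :
    X 0 ^ n ∣ φ p - p :=
  Ideal.mem_span_singleton.1 (h.2.2 p)

/-- To first order the `j`-th power of the identity plus `x^n δ` is the identity plus `j x^n δ`. -/
theorem dvd_iterate_sub {n : ℕ} (hn : 1 ≤ n) {φ : Rxzt ≃ₐ[ℂ] Rxzt} (h0 : φ (X 0) = X 0)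
    (h : ∀ p, X 0 ^ n ∣ φ p - p) (j : ℕ) (p : Rxzt) :
    X 0 ^ (n + 1) ∣ (φ ^ j) p - p - C (j : ℂ) * (φ p - p) := by
  induction j generalizing p with
  | zero => simp
  | succ j ih =>
    have e : (φ ^ (j + 1)) p - p - C ((j + 1 : ℕ) : ℂ) * (φ p - p) =
        ((φ ^ j) (φ p) - φ p - C (j : ℂ) * (φ (φ p) - φ p)) +
          C (j : ℂ) * (φ (φ p - p) - (φ p - p)) := by
      rw [pow_succ, AlgEquiv.mul_apply, map_sub]
      push_cast
      rw [C_add, C_1]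
      ring
    rw [e]
    refine dvd_add (ih _) (Dvd.dvd.mul_left ?_ _)
    obtain ⟨q, hq⟩ := h p
    rw [hq, map_mul, map_pow, h0, ← mul_sub, pow_succ]
    exact mul_dvd_mul_left _ ((dvd_pow_self _ (by omega)).trans (h q))

/-- If the `m`-th power is trivial, then `m` times the first order part vanishes, and `m` is
invertible. So triviality modulo `x^n` improves to `x^(n+1)`. -/
theorem dvd_sub_of_pow_eq_one {m : ℕ} (hm : m ≠ 0) {φ : Rxzt ≃ₐ[ℂ] Rxzt} (h0 : φ (X 0) = X 0)
    (hφ : φ ^ m = 1) (h : ∀ p, X 0 ∣ φ p - p) (n : ℕ) (p : Rxzt) : X 0 ^ (n + 1) ∣ φ p - p := by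
  induction n generalizing p with
  | zero => simpa using h p
  | succ n ih =>
    have h1 := dvd_iterate_sub (by omega) h0 ih m p
    rw [hφ, AlgEquiv.one_apply, sub_self, zero_sub, dvd_neg] at h1
    have h2 := h1.mul_left (C (m : ℂ)⁻¹)
    rwa [← mul_assoc, ← C_mul, inv_mul_cancel₀ (Nat.cast_ne_zero.2 hm), C_1, one_mul] at h2

theorem eq_zero_of_forall_X_pow_dvd {p : Rxzt} (h : ∀ n, X 0 ^ (n + 1) ∣ p) : p = 0 := by
  by_contra hp
  obtain ⟨n, hn⟩ := FiniteMultiplicity.of_not_isUnit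
    (X_prime (R := ℂ) (i := (0 : Fin 3))).not_isUnit hp
  exact hn (h n)

/-- Unipotent automorphisms have infinite order. -/
theorem eq_one_of_pow_eq_one (hd : 1 ≤ d) {m : ℕ} (hm : m ≠ 0) {ψ : Aut (threefold d k l)}
    (hψ : ψ ∈ subgroupA d k l 1) (h : ψ ^ m = 1) : ψ = 1 := by
  obtain ⟨φ, hφ, hI⟩ := hψ
  have hone : Induces (1 : Aut (threefold d k l)) 1 := fun p v => by simp
  have hpow : ∀ j : ℕ, Induces (ψ ^ j) (φ ^ j) := by
    intro j
    induction j with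
    | zero => simpa using hone
    | succ j ih =>
      rw [pow_succ, pow_succ']
      exact ih.mul hI
  have hφm : φ ^ m = 1 := induces_unique (h ▸ hpow m) hone
  have hφ1 : φ = 1 := AlgEquiv.ext fun p => sub_eq_zero.1 (eq_zero_of_forall_X_pow_dvd fun n =>
    dvd_sub_of_pow_eq_one hm hφ.2.1 hφm (fun q => by simpa using X_dvd_sub_of_mem hφ q) n p)
  rw [hφ1] at hI
  exact induces_injective hd one_ne_zero (by simp) hI hone

/-- The kernel `𝒜₁` of the character is torsion free, so a finite subgroup embeds in the
multiplicative group of a field. -/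
theorem isCyclic_of_finite (hd : 2 ≤ d) (hk : 2 ≤ k) (hkl : k < l) (hcop : Nat.Coprime k l)
    (H : Subgroup (Aut (threefold d k l))) [Finite H] : IsCyclic H := by
  choose χ hχ using exists_hasChar hd hk hkl hcop
  let f : H →* ℂ :=
    { toFun := fun ψ => χ ψ.1
      map_one' := (hχ 1).unique hcop hasChar_one
      map_mul' := fun ψ ψ' => (hχ _).unique hcop ((hχ ψ.1).mul (hχ ψ'.1)) }
  refine isCyclic_of_injective_ringHom f ((injective_iff_map_eq_one f).2 fun ψ hψ => ?_)
  have h1 : HasChar ψ.1 1 := by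
    have := hχ ψ.1
    rwa [show χ ψ.1 = 1 from hψ] at this
  refine Subtype.ext (eq_one_of_pow_eq_one (by omega) Nat.card_pos.ne' (hasChar_one_iff.1 h1)
    (m := Nat.card H) ?_)
  exact congrArg Subtype.val (pow_card_eq_one' (x := ψ))

end FiniteSubgroups

end KorasRussell

namespace KorasRussell

/-! ### Algebraic actions of the additive group and their generators. -/

section PolynomialFlows

variable {V R : Type*} [AddCommGroup V] [Module ℂ V] [CommRing R] [Algebra ℂ R]

/-- Vector-valued polynomials that vanish identically have vanishing coefficients. -/
theorem eq_zero_of_sum_pow_smul_eq_zero {D : ℕ} {f : ℕ → V}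
    (h : ∀ s : ℂ, ∑ m ∈ Finset.range D, s ^ m • f m = 0) {m : ℕ} (hm : m < D) : f m = 0 := by
  rw [← Module.forall_dual_apply_eq_zero_iff ℂ]
  intro L
  have h1 : (∑ i ∈ Finset.range D, Polynomial.C (L (f i)) * Polynomial.X ^ i : Polynomial ℂ)
      = 0 := by
    refine Polynomial.funext fun s => ?_
    have := congrArg L (h s)
    simp only [map_sum, map_smul, smul_eq_mul, map_zero] at this
    rw [Polynomial.eval_finsetSum, Polynomial.eval_zero, ← this]
    refine Finset.sum_congr rfl fun i _ => ?_
    rw [Polynomial.eval_mul, Polynomial.eval_C, Polynomial.eval_pow, Polynomial.eval_X, mul_comm]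
  have := congrArg (fun p => Polynomial.coeff p m) h1
  simpa [Polynomial.finsetSum_coeff, Polynomial.coeff_C_mul, Polynomial.coeff_X_pow,
    Finset.sum_ite_eq, hm] using this

/-- Vector-valued polynomials with values in a subspace have coefficients in it. -/
theorem mem_of_forall_sum_pow_smul_mem {W : Submodule ℂ V} {D : ℕ} {f : ℕ → V}
    (h : ∀ s : ℂ, ∑ m ∈ Finset.range D, s ^ m • f m ∈ W) {m : ℕ} (hm : m < D) : f m ∈ W := by
  rw [← Submodule.Quotient.mk_eq_zero]
  refine eq_zero_of_sum_pow_smul_eq_zero (f := fun m => W.mkQ (f m)) (fun s => ?_) hm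
  have := (Submodule.Quotient.mk_eq_zero W).2 (h s)
  rw [← Submodule.mkQ_apply, map_sum] at this
  simpa using this

theorem eq_of_forall_eval_algebraMap_eq [IsDomain R] {P Q : Polynomial R}
    (h : ∀ s : ℂ, P.eval (algebraMap ℂ R s) = Q.eval (algebraMap ℂ R s)) : P = Q := by
  refine Polynomial.eq_of_infinite_eval_eq P Q
    ((Set.infinite_range_of_injective (algebraMap ℂ R).injective).mono ?_)
  rintro _ ⟨s, rfl⟩
  exact h s

/-- The homomorphism `Γ` describes an algebraic action of the additive group by the automorphisms
`φ s`. -/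
structure IsFlow (φ : ℂ → R ≃ₐ[ℂ] R) (Γ : R →ₐ[ℂ] Polynomial R) : Prop where
  eval_eq : ∀ s p, (Γ p).eval (algebraMap ℂ R s) = φ s p
  add_eq : ∀ s t p, φ (s + t) p = φ s (φ t p)

namespace IsFlow

variable {φ : ℂ → R ≃ₐ[ℂ] R} {Γ : R →ₐ[ℂ] Polynomial R}

theorem zero_apply (h : IsFlow φ Γ) (p : R) : φ 0 p = p := by
  have := h.add_eq 0 0 p
  rw [add_zero] at this
  exact ((φ 0).injective this).symm

theorem coeff_zero (h : IsFlow φ Γ) (p : R) : (Γ p).coeff 0 = p := by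
  rw [Polynomial.coeff_zero_eq_eval_zero, ← map_zero (algebraMap ℂ R), h.eval_eq, h.zero_apply]

/-- The infinitesimal generator. -/
noncomputable def generator (h : IsFlow φ Γ) : Derivation ℂ R R :=
  Derivation.mk' (((Polynomial.lcoeff R 1).restrictScalars ℂ).comp Γ.toLinearMap) fun p q => by
    change (Γ (p * q)).coeff 1 = p • (Γ q).coeff 1 + q • (Γ p).coeff 1
    rw [map_mul, Polynomial.mul_coeff_one, h.coeff_zero, h.coeff_zero, smul_eq_mul, smul_eq_mul]
    ring

theorem generator_apply (h : IsFlow φ Γ) (p : R) : h.generator p = (Γ p).coeff 1 := rfl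

/-- If `φ s` is the identity modulo the kernel of `π`, so is the generator. -/
theorem map_generator_eq_zero (h : IsFlow φ Γ) {B : Type*} [CommRing B] [IsDomain B] [Algebra ℂ B]
    (π : R →ₐ[ℂ] B) {p : R} {b : B} (hp : ∀ s, π (φ s p) = b) : π (h.generator p) = 0 := by
  have h1 : (Γ p).map (π : R →+* B) = Polynomial.C b := by
    refine eq_of_forall_eval_algebraMap_eq fun s => ?_
    rw [Polynomial.eval_C, ← hp s, ← h.eval_eq]
    have : algebraMap ℂ B s = (π : R →+* B) (algebraMap ℂ R s) := (π.commutes s).symm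
    rw [this, Polynomial.eval_map, Polynomial.eval₂_at_apply]
    rfl
  have := congrArg (fun P => Polynomial.coeff P 1) h1
  rwa [Polynomial.coeff_map, Polynomial.coeff_C, if_neg one_ne_zero] at this

variable [IsDomain R]

/-- The group law makes the expansion of `φ t p` the Taylor shift of `Γ p`, so the generator acts on
`φ t p` as `d/dt`. Comparing coefficients of `t^j` gives the claim. -/
theorem generator_coeff (h : IsFlow φ Γ) (p : R) (j : ℕ) :
    h.generator ((Γ p).coeff j) = (Γ p).coeff (j + 1) * ((j : R) + 1) := by
  have key : ∀ t : ℂ, h.generator (φ t p) =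
      (Polynomial.derivative (Γ p)).eval (algebraMap ℂ R t) := by
    intro t
    have : Γ (φ t p) = Polynomial.taylor (algebraMap ℂ R t) (Γ p) := by
      refine eq_of_forall_eval_algebraMap_eq fun s => ?_
      rw [h.eval_eq, Polynomial.taylor_eval, ← map_add, h.eval_eq, ← h.add_eq]
    rw [generator_apply, this, Polynomial.taylor_coeff_one]
  let Q : Polynomial R := ∑ i ∈ (Γ p).support, Polynomial.monomial i (h.generator ((Γ p).coeff i))
  have hQ : Q = Polynomial.derivative (Γ p) := by
    refine eq_of_forall_eval_algebraMap_eq fun t => ?_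
    rw [← key, ← h.eval_eq, Polynomial.eval_finsetSum, Polynomial.eval_eq_sum, Polynomial.sum,
      map_sum]
    refine Finset.sum_congr rfl fun i _ => ?_
    rw [Polynomial.eval_monomial, ← map_pow, mul_comm, mul_comm ((Γ p).coeff i),
      ← Algebra.smul_def, ← Algebra.smul_def, h.generator.map_smul]
  have := congrArg (fun P => Polynomial.coeff P j) hQ
  rw [← Polynomial.coeff_derivative, ← this]
  simp only [Q, Polynomial.finsetSum_coeff, Polynomial.coeff_monomial, Finset.sum_ite_eq']
  split_ifs with hj
  · rfl
  · rw [Polynomial.notMem_support_iff.1 hj, map_zero]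

theorem iterate_generator (h : IsFlow φ Γ) (p : R) (j : ℕ) :
    h.generator^[j] p = (j.factorial : R) * (Γ p).coeff j := by
  induction j with
  | zero => simp [h.coeff_zero]
  | succ j ih =>
    rw [Function.iterate_succ_apply', ih, ← nsmul_eq_mul, map_nsmul, h.generator_coeff,
      Nat.factorial_succ]
    push_cast
    rw [nsmul_eq_mul]
    ring

theorem isNilAt (h : IsFlow φ Γ) (p : R) : IsNilAt h.generator p :=
  ⟨(Γ p).natDegree + 1, by
    rw [h.iterate_generator, Polynomial.coeff_eq_zero_of_natDegree_lt (Nat.lt_succ_self _),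
      mul_zero]⟩

theorem dvd_coeff_of_dvd (h : IsFlow φ Γ) {a : R} {j : ℕ} {p : R}
    (ha : a ∣ h.generator ((Γ p).coeff j)) : a ∣ (Γ p).coeff (j + 1) := by
  rw [h.generator_coeff] at ha
  have e : (Γ p).coeff (j + 1) * ((j : R) + 1) * algebraMap ℂ R ((j : ℂ) + 1)⁻¹ =
      (Γ p).coeff (j + 1) := by
    have : ((j : R) + 1) = algebraMap ℂ R ((j : ℂ) + 1) := by simp
    rw [this, mul_assoc, ← map_mul, mul_inv_cancel₀ (Nat.cast_add_one_ne_zero j), map_one, mul_one]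
  rw [← e]
  exact ha.mul_right _

theorem apply_eq_of_generator_eq_zero (h : IsFlow φ Γ) {p : R} (hp : h.generator p = 0) (s : ℂ) :
    φ s p = p := by
  have hc : ∀ j, (Γ p).coeff (j + 1) = 0 := by
    intro j
    induction j with
    | zero => exact hp
    | succ j ih =>
      rw [← zero_dvd_iff]
      exact h.dvd_coeff_of_dvd (by rw [ih, map_zero])
  rw [← h.eval_eq, Polynomial.eq_C_of_natDegree_eq_zero (p := Γ p), Polynomial.eval_C, h.coeff_zero]
  by_contra hne
  obtain ⟨j, hj⟩ := Nat.exists_eq_succ_of_ne_zero hne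
  have := hc j
  rw [← Nat.succ_eq_add_one, ← hj, Polynomial.coeff_natDegree, Polynomial.leadingCoeff_eq_zero] at this
  rw [this] at hne
  exact hne Polynomial.natDegree_zero

theorem dvd_apply_sub (h : IsFlow φ Γ) {a : R} (ha : ∀ p, a ∣ h.generator p) (s : ℂ) (p : R) :
    a ∣ φ s p - p := by
  have h1 : Polynomial.C a ∣ (Γ p).divX :=
    Polynomial.C_dvd_iff_dvd_coeff _ _ |>.2 fun j => by
      rw [Polynomial.coeff_divX]
      exact h.dvd_coeff_of_dvd (ha _)
  obtain ⟨Q, hQ⟩ := h1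
  have h2 := congrArg (Polynomial.eval (algebraMap ℂ R s)) (Γ p).divX_mul_X_add
  rw [h.eval_eq, h.coeff_zero, hQ] at h2
  refine ⟨Q.eval (algebraMap ℂ R s) * algebraMap ℂ R s, ?_⟩
  rw [← h2]
  simp [mul_assoc]

/-- Taylor expansion to second order: each coefficient of index at least two is a rational multiple
of the generator applied to an earlier coefficient, which is itself divisible by `a`. -/
theorem dvd_apply_sub_sub_generator (h : IsFlow φ Γ) {a b : R}
    (hab : ∀ u, b ∣ h.generator (a * u)) (ha : ∀ p, a ∣ h.generator p) (p : R) :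
    b ∣ φ 1 p - p - h.generator p := by
  have h1 : Polynomial.C b ∣ (Γ p).divX.divX :=
    Polynomial.C_dvd_iff_dvd_coeff _ _ |>.2 fun j => by
      rw [Polynomial.coeff_divX, Polynomial.coeff_divX]
      refine h.dvd_coeff_of_dvd ?_
      obtain ⟨u, hu⟩ := h.dvd_coeff_of_dvd (ha ((Γ p).coeff j))
      rw [hu]
      exact hab u
  obtain ⟨Q, hQ⟩ := h1
  have h2 := congrArg (Polynomial.eval (algebraMap ℂ R 1)) (Γ p).divX_mul_X_add
  have h3 := congrArg (Polynomial.eval (algebraMap ℂ R 1)) (Γ p).divX.divX_mul_X_add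
  rw [h.eval_eq, h.coeff_zero, Polynomial.eval_add, Polynomial.eval_mul, ← h3, hQ,
    Polynomial.coeff_divX, zero_add, ← h.generator_apply] at h2
  refine ⟨Q.eval 1, ?_⟩
  rw [← h2]
  simp

end IsFlow

end PolynomialFlows

end KorasRussell

namespace KorasRussell

/-! ### One-parameter unipotent subgroups. -/

section OneParameterSubgroups

open MvPolynomial

variable {d k l : ℕ}

/-- Restriction of polynomials in `x`, `z`, `t` to the threefold. -/
noncomputable def restrictXZT (d k l : ℕ) : Rxzt →ₗ[ℂ] (threefold d k l → ℂ) where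
  toFun p v := eval (proj v.1) p
  map_add' p q := funext fun _ => map_add _ p q
  map_smul' c p := funext fun _ => smul_eval _ p c

theorem restrictXZT_injective : Function.Injective (restrictXZT d k l) :=
  (injective_iff_map_eq_zero _).2 fun _ hp =>
    eq_zero_of_eval_eq_zero fun v hv _ => congrFun hp ⟨v, hv⟩

/-- Expand in powers of `s`. All values lie in the subspace of functions coming from `ℂ[x, z, t]`,
hence so do the coefficients, although `F` itself may involve `y`. -/
theorem exists_polynomial_family {f : ℂ → Rxzt} {F : MvPolynomial (Fin 5) ℂ}
    (h : ∀ s, ∀ v : threefold d k l,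
      eval (proj v.1) (f s) = eval (Fin.cons s v.1 : Fin 5 → ℂ) F) :
    ∃ G : Polynomial Rxzt, ∀ s, G.eval (C s) = f s := by
  let P := finSuccEquiv ℂ 4 F
  have hP : ∀ s, ∑ m ∈ Finset.range (P.natDegree + 1),
      s ^ m • (fun v : threefold d k l => eval v.1 (P.coeff m)) = restrictXZT d k l (f s) := by
    intro s
    funext v
    change _ = eval (proj v.1) (f s)
    rw [h, eval_eq_eval_mv_eval', Polynomial.eval_map, Polynomial.eval₂_eq_sum_range,
      Finset.sum_apply]
    refine Finset.sum_congr rfl fun m _ => ?_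
    rw [Pi.smul_apply, smul_eq_mul, mul_comm]
  have hmem : ∀ m : Fin (P.natDegree + 1), ∃ q, restrictXZT d k l q =
      fun v : threefold d k l => eval v.1 (P.coeff m) := fun m =>
    mem_of_forall_sum_pow_smul_mem (W := LinearMap.range (restrictXZT d k l))
      (f := fun m v => eval v.1 (P.coeff m)) (fun s => ⟨f s, (hP s).symm⟩) m.2
  choose q hq using hmem
  refine ⟨∑ m, Polynomial.monomial m.1 (q m), fun s => restrictXZT_injective (d := d) (k := k)
    (l := l) ?_⟩
  rw [← hP, Polynomial.eval_finsetSum, map_sum, Finset.sum_range]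
  refine Finset.sum_congr rfl fun m _ => ?_
  rw [Polynomial.eval_monomial, ← C_pow, mul_comm, ← smul_eq_C_mul, map_smul, hq]

/-- Algebraic actions of the additive group on the threefold restrict to `ℂ[x, z, t]`. -/
theorem exists_isFlow (hd : 2 ≤ d) (hk : 2 ≤ k) (hkl : k < l) (hcop : Nat.Coprime k l)
    {ρ : Multiplicative ℂ →* Aut (threefold d k l)} {F : Fin 4 → MvPolynomial (Fin 5) ℂ}
    (hF : ∀ (s : ℂ) (v : threefold d k l) (i : Fin 4),
      (ρ (Multiplicative.ofAdd s) • v).1 i = eval (Fin.cons s v.1 : Fin 5 → ℂ) (F i)) :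
    ∃ (φ : ℂ → Rxzt ≃ₐ[ℂ] Rxzt) (Γ : Rxzt →ₐ[ℂ] Polynomial Rxzt), IsFlow φ Γ ∧
      ∀ s, φ s ∈ groupA d k l ∧ Induces (ρ (Multiplicative.ofAdd s)) (φ s) := by
  have hex := fun s : ℂ => exists_induces hd hk (by omega) hcop (ρ (Multiplicative.ofAdd s))
  choose φ hA hI _ using hex
  have hG : ∀ i : Fin 3, ∃ G : Polynomial Rxzt, ∀ s, G.eval (C s) = φ s (X i) := by
    intro i
    refine exists_polynomial_family (d := d) (k := k) (l := l) (F := F (![0, 2, 3] i))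
      fun s v => ?_
    rw [← hF, ← hI, eval_X]
    fin_cases i <;> rfl
  choose G hG using hG
  refine ⟨φ, aeval G, ⟨fun s p => ?_, fun s t p => ?_⟩, fun s => ⟨hA s, hI s⟩⟩
  · induction p using MvPolynomial.induction_on with
    | C a =>
      rw [← algebraMap_eq, AlgHom.commutes, AlgEquiv.commutes]
      exact Polynomial.eval_C
    | add p q hp hq => rw [map_add, Polynomial.eval_add, hp, hq, map_add]
    | mul_X p i hp =>
      rw [map_mul, Polynomial.eval_mul, hp, aeval_X, map_mul]
      exact congrArg _ (hG i s)
  · have h1 := (hI t).mul (hI s)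
    rw [← map_mul, ← ofAdd_add, add_comm] at h1
    rw [induces_unique (hI (s + t)) h1, AlgEquiv.mul_apply]

theorem subgroupA_anti {m n : ℕ} (h : m ≤ n) : subgroupA d k l n ≤ subgroupA d k l m := by
  rintro ψ ⟨φ, ⟨hA, h0, hφ⟩, hI⟩
  refine ⟨φ, ⟨hA, h0, fun p => ?_⟩, hI⟩
  have := hφ p
  rw [Ideal.mem_span_singleton] at this ⊢
  exact (pow_dvd_pow _ h).trans this

theorem pderiv_modX (p : Rxzt) :
    pderiv 0 (modX p) = modX (pderiv 1 p) ∧ pderiv 1 (modX p) = modX (pderiv 2 p) := by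
  induction p using MvPolynomial.induction_on with
  | C a => simp [modX]
  | add p q hp hq => simp only [map_add, hp, hq, and_self]
  | mul_X p i hp =>
    have hX : pderiv 0 (modX (X i)) = modX (pderiv 1 (X i)) ∧
        pderiv 1 (modX (X i)) = modX (pderiv 2 (X i)) := by
      fin_cases i <;> simp [modX, pderiv_X]
    simp only [map_mul, Derivation.leibniz, hp, hX, smul_eq_mul, map_add, and_self]

theorem modX_bracket (p q : Rxzt) :
    modX (bracket 1 2 p q) = bracket 0 1 (modX p) (modX q) := by
  simp only [bracket, map_sub, map_mul, pderiv_modX]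

/-- A locally nilpotent Hamiltonian derivation whose Hamiltonian is divisible by the equation of
the cusp is trivial. -/
theorem hamiltonian_eq_zero_of_isNilAt (hk : 2 ≤ k) (hl : 2 ≤ l) (g : Rzt)
    (hnil : ∀ p, IsNilAt (hamiltonian 0 1 (cuspR k l * g)) p) (p : Rzt) :
    bracket 0 1 (cuspR k l * g) p = 0 := by
  have hr0 : cuspR k l ≠ 0 := by
    intro h
    have := congrArg (eval ![1, 0]) h
    simp [cuspR, show l ≠ 0 by omega] at this
  have h1 : hamiltonian 0 1 (cuspR k l * g) (cuspR k l) = 0 := by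
    -- For `r` the cusp equation, `{r g, r} = r {g, r}`: it divides its own derivative, so it is a
    -- constant.
    refine map_eq_zero_of_eq_mul (hnil _) (hnil (bracket 0 1 g (cuspR k l))) ?_
    rw [hamiltonian_apply, bracket_mul_left, bracket_self]
    ring
  obtain ⟨h2, h3⟩ := map_eq_zero_of_add_pow (u := 1) (v := 1) hk hl (hnil (X 0)) (hnil (X 1))
    (Derivation.map_one_eq_zero _) (Derivation.map_one_eq_zero _) one_ne_zero one_ne_zero
    (by rwa [one_mul, one_mul, ← cuspR]) (by rwa [one_mul, one_mul, ← cuspR])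
  have : hamiltonian 0 1 (cuspR k l * g) = 0 := by
    refine MvPolynomial.derivation_ext fun i => ?_
    fin_cases i
    · exact h2
    · exact h3
  exact DFunLike.congr_fun this p

/-- The quotient of the generator by `x^n`, taken modulo `x`, is a Hamiltonian derivation of the
plane whose Hamiltonian is a multiple of the cusp equation. It inherits local nilpotence, so it
vanishes. -/
theorem dvd_generator_succ (hk : 2 ≤ k) (hl : 2 ≤ l) (hcop : Nat.Coprime k l)
    {φ : ℂ → Rxzt ≃ₐ[ℂ] Rxzt} {Γ : Rxzt →ₐ[ℂ] Polynomial Rxzt} (h : IsFlow φ Γ)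
    (hA : ∀ s, φ s ∈ groupA d k l) (h0 : h.generator (X 0) = 0) {n : ℕ} (hn : 1 ≤ n) (hnd : n < d)
    (hdvd : ∀ p, X 0 ^ n ∣ h.generator p) (p : Rxzt) : X 0 ^ (n + 1) ∣ h.generator p := by
  have hX : ∀ (m : ℕ) (q : Rxzt), h.generator (X 0 ^ m * q) = X 0 ^ m * h.generator q := by
    intro m q
    rw [Derivation.leibniz, Derivation.leibniz_pow, h0]
    simp
  have hmem : φ 1 ∈ groupAn d k l n := ⟨hA 1, h.apply_eq_of_generator_eq_zero h0 1, fun p =>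
    Ideal.mem_span_singleton.2 (h.dvd_apply_sub hdvd 1 p)⟩
  obtain ⟨g, hg⟩ := exists_first_order_hamiltonian hk hl hcop hn hnd hmem
  have hgen : ∀ p, ∃ q, h.generator p = X 0 ^ n * q ∧
      modX q = bracket 0 1 (cuspR k l * modX g) (modX p) := by
    intro p
    obtain ⟨q, hq⟩ := hdvd p
    refine ⟨q, hq, ?_⟩
    have h1 := h.dvd_apply_sub_sub_generator (a := X 0 ^ n) (b := X 0 ^ (n + 1))
      (fun u => by
        rw [hX, pow_succ]
        exact mul_dvd_mul_left _ ((dvd_pow_self _ (by omega)).trans (hdvd u))) hdvd p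
    have h2 := dvd_sub (hg p) h1
    have e : φ 1 p - p - X 0 ^ n * bracket 1 2 (polyS k l * g) p -
        (φ 1 p - p - h.generator p) = X 0 ^ n * (q - bracket 1 2 (polyS k l * g) p) := by
      rw [hq]; ring
    rw [e, pow_succ, mul_dvd_mul_iff_left (pow_ne_zero n (X_ne_zero 0)), ← modX_eq_iff] at h2
    rw [h2, modX_bracket, map_mul, modX_polyS]
  have hiter : ∀ (i : ℕ) (p : Rxzt), ∃ q, h.generator^[i] p = X 0 ^ (n * i) * q ∧
      modX q = (hamiltonian 0 1 (cuspR k l * modX g))^[i] (modX p) := by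
    intro i p
    induction i with
    | zero => exact ⟨p, by simp⟩
    | succ i ih =>
      obtain ⟨q, hq, hq'⟩ := ih
      obtain ⟨q₂, h1, h2⟩ := hgen q
      refine ⟨q₂, ?_, ?_⟩
      · rw [Function.iterate_succ_apply', hq, hX, h1]; ring
      · rw [Function.iterate_succ_apply', ← hq', h2, hamiltonian_apply]
  have hzero := hamiltonian_eq_zero_of_isNilAt hk hl (modX g) (fun p => by
    obtain ⟨i, hi⟩ := h.isNilAt (liftX p)
    obtain ⟨q, hq, hq'⟩ := hiter i (liftX p)
    rw [hi] at hq
    have hq0 : q = 0 := (mul_eq_zero.1 hq.symm).resolve_left (pow_ne_zero _ (X_ne_zero 0))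
    rw [hq0, map_zero, modX_liftX] at hq'
    exact ⟨i, hq'.symm⟩)
  obtain ⟨q, h1, h2⟩ := hgen p
  rw [hzero, modX_eq_zero_iff] at h2
  rw [h1, pow_succ]
  exact mul_dvd_mul_left _ h2

/-- One-parameter unipotent subgroups act trivially modulo `x^d`. -/
theorem le_subgroupA_of_isOneParameterUnipotent (hd : 2 ≤ d) (hk : 2 ≤ k) (hkl : k < l)
    (hcop : Nat.Coprime k l) {H : Subgroup (Aut (threefold d k l))}
    (hH : IsOneParameterUnipotent H) : H ≤ subgroupA d k l d := by
  obtain ⟨ρ, ⟨F, hF⟩, rfl⟩ := hH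
  obtain ⟨φ, Γ, h, hφ⟩ := exists_isFlow hd hk hkl hcop hF
  choose α hα using fun s : ℂ => exists_hasChar hd hk hkl hcop (ρ (Multiplicative.ofAdd s))
  have hαφ : ∀ s, φ s (X 0) = C (α s ^ (k * l)) * X 0 := by
    intro s
    obtain ⟨-, φ', -, hI', h0', -⟩ := hα s
    rwa [induces_unique (hφ s).2 hI']
  -- Each `φ s` multiplies `x` by a scalar, so `x` divides its derivative; local nilpotence makes
  -- that derivative zero.
  have h0 : h.generator (X 0) = 0 := by
    obtain ⟨m, hm⟩ := modX_eq_zero_iff.1 (h.map_generator_eq_zero modX (p := X 0) (b := 0)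
      fun s => by rw [hαφ, map_mul, modX_X_zero, mul_zero])
    exact map_eq_zero_of_eq_mul (h.isNilAt _) (h.isNilAt m) hm
  have hpow : ∀ s, α s ^ (k * l) = 1 := by
    intro s
    have h1 := hαφ s
    rw [h.apply_eq_of_generator_eq_zero h0] at h1
    have := congrArg (eval 1) h1
    simpa using this.symm
  have hmul : ∀ (m : ℕ) (s : ℂ), HasChar (ρ (Multiplicative.ofAdd (m * s))) (α s ^ m) := by
    intro m s
    induction m with
    | zero => simpa using hasChar_one
    | succ m ih =>
      have e : ((m + 1 : ℕ) : ℂ) * s = m * s + s := by push_cast; ring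
      rw [e, ofAdd_add, map_mul, pow_succ]
      exact ih.mul (hα s)
  -- The characters take values in roots of unity of order dividing `k l`. As `s` is `k l` times
  -- another parameter, its character is a `k l`-th power, hence trivial.
  have hone : ∀ s, HasChar (ρ (Multiplicative.ofAdd s)) 1 := by
    intro s
    have h1 := hmul (k * l) (s / (k * l : ℕ))
    have hne : ((k * l : ℕ) : ℂ) ≠ 0 :=
      Nat.cast_ne_zero.2 (Nat.mul_ne_zero (by omega) (by omega))
    rwa [mul_div_cancel₀ _ hne, hpow] at h1
  have hbase : ∀ p, X 0 ∣ h.generator p := by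
    intro p
    refine modX_eq_zero_iff.1 (h.map_generator_eq_zero modX (b := modX p) fun s => ?_)
    obtain ⟨φ', hφ', hI'⟩ := hasChar_one_iff.1 (hone s)
    rw [induces_unique (hφ s).2 hI', modX_eq_iff]
    simpa using X_dvd_sub_of_mem hφ' p
  have hall : ∀ n, n < d → ∀ p, X 0 ^ (n + 1) ∣ h.generator p := by
    intro n
    induction n with
    | zero => intro _ p; simpa using hbase p
    | succ n ih =>
      intro hnd
      exact dvd_generator_succ hk (by omega) hcop h (fun s => (hφ s).1) h0 (by omega) hnd
        (ih (by omega))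
  rintro _ ⟨s, rfl⟩
  refine ⟨φ s.toAdd, ⟨(hφ _).1, h.apply_eq_of_generator_eq_zero h0 _, fun p =>
    Ideal.mem_span_singleton.2 (h.dvd_apply_sub (fun p => ?_) _ p)⟩, (hφ s.toAdd).2⟩
  have := hall (d - 1) (by omega) p
  rwa [Nat.sub_add_cancel (by omega)] at this

/-- Not every element of `𝒜₁` is trivial modulo `x²`. -/
theorem exists_mem_subgroupA_one (hd : 2 ≤ d) (hk : 2 ≤ k) (hl : 2 ≤ l) (hcop : Nat.Coprime k l) :
    ∃ ψ ∈ subgroupA d k l 1, ψ ∉ subgroupA d k l 2 := by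
  obtain ⟨ψ, φ, h0, hI, -, -, hφ⟩ := exists_aut_of_hamiltonian (d := d) (k := k) (l := l) 1
    (n := 1) le_rfl (by omega)
  refine ⟨ψ, ⟨φ, ⟨?_, h0, fun p => ?_⟩, hI⟩, ?_⟩
  · obtain ⟨φ', hA', hI', -⟩ := exists_induces hd hk hl hcop ψ
    rwa [induces_unique hI hI']
  · rw [Ideal.mem_span_singleton]
    have h1 := (pow_dvd_pow (X 0 : Rxzt) (Nat.le_succ 1)).trans (hφ p)
    exact (dvd_sub_left (Dvd.intro _ rfl)).1 h1
  · rintro ⟨φ', hφ', hI'⟩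
    obtain rfl := induces_unique hI hI'
    -- For `g = 1` the first order term at `z` is `-x l t^(l-1)`, which is not divisible by `x²`.
    have h1 := dvd_sub (X_dvd_sub_of_mem hφ' (X 1)) (hφ (X 1))
    rw [sub_sub_cancel, pow_one, pow_two, mul_dvd_mul_iff_left (X_ne_zero 0), mul_one,
      ← modX_eq_zero_iff, modX_bracket, modX_polyS] at h1
    have h2 : modX (X 1) = X 0 := by simp [modX]
    rw [h2, (bracket_X (by decide) _).1, (pderiv_cuspR k l).2, neg_eq_zero] at h1
    have := congrArg (eval 1) h1
    simp [show l ≠ 0 by omega] at this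

theorem sSup_isOneParameterUnipotent_lt (hd : 2 ≤ d) (hk : 2 ≤ k) (hkl : k < l)
    (hcop : Nat.Coprime k l) :
    sSup {H : Subgroup (Aut (threefold d k l)) | IsOneParameterUnipotent H} <
      subgroupA d k l 1 := by
  have hle : sSup {H : Subgroup (Aut (threefold d k l)) | IsOneParameterUnipotent H} ≤
      subgroupA d k l 2 := sSup_le fun H hH =>
    (le_subgroupA_of_isOneParameterUnipotent hd hk hkl hcop hH).trans (subgroupA_anti hd)
  refine lt_of_le_of_ne (hle.trans (subgroupA_anti one_le_two)) fun h => ?_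
  obtain ⟨ψ, h1, h2⟩ := exists_mem_subgroupA_one hd hk (by omega) hcop
  exact h2 (hle (h ▸ h1))

end OneParameterSubgroups

end KorasRussell

theorem mainTheorem1 (d k l : ℕ) (hd : 2 ≤ d) (hk : 2 ≤ k) (hkl : k < l)
    (hcop : Nat.Coprime k l) :
    -- 1) automorphisms of the threefold extend to affine 4-space
    (∀ ψ : KorasRussell.Aut (KorasRussell.threefold d k l),
      ∃ Φ : KorasRussell.Aut (Set.univ : Set (Fin 4 → ℂ)),
        ∀ v : KorasRussell.threefold d k l, (Φ • ⟨v.1, Set.mem_univ v.1⟩ :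
          (Set.univ : Set (Fin 4 → ℂ))).1 = (ψ • v).1) ∧
    -- 2) there are exactly four orbits
    (Set.range (fun v : KorasRussell.threefold d k l =>
        (Subtype.val '' MulAction.orbit (KorasRussell.Aut (KorasRussell.threefold d k l)) v :
          Set (Fin 4 → ℂ))) =
      {KorasRussell.openStratum d k l, KorasRussell.surfaceStratum d k l,
        KorasRussell.puncturedLine, {0}} ∧
      ({KorasRussell.openStratum d k l, KorasRussell.surfaceStratum d k l,
        KorasRussell.puncturedLine, {0}} : Set (Set (Fin 4 → ℂ))).ncard = 4 ∧
      KorasRussell.AreIsomorphic (KorasRussell.openStratum d k l)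
        {w : Fin 3 → ℂ | w 0 ≠ 0} ∧
      KorasRussell.AreIsomorphic (KorasRussell.surfaceStratum d k l)
        {w : Fin 2 → ℂ | w 0 ≠ 0}) ∧
    -- 3) finite subgroups are cyclic
    (∀ H : Subgroup (KorasRussell.Aut (KorasRussell.threefold d k l)),
      Finite H → IsCyclic H) ∧
    -- 4) one-parameter unipotent subgroups
    ((∀ H : Subgroup (KorasRussell.Aut (KorasRussell.threefold d k l)),
        KorasRussell.IsOneParameterUnipotent H → H ≤ KorasRussell.subgroupA d k l d) ∧
      sSup {H : Subgroup (KorasRussell.Aut (KorasRussell.threefold d k l)) |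
        KorasRussell.IsOneParameterUnipotent H} < KorasRussell.subgroupA d k l 1) := by
  have hl : 1 ≤ l := by omega
  exact ⟨fun ψ => (KorasRussell.extends_and_fixes_of_aut hd hk hkl hcop ψ).1,
    ⟨KorasRussell.range_orbits hd hk hkl hcop,
      KorasRussell.ncard_strata (by omega) hl,
      KorasRussell.openStratum_areIsomorphic,
      KorasRussell.surfaceStratum_areIsomorphic (by omega) hk hl hcop⟩,
    fun H _ => KorasRussell.isCyclic_of_finite hd hk hkl hcop H,
    fun _ hH => KorasRussell.le_subgroupA_of_isOneParameterUnipotent hd hk hkl hcop hH,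
    KorasRussell.sSup_isOneParameterUnipotent_lt hd hk hkl hcop⟩
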